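/- **Weitzenböck manifolds.** A *Weitzenböck manifold* is a Riemannian manifold with a metric, locally flat connection (every point has a neighbourhood with a parallel frame field); the connection may have torsion. **Convergence.** Let $(\mathcal M_n',\mathfrak g_n,\nabla_n)$ (given for all large $n$) and $(\mathcal N,\mathfrak g,\nabla)$ be compact oriented $d$-dimensional Weitzenböck manifolds with corners and let $p\in[d,\infty)$. The sequence $\mathcal M_n'$ *converges to* $\mathcal N$ *with exponent* $p$ if, for all large $n$, there are sets $A_n\subset\mathcal N$ and diffeomorphisms $F_n:A_n\to\mathcal M_n'$ such that 1. $\mathrm{Vol}_{\mathfrak g}(\mathcal N\setminus A_n)\to0$; 2. $\operatorname{dis}F_n=\sup_{x,y\in A_n}|d_{\mathcal N}(x,y)-d_{\mathcal M_n'}(F_n(x),F_n(y))|\to0$, where $d_{\mathcal N}$ and $d_{\mathcal M_n'}$ are the Riemannian distance functions (infimum of lengths of curves); 3. $\int_{A_n}\operatorname{dist}^p(dF_n,\mathrm{SO}(\mathfrak g,\mathfrak g_n))\,d\mathrm{Vol}_{\mathfrak g}\to0$, where $\mathrm{SO}(\mathfrak g,\mathfrak g_n)$ is the set of orientation-preserving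 linear isometries $T_x\mathcal N\to T_{F_n(x)}\mathcal M_n'$; 4. every point of $\mathcal N$ has a neighbourhood $U$ with a $\nabla$-parallel frame field $E$ on $U$ and $\nabla_n$-parallel frame fields $E_n$ on $F_n(U\cap A_n)$ such that $\int_{U\cap A_n}|F_n^\star E_n-E|_{\mathfrak g}^p\,d\mathrm{Vol}_{\mathfrak g}\to0$, where $F_n^\star X(x)=(dF_n)_x^{-1}X(F_n(x))$. **The surfaces with edge-dislocations.** For $\alpha,\beta,\delta>0$ and $0<\theta<\pi/2$ put $\ell=\delta/(2\sin\theta)$ and suppose that $\ell\cos\theta\le\beta$. The block $\tilde R(\alpha,\beta,\theta,\delta)$ is obtained from the hexagon $\{(u,y):0\le u\le\beta,\ 0\le y\le h(u)\}$ and its mirror image in the $u$-axis by identifying the graph of $h$ with its mirror image, points with the same abscissa $u$ being identified; here $h$ is the continuous function which equals $\alpha/2$ to the left and $(\alpha+\delta)/2$ to the right of the interval of length $\ell\cos\theta$ centred at $\beta/2$, and which has slope $\tan\theta$ on this interval. It is a "rectangle" with left side $\alpha$, right side $\alpha+\delta$, and bottom and top sides $\beta$. The segment of the common side with slope $\tan\theta$,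 of length $\ell$, is its *dislocation line*. Fix $a,b,\varepsilon>0$ and $0<\theta<\pi/2$. For $n\in\mathbb N$ large (so that the blocks exist) let $\tilde{\mathcal M}_n$ be obtained by gluing along their sides, in an $n\times n$ array, $n^2$ blocks, the block in column $i\in\{1,\dots,n\}$ and row $j\in\{1,\dots,n\}$ being $$\tilde R(a_{n,i},b_n,\theta,\varepsilon_n),\qquad a_{n,i}=\frac{a+(i-1)\varepsilon/n}{n},\quad b_n=\frac bn,\quad \varepsilon_n=\frac{\varepsilon}{n^2}.$$ Let $\mathcal M_n$ be $\tilde{\mathcal M}_n$ without the $n^2$ dislocation lines, $\mathfrak g_n$ its flat metric (Euclidean on the hexagons), oriented by the lower hexagons, and $\nabla_n$ its Levi-Civita connection. **The limit.** Let $\mathcal N$ be the Euclidean annular sector of angle $\varepsilon/b$, inner radius $R_0=ab/\varepsilon$ and outer radius $R_0+b$, that is, $\{(r,\varphi): R_0\le r\le R_0+b,\ 0\le\varphi\le\varepsilon/b\}$ with the metric $\mathfrak g=dr^2+r^2d\varphi^2$ and the orientation $dr\wedge d\varphi$. Let $\nabla$ be the connection on $\mathcal N$ for which the frame field $(\partial_r,r^{-1}\partial_\varphi)$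 is parallel. **Statement.** $(\mathcal M_n,\mathfrak g_n,\nabla_n)$ is locally flat, and $(\mathcal N,\mathfrak g,\nabla)$ is a Weitzenböck manifold whose torsion is $\frac1r\,dr\wedge d\varphi\otimes\partial_\varphi$. The sequence $(\mathcal M_n,\mathfrak g_n,\nabla_n)$ converges to $(\mathcal N,\mathfrak g,\nabla)$ after removal of small neighbourhoods of the dislocation lines: there are a constant $C$ and, for all large $n$, open neighbourhoods (in $\tilde{\mathcal M}_n$) of the $n^2$ dislocation lines whose parts in $\mathcal M_n$ have diameter at most $C/n^2$ in $\mathcal M_n$, such that the sets $\mathcal M_n'\subset\mathcal M_n$ that remain when these neighbourhoods are removed are compact manifolds with corners and, with the restrictions of $\mathfrak g_n$ and $\nabla_n$, converge to $(\mathcal N,\mathfrak g,\nabla)$ with exponent $p$ for every $p\in[2,\infty)$. -/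

import Mathlib

open Set Filter Topology MeasureTheory Manifold Bundle
open scoped ContDiff ENNReal

noncomputable section

/-! ### Weitzenböck manifolds and their convergence

A compact manifold with corners is realised as a compact domain with corners `K` in a manifold
without boundary of the same dimension. Everything that enters the notion of convergence (distance,
volume, differentials, frame fields) is the one of the domain `K`. -/

/-- `ℝ^d`, the model space of `d`-dimensional manifolds. -/
abbrev Model (d : ℕ) : Type := EuclideanSpace ℝ (Fin d)

/-- Vector fields on `M` (no regularity assumed). -/
abbrev VField (d : ℕ) (M : Type) [TopologicalSpace M] [ChartedSpace (Model d) M] : Type :=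
  (x : M) → TangentSpace (𝓡 d) x

/-- `E = (E_1, …, E_d)` is a smooth `∇`-parallel frame field on the open set `O`. -/
def IsParallelFrameOn {d : ℕ} {M : Type} [TopologicalSpace M] [ChartedSpace (Model d) M]
    [IsManifold (𝓡 d) ∞ M]
    (conn : CovariantDerivative (𝓡 d) (Model d) (fun x : M ↦ TangentSpace (𝓡 d) x))
    (E : Fin d → VField d M) (O : Set M) : Prop :=
  IsOpen O ∧
  (∀ i, ContMDiffOn (𝓡 d) (𝓡 d).tangent ∞ (fun x ↦ (⟨x, E i x⟩ : TangentBundle (𝓡 d) M)) O) ∧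
  (∀ x ∈ O, LinearIndependent ℝ (fun i ↦ E i x)) ∧
  (∀ i, ∀ x ∈ O, conn (E i) x = 0)

set_option synthInstance.maxHeartbeats 400000 in
/-- An oriented `d`-dimensional Weitzenböck manifold (without boundary): a smooth manifold with an
oriented atlas, a smooth Riemannian metric, and a connection on its tangent bundle which is
compatible with the metric and locally flat (near every point there is a parallel frame field).
The connection may have torsion. -/
structure WeitzenbockManifold (d : ℕ) where
  carrier : Type
  [top : TopologicalSpace carrier]
  [t2 : T2Space carrier]
  [sc : SecondCountableTopology carrier]
  [meas : MeasurableSpace carrier]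
  [borel : BorelSpace carrier]
  [charted : ChartedSpace (Model d) carrier]
  [smooth : IsManifold (𝓡 d) ∞ carrier]
  [metric : RiemannianBundle (fun x : carrier ↦ TangentSpace (𝓡 d) x)]
  [smoothMetric : IsContMDiffRiemannianBundle (𝓡 d) ∞ (Model d)
    (fun x : carrier ↦ TangentSpace (𝓡 d) x)]
  oriented : ∀ e ∈ atlas (Model d) carrier, ∀ e' ∈ atlas (Model d) carrier,
    ∀ y ∈ (e.symm.trans e').source, 0 < (fderiv ℝ (e.symm.trans e') y).det
  conn : CovariantDerivative (𝓡 d) (Model d) (fun x : carrier ↦ TangentSpace (𝓡 d) x)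
  metricConn : conn.IsMetricCompatible
  flatConn : ∀ x : carrier, ∃ (O : Set carrier) (E : Fin d → VField d carrier),
    x ∈ O ∧ IsParallelFrameOn conn E O

attribute [instance] WeitzenbockManifold.top WeitzenbockManifold.t2 WeitzenbockManifold.sc
  WeitzenbockManifold.meas WeitzenbockManifold.borel WeitzenbockManifold.charted
  WeitzenbockManifold.smooth WeitzenbockManifold.metric WeitzenbockManifold.smoothMetric

/-- `K` is a compact domain with corners in `M`: near each of its points there is a smooth chart of
`M` in which `K` is the quadrant `[0,∞)^d`. Such a `K` is a compact manifold with corners. -/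
def IsCompactDomainWithCorners {d : ℕ} {M : Type} [TopologicalSpace M] [ChartedSpace (Model d) M]
    (K : Set M) : Prop :=
  IsCompact K ∧ ∀ x ∈ K, ∃ Φ ∈ IsManifold.maximalAtlas (𝓡 d) ∞ M, x ∈ Φ.source ∧
    ∀ y ∈ Φ.source, y ∈ K ↔ ∀ i, 0 ≤ Φ y i

/-- The distance function of the Riemannian manifold with corners `K`: the infimum of the lengths of
`C^1` paths that stay in `K` (it is `∞` if there is no such path). -/
def intrinsicEDist {d : ℕ} (W : WeitzenbockManifold d) (K : Set W.carrier) (x y : W.carrier) :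
    ℝ≥0∞ :=
  ⨅ (γ : ℝ → W.carrier) (_ : ContMDiffOn 𝓘(ℝ) (𝓡 d) 1 γ (Icc 0 1)) (_ : MapsTo γ (Icc 0 1) K)
    (_ : γ 0 = x) (_ : γ 1 = y), pathELength (𝓡 d) γ 0 1

/-- The distortion `sup_{x,y ∈ A} |d_K(x,y) - d_{K'}(F x, F y)|` of a map `F` from `A ⊆ K`
to `K'`. -/
def distortion {d : ℕ} (W W' : WeitzenbockManifold d) (K : Set W.carrier) (K' : Set W'.carrier)
    (F : W.carrier → W'.carrier) (A : Set W.carrier) : ℝ≥0∞ :=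
  ⨆ (x ∈ A) (y ∈ A),
    max (intrinsicEDist W K x y - intrinsicEDist W' K' (F x) (F y))
      (intrinsicEDist W' K' (F x) (F y) - intrinsicEDist W K x y)

/-- `μ` is the Riemannian volume measure: in every chart of the atlas its density with respect to
Lebesgue measure is `√(det g_ij)`. This determines `μ`. -/
def IsRiemannianVolume {d : ℕ} (W : WeitzenbockManifold d) (μ : Measure W.carrier) : Prop :=
  ∀ e ∈ atlas (Model d) W.carrier, ∀ s ⊆ e.source, MeasurableSet s →
    μ s = ∫⁻ y in e '' s, ENNReal.ofReal (Real.sqrt (Matrix.det (Matrix.of fun i j : Fin d ↦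
      inner ℝ (mfderiv (𝓡 d) (𝓡 d) e.symm y (EuclideanSpace.single i (1 : ℝ)))
        (mfderiv (𝓡 d) (𝓡 d) e.symm y (EuclideanSpace.single j (1 : ℝ))))))

/-- `F` restricts to a diffeomorphism from `A` onto `K'`. -/
def IsDiffeoOn {d : ℕ} (W W' : WeitzenbockManifold d) (F : W.carrier → W'.carrier)
    (A : Set W.carrier) (K' : Set W'.carrier) : Prop :=
  ContMDiffOn (𝓡 d) (𝓡 d) ∞ F A ∧ BijOn F A K' ∧
    ∃ G : W'.carrier → W.carrier, ContMDiffOn (𝓡 d) (𝓡 d) ∞ G K' ∧ InvOn G F A K'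

/-- The differential `dF_x : T_x M → T_{F x} M'` of a map `F` defined on `A`. -/
def differential {d : ℕ} (W W' : WeitzenbockManifold d) (F : W.carrier → W'.carrier)
    (A : Set W.carrier) (x : W.carrier) :
    TangentSpace (𝓡 d) x →L[ℝ] TangentSpace (𝓡 d) (F x) :=
  mfderivWithin (𝓡 d) (𝓡 d) F A x

/-- `SO(g,g')` at `(x,y)`: the linear isometries `T_x M → T_y M'` that preserve the orientations
given by the two oriented atlases. -/
def rotations {d : ℕ} (W W' : WeitzenbockManifold d) (x : W.carrier) (y : W'.carrier) :
    Set (TangentSpace (𝓡 d) x →L[ℝ] TangentSpace (𝓡 d) y) :=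
  {A | (∀ v, ‖A v‖ = ‖v‖) ∧ 0 < ContinuousLinearMap.det (M := Model d) A}

/-- The compact oriented Weitzenböck manifolds with corners `K n ⊆ W n` converge to
`Klim ⊆ Wlim`, with exponent `p ∈ [d, ∞)`: there are sets `A n ⊆ Klim` and diffeomorphisms
`F n : A n → K n` (for all large `n`) such that

* the volume of `Klim \ A n` tends to `0`;
* the distortion of `F n` tends to `0`;
* the integral over `A n` of `dist(dF n, SO)^p` tends to `0`, where `dist` is the distance in
  operator norm;
* every point of `Klim` has a neighbourhood `U` with a parallel frame field `E` on `U` and parallel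
  frame fields `En n` on (a neighbourhood `O n` of) `F n (U ∩ A n)` such that the integral over
  `U ∩ A n` of `|F n^⋆ (En n) - E|^p` tends to `0`; here the norm of a tuple of vector fields is
  the sum of the norms and `F^⋆ X (x) = dF_x⁻¹ (X (F x))`. -/
def ConvergesTo {d : ℕ} (p : ℝ) (W : ℕ → WeitzenbockManifold d) (K : ∀ n, Set (W n).carrier)
    (Wlim : WeitzenbockManifold d) (Klim : Set Wlim.carrier) : Prop :=
  (d : ℝ) ≤ p ∧
  IsCompactDomainWithCorners (d := d) Klim ∧
  (∀ᶠ n in atTop, IsCompactDomainWithCorners (d := d) (K n)) ∧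
  ∃ μ : Measure Wlim.carrier, IsRiemannianVolume Wlim μ ∧
  ∃ (A : ℕ → Set Wlim.carrier) (F : ∀ n, Wlim.carrier → (W n).carrier),
    (∀ᶠ n in atTop, A n ⊆ Klim ∧ IsDiffeoOn Wlim (W n) (F n) (A n) (K n)) ∧
    Tendsto (fun n ↦ μ (Klim \ A n)) atTop (𝓝 0) ∧
    Tendsto (fun n ↦ distortion Wlim (W n) Klim (K n) (F n) (A n)) atTop (𝓝 0) ∧
    Tendsto (fun n ↦ ∫⁻ x : Wlim.carrier in A n, ENNReal.ofReal
      (Metric.infDist (differential Wlim (W n) (F n) (A n) x)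
        (rotations Wlim (W n) x (F n x)) ^ p) ∂μ) atTop (𝓝 0) ∧
    ∀ x₀ ∈ Klim, ∃ (U : Set Wlim.carrier) (E : Fin d → VField d Wlim.carrier)
      (O : ∀ n, Set (W n).carrier) (En : ∀ n, Fin d → VField d (W n).carrier),
      x₀ ∈ U ∧ IsParallelFrameOn Wlim.conn E U ∧
      (∀ᶠ n in atTop, IsParallelFrameOn (W n).conn (En n) (O n) ∧ F n '' (U ∩ A n) ⊆ O n) ∧
      Tendsto (fun n ↦ ∫⁻ x : Wlim.carrier in U ∩ A n, ENNReal.ofReal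
        ((∑ i, ‖(differential Wlim (W n) (F n) (A n) x).inverse (En n i (F n x)) - E i x‖) ^ p) ∂μ)
        atTop (𝓝 0)

/-! ### The Weitzenböck manifold defined by a global frame field

The manifolds below have atlases whose coordinate changes are translations, so that each tangent
space is canonically `ℝ^d`. A frame field then determines the metric for which it is orthonormal
and the connection for which it is parallel. -/

section Frame
variable {d : ℕ} {M : Type} [TopologicalSpace M] [ChartedSpace (Model d) M]

/-- All coordinate changes are locally translations. -/
def IsTranslationAtlas (d : ℕ) (M : Type) [TopologicalSpace M] [ChartedSpace (Model d) M] : Prop :=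
  ∀ e ∈ atlas (Model d) M, ∀ e' ∈ atlas (Model d) M, ∀ y ∈ (e.symm.trans e').source,
    ∃ c : Model d, (e.symm.trans e') =ᶠ[𝓝 y] fun z ↦ z + c

theorem IsTranslationAtlas.isManifold (h : IsTranslationAtlas d M) : IsManifold (𝓡 d) ∞ M := by
  apply isManifold_of_contDiffOn
  intro e e' he he' y hy
  simp only [mfld_simps] at hy
  obtain ⟨c, hc⟩ := h e he e' he' y (by simpa using hy)
  have : ContDiffAt ℝ ∞ (e.symm.trans e') y :=
    ContDiffAt.congr_of_eventuallyEq (by fun_prop) hc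
  simpa using this.contDiffWithinAt

theorem IsTranslationAtlas.hasFDerivAt (h : IsTranslationAtlas d M)
    {e e' : OpenPartialHomeomorph M (Model d)} (he : e ∈ atlas (Model d) M)
    (he' : e' ∈ atlas (Model d) M) {y : Model d} (hy : y ∈ (e.symm.trans e').source) :
    HasFDerivAt (e.symm.trans e') (ContinuousLinearMap.id ℝ (Model d)) y := by
  obtain ⟨c, hc⟩ := h e he e' he' y hy
  exact HasFDerivAt.congr_of_eventuallyEq ((hasFDerivAt_id y).add_const c) hc

theorem IsTranslationAtlas.triv (h : IsTranslationAtlas d M) [IsManifold (𝓡 d) ∞ M] {x₀ x : M}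
    (hx : x ∈ (chartAt (Model d) x₀).source) (v : TangentSpace (𝓡 d) x) :
    (trivializationAt (Model d) (TangentSpace (𝓡 d) : M → Type) x₀ ⟨x, v⟩).2 = v := by
  rw [TangentBundle.trivializationAt_apply]
  have := (h.hasFDerivAt (chart_mem_atlas _ x) (chart_mem_atlas _ x₀)
    (y := chartAt (Model d) x x) (by simp [hx])).fderiv
  simp only [mfld_simps, fderivWithin_univ] at this ⊢
  erw [this]
  rfl

theorem IsTranslationAtlas.contMDiffAt_section (h : IsTranslationAtlas d M)
    [IsManifold (𝓡 d) ∞ M] (X : VField d M) (x₀ : M) :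
    ContMDiffAt (𝓡 d) (𝓡 d).tangent ∞ (fun x ↦ (⟨x, X x⟩ : TangentBundle (𝓡 d) M)) x₀ ↔
    ContMDiffAt (𝓡 d) 𝓘(ℝ, Model d) ∞ (fun x ↦ (X x : Model d)) x₀ := by
  rw [Bundle.contMDiffAt_section]
  apply Filter.EventuallyEq.contMDiffAt_iff
  filter_upwards [(chartAt (Model d) x₀).open_source.mem_nhds (mem_chart_source _ x₀)] with x hx
  exact h.triv hx _

theorem IsTranslationAtlas.mdifferentiableAt_section (h : IsTranslationAtlas d M)
    [IsManifold (𝓡 d) ∞ M] (X : VField d M) (x₀ : M) :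
    MDifferentiableAt (𝓡 d) (𝓡 d).tangent (fun x ↦ (⟨x, X x⟩ : TangentBundle (𝓡 d) M)) x₀ ↔
    MDifferentiableAt (𝓡 d) 𝓘(ℝ, Model d) (fun x ↦ (X x : Model d)) x₀ := by
  rw [_root_.mdifferentiableAt_section]
  apply Filter.EventuallyEq.mdifferentiableAt_iff
  filter_upwards [(chartAt (Model d) x₀).open_source.mem_nhds (mem_chart_source _ x₀)] with x hx
  exact h.triv hx _

/-- A smooth global frame field, written in the coordinates of a translation atlas: at `x` the frame
consists of the images of the standard basis vectors under the linear isomorphism `toFun x`. -/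
structure FrameField (d : ℕ) (M : Type) [TopologicalSpace M] [ChartedSpace (Model d) M] where
  toFun : M → Model d →L[ℝ] Model d
  inv : M → Model d →L[ℝ] Model d
  toFun_inv : ∀ x v, toFun x (inv x v) = v
  inv_toFun : ∀ x v, inv x (toFun x v) = v
  smooth_toFun : ContMDiff (𝓡 d) 𝓘(ℝ, Model d →L[ℝ] Model d) ∞ toFun
  smooth_inv : ContMDiff (𝓡 d) 𝓘(ℝ, Model d →L[ℝ] Model d) ∞ inv

/-- The `i`-th vector field of the frame. -/
def FrameField.field (e : FrameField d M) (i : Fin d) : VField d M :=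
  fun x ↦ e.toFun x (EuclideanSpace.single i (1 : ℝ))

theorem mvfderiv_inner_apply {f g : M → Model d} {x : M}
    (hf : MDifferentiableAt (𝓡 d) 𝓘(ℝ, Model d) f x)
    (hg : MDifferentiableAt (𝓡 d) 𝓘(ℝ, Model d) g x) (v : TangentSpace (𝓡 d) x) :
    mvfderiv (𝓡 d) (fun y ↦ (inner ℝ (f y) (g y) : ℝ)) x v =
      inner ℝ (mvfderiv (𝓡 d) f x v) (g x) + inner ℝ (f x) (mvfderiv (𝓡 d) g x v) := by
  have H : HasMFDerivAt (𝓡 d) 𝓘(ℝ, ℝ) (fun y ↦ (inner ℝ (f y) (g y) : ℝ)) x _ :=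
    ⟨hf.continuousAt.inner (𝕜 := ℝ) hg.continuousAt, hf.hasMFDerivAt.2.inner ℝ hg.hasMFDerivAt.2⟩
  have h2 : mvfderiv (𝓡 d) (fun y ↦ (inner ℝ (f y) (g y) : ℝ)) x v =
    mfderiv (𝓡 d) 𝓘(ℝ, ℝ) (fun y ↦ (inner ℝ (f y) (g y) : ℝ)) x v := rfl
  rw [h2, H.mfderiv]
  simp only [mfld_simps]
  exact add_comm _ _

theorem FrameField.mdifferentiableAt_inv (e : FrameField d M) (h : IsTranslationAtlas d M)
    [IsManifold (𝓡 d) ∞ M] {σ : VField d M} {x : M}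
    (hσ : MDifferentiableAt (𝓡 d) (𝓡 d).tangent
      (fun x ↦ (⟨x, σ x⟩ : TangentBundle (𝓡 d) M)) x) :
    MDifferentiableAt (𝓡 d) 𝓘(ℝ, Model d) (fun y ↦ e.inv y (σ y)) x :=
  ((e.smooth_inv x).mdifferentiableAt (by simp)).clm_apply ((h.mdifferentiableAt_section σ x).1 hσ)

/-- The connection for which the frame is parallel: the components with respect to the frame are
differentiated, `∇_v (∑ fⁱ E_i) = ∑ df^i(v) E_i`. -/
def FrameField.conn (e : FrameField d M) (h : IsTranslationAtlas d M)
    [IsManifold (𝓡 d) ∞ M] :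
    CovariantDerivative (𝓡 d) (Model d) (fun x : M ↦ TangentSpace (𝓡 d) x) where
  toFun σ x := (e.toFun x).comp (mvfderiv (𝓡 d) (fun y ↦ e.inv y (σ y)) x)
  isCovariantDerivativeOnUniv := by
    constructor
    · intro σ σ' x hσ hσ' _
      have := mvfderiv_add (e.mdifferentiableAt_inv h hσ) (e.mdifferentiableAt_inv h hσ')
      have h2 : (fun y ↦ e.inv y ((σ + σ') y)) = (fun y ↦ e.inv y (σ y)) + fun y ↦ e.inv y (σ' y) := by
        funext y; exact (e.inv y).map_add _ _
      rw [h2, this]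
      exact ContinuousLinearMap.comp_add _ _ _
    · intro σ g x hσ hg _
      have := mvfderiv_smul hg (e.mdifferentiableAt_inv h hσ)
      have h2 : (fun y ↦ e.inv y ((g • σ) y)) = g • (fun y ↦ e.inv y (σ y)) := by
        funext y; exact (e.inv y).map_smul _ _
      rw [h2, this]
      refine ContinuousLinearMap.ext fun v ↦ ?_
      have h3 : e.toFun x (g x • mvfderiv (𝓡 d) (fun y ↦ e.inv y (σ y)) x v
          + mvfderiv (𝓡 d) g x v • e.inv x (σ x)) =
          g x • e.toFun x (mvfderiv (𝓡 d) (fun y ↦ e.inv y (σ y)) x v)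
          + mvfderiv (𝓡 d) g x v • (id (σ x) : Model d) := by
        rw [map_add, map_smul, map_smul]
        exact congrArg (fun z : Model d ↦ g x • e.toFun x (mvfderiv (𝓡 d) (fun y ↦ e.inv y (σ y)) x v)
          + mvfderiv (𝓡 d) g x v • z) (e.toFun_inv x (σ x))
      exact h3

theorem FrameField.isParallelFrameOn (e : FrameField d M) (h : IsTranslationAtlas d M)
    [IsManifold (𝓡 d) ∞ M] : IsParallelFrameOn (e.conn h) e.field univ := by
  refine ⟨isOpen_univ, fun i ↦ ?_, fun x _ ↦ ?_, fun i x _ ↦ ?_⟩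
  · refine fun x _ ↦ ((h.contMDiffAt_section _ x).2 ?_).contMDiffWithinAt
    exact (e.smooth_toFun x).clm_apply contMDiffAt_const
  · have h1 : LinearIndependent ℝ (fun i : Fin d ↦ EuclideanSpace.single i (1 : ℝ)) := by
      exact EuclideanSpace.orthonormal_single.linearIndependent
    refine h1.map' (e.toFun x).toLinearMap (LinearMap.ker_eq_bot.2 ?_)
    exact Function.LeftInverse.injective (e.inv_toFun x)
  · have h1 : (fun y ↦ e.inv y (e.field i y)) = fun _ ↦ EuclideanSpace.single i (1 : ℝ) := by
      funext y; exact e.inv_toFun y _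
    change (e.toFun x).comp (mvfderiv (𝓡 d) (fun y ↦ e.inv y (e.field i y)) x) = 0
    rw [h1, mvfderiv_const, ContinuousLinearMap.comp_zero]

/-- The bilinear form for which the frame is orthonormal at `x`. -/
def FrameField.gram (e : FrameField d M) (x : M) : Model d →L[ℝ] Model d →L[ℝ] ℝ :=
  (innerSL ℝ (E := Model d)).bilinearComp (e.inv x) (e.inv x)

theorem FrameField.gram_apply (e : FrameField d M) (x : M) (v w : Model d) :
    e.gram x v w = inner ℝ (e.inv x v) (e.inv x w) := rfl

theorem FrameField.contMDiff_gram (e : FrameField d M) :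
    ContMDiff (𝓡 d) 𝓘(ℝ, Model d →L[ℝ] Model d →L[ℝ] ℝ) ∞ e.gram := by
  have h : ContDiff ℝ ∞ (fun L : Model d →L[ℝ] Model d ↦
      (innerSL ℝ (E := Model d)).bilinearComp L L) := by
    have : (fun L : Model d →L[ℝ] Model d ↦ (innerSL ℝ (E := Model d)).bilinearComp L L) =
      fun L ↦ ((ContinuousLinearMap.compL ℝ (Model d) (Model d) ℝ).flip L).comp
        ((innerSL ℝ (E := Model d)).comp L) := by
      ext; rfl
    rw [this]
    fun_prop
  exact h.contMDiff.comp e.smooth_inv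

/-- The Riemannian metric for which the frame is orthonormal. -/
def FrameField.metric (e : FrameField d M) (h : IsTranslationAtlas d M)
    [IsManifold (𝓡 d) ∞ M] :
    ContMDiffRiemannianMetric (𝓡 d) ∞ (Model d) (fun x : M ↦ TangentSpace (𝓡 d) x) where
  inner x := e.gram x
  symm x v w := real_inner_comm (F := Model d) (e.inv x w) (e.inv x v)
  pos x v hv := by
    refine (real_inner_self_pos (F := Model d)).2 fun h0 ↦ hv ?_
    have := e.toFun_inv x v
    exact this.symm.trans ((congrArg (e.toFun x) h0).trans (map_zero _))
  isVonNBounded x := by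
    change Bornology.IsVonNBounded ℝ {v : Model d | inner ℝ (e.inv x v) (e.inv x v) < 1}
    refine ((NormedSpace.isVonNBounded_ball ℝ (Model d) 1).image (e.toFun x)).subset ?_
    intro v hv
    refine ⟨e.inv x v, ?_, e.toFun_inv x v⟩
    rw [mem_ofPred_eq, real_inner_self_eq_norm_sq] at hv
    rw [mem_ball_zero_iff]
    nlinarith [norm_nonneg (e.inv x v)]
  contMDiff := by
    intro x₀
    refine (Bundle.contMDiffAt_section (E := fun x : M ↦ TangentSpace (𝓡 d) x →L[ℝ] TangentSpace (𝓡 d) x →L[ℝ] ℝ)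
      (F := Model d →L[ℝ] Model d →L[ℝ] ℝ) (s := e.gram) x₀).2 ?_
    refine (e.contMDiff_gram x₀).congr_of_eventuallyEq ?_
    filter_upwards [(chartAt (Model d) x₀).open_source.mem_nhds (mem_chart_source _ x₀)] with x hx
    have hsymm : ∀ v : Model d,
        (trivializationAt (Model d) (TangentSpace (𝓡 d) : M → Type) x₀).symm x v = v := by
      intro v
      have hb : x ∈ (trivializationAt (Model d) (TangentSpace (𝓡 d) : M → Type) x₀).baseSet := hx
      have := (trivializationAt (Model d) (TangentSpace (𝓡 d) : M → Type) x₀).symm_apply_apply_mk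
        hb v
      exact (congrArg _ (h.triv hx v).symm).trans this
    refine ContinuousLinearMap.ext fun v ↦ ContinuousLinearMap.ext fun w ↦ ?_
    rw [hom_trivializationAt_apply]
    refine (inCoordinates_apply_eq₂ (by exact hx) (by exact hx) (mem_univ _)).trans ?_
    rw [hsymm, hsymm]
    exact congrFun (congrArg DFunLike.coe (Bundle.Trivial.linearMapAt_trivialization ℝ M ℝ x)) _

/-- The Weitzenböck manifold in which the given frame field is orthonormal and parallel. -/
def WeitzenbockManifold.ofFrame [T2Space M] [SecondCountableTopology M] [MeasurableSpace M]
    [BorelSpace M] (h : IsTranslationAtlas d M) (e : FrameField d M) : WeitzenbockManifold d :=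
  letI : IsManifold (𝓡 d) ∞ M := h.isManifold
  letI : RiemannianBundle (fun x : M ↦ TangentSpace (𝓡 d) x) := ⟨(e.metric h).toRiemannianMetric⟩
  { carrier := M
    oriented := by
      intro e he e' he' y hy
      rw [(h.hasFDerivAt he he' hy).fderiv]
      exact (show (0 : ℝ) < LinearMap.det (LinearMap.id : Model d →ₗ[ℝ] Model d) by simp)
    conn := e.conn h
    metricConn := by
      rw [CovariantDerivative.isMetricCompatible_iff]
      intro x X σ τ hX hσ hτ
      have hs := e.mdifferentiableAt_inv h hσ
      have ht := e.mdifferentiableAt_inv h hτ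
      have hd := mvfderiv_inner_apply hs ht (X x)
      exact hd.trans (congrArg₂ (· + ·)
        (congrArg (fun z : Model d ↦ (inner ℝ z (e.inv x (τ x)) : ℝ)) (e.inv_toFun x _).symm)
        (congrArg (fun z : Model d ↦ (inner ℝ (e.inv x (σ x)) z : ℝ)) (e.inv_toFun x _).symm))
    flatConn := fun x ↦ ⟨univ, e.field, mem_univ _, e.isParallelFrameOn h⟩ }

/-- The standard frame: the coordinate vector fields of a translation atlas. -/
def FrameField.standard (d : ℕ) (M : Type) [TopologicalSpace M] [ChartedSpace (Model d) M] :
    FrameField d M where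
  toFun _ := ContinuousLinearMap.id ℝ (Model d)
  inv _ := ContinuousLinearMap.id ℝ (Model d)
  toFun_inv _ _ := rfl
  inv_toFun _ _ := rfl
  smooth_toFun := contMDiff_const
  smooth_inv := contMDiff_const

end Frame

/-! ### The locally flat surfaces with edge-dislocations

Let `d = δ / (2 sin θ)`. The building block `R(α,β,θ,δ)` consists of two hexagons. The lower one is
`{(u,y) | 0 ≤ u ≤ β, 0 ≤ y ≤ h(u)}`, where `h` is `α/2` to the left, `(α+δ)/2` to the right, and
has slope `tan θ` on the interval of length `d cos θ` centred at `β/2`; the upper one is its mirror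
image. The two are glued along the upper side of the lower hexagon and the lower side of the upper
one, points with the same abscissa being identified. The slanted part of the common side is the
dislocation line, of length `d`; it is removed. -/

/-- The parameters `a, b, ε > 0` and `0 < θ < π/2`. -/
structure DislocationData where
  a : ℝ
  b : ℝ
  ε : ℝ
  θ : ℝ
  a_pos : 0 < a
  b_pos : 0 < b
  ε_pos : 0 < ε
  θ_pos : 0 < θ
  θ_lt : θ < Real.pi / 2

/-- The width `d cos θ` of the dislocation line, where `d = δ / (2 sin θ)`. -/
def slitWidth (θ δ : ℝ) : ℝ := δ / (2 * Real.sin θ) * Real.cos θ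

/-- The height `h(u)` of the lower hexagon of the building block `R(α,β,θ,δ)`. -/
def hexagonHeight (α β θ δ u : ℝ) : ℝ :=
  α / 2 + min (max (Real.tan θ * (u - (β - slitWidth θ δ) / 2)) 0) (δ / 2)

theorem hexagonHeight_of_le {α β θ δ u : ℝ} (hθ : 0 < θ) (hθ' : θ < Real.pi / 2) (hδ : 0 ≤ δ)
    (hu : u ≤ (β - slitWidth θ δ) / 2) : hexagonHeight α β θ δ u = α / 2 := by
  have ht := Real.tan_pos_of_pos_of_lt_pi_div_two hθ hθ'
  rw [hexagonHeight, max_eq_right (by nlinarith), min_eq_left (by linarith), add_zero]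

theorem hexagonHeight_of_ge {α β θ δ u : ℝ} (hθ : 0 < θ) (hθ' : θ < Real.pi / 2)
    (hu : (β + slitWidth θ δ) / 2 ≤ u) : hexagonHeight α β θ δ u = (α + δ) / 2 := by
  have ht := Real.tan_pos_of_pos_of_lt_pi_div_two hθ hθ'
  have hs := Real.sin_pos_of_pos_of_lt_pi hθ (by linarith [Real.pi_pos])
  have hc := Real.cos_pos_of_mem_Ioo ⟨by linarith, hθ'⟩
  have h1 : Real.tan θ * slitWidth θ δ = δ / 2 := by
    rw [slitWidth, Real.tan_eq_sin_div_cos]; field_simp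
  have h2 : δ / 2 ≤ Real.tan θ * (u - (β - slitWidth θ δ) / 2) := by
    rw [← h1]; exact mul_le_mul_of_nonneg_left (by linarith) ht.le
  rw [hexagonHeight, min_eq_right (h2.trans (le_max_left _ _))]; ring

theorem continuous_vec {X : Type} [TopologicalSpace X] {f g : X → ℝ} (hf : Continuous f)
    (hg : Continuous g) : Continuous fun x ↦ (!₂[f x, g x] : Model 2) :=
  (PiLp.continuous_toLp 2 _).comp (continuous_pi (Fin.forall_fin_two.2 ⟨hf, hg⟩))

namespace DislocationData
variable (P : DislocationData) (n : ℕ)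

/-- The width `b_n = b/n` of the blocks. -/
def bBlock : ℝ := P.b / n
/-- The dislocation magnitude `ε_n = ε/n²` of the blocks. -/
def εBlock : ℝ := P.ε / n ^ 2
/-- The left side length of the blocks in column `i = 0, …, n-1`. -/
def aBlock (i : ℕ) : ℝ := (P.a + i * P.ε / n) / n

/-- The height over `x` of the lower half of a row of `n` blocks placed side by side, the block in
column `i` having type `R(a_{n,i}, b_n, θ, ε_n)`. The lower half of the row is the union of the
lower hexagons of its blocks, see `rowHeight_eq_hexagonHeight`. -/
def rowHeight (x : ℝ) : ℝ :=
  P.aBlock n 0 / 2 + ∑ i ∈ Finset.range n,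
    (hexagonHeight (P.aBlock n i) (P.bBlock n) P.θ (P.εBlock n) (x - i * P.bBlock n) - P.aBlock n i / 2)

/-- The abscissas of the dislocation lines in column `i`. -/
def columnSlit (i : ℕ) : Set ℝ :=
  Icc (i * P.bBlock n + (P.bBlock n - slitWidth P.θ (P.εBlock n)) / 2)
    (i * P.bBlock n + (P.bBlock n + slitWidth P.θ (P.εBlock n)) / 2)

/-- The abscissas of all dislocation lines. -/
def slitX : Set ℝ := ⋃ i ∈ Finset.range n, P.columnSlit n i

/-- The dislocation line of the block in column `i` and row `j`, in the coordinates `(x,t)` that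
are used on the glued surface (see `Surface`). -/
def slit (i j : ℕ) : Set (Model 2) := {p | p 0 ∈ P.columnSlit n i ∧ p 1 = 2 * j + 1}

/-- The union of all dislocation lines. -/
def slits : Set (Model 2) := {p | p 0 ∈ P.slitX n ∧ ∃ j : ℤ, p 1 = 2 * j + 1}

theorem εBlock_nonneg : 0 ≤ P.εBlock n := by
  have := P.ε_pos; unfold εBlock; positivity

theorem rowHeight_pos [NeZero n] (x : ℝ) : 0 < P.rowHeight n x := by
  have h0 : (0:ℝ) < n := by exact_mod_cast Nat.pos_of_ne_zero (NeZero.ne n)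
  have : 0 < P.aBlock n 0 := by
    have := P.a_pos; have := P.ε_pos; unfold aBlock; positivity
  refine add_pos_of_pos_of_nonneg (by linarith) (Finset.sum_nonneg fun i _ ↦ ?_)
  rw [hexagonHeight, add_sub_cancel_left]
  have := P.εBlock_nonneg n
  exact le_min (le_max_right _ _) (by linarith)

theorem continuous_rowHeight : Continuous (P.rowHeight n) := by
  unfold rowHeight hexagonHeight; fun_prop

theorem isClosed_slitX : IsClosed (P.slitX n) :=
  (Finset.range n).finite_toSet.isClosed_biUnion fun _ _ ↦ isClosed_Icc

theorem isClosed_slits : IsClosed (P.slits n) := by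
  have h1 : Continuous fun p : Model 2 ↦ p 0 := by fun_prop
  have h2 : Continuous fun p : Model 2 ↦ (p 1 - 1) / 2 := by fun_prop
  have h : P.slits n = (fun p : Model 2 ↦ p 0) ⁻¹' P.slitX n ∩
      (fun p : Model 2 ↦ (p 1 - 1) / 2) ⁻¹' range ((↑) : ℤ → ℝ) := by
    ext p
    simp only [slits, mem_ofPred_eq, mem_inter_iff, mem_preimage, mem_range]
    refine and_congr_right fun _ ↦ exists_congr fun j ↦ ?_
    constructor <;> intro h <;> linarith
  rw [h]
  exact ((P.isClosed_slitX n).preimage h1).inter (Int.isClosedEmbedding_coe_real.isClosed_range.preimage h2)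

theorem rowHeight_eventually_const {x : ℝ} (hx : x ∉ P.slitX n) :
    ∀ᶠ y in 𝓝 x, P.rowHeight n y = P.rowHeight n x := by
  have key : ∀ i ∈ Finset.range n, ∀ᶠ y in 𝓝 x,
      hexagonHeight (P.aBlock n i) (P.bBlock n) P.θ (P.εBlock n) (y - i * P.bBlock n) =
      hexagonHeight (P.aBlock n i) (P.bBlock n) P.θ (P.εBlock n) (x - i * P.bBlock n) := by
    intro i hi
    have hx' := hx
    simp only [slitX, columnSlit, mem_iUnion, not_exists, mem_Icc, not_and_or, not_le] at hx'
    rcases hx' i hi with h | h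
    · filter_upwards [Iio_mem_nhds h] with y hy
      rw [mem_Iio] at hy
      rw [hexagonHeight_of_le P.θ_pos P.θ_lt (P.εBlock_nonneg n) (by linarith),
        hexagonHeight_of_le P.θ_pos P.θ_lt (P.εBlock_nonneg n) (by linarith)]
    · filter_upwards [Ioi_mem_nhds h] with y hy
      rw [mem_Ioi] at hy
      rw [hexagonHeight_of_ge P.θ_pos P.θ_lt (by linarith),
        hexagonHeight_of_ge P.θ_pos P.θ_lt (by linarith)]
  filter_upwards [(Finset.range n).eventually_all.2 key] with y hy
  rw [rowHeight, rowHeight, Finset.sum_congr rfl fun i hi ↦ by rw [hy i hi]]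

/-- Over the `i`-th column, provided the dislocation line fits into the block, the lower half of the
row is the lower hexagon of the block `R(a_{n,i}, b_n, θ, ε_n)`. -/
theorem rowHeight_eq_hexagonHeight [NeZero n] (hfit : slitWidth P.θ (P.εBlock n) ≤ P.bBlock n)
    {i : ℕ} (hi : i < n) {x : ℝ} (hx : x ∈ Icc (i * P.bBlock n) ((i + 1) * P.bBlock n)) :
    P.rowHeight n x =
      hexagonHeight (P.aBlock n i) (P.bBlock n) P.θ (P.εBlock n) (x - i * P.bBlock n) := by
  have h0 : (0:ℝ) < n := by exact_mod_cast Nat.pos_of_ne_zero (NeZero.ne n)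
  have hb : 0 ≤ P.bBlock n := by have := P.b_pos; unfold bBlock; positivity
  have h1 : ∀ k ∈ Finset.range n, hexagonHeight (P.aBlock n k) (P.bBlock n) P.θ (P.εBlock n)
      (x - k * P.bBlock n) - P.aBlock n k / 2 = if k < i then P.εBlock n / 2 else if k = i then
      hexagonHeight (P.aBlock n i) (P.bBlock n) P.θ (P.εBlock n) (x - i * P.bBlock n)
        - P.aBlock n i / 2 else 0 := by
    intro k _
    split_ifs with h h'
    · have : (k : ℝ) + 1 ≤ i := by exact_mod_cast h
      rw [hexagonHeight_of_ge P.θ_pos P.θ_lt (by nlinarith [hx.1])]; ring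
    · rw [h']
    · have : (i : ℝ) + 1 ≤ k := by exact_mod_cast (by omega : i + 1 ≤ k)
      rw [hexagonHeight_of_le P.θ_pos P.θ_lt (P.εBlock_nonneg n) (by nlinarith [hx.2])]; ring
  have h2 : ∀ m ≤ n, i < m → ∑ k ∈ Finset.range m, (if k < i then P.εBlock n / 2 else if k = i then
      hexagonHeight (P.aBlock n i) (P.bBlock n) P.θ (P.εBlock n) (x - i * P.bBlock n)
        - P.aBlock n i / 2 else 0) = i * (P.εBlock n / 2) + 
      (hexagonHeight (P.aBlock n i) (P.bBlock n) P.θ (P.εBlock n) (x - i * P.bBlock n)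
        - P.aBlock n i / 2) := by
    intro m _ hm
    induction m, hm using Nat.le_induction with
    | base =>
      rw [Finset.sum_range_succ, Finset.sum_congr rfl
        (g := fun _ ↦ P.εBlock n / 2) fun k hk ↦ if_pos (Finset.mem_range.1 hk)]
      simp
    | succ m hm ih =>
      rw [Finset.sum_range_succ, ih (by omega), if_neg (by omega), if_neg (by omega), add_zero]
  rw [rowHeight, Finset.sum_congr rfl h1, h2 n le_rfl hi]
  simp only [aBlock, εBlock]
  field_simp
  push_cast
  ring

/-- The flat coordinates `(x, (t - 2j) ρ(x))`, where `ρ` is the height of the half rows. -/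
def shear [NeZero n] (j : ℤ) : Model 2 ≃ₜ Model 2 where
  toFun p := !₂[p 0, (p 1 - 2 * j) * P.rowHeight n (p 0)]
  invFun p := !₂[p 0, p 1 / P.rowHeight n (p 0) + 2 * j]
  left_inv p := by
    have := (P.rowHeight_pos n (p 0)).ne'
    ext i; fin_cases i <;> simp [this]
  right_inv p := by
    have := (P.rowHeight_pos n (p 0)).ne'
    ext i; fin_cases i <;> simp [this]
  continuous_toFun := by
    have h0 : Continuous fun p : Model 2 ↦ p 0 := PiLp.continuous_apply 2 _ 0
    have h1 : Continuous fun p : Model 2 ↦ p 1 := PiLp.continuous_apply 2 _ 1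
    exact continuous_vec h0
      ((h1.sub continuous_const).mul ((P.continuous_rowHeight n).comp h0))
  continuous_invFun := by
    have h0 : Continuous fun p : Model 2 ↦ p 0 := PiLp.continuous_apply 2 _ 0
    have h1 : Continuous fun p : Model 2 ↦ p 1 := PiLp.continuous_apply 2 _ 1
    exact continuous_vec h0 ((h1.div ((P.continuous_rowHeight n).comp h0)
      fun p ↦ (P.rowHeight_pos n (p 0)).ne').add continuous_const)

/-- The glued surface without the dislocation lines. Let `ρ(x)` be the height of the half rows.
A point has coordinates `(x,t)`: for `2j ≤ t ≤ 2j+1` it is the point with Euclidean coordinates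
`(x, (t-2j) ρ(x))` in the lower half of row `j`, for `2j+1 ≤ t ≤ 2j+2` it is the point at distance
`(2j+2-t) ρ(x)` below the top side, with abscissa `x`, in the upper half of row `j`. In this way the
topological space obtained by gluing all hexagons is the `(x,t)`-plane, and the union of the `n²`
blocks is the rectangle `0 ≤ x ≤ b`, `0 ≤ t ≤ 2n`. The points outside of this rectangle (where rows
are continued to all integers `j` and all real `x`) only serve to have a manifold without boundary
around it. -/
abbrev Surface (P : DislocationData) (n : ℕ) : Type := {p : Model 2 // p ∉ P.slits n}

namespace Surface

instance : Nonempty (P.Surface n) := ⟨⟨0, fun h ↦ by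
  obtain ⟨_, j, hj⟩ := h
  have h0 : (0 : ℝ) = 2 * j + 1 := hj
  have : (0 : ℤ) = 2 * j + 1 := by exact_mod_cast h0
  omega⟩⟩

theorem isOpenEmbedding_val : Topology.IsOpenEmbedding (Subtype.val : P.Surface n → Model 2) :=
  (P.isClosed_slits n).isOpen_compl.isOpenEmbedding_subtypeVal

/-- The domain of the flat chart around the bottom side of row `j`: the upper half of row `j-1`, the
lower half of row `j`, and the upper half of row `j` without the points above or below a dislocation
line. -/
def chartDomain (j : ℤ) : Set (P.Surface n) :=
  {p | (2 * j - 1 < p.1 1 ∧ p.1 1 < 2 * j + 1) ∨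
    (2 * j < p.1 1 ∧ p.1 1 < 2 * j + 2 ∧ p.1 0 ∉ P.slitX n)}

theorem isOpen_chartDomain (j : ℤ) : IsOpen (chartDomain P n j) := by
  have h0 : Continuous fun p : P.Surface n ↦ p.1 0 :=
    (PiLp.continuous_apply 2 _ 0).comp (isOpenEmbedding_val P n).continuous
  have h1 : Continuous fun p : P.Surface n ↦ p.1 1 :=
    (PiLp.continuous_apply 2 _ 1).comp (isOpenEmbedding_val P n).continuous
  exact ((isOpen_lt continuous_const h1).inter (isOpen_lt h1 continuous_const)).union
    ((isOpen_lt continuous_const h1).inter ((isOpen_lt h1 continuous_const).inter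
      ((P.isClosed_slitX n).isOpen_compl.preimage h0)))

theorem exists_chartDomain (p : P.Surface n) : ∃ j : ℤ, p ∈ chartDomain P n j := by
  by_cases h : ∃ j : ℤ, p.1 1 = 2 * j + 1
  · have hp := p.2
    obtain ⟨j, hj⟩ := h
    have h3 : p.1 0 ∉ P.slitX n := fun h' ↦ hp ⟨h', j, hj⟩
    exact ⟨j, Or.inr ⟨by linarith, by linarith, h3⟩⟩
  · push Not at h
    refine ⟨⌊(p.1 1 + 1) / 2⌋, Or.inl ⟨?_, ?_⟩⟩
    · have h1 := Int.floor_le ((p.1 1 + 1) / 2)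
      have h2 := h (⌊(p.1 1 + 1) / 2⌋ - 1)
      push_cast at h2
      refine lt_of_le_of_ne (by linarith) fun h3 ↦ h2 (by linarith)
    · linarith [Int.lt_floor_add_one ((p.1 1 + 1) / 2)]

variable [NeZero n]

/-- The flat chart `(x,t) ↦ (x, (t-2j) ρ(x))`. On the upper half of row `j`, where `ρ` is locally
constant on the chart domain, and on the upper half of row `j-1` it is given by Euclidean
coordinates in the upper hexagons, so the atlas of all flat charts is the one obtained by gluing the
hexagons isometrically along their common sides. -/
def flatChart (j : ℤ) : OpenPartialHomeomorph (P.Surface n) (Model 2) :=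
  ((Topology.IsOpenEmbedding.toOpenPartialHomeomorph (X := P.Surface n) Subtype.val
    (isOpenEmbedding_val P n)).trans
    (P.shear n j).toOpenPartialHomeomorph).restrOpen (chartDomain P n j) (isOpen_chartDomain P n j)

theorem flatChart_source (j : ℤ) : (flatChart P n j).source = chartDomain P n j := by
  rw [flatChart, OpenPartialHomeomorph.restrOpen_source]
  ext p
  simp

theorem flatChart_apply (j : ℤ) (p : P.Surface n) :
    flatChart P n j p = !₂[p.1 0, (p.1 1 - 2 * j) * P.rowHeight n (p.1 0)] := rfl

instance : ChartedSpace (Model 2) (P.Surface n) where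
  atlas := range (flatChart P n)
  chartAt p := flatChart P n (exists_chartDomain P n p).choose
  mem_chart_source p := by
    rw [flatChart_source]; exact (exists_chartDomain P n p).choose_spec
  chart_mem_atlas p := mem_range_self _

theorem isTranslationAtlas : IsTranslationAtlas 2 (P.Surface n) := by
  rintro _ ⟨j, rfl⟩ _ ⟨k, rfl⟩ y hy
  have hform : ∀ z ∈ ((flatChart P n j).symm.trans (flatChart P n k)).source,
      ((flatChart P n j).symm.trans (flatChart P n k)) z =
        z + !₂[0, 2 * ((j : ℝ) - k) * P.rowHeight n (z 0)] := by
    intro z hz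
    have hz1 : z ∈ (flatChart P n j).target := by simpa using hz.1
    have hr := (flatChart P n j).right_inv hz1
    set q := (flatChart P n j).symm z with hq
    change flatChart P n k q = _
    rw [flatChart_apply] at hr ⊢
    rw [← hr]
    ext i; fin_cases i <;> simp
    ring
  have hev : ∀ᶠ z in 𝓝 y, z ∈ ((flatChart P n j).symm.trans (flatChart P n k)).source :=
    ((flatChart P n j).symm.trans (flatChart P n k)).open_source.mem_nhds hy
  refine ⟨!₂[0, 2 * ((j : ℝ) - k) * P.rowHeight n (y 0)], ?_⟩
  by_cases hjk : j = k
  · filter_upwards [hev] with z hz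
    rw [hform z hz, hjk]; simp
  · have hx : y 0 ∉ P.slitX n := by
      have hy1 : y ∈ (flatChart P n j).target := by simpa using hy.1
      have hr := (flatChart P n j).right_inv hy1
      have hs := (flatChart P n j).map_target hy1
      have hs' : (flatChart P n j).symm y ∈ (flatChart P n k).source := by simpa using hy.2
      rw [flatChart_source] at hs hs'
      rw [flatChart_apply] at hr
      have h0 : ((flatChart P n j).symm y).1 0 = y 0 := by
        conv_rhs => rw [← hr]
        simp
      rw [← h0]
      rcases hs with hs | hs
      · rcases hs' with hs' | hs'
        · exfalso
          have h1 : (j : ℝ) < k + 1 := by linarith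
          have h2 : (k : ℝ) < j + 1 := by linarith
          norm_cast at h1 h2; omega
        · exact hs'.2.2
      · exact hs.2.2
    have hc : ∀ᶠ z : Model 2 in 𝓝 y, P.rowHeight n (z 0) = P.rowHeight n (y 0) :=
      (PiLp.continuous_apply 2 _ 0).continuousAt.eventually (P.rowHeight_eventually_const n hx)
    filter_upwards [hev, hc] with z hz hz'
    rw [hform z hz, hz']

end Surface

/-- The glued surface with the flat metric which is Euclidean in the flat charts, and the connection
for which the orthonormal frame `(∂_X, ∂_Y)` of the flat coordinates is parallel. -/
def surface [NeZero n] : WeitzenbockManifold 2 :=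
  WeitzenbockManifold.ofFrame (Surface.isTranslationAtlas P n) (FrameField.standard 2 (P.Surface n))

/-- The surface `M_n`: the union of the `n²` blocks without the dislocation lines. -/
def rectangle (n : ℕ) [NeZero n] : Set (P.surface n).carrier :=
  {x : P.Surface n | x.1 0 ∈ Icc 0 P.b ∧ x.1 1 ∈ Icc 0 (2 * n : ℝ)}

/-- `K` is obtained from `M_n` by removing open neighbourhoods of the `n²` dislocation lines (open in
the glued surface, dislocation lines included) whose diameters, with respect to the distance
function of `M_n`, are at most `δ`. -/
def IsPerforated (n : ℕ) [NeZero n] (δ : ℝ) (K : Set (P.surface n).carrier) : Prop :=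
  ∃ V : Fin n → Fin n → Set (Model 2),
    (∀ i j, IsOpen (V i j) ∧ P.slit n i j ⊆ V i j ∧
      ∀ x y : P.Surface n, x ∈ P.rectangle n → y ∈ P.rectangle n → x.1 ∈ V i j → y.1 ∈ V i j →
        intrinsicEDist (P.surface n) (P.rectangle n) x y ≤ ENNReal.ofReal δ) ∧
    K = {x : P.Surface n | x ∈ P.rectangle n ∧ ∀ i j, x.1 ∉ V i j}

end DislocationData

/-! ### The limit: an annular sector with a non-symmetric connection -/

/-- The half-plane `{(r,φ) | r > 0}` of polar coordinates. -/
abbrev PolarPlane : Type := {p : Model 2 // 0 < p 0}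

namespace PolarPlane

instance : Nonempty PolarPlane := ⟨⟨!₂[1, 0], by simp⟩⟩

/-- The polar coordinate `r`. -/
def r (p : PolarPlane) : ℝ := p.1 0
/-- The polar coordinate `φ`. -/
def φ (p : PolarPlane) : ℝ := p.1 1

theorem isOpenEmbedding_val : Topology.IsOpenEmbedding (Subtype.val : PolarPlane → Model 2) :=
  (isOpen_lt continuous_const (PiLp.continuous_apply 2 _ 0)).isOpenEmbedding_subtypeVal

instance : ChartedSpace (Model 2) PolarPlane := isOpenEmbedding_val.singletonChartedSpace

theorem isTranslationAtlas : IsTranslationAtlas 2 PolarPlane := by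
  intro e he e' he' y hy
  have h1 : e = isOpenEmbedding_val.toOpenPartialHomeomorph Subtype.val := he
  have h2 : e' = e := (show e' = isOpenEmbedding_val.toOpenPartialHomeomorph Subtype.val from
    he').trans h1.symm
  subst h2
  refine ⟨0, ?_⟩
  filter_upwards [(e'.symm.trans e').open_source.mem_nhds hy] with z hz
  simpa using e'.right_inv (show z ∈ e'.target from hz.1)

/-- The projection to the `i`-th coordinate axis. -/
def axis (i : Fin 2) : Model 2 →L[ℝ] Model 2 :=
  (EuclideanSpace.proj i : Model 2 →L[ℝ] ℝ).smulRight (EuclideanSpace.single i (1 : ℝ))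

theorem axis_apply (i : Fin 2) (v : Model 2) : axis i v = EuclideanSpace.single i (v i) := by
  ext j; simp [axis]

theorem contMDiff_r : ContMDiff (𝓡 2) 𝓘(ℝ, ℝ) ∞ r :=
  (EuclideanSpace.proj 0 : Model 2 →L[ℝ] ℝ).contMDiff.comp
    (contMDiff_isOpenEmbedding isOpenEmbedding_val)

/-- The frame field `(∂_r, r⁻¹ ∂_φ)`. -/
def frame : FrameField 2 PolarPlane where
  toFun p := axis 0 + (r p)⁻¹ • axis 1
  inv p := axis 0 + r p • axis 1
  toFun_inv p v := by
    have : r p ≠ 0 := p.2.ne'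
    ext i; fin_cases i <;> simp [axis_apply, this]
  inv_toFun p v := by
    have : r p ≠ 0 := p.2.ne'
    ext i; fin_cases i <;> simp [axis_apply, this]
  smooth_toFun := contMDiff_const.add
    ((contMDiff_r.inv₀ fun p ↦ p.2.ne').smul contMDiff_const)
  smooth_inv := contMDiff_const.add (contMDiff_r.smul contMDiff_const)

/-- The polar plane with the metric for which `(∂_r, r⁻¹ ∂_φ)` is orthonormal, that is, the
Euclidean metric `dr² + r² dφ²`, and the connection for which this frame is parallel. -/
def weitzenbock : WeitzenbockManifold 2 := WeitzenbockManifold.ofFrame isTranslationAtlas frame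

/-- The radius as a function on the Weitzenböck manifold. -/
def radius (x : weitzenbock.carrier) : ℝ := r x

/-- The coordinate vector field `∂_r`. -/
def partialR : VField 2 weitzenbock.carrier :=
  fun _ ↦ (EuclideanSpace.single 0 (1 : ℝ) : Model 2)

/-- The coordinate vector field `∂_φ`. -/
def partialPhi : VField 2 weitzenbock.carrier :=
  fun _ ↦ (EuclideanSpace.single 1 (1 : ℝ) : Model 2)

/-- The coordinate one-form `dr`. -/
def dr (x : weitzenbock.carrier) : TangentSpace (𝓡 2) x →L[ℝ] ℝ :=
  (EuclideanSpace.proj 0 : Model 2 →L[ℝ] ℝ)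

/-- The coordinate one-form `dφ`. -/
def dphi (x : weitzenbock.carrier) : TangentSpace (𝓡 2) x →L[ℝ] ℝ :=
  (EuclideanSpace.proj 1 : Model 2 →L[ℝ] ℝ)

end PolarPlane

/-- The annular sector `N` of angle `ε/b`, inner radius `R_0 = ab/ε` and outer radius `R_0 + b`, in
polar coordinates. -/
def DislocationData.sector (P : DislocationData) : Set PolarPlane.weitzenbock.carrier :=
  {x : PolarPlane | x.r ∈ Icc (P.a * P.b / P.ε) (P.a * P.b / P.ε + P.b) ∧
    x.φ ∈ Icc 0 (P.ε / P.b)}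

end

/-! Let x be the abscissa on the glued surface, t the height counted in half rows, and ρ(x) the
height of a half row. Each column has width b/n and adds ε/(2n²) to ρ. Therefore ρ(x) is within
ε/(2n²) of κ(R₀+x), where κ = ε/(2nb) is the angle of the sector per half row (`abs_sum_sub_le`).
Under the identification r = R₀+x, φ = κt, flat coordinates measured from the bottom side of a row
are (x, (φ/κ − 2j)ρ(x)). Where ρ is constant, the differential is diag(1, ρ/κ), which is
O(1/n)-close to diag(1, r). The latter is an isometry from dr²+r²dφ² to the Euclidean metric and
carries (∂_r, r⁻¹∂_φ) to the flat frame.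

Near the columns of dislocation lines ρ is replaced by a smooth function h ≤ ρ (`smoothHeight`),
which differs from ρ only on intervals of length O(1/n²) and has slope bounded independently of n.
The resulting map (`unroll`, represented by `toFlat` in flat charts) is torn open along the seam t =
2j+1 only where h < ρ. Ellipses around the dislocation lines in polar coordinates, and the
corresponding holes on the surface, contain the tears. What remains is mapped diffeomorphically, and
it has corners only at those of the rectangle. The differential is bounded everywhere and
O(1/n)-close to a rotation outside n strips of total area O(1/n) (`exists_differential_eq`,
`area_strips_inter_sector_le`). This gives the two integral conditions for every exponent at once.

The distortion needs two estimates. Upper bound for distances on the surface: points of the sector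
are sent to points with the same coordinates, pushed away from the dislocation lines (`shadow`). Two
such points are joined by a segment that is straight in (x,t) and makes a detour at each of the at
most n columns. Every detour costs O(1/n²): shrink towards the bottom side of the row, pass below
the holes at constant flat height, and return (`intrinsicEDist_cross_le`). The comparison is sharp
only for short distances, with an error quadratic in the distance, so a path in the sector is first
cut into m pieces of equal length, with m fixed before n.

Lower bound: the whole surface is mapped back to the sector by a map with Lipschitz constant close
to 1 (`wrap`). In each row the angle grows slightly too fast, by the factor 1+2η, and is stopped by
a soft clamp when half a row is used up. Since this happens before a seam is reached, the map is
smooth across the seams and ignores the mismatch of heights at the dislocation lines. Composed with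
`unrollMap` it moves points by O(1/n) only.

The torsion of the limit is computed from constant coordinate fields. Their bracket vanishes, and
the only component of the inverse frame that depends on the point is r dφ. -/

noncomputable section

/-! ### Differentials, brackets and torsion in translation atlases -/

section TranslationAtlas

variable {d : ℕ} {M : Type} [TopologicalSpace M] [ChartedSpace (Model d) M]
variable {M' : Type} [TopologicalSpace M'] [ChartedSpace (Model d) M']

/-- Tangent vectors at `x` are read off in the preferred chart at `x`, and near `x` every other
chart of the atlas differs from it by a translation. -/
theorem IsTranslationAtlas.hasMFDerivAt_chart (h : IsTranslationAtlas d M)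
    {e : OpenPartialHomeomorph M (Model d)} (he : e ∈ atlas (Model d) M) {x : M}
    (hx : x ∈ e.source) :
    HasMFDerivAt (𝓡 d) (𝓡 d) e x (ContinuousLinearMap.id ℝ (Model d)) := by
  refine ⟨e.continuousAt hx, ?_⟩
  have h1 := h.hasFDerivAt (chart_mem_atlas _ x) he
    (y := chartAt (Model d) x x) (by simp [hx])
  exact h1.hasFDerivWithinAt

theorem IsTranslationAtlas.hasMFDerivAt_symm (h : IsTranslationAtlas d M)
    {e : OpenPartialHomeomorph M (Model d)} (he : e ∈ atlas (Model d) M) {y : Model d}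
    (hy : y ∈ e.target) :
    HasMFDerivAt (𝓡 d) (𝓡 d) e.symm y (ContinuousLinearMap.id ℝ (Model d)) := by
  refine ⟨e.symm.continuousAt hy, ?_⟩
  have h1 := h.hasFDerivAt he (chart_mem_atlas _ (e.symm y)) (y := y) (by simp [hy])
  exact h1.hasFDerivWithinAt

/-- A map which is smooth in charts of the atlases is smooth, and its differential is the one of its
coordinate expression. -/
theorem IsTranslationAtlas.contMDiffAt_of_charts [IsManifold (𝓡 d) ∞ M] [IsManifold (𝓡 d) ∞ M']
    {e : OpenPartialHomeomorph M (Model d)} (he : e ∈ atlas (Model d) M)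
    {e' : OpenPartialHomeomorph M' (Model d)} (he' : e' ∈ atlas (Model d) M')
    {f : M → M'} {g : Model d → Model d} {x : M} (hx : x ∈ e.source) {k : ℕ∞}
    (hg : ContDiffAt ℝ k g (e x)) (hf : ∀ᶠ y in 𝓝 x, f y ∈ e'.source ∧ e' (f y) = g (e y)) :
    ContMDiffAt (𝓡 d) (𝓡 d) k f x := by
  have hk : ((k : ℕ∞) : ℕ∞ω) ≤ ((⊤ : ℕ∞) : ℕ∞ω) := by exact_mod_cast le_top
  have hfx := hf.self_of_nhds
  have heq : f =ᶠ[𝓝 x] e'.symm ∘ g ∘ e := by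
    filter_upwards [hf] with y hy
    simp only [Function.comp_apply]
    rw [← hy.2, e'.left_inv hy.1]
  refine ContMDiffAt.congr_of_eventuallyEq ?_ heq
  have h1 : ContMDiffAt (𝓡 d) (𝓡 d) k e x :=
    (contMDiffAt_of_mem_maximalAtlas (IsManifold.subset_maximalAtlas he) hx).of_le hk
  have h3 : ContMDiffAt (𝓡 d) (𝓡 d) k e'.symm (g (e x)) :=
    (contMDiffAt_symm_of_mem_maximalAtlas (n := ((⊤ : ℕ∞) : ℕ∞ω)) (IsManifold.subset_maximalAtlas he')
      (by rw [← hfx.2]; exact e'.map_source hfx.1)).of_le hk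
  exact ContMDiffAt.comp x h3 (hg.contMDiffAt.comp x h1)

/-- The map is locally inverse chart ∘ coordinate expression ∘ chart, and the two outer
differentials are identities. -/
theorem IsTranslationAtlas.hasMFDerivAt_of_charts (h : IsTranslationAtlas d M)
    (h' : IsTranslationAtlas d M')
    {e : OpenPartialHomeomorph M (Model d)} (he : e ∈ atlas (Model d) M)
    {e' : OpenPartialHomeomorph M' (Model d)} (he' : e' ∈ atlas (Model d) M')
    {f : M → M'} {g : Model d → Model d} {L : Model d →L[ℝ] Model d} {x : M} (hx : x ∈ e.source)
    (hg : HasFDerivAt g L (e x)) (hf : ∀ᶠ y in 𝓝 x, f y ∈ e'.source ∧ e' (f y) = g (e y)) :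
    HasMFDerivAt (𝓡 d) (𝓡 d) f x L := by
  have hfx := hf.self_of_nhds
  have heq : f =ᶠ[𝓝 x] e'.symm ∘ g ∘ e := by
    filter_upwards [hf] with y hy
    simp only [Function.comp_apply]
    rw [← hy.2, e'.left_inv hy.1]
  have h1 := h.hasMFDerivAt_chart he hx
  have h3 := h'.hasMFDerivAt_symm he' (y := g (e x)) (by rw [← hfx.2]; exact e'.map_source hfx.1)
  have h2 : HasMFDerivAt (𝓡 d) (𝓡 d) g (e x) L := hg.hasMFDerivAt
  have := (h3.comp x (h2.comp x h1)).congr_of_eventuallyEq heq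
  exact this

theorem IsTranslationAtlas.contMDiffAt_path [IsManifold (𝓡 d) ∞ M]
    {e : OpenPartialHomeomorph M (Model d)} (he : e ∈ atlas (Model d) M)
    {γ : ℝ → M} {c : ℝ → Model d} {s : ℝ} (hc : ContDiffAt ℝ 1 c s)
    (hγ : ∀ᶠ t in 𝓝 s, γ t ∈ e.source ∧ e (γ t) = c t) :
    ContMDiffAt 𝓘(ℝ) (𝓡 d) 1 γ s := by
  have hγs := hγ.self_of_nhds
  have heq : γ =ᶠ[𝓝 s] e.symm ∘ c := by
    filter_upwards [hγ] with y hy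
    simp only [Function.comp_apply]
    rw [← hy.2, e.left_inv hy.1]
  refine ContMDiffAt.congr_of_eventuallyEq ?_ heq
  have h3 : ContMDiffAt (𝓡 d) (𝓡 d) 1 e.symm (c s) :=
    (contMDiffAt_symm_of_mem_maximalAtlas (n := ((⊤ : ℕ∞) : ℕ∞ω)) (IsManifold.subset_maximalAtlas he)
      (by rw [← hγs.2]; exact e.map_source hγs.1)).of_le (by exact_mod_cast le_top)
  exact ContMDiffAt.comp s h3 hc.contMDiffAt

theorem IsTranslationAtlas.mfderiv_path (h : IsTranslationAtlas d M)
    {e : OpenPartialHomeomorph M (Model d)} (he : e ∈ atlas (Model d) M)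
    {γ : ℝ → M} {c : ℝ → Model d} {v : Model d} {s : ℝ} (hc : HasDerivAt c v s)
    (hγ : ∀ᶠ t in 𝓝 s, γ t ∈ e.source ∧ e (γ t) = c t) :
    mfderiv 𝓘(ℝ) (𝓡 d) γ s (1 : ℝ) = v := by
  have hγs := hγ.self_of_nhds
  have heq : γ =ᶠ[𝓝 s] e.symm ∘ c := by
    filter_upwards [hγ] with y hy
    simp only [Function.comp_apply]
    rw [← hy.2, e.left_inv hy.1]
  have h3 := h.hasMFDerivAt_symm he (y := c s) (by rw [← hγs.2]; exact e.map_source hγs.1)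
  have h2 : HasMFDerivAt 𝓘(ℝ) (𝓡 d) c s (ContinuousLinearMap.toSpanSingleton ℝ v) :=
    hc.hasFDerivAt.hasMFDerivAt
  have := (h3.comp s h2).congr_of_eventuallyEq heq
  rw [this.mfderiv]
  exact one_smul ℝ v

/-- The vector field with constant components in a translation atlas. -/
def constField (M : Type) [TopologicalSpace M] [ChartedSpace (Model d) M] (v : Model d) :
    VField d M := fun _ ↦ v

/-- The Lie bracket on a manifold is computed from pull-backs to the preferred chart; fields with
constant components stay constant there. -/
theorem IsTranslationAtlas.mpullbackWithin_constField (h : IsTranslationAtlas d M)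
    (u : Model d) (x : M) : VectorField.mpullbackWithin 𝓘(ℝ, Model d) (𝓡 d)
      (extChartAt (𝓡 d) x).symm (constField M u) (range (𝓡 d))
      =ᶠ[𝓝 (extChartAt (𝓡 d) x x)] fun _ ↦ u := by
  have ht : (chartAt (Model d) x).target ∈ 𝓝 (extChartAt (𝓡 d) x x) := by
    simpa using (chartAt (Model d) x).open_target.mem_nhds (mem_chart_target _ x)
  filter_upwards [ht] with y hy
  have h1 := (h.hasMFDerivAt_symm (chart_mem_atlas _ x) hy).mfderiv
  have h2 : mfderivWithin 𝓘(ℝ, Model d) (𝓡 d) (extChartAt (𝓡 d) x).symm (range (𝓡 d)) y =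
      ContinuousLinearMap.id ℝ (Model d) := by
    rw [← h1, modelWithCornersSelf_coe, range_id, mfderivWithin_univ]
    rfl
  have h3 : (mfderivWithin 𝓘(ℝ, Model d) (𝓡 d) (extChartAt (𝓡 d) x).symm (range (𝓡 d)) y).inverse
      = ContinuousLinearMap.id ℝ (Model d) :=
    (congrArg ContinuousLinearMap.inverse h2).trans ContinuousLinearMap.inverse_id
  exact congrArg (fun A : Model d →L[ℝ] Model d ↦ A u) h3

theorem IsTranslationAtlas.mlieBracket_constField (h : IsTranslationAtlas d M)
    (v w : Model d) (x : M) :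
    VectorField.mlieBracket (𝓡 d) (constField M v) (constField M w) x = 0 := by
  rw [← VectorField.mlieBracketWithin_univ, VectorField.mlieBracketWithin_apply]
  have gen : ∀ (V W : Model d → Model d) (y : Model d) (S : Set (Model d)), S = univ →
      (V =ᶠ[𝓝 y] fun _ ↦ v) → (W =ᶠ[𝓝 y] fun _ ↦ w) →
      VectorField.lieBracketWithin ℝ V W S y = 0 := by
    intro V W y S hS hV hW
    rw [hS, VectorField.lieBracketWithin_univ, hV.lieBracket_vectorField_eq hW]
    simp [VectorField.lieBracket]
  have key := gen _ _ _ ((extChartAt (𝓡 d) x).symm ⁻¹' univ ∩ range (𝓡 d)) (by simp)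
    (h.mpullbackWithin_constField v x) (h.mpullbackWithin_constField w x)
  exact (congrArg _ key).trans (map_zero _)

/-- The two constant fields commute, so the torsion is the difference of two covariant derivatives,
and these differentiate the components with respect to the frame. -/
theorem FrameField.torsion_conn [IsManifold (𝓡 d) ∞ M] (h : IsTranslationAtlas d M)
    (e : FrameField d M) (x : M)
    (v w : Model d) :
    (e.conn h).torsion x (constField M v x) (constField M w x) = e.toFun x
      (mvfderiv (𝓡 d) (fun y ↦ e.inv y w) x v - mvfderiv (𝓡 d) (fun y ↦ e.inv y v) x w) := by
  have hs : ∀ u : Model d, MDifferentiableAt (𝓡 d) (𝓡 d).tangent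
      (fun x ↦ (⟨x, u⟩ : TangentBundle (𝓡 d) M)) x := fun u ↦
    (h.mdifferentiableAt_section (fun _ ↦ u) x).2 mdifferentiableAt_const
  have := (e.conn h).torsion_apply (X := constField M v) (Y := constField M w) (hs v) (hs w)
  rw [h.mlieBracket_constField v w x, sub_zero] at this
  refine this.trans ?_
  exact (map_sub (e.toFun x) _ _).symm

theorem FrameField.standard_torsion [IsManifold (𝓡 d) ∞ M] (h : IsTranslationAtlas d M) :
    ((FrameField.standard d M).conn h).torsion = 0 := by
  funext x
  refine ContinuousLinearMap.ext fun v ↦ ContinuousLinearMap.ext fun w ↦ ?_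
  refine (FrameField.torsion_conn h _ x v w).trans ?_
  have : ∀ u : Model d, mvfderiv (𝓡 d) (fun y : M ↦ (FrameField.standard d M).inv y u) x = 0 :=
    fun u ↦ mvfderiv_const u
  have h2 := congrArg₂ (fun A B : Model d →L[ℝ] Model d ↦ A v - B w) (this w) (this v)
  exact h2.trans (sub_zero (0 : Model d))

theorem WeitzenbockManifold.norm_ofFrame [T2Space M] [SecondCountableTopology M]
    [MeasurableSpace M] [BorelSpace M] (h : IsTranslationAtlas d M) (e : FrameField d M)
    (x : (WeitzenbockManifold.ofFrame h e).carrier) (v : TangentSpace (𝓡 d) x) :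
    ‖v‖ = ‖(e.inv x v : Model d)‖ := by
  rw [norm_eq_sqrt_real_inner]
  change √(inner ℝ (e.inv x v) (e.inv x v)) = _
  exact (norm_eq_sqrt_real_inner (F := Model d) _).symm

end TranslationAtlas

/-! ### The intrinsic distance: symmetry, triangle inequality, Lipschitz maps -/

section IntrinsicDistance

variable {d : ℕ} {W W' : WeitzenbockManifold d} {K : Set W.carrier} {K' : Set W'.carrier}

theorem intrinsicEDist_le_pathELength {γ : ℝ → W.carrier} {x y : W.carrier}
    (hγ : ContMDiffOn 𝓘(ℝ) (𝓡 d) 1 γ (Icc 0 1)) (hK : MapsTo γ (Icc 0 1) K)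
    (h0 : γ 0 = x) (h1 : γ 1 = y) : intrinsicEDist W K x y ≤ pathELength (𝓡 d) γ 0 1 :=
  iInf_le_of_le γ (iInf_le_of_le hγ (iInf_le_of_le hK (iInf_le_of_le h0 (iInf_le_of_le h1 le_rfl))))

theorem exists_of_intrinsicEDist_lt {x y : W.carrier} {r : ℝ≥0∞} (h : intrinsicEDist W K x y < r) :
    ∃ γ : ℝ → W.carrier, ContMDiffOn 𝓘(ℝ) (𝓡 d) 1 γ (Icc 0 1) ∧ MapsTo γ (Icc 0 1) K ∧
      γ 0 = x ∧ γ 1 = y ∧ pathELength (𝓡 d) γ 0 1 < r := by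
  simp only [intrinsicEDist, iInf_lt_iff, exists_prop] at h
  exact h

theorem intrinsicEDist_self {x : W.carrier} (hx : x ∈ K) : intrinsicEDist W K x x = 0 := by
  refine le_antisymm ?_ bot_le
  refine (intrinsicEDist_le_pathELength (γ := fun _ ↦ x) contMDiffOn_const (fun _ _ ↦ hx) rfl
    rfl).trans ?_
  rw [pathELength_eq_lintegral_mfderiv_Icc]
  have : ∀ t : ℝ, mfderiv 𝓘(ℝ) (𝓡 d) (fun _ : ℝ ↦ x) t = 0 := fun t ↦ mfderiv_const
  simp [this]

theorem intrinsicEDist_comm (x y : W.carrier) :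
    intrinsicEDist W K x y = intrinsicEDist W K y x := by
  suffices H : ∀ x y, intrinsicEDist W K y x ≤ intrinsicEDist W K x y from
    le_antisymm (H y x) (H x y)
  intro x y
  refine le_of_forall_gt fun r hr ↦ ?_
  obtain ⟨γ, hγ, hK, h0, h1, hl⟩ := exists_of_intrinsicEDist_lt hr
  have hm : MapsTo (fun t : ℝ ↦ 1 - t) (Icc 0 1) (Icc 0 1) := fun t ht ↦
    ⟨by linarith [ht.2], by linarith [ht.1]⟩
  have hs : ContMDiffOn 𝓘(ℝ) (𝓡 d) 1 (γ ∘ fun t : ℝ ↦ 1 - t) (Icc 0 1) := by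
    refine hγ.comp ?_ hm
    rw [contMDiffOn_iff_contDiffOn]
    fun_prop
  refine (intrinsicEDist_le_pathELength hs (hK.comp hm) (by simpa using h1)
    (by simpa using h0)).trans_lt ?_
  rw [pathELength_comp_of_antitoneOn zero_le_one (fun a _ b _ hab ↦ by show 1 - b ≤ 1 - a; linarith)
    (by fun_prop)]
  · simpa using hl
  · simpa using hγ.mdifferentiableOn one_ne_zero

/-- Reparametrisation by a smooth transition function keeps the length and makes the path constant
near both ends, so that two such paths can be concatenated to a `C^1` path. -/
theorem exists_locally_constant_of_intrinsicEDist_lt {x y : W.carrier} {r : ℝ≥0∞} {a b : ℝ}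
    (hr : intrinsicEDist W K x y < r) (hab : a < b) :
    ∃ γ : ℝ → W.carrier, γ a = x ∧ γ b = y ∧ ContMDiff 𝓘(ℝ) (𝓡 d) 1 γ ∧ (∀ t, γ t ∈ K) ∧
    pathELength (𝓡 d) γ a b < r ∧ γ =ᶠ[𝓝 a] (fun _ ↦ x) ∧ γ =ᶠ[𝓝 b] (fun _ ↦ y) := by
  rcases exists_of_intrinsicEDist_lt hr with ⟨γ, γ_smooth, hK, hγx, hγy, hγ⟩
  rcases exists_between hab with ⟨a', haa', ha'b⟩
  rcases exists_between ha'b with ⟨b', ha'b', hb'b⟩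
  let η (t : ℝ) : ℝ := Real.smoothTransition ((b' - a')⁻¹ * (t - a'))
  have A (t) (ht : t < a') : η t = 0 := by
    simp only [η, Real.smoothTransition.zero_iff_nonpos]
    apply mul_nonpos_of_nonneg_of_nonpos
    · simpa using ha'b'.le
    · linarith
  have A' (t) (ht : t < a') : (γ ∘ η) t = x := by simp [A t ht, hγx]
  have B (t) (ht : b' < t) : η t = 1 := by
    simp only [η, Real.smoothTransition.eq_one_iff_one_le, inv_mul_eq_div]
    rw [one_le_div₀] <;> linarith
  have B' (t) (ht : b' < t) : (γ ∘ η) t = y := by simp [B t ht, hγy]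
  have hη : ∀ t, η t ∈ Icc (0 : ℝ) 1 := fun t ↦
    ⟨Real.smoothTransition.nonneg _, Real.smoothTransition.le_one _⟩
  refine ⟨γ ∘ η, A' _ haa', B' _ hb'b, ?_, fun t ↦ hK (hη t), ?_, ?_, ?_⟩
  · rw [← contMDiffOn_univ]
    apply γ_smooth.comp
    · rw [contMDiffOn_univ, contMDiff_iff_contDiff]
      fun_prop
    · exact fun t _ ↦ hη t
  · convert! hγ using 1
    rw [← A a haa', ← B b hb'b]
    apply pathELength_comp_of_monotoneOn hab.le
    · apply Monotone.monotoneOn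
      apply Real.smoothTransition.monotone.comp
      intro t u htu
      dsimp only
      gcongr
    · simp only [η]
      apply (ContDiff.contDiffOn _).differentiableOn one_ne_zero
      fun_prop
    · rw [A a haa', B b hb'b]
      apply γ_smooth.mdifferentiableOn one_ne_zero
  · filter_upwards [Iio_mem_nhds haa'] with t ht using A' t ht
  · filter_upwards [Ioi_mem_nhds hb'b] with t ht using B' t ht

theorem intrinsicEDist_triangle (x y z : W.carrier) :
    intrinsicEDist W K x z ≤ intrinsicEDist W K x y + intrinsicEDist W K y z := by
  apply le_of_forall_gt (fun r hr ↦ ?_)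
  rcases ENNReal.exists_add_lt_of_add_lt hr with ⟨u, hu, v, hv, huv⟩
  rcases exists_locally_constant_of_intrinsicEDist_lt hu zero_lt_one with
    ⟨γ₁, hγ₁0, hγ₁1, hγ₁_smooth, hK₁, hγ₁, -, hγ₁_const⟩
  rcases exists_locally_constant_of_intrinsicEDist_lt hv one_lt_two with
    ⟨γ₂, hγ₂1, hγ₂2, hγ₂_smooth, hK₂, hγ₂, hγ₂_const, -⟩
  let γ := piecewise (Iic 1) γ₁ γ₂
  have hsm : ContMDiff 𝓘(ℝ) (𝓡 d) 1 γ :=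
    ContMDiff.piecewise_Iic hγ₁_smooth hγ₂_smooth (hγ₁_const.trans hγ₂_const.symm)
  have hγK : ∀ t, γ t ∈ K := by
    intro t
    by_cases ht : t ≤ 1
    · simpa [γ, ht] using hK₁ t
    · simpa [γ, ht] using hK₂ t
  have : intrinsicEDist W K x z ≤ pathELength (𝓡 d) (γ ∘ fun t : ℝ ↦ 2 * t) 0 1 := by
    refine intrinsicEDist_le_pathELength ?_ (fun t _ ↦ hγK _) ?_ ?_
    · refine (hsm.comp ?_).contMDiffOn
      rw [contMDiff_iff_contDiff]
      fun_prop
    · simp [γ, hγ₁0]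
    · simp [γ, hγ₂2]
  rw [pathELength_comp_of_monotoneOn zero_le_one (fun a _ b _ hab ↦ by simpa using hab)
    (by fun_prop) (by simpa using hsm.contMDiffOn.mdifferentiableOn one_ne_zero)] at this
  apply this.trans_lt (lt_trans ?_ huv)
  rw [mul_zero, mul_one, ← pathELength_add zero_le_one one_le_two]
  gcongr
  · convert! hγ₁ using 1
    apply pathELength_congr
    intro t ht
    simp [γ, ht.2]
  · convert! hγ₂ using 1
    apply pathELength_congr_Ioo
    intro t ht
    simp [γ, ht.1]

/-- A map which does not stretch tangent vectors by more than `C` does not stretch distances by more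
than `C`. -/
theorem intrinsicEDist_le_of_norm_mfderiv_le {G : W.carrier → W'.carrier} {C : ℝ} (hC : 0 < C)
    (hG : ∀ x ∈ K, ContMDiffAt (𝓡 d) (𝓡 d) 1 G x) (hmaps : MapsTo G K K')
    (hb : ∀ x ∈ K, ∀ v : TangentSpace (𝓡 d) x, ‖mfderiv (𝓡 d) (𝓡 d) G x v‖ ≤ C * ‖v‖)
    (x y : W.carrier) :
    intrinsicEDist W' K' (G x) (G y) ≤ ENNReal.ofReal C * intrinsicEDist W K x y := by
  have hC0 : ENNReal.ofReal C ≠ 0 := by simpa using hC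
  rw [← ENNReal.div_le_iff' hC0 ENNReal.ofReal_ne_top]
  refine le_iInf fun γ ↦ le_iInf fun hγ ↦ le_iInf fun hK ↦ le_iInf fun h0 ↦ le_iInf fun h1 ↦ ?_
  rw [ENNReal.div_le_iff' hC0 ENNReal.ofReal_ne_top]
  have hcomp : ContMDiffOn 𝓘(ℝ) (𝓡 d) 1 (G ∘ γ) (Icc 0 1) := fun t ht ↦
    (hG _ (hK ht)).comp_contMDiffWithinAt t (hγ t ht)
  refine (intrinsicEDist_le_pathELength hcomp (hmaps.comp hK) (congrArg G h0)
    (congrArg G h1)).trans ?_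
  rw [pathELength_eq_lintegral_mfderiv_Ioo, pathELength_eq_lintegral_mfderiv_Ioo,
    ← lintegral_const_mul' _ _ ENNReal.ofReal_ne_top]
  refine setLIntegral_mono' measurableSet_Ioo fun t ht ↦ ?_
  have ht' : t ∈ Icc (0 : ℝ) 1 := Ioo_subset_Icc_self ht
  have hd : MDifferentiableAt 𝓘(ℝ) (𝓡 d) γ t :=
    ((hγ t ht').contMDiffAt (Icc_mem_nhds ht.1 ht.2)).mdifferentiableAt one_ne_zero
  rw [mfderiv_comp t ((hG _ (hK ht')).mdifferentiableAt one_ne_zero) hd]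
  have := hb _ (hK ht') (mfderiv 𝓘(ℝ) (𝓡 d) γ t (1 : ℝ))
  rw [← ofReal_norm, ← ofReal_norm, ← ENNReal.ofReal_mul hC.le]
  exact ENNReal.ofReal_le_ofReal this

end IntrinsicDistance

/-! ### Staircases and the slope of the smooth transition -/

section Steps

/-- A sum of functions that climb from `0` to `1` over consecutive intervals of length `β` differs by
at most `1` from `x / β`. -/
theorem abs_sum_steps_sub_le {n : ℕ} {β x : ℝ} (hβ : 0 < β) (hx0 : 0 ≤ x) (hxn : x ≤ n * β)
    {T : ℕ → ℝ} (h0 : ∀ k, 0 ≤ T k) (h1 : ∀ k, T k ≤ 1)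
    (hl : ∀ k : ℕ, x ≤ k * β → T k = 0) (hr : ∀ k : ℕ, (k + 1) * β ≤ x → T k = 1) :
    |∑ k ∈ Finset.range n, T k - x / β| ≤ 1 := by
  have hy : x / β ≤ n := by rwa [div_le_iff₀ hβ]
  have hy0 : 0 ≤ x / β := by positivity
  have count : ∀ m : ℕ, m ≤ n → ∑ k ∈ Finset.range n, (if k < m then (1 : ℝ) else 0) = m := by
    intro m hm
    rw [← Finset.sum_filter, Finset.sum_const, nsmul_eq_mul, mul_one]
    congr 1
    rw [show (Finset.range n).filter (fun k ↦ k < m) = Finset.range m by ext k; simp; omega]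
    simp
  rw [abs_le]
  -- The steps with index below `⌊x / β⌋` are complete, and those with index at least `⌈x / β⌉` have
  -- not begun; both integers are within 1 of `x / β`.
  constructor
  · have hm : ⌊x / β⌋₊ ≤ n := Nat.floor_le_of_le hy
    have : (⌊x / β⌋₊ : ℝ) ≤ ∑ k ∈ Finset.range n, T k := by
      rw [← count _ hm]
      refine Finset.sum_le_sum fun k _ ↦ ?_
      split_ifs with hk
      · rw [hr k]
        rw [← le_div_iff₀ hβ]
        have := Nat.floor_le hy0
        have h2 : (k : ℝ) + 1 ≤ ⌊x / β⌋₊ := by exact_mod_cast hk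
        linarith
      · exact h0 k
    have := Nat.lt_floor_add_one (x / β)
    linarith
  · have hm : ⌈x / β⌉₊ ≤ n := Nat.ceil_le.2 hy
    have : ∑ k ∈ Finset.range n, T k ≤ ⌈x / β⌉₊ := by
      rw [← count _ hm]
      refine Finset.sum_le_sum fun k _ ↦ ?_
      split_ifs with hk
      · exact h1 k
      · rw [hl k]
        rw [← div_le_iff₀ hβ]
        exact (Nat.le_ceil _).trans (by exact_mod_cast not_lt.1 hk)
    have := Nat.ceil_lt_add_one hy0
    linarith

/-- At these points, including the end points 0 and 1, the function attains its global minimum or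
maximum. -/
theorem Real.deriv_smoothTransition_eq_zero {u : ℝ} (hu : u ≤ 0 ∨ 1 ≤ u) :
    deriv Real.smoothTransition u = 0 := by
  rcases hu with hu | hu
  · refine IsLocalMin.deriv_eq_zero (Filter.Eventually.of_forall fun y ↦ ?_)
    rw [Real.smoothTransition.zero_of_nonpos hu]
    exact Real.smoothTransition.nonneg y
  · refine IsLocalMax.deriv_eq_zero (Filter.Eventually.of_forall fun y ↦ ?_)
    rw [Real.smoothTransition.one_of_one_le hu]
    exact Real.smoothTransition.le_one y

theorem Real.exists_abs_deriv_smoothTransition_le :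
    ∃ C : ℝ, 0 ≤ C ∧ ∀ u, |deriv Real.smoothTransition u| ≤ C := by
  have hc : Continuous (deriv Real.smoothTransition) :=
    (Real.smoothTransition.contDiff (n := 1)).continuous_deriv le_rfl
  obtain ⟨C, hC⟩ := isCompact_Icc.exists_bound_of_continuousOn
    (s := Icc (0 : ℝ) 1) hc.continuousOn
  have hC0 : 0 ≤ C := (norm_nonneg _).trans (hC 0 (by simp))
  refine ⟨C, hC0, fun u ↦ ?_⟩
  by_cases hu : u ∈ Icc (0 : ℝ) 1
  · exact hC u hu
  · rw [Real.deriv_smoothTransition_eq_zero, abs_zero]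
    · exact hC0
    · rw [mem_Icc, not_and_or, not_le, not_le] at hu
      exact hu.imp le_of_lt le_of_lt

/-- A bound for the derivative of the smooth transition function. -/
def transitionSlope : ℝ := Real.exists_abs_deriv_smoothTransition_le.choose

theorem transitionSlope_nonneg : 0 ≤ transitionSlope :=
  Real.exists_abs_deriv_smoothTransition_le.choose_spec.1

theorem abs_deriv_smoothTransition_le (u : ℝ) :
    |deriv Real.smoothTransition u| ≤ transitionSlope :=
  Real.exists_abs_deriv_smoothTransition_le.choose_spec.2 u

end Steps

/-! ### Heights of the half rows and their smooth approximation -/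

namespace DislocationData

variable (P : DislocationData) (n : ℕ)

/-- The width of the dislocation lines. -/
def width : ℝ := slitWidth P.θ (P.εBlock n)

/-- The abscissa of the centre of the dislocation lines in column `i`. -/
def center (i : ℕ) : ℝ := (i + 1 / 2) * P.bBlock n

theorem slitWidth_pos {δ : ℝ} (hδ : 0 < δ) : 0 < slitWidth P.θ δ := by
  have hs := Real.sin_pos_of_pos_of_lt_pi P.θ_pos (by linarith [P.θ_lt, Real.pi_pos])
  have hc := Real.cos_pos_of_mem_Ioo ⟨by linarith [P.θ_pos, Real.pi_pos], P.θ_lt⟩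
  unfold slitWidth; positivity

theorem width_eq : P.width n = slitWidth P.θ P.ε / n ^ 2 := by
  simp only [width, slitWidth, εBlock]; ring

variable [NeZero n]

theorem cast_pos' : (0 : ℝ) < n := by exact_mod_cast Nat.pos_of_ne_zero (NeZero.ne n)

theorem εBlock_pos : 0 < P.εBlock n := by
  have := P.ε_pos; have := cast_pos' n; unfold εBlock; positivity

theorem width_pos : 0 < P.width n := P.slitWidth_pos (P.εBlock_pos n)

theorem bBlock_pos : 0 < P.bBlock n := by
  have := P.b_pos; have := cast_pos' n; unfold bBlock; positivity

omit [NeZero n] in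
theorem columnSlit_eq (i : ℕ) : P.columnSlit n i =
    Icc (P.center n i - P.width n / 2) (P.center n i + P.width n / 2) := by
  simp only [columnSlit, center, width]
  congr 1 <;> ring

/-- The increase of the height of a half row in column `i`. -/
def rise (i : ℕ) (x : ℝ) : ℝ :=
  hexagonHeight (P.aBlock n i) (P.bBlock n) P.θ (P.εBlock n) (x - i * P.bBlock n) - P.aBlock n i / 2

omit [NeZero n] in
theorem rowHeight_eq (x : ℝ) :
    P.rowHeight n x = P.aBlock n 0 / 2 + ∑ i ∈ Finset.range n, P.rise n i x := rfl

omit [NeZero n] in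
theorem rise_nonneg (i : ℕ) (x : ℝ) : 0 ≤ P.rise n i x := by
  have := P.εBlock_nonneg n
  rw [rise, hexagonHeight, add_sub_cancel_left]
  exact le_min (le_max_right _ _) (by linarith)

omit [NeZero n] in
theorem rise_le (i : ℕ) (x : ℝ) : P.rise n i x ≤ P.εBlock n / 2 := by
  rw [rise, hexagonHeight, add_sub_cancel_left]
  exact min_le_right _ _

omit [NeZero n] in
theorem rise_of_le {i : ℕ} {x : ℝ} (h : x ≤ P.center n i - P.width n / 2) : P.rise n i x = 0 := by
  rw [rise, hexagonHeight_of_le P.θ_pos P.θ_lt (P.εBlock_nonneg n), sub_self]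
  simp only [center, width] at h; linarith

omit [NeZero n] in
theorem rise_of_ge {i : ℕ} {x : ℝ} (h : P.center n i + P.width n / 2 ≤ x) :
    P.rise n i x = P.εBlock n / 2 := by
  rw [rise, hexagonHeight_of_ge P.θ_pos P.θ_lt]
  · ring
  · simp only [center, width] at h; linarith

/-- A smooth function that climbs from `0` to `1` immediately to the right of the dislocation lines in
column `i`. -/
def ramp (i : ℕ) (x : ℝ) : ℝ :=
  Real.smoothTransition ((x - P.center n i - P.width n / 2) / (P.width n / 2))

theorem ramp_of_le {i : ℕ} {x : ℝ} (h : x ≤ P.center n i + P.width n / 2) : P.ramp n i x = 0 := by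
  have := P.width_pos n
  exact Real.smoothTransition.zero_of_nonpos (div_nonpos_of_nonpos_of_nonneg (by linarith)
    (by linarith))

theorem ramp_of_ge {i : ℕ} {x : ℝ} (h : P.center n i + P.width n ≤ x) : P.ramp n i x = 1 := by
  have := P.width_pos n
  refine Real.smoothTransition.one_of_one_le ?_
  rw [le_div_iff₀ (by linarith)]; linarith

omit [NeZero n] in
theorem contDiff_ramp (i : ℕ) : ContDiff ℝ ∞ (P.ramp n i) := by
  unfold ramp; fun_prop

omit [NeZero n] in
theorem hasDerivAt_ramp (i : ℕ) (x : ℝ) : HasDerivAt (P.ramp n i)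
    (deriv Real.smoothTransition ((x - P.center n i - P.width n / 2) / (P.width n / 2))
      / (P.width n / 2)) x := by
  have h1 : HasDerivAt (fun x ↦ (x - P.center n i - P.width n / 2) / (P.width n / 2))
      (1 / (P.width n / 2)) x :=
    (((hasDerivAt_id x).sub_const _).sub_const _).div_const _
  have h2 := ((Real.smoothTransition.contDiff (n := 1)).differentiable one_ne_zero
    ((x - P.center n i - P.width n / 2) / (P.width n / 2))).hasDerivAt
  have := h2.comp x h1
  rw [mul_one_div] at this
  exact this

theorem deriv_ramp_eq_zero {i : ℕ} {x : ℝ}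
    (h : x ∉ Ioo (P.center n i + P.width n / 2) (P.center n i + P.width n)) :
    deriv (P.ramp n i) x = 0 := by
  have := P.width_pos n
  rw [(P.hasDerivAt_ramp n i x).deriv, Real.deriv_smoothTransition_eq_zero, zero_div]
  rw [mem_Ioo, not_and_or, not_lt, not_lt] at h
  rcases h with h | h
  · left; exact div_nonpos_of_nonpos_of_nonneg (by linarith) (by linarith)
  · right; rw [le_div_iff₀ (by linarith)]; linarith

theorem abs_deriv_ramp_le (i : ℕ) (x : ℝ) :
    |deriv (P.ramp n i) x| ≤ transitionSlope * 2 / P.width n := by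
  have := P.width_pos n
  rw [(P.hasDerivAt_ramp n i x).deriv, abs_div, abs_of_pos (half_pos this), div_div_eq_mul_div]
  have := abs_deriv_smoothTransition_le ((x - P.center n i - P.width n / 2) / (P.width n / 2))
  gcongr

/-- A smooth approximation from below of the height of the half rows. It differs from the height only
near the dislocation lines. -/
def smoothHeight (x : ℝ) : ℝ :=
  P.aBlock n 0 / 2 + ∑ i ∈ Finset.range n, P.εBlock n / 2 * P.ramp n i x

/-- The ramp is still zero until the end of the dislocation line, and from there on the rise is
already complete. -/
theorem ramp_mul_le_rise (i : ℕ) (x : ℝ) : P.εBlock n / 2 * P.ramp n i x ≤ P.rise n i x := by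
  rcases le_total x (P.center n i + P.width n / 2) with h | h
  · rw [P.ramp_of_le n h, mul_zero]; exact P.rise_nonneg n i x
  · rw [P.rise_of_ge n h]
    have := P.εBlock_pos n
    exact mul_le_of_le_one_right (by linarith) (Real.smoothTransition.le_one _)

theorem smoothHeight_le_rowHeight (x : ℝ) : P.smoothHeight n x ≤ P.rowHeight n x := by
  rw [rowHeight_eq, smoothHeight]
  gcongr with i
  exact P.ramp_mul_le_rise n i x

theorem smoothHeight_eq_rowHeight {x : ℝ}
    (h : ∀ i < n, x ∉ Ioo (P.center n i - P.width n / 2) (P.center n i + P.width n)) :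
    P.smoothHeight n x = P.rowHeight n x := by
  have hw := P.width_pos n
  rw [rowHeight_eq, smoothHeight]
  congr 1
  refine Finset.sum_congr rfl fun i hi ↦ ?_
  have := h i (Finset.mem_range.1 hi)
  rw [mem_Ioo, not_and_or, not_lt, not_lt] at this
  rcases this with h1 | h1
  · rw [P.rise_of_le n h1, P.ramp_of_le n (by linarith), mul_zero]
  · rw [P.rise_of_ge n (by linarith), P.ramp_of_ge n h1, mul_one]

omit [NeZero n] in
theorem contDiff_smoothHeight : ContDiff ℝ ∞ (P.smoothHeight n) := by
  unfold smoothHeight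
  refine contDiff_const.add (ContDiff.sum fun i _ ↦ contDiff_const.mul (P.contDiff_ramp n i))

theorem le_smoothHeight (x : ℝ) : P.a / (2 * n) ≤ P.smoothHeight n x := by
  have := P.εBlock_pos n
  have h1 : P.a / (2 * n) = P.aBlock n 0 / 2 := by simp [aBlock]; ring
  rw [h1, smoothHeight]
  exact le_add_of_nonneg_right (Finset.sum_nonneg fun i _ ↦
    mul_nonneg (by linarith) (Real.smoothTransition.nonneg _))

theorem smoothHeight_pos (x : ℝ) : 0 < P.smoothHeight n x := by
  have := P.a_pos; have := cast_pos' n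
  exact lt_of_lt_of_le (by positivity) (P.le_smoothHeight n x)

theorem le_rowHeight (x : ℝ) : P.a / (2 * n) ≤ P.rowHeight n x :=
  (P.le_smoothHeight n x).trans (P.smoothHeight_le_rowHeight n x)

/-- The initial height is `a/(2n)`, and each of the `n` columns adds at most `ε/(2n²)`. -/
theorem rowHeight_le (x : ℝ) : P.rowHeight n x ≤ (P.a + P.ε) / (2 * n) := by
  have hn := cast_pos' n
  rw [rowHeight_eq]
  have : ∑ i ∈ Finset.range n, P.rise n i x ≤ ∑ i ∈ Finset.range n, P.εBlock n / 2 :=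
    Finset.sum_le_sum fun i _ ↦ P.rise_le n i x
  rw [Finset.sum_const, Finset.card_range, nsmul_eq_mul] at this
  have h1 : P.aBlock n 0 / 2 + n * (P.εBlock n / 2) = (P.a + P.ε) / (2 * n) := by
    simp [aBlock, εBlock]; field_simp
  linarith

/-- The dislocation lines are short compared with the blocks: true for large `n`. -/
def IsFine : Prop := 8 * P.width n ≤ P.bBlock n ∧ 8 * P.width n * n ≤ 1

/-- The factor between the height `t` on the surface, in units of half rows, and the angle `φ`. -/
def angleStep : ℝ := P.ε / (2 * n * P.b)

/-- The inner radius of the annular sector. -/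
def innerRadius : ℝ := P.a * P.b / P.ε

theorem angleStep_pos : 0 < P.angleStep n := by
  have := P.ε_pos; have := P.b_pos; have := cast_pos' n; unfold angleStep; positivity

omit [NeZero n] in
theorem innerRadius_pos : 0 < P.innerRadius := by
  have := P.ε_pos; have := P.b_pos; have := P.a_pos; unfold innerRadius; positivity

/-- With κ = `angleStep` and R₀ = `innerRadius`, the product κR₀ = a/(2n) is the height at `x = 0`,
and κb/n = ε_n/2 is the rise in one column. After division by ε_n/2 only the comparison of a
staircase with a line is left. -/
theorem abs_sum_sub_le {x : ℝ} (hx : x ∈ Icc 0 P.b) {T : ℕ → ℝ} (h0 : ∀ k, 0 ≤ T k)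
    (h1 : ∀ k, T k ≤ P.εBlock n / 2) (hl : ∀ k : ℕ, x ≤ k * P.bBlock n → T k = 0)
    (hr : ∀ k : ℕ, (k + 1) * P.bBlock n ≤ x → T k = P.εBlock n / 2) :
    |P.aBlock n 0 / 2 + ∑ k ∈ Finset.range n, T k - P.angleStep n * (P.innerRadius + x)|
      ≤ P.εBlock n / 2 := by
  have hn := cast_pos' n
  have hε := P.εBlock_pos n
  have hb := P.b_pos
  have hε' := P.ε_pos
  have key := abs_sum_steps_sub_le (n := n) (P.bBlock_pos n) hx.1
    (by rw [bBlock, mul_div_cancel₀ _ hn.ne']; exact hx.2) (T := fun k ↦ T k / (P.εBlock n / 2))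
    (fun k ↦ div_nonneg (h0 k) (by linarith)) (fun k ↦ (div_le_one (by linarith)).2 (h1 k))
    (fun k hk ↦ by simp [hl k hk]) (fun k hk ↦ by
      rw [hr k hk, div_self (by linarith)])
  rw [← Finset.sum_div] at key
  have h2 : P.aBlock n 0 / 2 + ∑ k ∈ Finset.range n, T k - P.angleStep n * (P.innerRadius + x) =
      ((∑ k ∈ Finset.range n, T k) / (P.εBlock n / 2) - x / P.bBlock n) * (P.εBlock n / 2) := by
    simp only [aBlock, angleStep, innerRadius, εBlock, bBlock]
    field_simp
    push_cast
    ring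
  rw [h2, abs_mul, abs_of_pos (half_pos hε)]
  nlinarith

variable {n} in
omit [NeZero n] in
theorem IsFine.slit_subset (h : P.IsFine n) (i : ℕ) :
    i * P.bBlock n ≤ P.center n i - 4 * P.width n ∧
      P.center n i + 4 * P.width n ≤ (i + 1) * P.bBlock n := by
  have h1 := h.1
  constructor <;> simp only [center] <;> linarith

variable {n} in
theorem IsFine.abs_rowHeight_sub_le (h : P.IsFine n) {x : ℝ} (hx : x ∈ Icc 0 P.b) :
    |P.rowHeight n x - P.angleStep n * (P.innerRadius + x)| ≤ P.εBlock n / 2 := by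
  have hw := P.width_pos n
  refine P.abs_sum_sub_le n hx (fun k ↦ P.rise_nonneg n k x) (fun k ↦ P.rise_le n k x)
    (fun k hk ↦ P.rise_of_le n ?_) (fun k hk ↦ P.rise_of_ge n ?_)
  · linarith [(IsFine.slit_subset P h k).1]
  · linarith [(IsFine.slit_subset P h k).2]

variable {n} in
theorem IsFine.abs_smoothHeight_sub_le (h : P.IsFine n) {x : ℝ} (hx : x ∈ Icc 0 P.b) :
    |P.smoothHeight n x - P.angleStep n * (P.innerRadius + x)| ≤ P.εBlock n / 2 := by
  have hw := P.width_pos n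
  have hε := P.εBlock_pos n
  refine P.abs_sum_sub_le n hx (T := fun k ↦ P.εBlock n / 2 * P.ramp n k x)
    (fun k ↦ mul_nonneg (by linarith) (Real.smoothTransition.nonneg _))
    (fun k ↦ mul_le_of_le_one_right (by linarith) (Real.smoothTransition.le_one _))
    (fun k hk ↦ ?_) (fun k hk ↦ ?_)
  · simp only [P.ramp_of_le n (x := x) (i := k) (by linarith [(IsFine.slit_subset P h k).1]), mul_zero]
  · simp only [P.ramp_of_ge n (x := x) (i := k) (by linarith [(IsFine.slit_subset P h k).2]), mul_one]

omit [NeZero n] in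
theorem hasDerivAt_smoothHeight (x : ℝ) : HasDerivAt (P.smoothHeight n)
    (∑ i ∈ Finset.range n, P.εBlock n / 2 * deriv (P.ramp n i) x) x := by
  unfold smoothHeight
  refine HasDerivAt.const_add _ (HasDerivAt.fun_sum fun i _ ↦ HasDerivAt.const_mul _ ?_)
  exact ((P.contDiff_ramp n i).differentiable (by simp) x).hasDerivAt

theorem deriv_smoothHeight_eq_zero {x : ℝ}
    (h : ∀ i < n, x ∉ Ioo (P.center n i + P.width n / 2) (P.center n i + P.width n)) :
    deriv (P.smoothHeight n) x = 0 := by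
  rw [(P.hasDerivAt_smoothHeight n x).deriv]
  exact Finset.sum_eq_zero fun i hi ↦ by
    rw [P.deriv_ramp_eq_zero n (h i (Finset.mem_range.1 hi)), mul_zero]

/-- A bound for the slope of the smooth height. -/
def heightSlope : ℝ := transitionSlope * P.ε / slitWidth P.θ P.ε

omit [NeZero n] in
theorem heightSlope_nonneg : 0 ≤ P.heightSlope := by
  have := transitionSlope_nonneg; have := P.ε_pos; have := P.slitWidth_pos P.ε_pos
  unfold heightSlope; positivity

variable {n} in
-- Ramps of different columns have disjoint supports of the slope, so a single one contributes. It
-- rises by ε_n/2 over half a width, and both quantities scale like 1/n².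
theorem IsFine.abs_deriv_smoothHeight_le (h : P.IsFine n) (x : ℝ) :
    |deriv (P.smoothHeight n) x| ≤ P.heightSlope := by
  have hw := P.width_pos n
  by_cases hx : ∀ i < n, x ∉ Ioo (P.center n i + P.width n / 2) (P.center n i + P.width n)
  · rw [P.deriv_smoothHeight_eq_zero n hx, abs_zero]
    exact P.heightSlope_nonneg
  · push Not at hx
    obtain ⟨i, hi, hxi⟩ := hx
    have hs := IsFine.slit_subset P h
    rw [(P.hasDerivAt_smoothHeight n x).deriv, Finset.sum_eq_single i]
    · have h1 := P.abs_deriv_ramp_le n i x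
      have hε := P.εBlock_pos n
      rw [abs_mul, abs_of_pos (half_pos hε)]
      have h2 : P.heightSlope = P.εBlock n / 2 * (transitionSlope * 2 / P.width n) := by
        have hn := cast_pos' n
        have := P.slitWidth_pos P.ε_pos
        rw [width_eq, heightSlope, εBlock]; field_simp
      rw [h2]
      gcongr
    · intro k _ hk
      rw [P.deriv_ramp_eq_zero n, mul_zero]
      intro hxk
      have h1 := hs i
      have h2 := hs k
      have hb := P.bBlock_pos n
      rcases lt_or_gt_of_ne hk with h3 | h3
      · have : (k : ℝ) + 1 ≤ i := by exact_mod_cast h3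
        nlinarith [hxk.1, hxk.2, hxi.1, hxi.2]
      · have : (i : ℝ) + 1 ≤ k := by exact_mod_cast h3
        nlinarith [hxk.1, hxk.2, hxi.1, hxi.2]
    · intro h'; exact absurd (Finset.mem_range.2 hi) h'

end DislocationData

/-- The chart of the polar plane. -/
def PolarPlane.chart : OpenPartialHomeomorph PolarPlane (Model 2) :=
  PolarPlane.isOpenEmbedding_val.toOpenPartialHomeomorph Subtype.val

theorem PolarPlane.chart_mem_atlas : PolarPlane.chart ∈ atlas (Model 2) PolarPlane := rfl

theorem PolarPlane.chart_apply (p : PolarPlane) : PolarPlane.chart p = p.1 := rfl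

open Classical in
/-- The point of the polar plane with given coordinates. -/
def PolarPlane.ofCoords (q : Model 2) : PolarPlane :=
  if h : 0 < q 0 then ⟨q, h⟩ else Classical.arbitrary _

theorem PolarPlane.ofCoords_val {q : Model 2} (h : 0 < q 0) : (PolarPlane.ofCoords q).1 = q := by
  rw [ofCoords, dif_pos h]

/-! ### The diffeomorphism between sector and surface -/

namespace DislocationData

variable (P : DislocationData) (n : ℕ)

open Classical in
/-- The point of the glued surface with given coordinates. -/
def Surface.ofCoords (q : Model 2) : P.Surface n :=
  if h : q ∉ P.slits n then ⟨q, h⟩ else Classical.arbitrary _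

theorem Surface.ofCoords_val {q : Model 2} (h : q ∉ P.slits n) :
    (Surface.ofCoords P n q).1 = q := by
  rw [Surface.ofCoords, dif_pos h]

/-- The abscissa `x` is away from the dislocation lines. -/
def IsClear (x : ℝ) : Prop :=
  ∀ i < n, x ∉ Icc (P.center n i - P.width n) (P.center n i + P.width n)

theorem isOpen_isClear : IsOpen {x | P.IsClear n x} := by
  have : {x | P.IsClear n x} = ⋂ i ∈ Finset.range n,
      (Icc (P.center n i - P.width n) (P.center n i + P.width n))ᶜ := by
    ext x; simp [IsClear]
  rw [this]
  exact isOpen_biInter_finset fun i _ ↦ isClosed_Icc.isOpen_compl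

variable [NeZero n]

variable {P n} in
theorem IsClear.notMem_slitX {x : ℝ} (h : P.IsClear n x) : x ∉ P.slitX n := by
  have hw := P.width_pos n
  intro hx
  simp only [slitX, mem_iUnion] at hx
  obtain ⟨i, hi, hx⟩ := hx
  rw [columnSlit_eq] at hx
  exact h i (Finset.mem_range.1 hi) ⟨by linarith [hx.1], by linarith [hx.2]⟩

variable {P n} in
theorem IsClear.smoothHeight_eq {x : ℝ} (h : P.IsClear n x) :
    P.smoothHeight n x = P.rowHeight n x := by
  have hw := P.width_pos n
  exact P.smoothHeight_eq_rowHeight n fun i hi hx ↦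
    h i hi ⟨by linarith [hx.1], by linarith [hx.2]⟩

theorem round_half_eq {τ : ℝ} {j : ℤ} (h : |τ - 2 * j| < 1) : round (τ / 2) = j := by
  rw [abs_lt] at h
  rw [round_eq, Int.floor_eq_iff]
  constructor <;> linarith

theorem abs_sub_round_half_le (τ : ℝ) : |τ - 2 * round (τ / 2)| ≤ 1 := by
  have := abs_sub_round (τ / 2)
  rw [abs_le] at this ⊢
  constructor <;> linarith

/-- Polar coordinates in terms of coordinates `(x,t)` on the surface and vice versa, up to units:
heights are rescaled by the factor `u` within each half row. -/
def stretch (u τ : ℝ) : ℝ := 2 * round (τ / 2) + (τ - 2 * round (τ / 2)) * u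

theorem stretch_one (τ : ℝ) : stretch 1 τ = τ := by simp [stretch]

theorem stretch_eq {u τ : ℝ} {j : ℤ} (h : |τ - 2 * j| < 1) :
    stretch u τ = 2 * j + (τ - 2 * j) * u := by
  rw [stretch, round_half_eq h]

/-- The diffeomorphism from the perforated sector to the perforated surface, in coordinates. -/
def unroll (q : Model 2) : Model 2 :=
  !₂[q 0 - P.innerRadius, stretch (P.smoothHeight n (q 0 - P.innerRadius) /
    P.rowHeight n (q 0 - P.innerRadius)) (q 1 / P.angleStep n)]

/-- The inverse of `unroll`. -/
def roll (q : Model 2) : Model 2 :=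
  !₂[P.innerRadius + q 0,
    P.angleStep n * stretch (P.rowHeight n (q 0) / P.smoothHeight n (q 0)) (q 1)]

/-- The diffeomorphism from polar coordinates to flat coordinates around the bottom side of row `j`,
which agrees with `unroll` there. -/
def toFlat (j : ℤ) (q : Model 2) : Model 2 :=
  !₂[q 0 - P.innerRadius, (q 1 / P.angleStep n - 2 * j) * P.smoothHeight n (q 0 - P.innerRadius)]

/-- The inverse of `toFlat`. -/
def ofFlat (j : ℤ) (q : Model 2) : Model 2 :=
  !₂[P.innerRadius + q 0, P.angleStep n * (2 * j + q 1 / P.smoothHeight n (q 0))]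

theorem contDiff_vec {E : Type*} [NormedAddCommGroup E] [NormedSpace ℝ E] {k : ℕ∞ω} {f g : E → ℝ}
    (hf : ContDiff ℝ k f) (hg : ContDiff ℝ k g) : ContDiff ℝ k fun x ↦ (!₂[f x, g x] : Model 2) := by
  rw [contDiff_euclidean]
  intro i; fin_cases i
  · exact hf
  · exact hg

omit [NeZero n] in
theorem contDiff_toFlat (j : ℤ) : ContDiff ℝ ∞ (P.toFlat n j) := by
  have h0 : ContDiff ℝ ∞ fun q : Model 2 ↦ q 0 - P.innerRadius := by fun_prop
  have h1 : ContDiff ℝ ∞ fun q : Model 2 ↦ q 1 / P.angleStep n - 2 * j := by fun_prop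
  exact contDiff_vec h0 (h1.mul ((P.contDiff_smoothHeight n).comp h0))

theorem contDiff_ofFlat (j : ℤ) : ContDiff ℝ ∞ (P.ofFlat n j) := by
  have h0 : ContDiff ℝ ∞ fun q : Model 2 ↦ q 0 := by fun_prop
  have h1 : ContDiff ℝ ∞ fun q : Model 2 ↦ q 1 := by fun_prop
  exact contDiff_vec (contDiff_const.add h0) (contDiff_const.mul (contDiff_const.add
    (h1.div ((P.contDiff_smoothHeight n).comp h0) fun q ↦ (P.smoothHeight_pos n _).ne')))

theorem ofFlat_toFlat (j : ℤ) (q : Model 2) : P.ofFlat n j (P.toFlat n j q) = q := by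
  have h1 := (P.smoothHeight_pos n (q 0 - P.innerRadius)).ne'
  have h2 := (P.angleStep_pos n).ne'
  ext i; fin_cases i
  · simp [ofFlat, toFlat]
  · simp [ofFlat, toFlat, h1]; field_simp

theorem toFlat_ofFlat (j : ℤ) (q : Model 2) : P.toFlat n j (P.ofFlat n j q) = q := by
  have h1 := (P.smoothHeight_pos n (q 0)).ne'
  have h2 := (P.angleStep_pos n).ne'
  ext i; fin_cases i
  · simp [ofFlat, toFlat]
  · simp [ofFlat, toFlat, h1, h2]

/-- The polar coordinates in which `unroll` is represented by `toFlat j`. -/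
def polarDomain (j : ℤ) : Set (Model 2) :=
  {q | |q 1 / P.angleStep n - 2 * j| < 1 ∨
    (q 1 / P.angleStep n ∈ Ioo (2 * j : ℝ) (2 * j + 2) ∧ P.IsClear n (q 0 - P.innerRadius))}

/-- The coordinates on the surface in which `roll` is represented by `ofFlat j`. -/
def surfaceDomain (j : ℤ) : Set (Model 2) :=
  {q | |q 1 - 2 * j| * P.rowHeight n (q 0) < P.smoothHeight n (q 0) ∨
    (q 1 ∈ Ioo (2 * j : ℝ) (2 * j + 2) ∧ P.IsClear n (q 0))}

omit [NeZero n] in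
theorem isOpen_polarDomain (j : ℤ) : IsOpen (P.polarDomain n j) := by
  have h0 : Continuous fun q : Model 2 ↦ q 0 - P.innerRadius := by fun_prop
  have h1 : Continuous fun q : Model 2 ↦ q 1 / P.angleStep n := by fun_prop
  exact (isOpen_lt (h1.sub continuous_const).abs continuous_const).union
    ((isOpen_Ioo.preimage h1).inter ((P.isOpen_isClear n).preimage h0))

omit [NeZero n] in
theorem isOpen_surfaceDomain (j : ℤ) : IsOpen (P.surfaceDomain n j) := by
  have h0 : Continuous fun q : Model 2 ↦ q 0 := by fun_prop
  have h1 : Continuous fun q : Model 2 ↦ q 1 := by fun_prop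
  have h2 := (P.contDiff_smoothHeight n).continuous
  exact (isOpen_lt ((h1.sub continuous_const).abs.mul ((P.continuous_rowHeight n).comp h0))
    (h2.comp h0)).union ((isOpen_Ioo.preimage h1).inter ((P.isOpen_isClear n).preimage h0))

omit [NeZero n] in
theorem notMem_slits_of_lt {q : Model 2} {j : ℤ} (h : |q 1 - 2 * j| < 1) : q ∉ P.slits n := by
  rintro ⟨_, k, hk⟩
  rw [hk, abs_lt] at h
  have h1 : (j : ℝ) < k + 1 := by linarith [h.1]
  have h2 : (k : ℝ) < j := by linarith [h.2]
  norm_cast at h1 h2; omega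

theorem abs_mul_div_lt {σ u v : ℝ} (hσ : |σ| < 1) (hu : 0 < u) (huv : u ≤ v) : |σ * (u / v)| < 1 := by
  have hv : 0 < v := hu.trans_le huv
  rw [abs_mul, abs_of_pos (div_pos hu hv)]
  have : u / v ≤ 1 := (div_le_one hv).2 huv
  nlinarith [abs_nonneg σ, div_pos hu hv]

variable {P n} in
-- Away from the dislocation lines the two heights agree, so nothing is stretched and the formula
-- does not refer to a row. This makes the map smooth across the seams there.
theorem unroll_of_isClear {q : Model 2} (h : P.IsClear n (q 0 - P.innerRadius)) :
    P.unroll n q = !₂[q 0 - P.innerRadius, q 1 / P.angleStep n] := by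
  rw [unroll, h.smoothHeight_eq, div_self (P.rowHeight_pos n _).ne', stretch_one]

variable {P n} in
theorem roll_of_isClear {q : Model 2} (h : P.IsClear n (q 0)) :
    P.roll n q = !₂[P.innerRadius + q 0, P.angleStep n * q 1] := by
  rw [roll, h.smoothHeight_eq, div_self (P.rowHeight_pos n _).ne', stretch_one]

variable {P n} in
-- Multiplication by h/ρ turns the condition |σ| < 1 on the height above the bottom side into |σ|ρ <
-- h.
theorem unroll_mem_surfaceDomain {q : Model 2} {j : ℤ} (h : q ∈ P.polarDomain n j) :
    P.unroll n q ∈ P.surfaceDomain n j := by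
  rcases h with h | ⟨h, hc⟩
  · left
    have hr := P.rowHeight_pos n (q 0 - P.innerRadius)
    have hs := P.smoothHeight_pos n (q 0 - P.innerRadius)
    have h1 : (P.unroll n q) 1 - 2 * j = (q 1 / P.angleStep n - 2 * j) *
        (P.smoothHeight n (q 0 - P.innerRadius) / P.rowHeight n (q 0 - P.innerRadius)) := by
      simp [unroll, stretch_eq h]
    have h0 : (P.unroll n q) 0 = q 0 - P.innerRadius := rfl
    change |(P.unroll n q) 1 - 2 * j| * P.rowHeight n ((P.unroll n q) 0) <
      P.smoothHeight n ((P.unroll n q) 0)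
    rw [h1, h0, abs_mul, abs_of_pos (div_pos hs hr), mul_assoc, div_mul_cancel₀ _ hr.ne']
    exact mul_lt_of_lt_one_left hs h
  · right
    rw [unroll_of_isClear hc]
    exact ⟨h, hc⟩

variable {P n} in
theorem roll_mem_polarDomain {q : Model 2} {j : ℤ} (h : q ∈ P.surfaceDomain n j) :
    P.roll n q ∈ P.polarDomain n j := by
  have hκ := P.angleStep_pos n
  have h0 : (P.roll n q) 0 - P.innerRadius = q 0 := by simp [roll]
  rcases h with h | ⟨h, hc⟩
  · left
    have hr := P.rowHeight_pos n (q 0)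
    have hs := P.smoothHeight_pos n (q 0)
    have h3 : |q 1 - 2 * j| < 1 := by
      by_contra! h4
      have := P.smoothHeight_le_rowHeight n (q 0)
      nlinarith
    have h1 : (P.roll n q) 1 / P.angleStep n - 2 * j = (q 1 - 2 * j) *
        (P.rowHeight n (q 0) / P.smoothHeight n (q 0)) := by
      simp [roll, stretch_eq h3, hκ.ne']
    rw [h1, abs_mul, abs_of_pos (div_pos hr hs), ← mul_div_assoc, div_lt_one hs]
    exact h
  · right
    rw [h0]
    refine ⟨?_, hc⟩
    rw [roll_of_isClear hc]
    simpa [hκ.ne'] using h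

variable {P n} in
theorem notMem_slits_of_mem_surfaceDomain {q : Model 2} {j : ℤ} (h : q ∈ P.surfaceDomain n j) :
    q ∉ P.slits n := by
  rcases h with h | ⟨h, hc⟩
  · refine P.notMem_slits_of_lt n (j := j) ?_
    by_contra! h4
    have := P.smoothHeight_le_rowHeight n (q 0)
    have := P.smoothHeight_pos n (q 0)
    nlinarith
  · exact fun h' ↦ hc.notMem_slitX h'.1

variable {P n} in
-- As h ≤ ρ, stretching by h/ρ leaves a point within distance 1 of the same even integer. Hence
-- `roll` rounds to the same row and undoes the factor.
theorem roll_unroll {q : Model 2} {j : ℤ} (h : q ∈ P.polarDomain n j) :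
    P.roll n (P.unroll n q) = q := by
  have hκ := P.angleStep_pos n
  have h2 := unroll_mem_surfaceDomain h
  rcases h with h | ⟨h, hc⟩
  · have hr := P.rowHeight_pos n (q 0 - P.innerRadius)
    have hs := P.smoothHeight_pos n (q 0 - P.innerRadius)
    have h3 : |(q 1 / P.angleStep n - 2 * j) * (P.smoothHeight n (q 0 - P.innerRadius) /
        P.rowHeight n (q 0 - P.innerRadius))| < 1 :=
      abs_mul_div_lt h hs (P.smoothHeight_le_rowHeight n _)
    ext i; fin_cases i
    · simp [roll, unroll]
    · simp only [roll, unroll, stretch_eq h]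
      simp only [Matrix.cons_val_zero, Matrix.cons_val_one, Fin.mk_one]
      rw [stretch_eq (j := j) (by simpa using h3)]
      field_simp
      ring
  · have h0 : (!₂[q 0 - P.innerRadius, q 1 / P.angleStep n] : Model 2) 0 = q 0 - P.innerRadius := rfl
    rw [unroll_of_isClear hc, roll_of_isClear (by rw [h0]; exact hc)]
    ext i; fin_cases i
    · simp
    · simp; field_simp

variable {P n} in
theorem unroll_roll {q : Model 2} {j : ℤ} (h : q ∈ P.surfaceDomain n j) :
    P.unroll n (P.roll n q) = q := by
  have hκ := P.angleStep_pos n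
  have h0 : (P.roll n q) 0 - P.innerRadius = q 0 := by simp [roll]
  have h2 := roll_mem_polarDomain h
  have hr := P.rowHeight_pos n (q 0)
  have hs := P.smoothHeight_pos n (q 0)
  rcases h with h | ⟨h, hc⟩
  · have h3 : |q 1 - 2 * j| < 1 := by
      by_contra! h4
      have := P.smoothHeight_le_rowHeight n (q 0)
      nlinarith
    have h1 : (P.roll n q) 1 / P.angleStep n - 2 * j = (q 1 - 2 * j) *
        (P.rowHeight n (q 0) / P.smoothHeight n (q 0)) := by
      simp [roll, stretch_eq h3, hκ.ne']
    have h4 : |(P.roll n q) 1 / P.angleStep n - 2 * j| < 1 := by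
      rw [h1, abs_mul, abs_of_pos (div_pos hr hs), ← mul_div_assoc, div_lt_one hs]
      exact h
    rw [unroll, h0, stretch_eq h4, h1]
    ext i; fin_cases i
    · simp
    · simp; field_simp; ring
  · rw [unroll_of_isClear (by rw [h0]; exact hc), roll_of_isClear hc]
    ext i; fin_cases i
    · simp
    · simp; field_simp

variable {P n} in
theorem mem_chartDomain_of_mem_surfaceDomain {p : P.Surface n} {j : ℤ}
    (h : p.1 ∈ P.surfaceDomain n j) : p ∈ Surface.chartDomain P n j := by
  rcases h with h | ⟨h, hc⟩
  · left
    have h3 : |p.1 1 - 2 * j| < 1 := by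
      by_contra! h4
      have := P.smoothHeight_le_rowHeight n (p.1 0)
      have := P.smoothHeight_pos n (p.1 0)
      nlinarith
    rw [abs_lt] at h3
    exact ⟨by linarith [h3.1], by linarith [h3.2]⟩
  · exact Or.inr ⟨h.1, h.2, hc.notMem_slitX⟩

/-- The diffeomorphism from the perforated sector to the perforated surface. -/
def unrollMap (p : PolarPlane) : P.Surface n := Surface.ofCoords P n (P.unroll n p.1)

/-- The inverse of `unrollMap`. -/
def rollMap (p : P.Surface n) : PolarPlane := PolarPlane.ofCoords (P.roll n p.1)

variable {P n} in
theorem unrollMap_val {p : PolarPlane} {j : ℤ} (h : p.1 ∈ P.polarDomain n j) :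
    (P.unrollMap n p).1 = P.unroll n p.1 :=
  Surface.ofCoords_val P n (notMem_slits_of_mem_surfaceDomain (unroll_mem_surfaceDomain h))

variable {P n} in
omit [NeZero n] in
theorem rollMap_val {p : P.Surface n} (h : 0 < P.innerRadius + p.1 0) :
    (P.rollMap n p).1 = P.roll n p.1 :=
  PolarPlane.ofCoords_val h

variable {P n} in
-- The factor h/ρ in `unroll` and the factor ρ in the flat chart multiply to the smooth function h.
-- The height ρ, which has kinks, disappears from the coordinate expression.
theorem flatChart_unrollMap {p : PolarPlane} {j : ℤ} (h : p.1 ∈ P.polarDomain n j) :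
    P.unrollMap n p ∈ (Surface.flatChart P n j).source ∧
      Surface.flatChart P n j (P.unrollMap n p) = P.toFlat n j p.1 := by
  have hv := unrollMap_val h
  have h2 := unroll_mem_surfaceDomain h
  rw [Surface.flatChart_source, Surface.flatChart_apply, hv]
  refine ⟨mem_chartDomain_of_mem_surfaceDomain (by rw [hv]; exact h2), ?_⟩
  have hr := P.rowHeight_pos n (p.1 0 - P.innerRadius)
  rcases h with h | ⟨h, hc⟩
  · ext i; fin_cases i
    · simp [unroll, toFlat]
    · simp [unroll, toFlat, stretch_eq h]; field_simp
  · rw [unroll_of_isClear hc]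
    ext i; fin_cases i
    · simp [toFlat]
    · simp [toFlat, hc.smoothHeight_eq]

variable {P n} in
-- This is the coordinate expression of `unrollMap`, inverted.
theorem rollMap_eq_ofFlat {p : P.Surface n} {j : ℤ} (h : p.1 ∈ P.surfaceDomain n j)
    (hp : 0 < P.innerRadius + p.1 0) :
    (P.rollMap n p).1 = P.ofFlat n j (Surface.flatChart P n j p) := by
  have h1 : (P.rollMap n p).1 ∈ P.polarDomain n j := by
    rw [rollMap_val hp]; exact roll_mem_polarDomain h
  have h2 : P.unrollMap n (P.rollMap n p) = p := by
    apply Subtype.ext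
    rw [unrollMap_val h1, rollMap_val hp, unroll_roll h]
  rw [← (P.ofFlat_toFlat n j (P.rollMap n p).1), ← (flatChart_unrollMap h1).2, h2]

variable {P n} in
theorem contMDiffAt_unrollMap {p : PolarPlane} {j : ℤ} (h : p.1 ∈ P.polarDomain n j) :
    ContMDiffAt (𝓡 2) (𝓡 2) ∞ (P.unrollMap n) p := by
  have := (Surface.isTranslationAtlas P n).isManifold
  have := PolarPlane.isTranslationAtlas.isManifold
  refine IsTranslationAtlas.contMDiffAt_of_charts PolarPlane.chart_mem_atlas (mem_range_self j)
    (mem_univ p) (g := P.toFlat n j) (P.contDiff_toFlat n j).contDiffAt ?_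
  have : ∀ᶠ q : PolarPlane in 𝓝 p, q.1 ∈ P.polarDomain n j :=
    ((P.isOpen_polarDomain n j).preimage continuous_subtype_val).mem_nhds h
  filter_upwards [this] with q hq
  exact flatChart_unrollMap hq

variable {P n} in
theorem hasMFDerivAt_unrollMap {p : PolarPlane} {j : ℤ} (h : p.1 ∈ P.polarDomain n j) :
    HasMFDerivAt (𝓡 2) (𝓡 2) (P.unrollMap n) p (fderiv ℝ (P.toFlat n j) p.1) := by
  refine PolarPlane.isTranslationAtlas.hasMFDerivAt_of_charts (Surface.isTranslationAtlas P n)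
    PolarPlane.chart_mem_atlas (mem_range_self j) (mem_univ p) (g := P.toFlat n j)
    ((P.contDiff_toFlat n j).differentiable (by simp) _).hasFDerivAt ?_
  have : ∀ᶠ q : PolarPlane in 𝓝 p, q.1 ∈ P.polarDomain n j :=
    ((P.isOpen_polarDomain n j).preimage continuous_subtype_val).mem_nhds h
  filter_upwards [this] with q hq
  exact flatChart_unrollMap hq

variable {P n} in
theorem contMDiffAt_rollMap {p : P.Surface n} {j : ℤ} (h : p.1 ∈ P.surfaceDomain n j)
    (hp : 0 < P.innerRadius + p.1 0) : ContMDiffAt (𝓡 2) (𝓡 2) ∞ (P.rollMap n) p := by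
  have := (Surface.isTranslationAtlas P n).isManifold
  have := PolarPlane.isTranslationAtlas.isManifold
  refine IsTranslationAtlas.contMDiffAt_of_charts (mem_range_self j) PolarPlane.chart_mem_atlas
    (by rw [Surface.flatChart_source]; exact mem_chartDomain_of_mem_surfaceDomain h)
    (g := P.ofFlat n j) (P.contDiff_ofFlat n j).contDiffAt ?_
  have h1 : ∀ᶠ q : P.Surface n in 𝓝 p, q.1 ∈ P.surfaceDomain n j :=
    ((P.isOpen_surfaceDomain n j).preimage continuous_subtype_val).mem_nhds h
  have h2 : ∀ᶠ q : P.Surface n in 𝓝 p, 0 < P.innerRadius + q.1 0 := by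
    refine IsOpen.mem_nhds (isOpen_lt continuous_const (continuous_const.add ?_)) hp
    exact (PiLp.continuous_apply 2 _ 0).comp continuous_subtype_val
  filter_upwards [h1, h2] with q hq hq'
  exact ⟨mem_univ _, rollMap_eq_ofFlat hq hq'⟩

end DislocationData

/-! ### Holes on the surface and ellipses in the sector -/

namespace DislocationData

variable (P : DislocationData) (n : ℕ)

/-- A neighbourhood of the dislocation line in column `i` and row `j`, in the coordinates of the glued
surface. -/
def hole (i j : ℕ) : Set (Model 2) :=
  {q | (q 0 - P.center n i) ^ 2 + (max 0 (1 - (1 - |q 1 - (2 * j + 1)|) *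
    (P.rowHeight n (q 0) / P.smoothHeight n (q 0))) / n) ^ 2 < (2 * P.width n) ^ 2}

/-- The surface without neighbourhoods of the dislocation lines. -/
def perforatedSurface [NeZero n] : Set (P.surface n).carrier :=
  {x : P.Surface n | x ∈ P.rectangle n ∧ ∀ i j : Fin n, x.1 ∉ P.hole n i j}

/-- The polar coordinates of the points outside of the neighbourhood of the dislocation line in column
`i` and row `j`. -/
def outside (i j : ℕ) : Set (Model 2) :=
  {q | (2 * P.width n) ^ 2 ≤ (q 0 - P.innerRadius - P.center n i) ^ 2 +
    ((q 1 / P.angleStep n - (2 * j + 1)) / n) ^ 2}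

/-- The sector without neighbourhoods of the dislocation lines. -/
def perforatedSector : Set PolarPlane.weitzenbock.carrier :=
  {p : PolarPlane | p ∈ P.sector ∧ ∀ i j : Fin n, p.1 ∈ P.outside n i j}

variable [NeZero n]

theorem mem_rectangle_iff {x : P.Surface n} :
    x ∈ P.rectangle n ↔ x.1 0 ∈ Icc 0 P.b ∧ x.1 1 ∈ Icc 0 (2 * n : ℝ) := Iff.rfl

/-- Since `2 n κ = ε/b` for every `n`, the angle of the sector consists of `2n` half rows, whatever
`n` is. -/
theorem mem_sector_iff {p : PolarPlane} :
    p ∈ P.sector ↔ p.1 0 - P.innerRadius ∈ Icc 0 P.b ∧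
      p.1 1 / P.angleStep n ∈ Icc 0 (2 * n : ℝ) := by
  have hκ := P.angleStep_pos n
  have hn := cast_pos' n
  have hb := P.b_pos
  have h1 : P.ε / P.b = 2 * n * P.angleStep n := by simp only [angleStep]; field_simp
  have h2 : p ∈ P.sector ↔ p.1 0 ∈ Icc P.innerRadius (P.innerRadius + P.b) ∧
    p.1 1 ∈ Icc 0 (P.ε / P.b) := Iff.rfl
  rw [h2, h1, mem_Icc, mem_Icc, mem_Icc, mem_Icc, div_le_iff₀ hκ, le_div_iff₀ hκ, zero_mul,
    sub_nonneg, sub_le_iff_le_add']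

/-- If `j ≠ 0`, both numbers have the sign of `j`; if `j = 0`, the factor `u > 0` does not affect
the sign of `σ`. -/
theorem nonneg_iff_of_sign {j : ℤ} {σ u : ℝ} (h : |σ| < 1) (hu : 0 < u) (h' : |σ * u| < 1) :
    0 ≤ 2 * j + σ ↔ 0 ≤ 2 * j + σ * u := by
  rw [abs_lt] at h h'
  rcases lt_trichotomy j 0 with hj | rfl | hj
  · have : (j : ℝ) ≤ -1 := by exact_mod_cast (by omega : j ≤ -1)
    constructor <;> intro <;> linarith
  · simp [hu]
  · have : (1 : ℝ) ≤ j := by exact_mod_cast hj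
    constructor <;> intro <;> linarith

omit [NeZero n] in
-- The upper bound is the lower bound for `n - j` and `-σ`.
theorem mem_Icc_iff_of_sign {j : ℤ} {σ u : ℝ} (h : |σ| < 1) (hu : 0 < u) (h' : |σ * u| < 1) :
    2 * j + σ ∈ Icc 0 (2 * n : ℝ) ↔ 2 * j + σ * u ∈ Icc 0 (2 * n : ℝ) := by
  have h1 := nonneg_iff_of_sign (j := j) h hu h'
  have h2 := nonneg_iff_of_sign (j := n - j) (σ := -σ) (u := u) (by rwa [abs_neg]) hu
    (by rwa [neg_mul, abs_neg])
  push_cast at h2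
  rw [mem_Icc, mem_Icc, h1]
  refine and_congr_right fun _ ↦ ?_
  constructor <;> intro h3
  · linarith [h2.1 (by linarith)]
  · linarith [h2.2 (by linarith)]

variable {P n} in
theorem unroll_mem_iff {q : Model 2} {j : ℤ} (h : q ∈ P.polarDomain n j) :
    (P.unroll n q) 1 ∈ Icc 0 (2 * n : ℝ) ↔ q 1 / P.angleStep n ∈ Icc 0 (2 * n : ℝ) := by
  rcases h with h | ⟨h, hc⟩
  · have hr := P.rowHeight_pos n (q 0 - P.innerRadius)
    have hs := P.smoothHeight_pos n (q 0 - P.innerRadius)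
    have h1 : (P.unroll n q) 1 = 2 * j + (q 1 / P.angleStep n - 2 * j) *
        (P.smoothHeight n (q 0 - P.innerRadius) / P.rowHeight n (q 0 - P.innerRadius)) := by
      simp [unroll, stretch_eq h]
    rw [h1, ← mem_Icc_iff_of_sign n h (div_pos hs hr)
      (abs_mul_div_lt h hs (P.smoothHeight_le_rowHeight n _)), add_sub_cancel]
  · rw [unroll_of_isClear hc]; rfl

/-- Here `t` and `τ` are the heights of corresponding points on the surface and in the sector, near
the even height `2m`. If `2j+1` is the seam next to them on their side of `2m`, then `1 - |t -
(2j+1)|` is `|t - 2m|`, and multiplication by `u` gives `|τ - 2m|`. Any other seam has distance at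
least 1 from both heights. -/
theorem gap_eq_or {t τ u : ℝ} {m j : ℤ} (hu : 1 ≤ u) (h : τ - 2 * m = (t - 2 * m) * u)
    (hτ : |τ - 2 * m| < 1) :
    max 0 (1 - (1 - |t - (2 * j + 1)|) * u) = |τ - (2 * j + 1)| ∨
      (1 ≤ max 0 (1 - (1 - |t - (2 * j + 1)|) * u) ∧ 1 ≤ |τ - (2 * j + 1)|) := by
  have key : ∀ {t τ : ℝ} {m j : ℤ}, τ - 2 * m = (t - 2 * m) * u → |τ - 2 * m| < 1 → m ≤ j →
      max 0 (1 - (1 - |t - (2 * j + 1)|) * u) = |τ - (2 * j + 1)| ∨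
      (1 ≤ max 0 (1 - (1 - |t - (2 * j + 1)|) * u) ∧ 1 ≤ |τ - (2 * j + 1)|) := by
    intro t τ m j h hτ hmj
    have hmj' : (m : ℝ) ≤ j := by exact_mod_cast hmj
    have ht : |t - 2 * m| < 1 := by
      rw [h, abs_mul, abs_of_pos (by linarith : 0 < u)] at hτ
      nlinarith [abs_nonneg (t - 2 * m)]
    rw [abs_lt] at ht hτ
    rw [abs_of_nonpos (by linarith : t - (2 * j + 1) ≤ 0),
      abs_of_nonpos (by linarith : τ - (2 * j + 1) ≤ 0)]
    by_cases hm : m = j ∧ 0 ≤ t - 2 * m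
    · left
      obtain ⟨rfl, hp⟩ := hm
      rw [max_eq_right] <;> nlinarith
    · right
      have h2 : 1 ≤ -(t - (2 * (j : ℝ) + 1)) ∧ 1 ≤ -(τ - (2 * (j : ℝ) + 1)) := by
        rcases hmj.eq_or_lt with rfl | hlt
        · have : t - 2 * m < 0 := by simpa using hm
          constructor
          · linarith
          · nlinarith
        · have : (m : ℝ) + 1 ≤ j := by exact_mod_cast hlt
          constructor <;> linarith
      exact ⟨le_max_of_le_right (by nlinarith [h2.1]), h2.2⟩
  rcases le_or_gt m j with hmj | hmj
  · exact key h hτ hmj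
  -- Seams below `2m` are reduced to seams above it by the reflection `t ↦ -t`, which takes `2j+1`
  -- to `2(-j-1)+1`.
  · have := key (t := -t) (τ := -τ) (m := -m) (j := -j - 1) (by push_cast; linarith)
      (by push_cast; rwa [show -τ - 2 * -(m : ℝ) = -(τ - 2 * m) by ring, abs_neg]) (by omega)
    push_cast at this
    rwa [show -t - (2 * (-(j : ℝ) - 1) + 1) = -(t - (2 * j + 1)) by ring, abs_neg,
      show -τ - (2 * (-(j : ℝ) - 1) + 1) = -(τ - (2 * j + 1)) by ring, abs_neg] at this

variable {P n} in
-- The formula for `hole` is the equation of an ellipse in polar coordinates, written on the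
-- surface: its second summand is the distance from the preimage to the seam. In the second
-- alternative of `gap_eq_or` the point is at least one half row away from the seam, whereas an
-- ellipse extends by 2wn ≤ 1/4 half rows only, w being the width of a dislocation line.
theorem IsFine.unroll_notMem_hole_iff (hf : P.IsFine n) {q : Model 2} {m : ℤ}
    (h : q ∈ P.polarDomain n m) (i j : ℕ) :
    P.unroll n q ∉ P.hole n i j ↔ q ∈ P.outside n i j := by
  have hr := P.rowHeight_pos n (q 0 - P.innerRadius)
  have hs := P.smoothHeight_pos n (q 0 - P.innerRadius)
  have hn := cast_pos' n
  have hw := P.width_pos n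
  have h0 : (P.unroll n q) 0 = q 0 - P.innerRadius := rfl
  simp only [hole, outside, mem_ofPred_eq, not_lt, h0]
  have key : max 0 (1 - (1 - |(P.unroll n q) 1 - (2 * (j : ℤ) + 1)|) *
      (P.rowHeight n (q 0 - P.innerRadius) / P.smoothHeight n (q 0 - P.innerRadius))) =
        |q 1 / P.angleStep n - (2 * (j : ℤ) + 1)| ∨
      (1 ≤ max 0 (1 - (1 - |(P.unroll n q) 1 - (2 * (j : ℤ) + 1)|) *
        (P.rowHeight n (q 0 - P.innerRadius) / P.smoothHeight n (q 0 - P.innerRadius))) ∧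
        1 ≤ |q 1 / P.angleStep n - (2 * (j : ℤ) + 1)|) := by
    rcases h with h | ⟨h, hc⟩
    · refine gap_eq_or (m := m) ?_ ?_ h
      · rw [one_le_div hs]; exact P.smoothHeight_le_rowHeight n _
      · simp only [unroll, stretch_eq h]
        simp; field_simp
    · left
      rw [unroll_of_isClear hc, hc.smoothHeight_eq, div_self hr.ne']
      simp
  push_cast at key
  rcases key with key | ⟨k1, k2⟩
  · rw [key, div_pow, div_pow, sq_abs]
  · have h2 : ∀ z : ℝ, 1 ≤ |z| → (2 * P.width n) ^ 2 ≤ (z / n) ^ 2 := by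
      intro z hz
      rw [← sq_abs (z / n), abs_div, abs_of_pos hn]
      refine pow_le_pow_left₀ (by linarith) ?_ 2
      rw [le_div_iff₀ hn]
      nlinarith [hf.2, hw]
    have h3 := h2 _ k2
    have h4 := h2 _ (k1.trans (le_abs_self _))
    constructor <;> intro _ <;> nlinarith

/-- A half row is found for every height which is not an odd integer. -/
theorem exists_abs_sub_lt_one {τ : ℝ} (h : ∀ k : ℤ, τ ≠ 2 * k + 1) : ∃ j : ℤ, |τ - 2 * j| < 1 := by
  refine ⟨round (τ / 2), lt_of_le_of_ne (abs_sub_round_half_le τ) fun h1 ↦ ?_⟩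
  rcases eq_or_eq_neg_of_abs_eq h1 with h2 | h2
  · exact h (round (τ / 2)) (by linarith)
  · exact h (round (τ / 2) - 1) (by push_cast; linarith)

/-- The polar or surface coordinates of a point away from the dislocation lines. -/
theorem exists_abs_sub_lt_one_or (τ : ℝ) :
    ∃ j : ℤ, |τ - 2 * j| < 1 ∨ τ ∈ Ioo (2 * j : ℝ) (2 * j + 2) := by
  by_cases h : ∃ k : ℤ, τ = 2 * k + 1
  · obtain ⟨k, rfl⟩ := h
    exact ⟨k, Or.inr ⟨by linarith, by linarith⟩⟩
  · push Not at h
    obtain ⟨j, hj⟩ := exists_abs_sub_lt_one h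
    exact ⟨j, Or.inl hj⟩

omit [NeZero n] in
theorem exists_fin_eq {k : ℤ} (h : (2 * k + 1 : ℝ) ∈ Icc 0 (2 * n : ℝ)) :
    ∃ j : Fin n, ((j : ℕ) : ℤ) = k := by
  have h1 : (-1 : ℝ) < k := by linarith [h.1]
  have h2 : (k : ℝ) < n := by linarith [h.2]
  have h1' : -1 < k := by exact_mod_cast h1
  have h2' : k < n := by exact_mod_cast h2
  exact ⟨⟨k.toNat, by omega⟩, by simp; omega⟩

variable {P n} in
-- A point that is not covered would lie on a seam, at distance at most one width from the abscissa
-- of the centre of a dislocation line. Such points belong to the ellipse, whose half-axis is two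
-- widths.
theorem exists_mem_polarDomain {q : Model 2} (hq : q 1 / P.angleStep n ∈ Icc 0 (2 * n : ℝ))
    (h : ∀ i j : Fin n, q ∈ P.outside n i j) : ∃ j, q ∈ P.polarDomain n j := by
  have hw := P.width_pos n
  by_cases hc : P.IsClear n (q 0 - P.innerRadius)
  · obtain ⟨j, hj⟩ := exists_abs_sub_lt_one_or (q 1 / P.angleStep n)
    exact ⟨j, hj.imp id fun h ↦ ⟨h, hc⟩⟩
  · simp only [IsClear] at hc
    push Not at hc
    obtain ⟨i, hi, hxi⟩ := hc
    obtain ⟨j, hj⟩ := exists_abs_sub_lt_one (τ := q 1 / P.angleStep n) (by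
      intro k hk
      rw [hk] at hq
      obtain ⟨j, rfl⟩ := exists_fin_eq n hq
      have := h ⟨i, hi⟩ j
      simp only [outside, mem_ofPred_eq, hk] at this
      push_cast at this
      rw [sub_self, zero_div] at this
      nlinarith [hxi.1, hxi.2])
    exact ⟨j, Or.inl hj⟩

variable {P n} in
-- A point that is not covered would lie in the gap between the images of the two sides of a seam.
-- There the second summand in the formula for `hole` vanishes, while the first is at most the
-- square of one width.
theorem exists_mem_surfaceDomain {q : Model 2} (hq : q 1 ∈ Icc 0 (2 * n : ℝ))
    (h : ∀ i j : Fin n, q ∉ P.hole n i j) : ∃ j, q ∈ P.surfaceDomain n j := by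
  have hw := P.width_pos n
  have hr := P.rowHeight_pos n (q 0)
  have hs := P.smoothHeight_pos n (q 0)
  by_cases hc : P.IsClear n (q 0)
  · obtain ⟨j, hj⟩ := exists_abs_sub_lt_one_or (q 1)
    refine ⟨j, hj.imp (fun h ↦ ?_) fun h ↦ ⟨h, hc⟩⟩
    rw [hc.smoothHeight_eq]
    exact mul_lt_of_lt_one_left hr h
  · simp only [IsClear] at hc
    push Not at hc
    obtain ⟨i, hi, hxi⟩ := hc
    have hm := abs_sub_round_half_le (q 1)
    set m := round (q 1 / 2)
    refine ⟨m, Or.inl ?_⟩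
    by_contra! hcon
    -- `2k+1` is the seam next to the point. The last hypothesis makes it one of the `n` seams
    -- inside the rectangle, which do have holes.
    have key : ∀ k : ℤ, 1 - |q 1 - (2 * k + 1)| = |q 1 - 2 * m| →
        (2 * k + 1 : ℝ) ∈ Icc 0 (2 * n : ℝ) → False := by
      intro k hk hk'
      obtain ⟨j, rfl⟩ := exists_fin_eq n hk'
      have := h ⟨i, hi⟩ j
      simp only [hole, mem_ofPred_eq] at this
      push_cast at hk
      rw [hk, max_eq_left, zero_div] at this
      · nlinarith [hxi.1, hxi.2]
      · rw [← mul_div_assoc, sub_nonpos, one_le_div hs]; exact hcon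
    have hne : |q 1 - 2 * m| ≠ 0 := by
      intro h0; rw [h0, zero_mul] at hcon; linarith
    rw [abs_le] at hm
    rcases lt_or_ge (q 1 - 2 * m) 0 with h1 | h1
    · refine key (m - 1) ?_ ?_
      · push_cast
        rw [abs_of_neg h1, abs_of_nonneg (by linarith)]; ring
      · have h2 : (0 : ℝ) < m := by linarith [hq.1]
        have h3 : (1 : ℝ) ≤ m := by exact_mod_cast (by exact_mod_cast h2 : 0 < m)
        have h4 : (m : ℝ) < n + 1 := by linarith [hq.2]
        have h5 : (m : ℝ) ≤ n := by
          have : m < n + 1 := by exact_mod_cast h4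
          exact_mod_cast (by omega : m ≤ n)
        push_cast
        constructor <;> linarith
    · have h1' : 0 < q 1 - 2 * m := lt_of_le_of_ne h1 fun h ↦ hne (by rw [← h, abs_zero])
      refine key m ?_ ?_
      · rw [abs_of_nonneg h1, abs_of_nonpos (by linarith)]; ring
      · have h2 : (m : ℝ) < n := by linarith [hq.2]
        have h3 : (m : ℝ) + 1 ≤ n := by exact_mod_cast (by exact_mod_cast h2 : m < n)
        have h4 : (-1 : ℝ) < m := by linarith [hq.1]
        have h5 : (0 : ℝ) ≤ m := by
          have : -1 < m := by exact_mod_cast h4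
          exact_mod_cast (by omega : 0 ≤ m)
        constructor <;> linarith

variable {P n} in
theorem exists_polarDomain_of_mem {p : PolarPlane} (hp : p ∈ P.perforatedSector n) :
    ∃ j, p.1 ∈ P.polarDomain n j :=
  exists_mem_polarDomain ((P.mem_sector_iff n).1 hp.1).2 hp.2

variable {P n} in
theorem exists_surfaceDomain_of_mem {p : P.Surface n} (hp : p ∈ P.perforatedSurface n) :
    ∃ j, p.1 ∈ P.surfaceDomain n j :=
  exists_mem_surfaceDomain hp.1.2 hp.2

variable {P n} in
theorem IsFine.unrollMap_mem (hf : P.IsFine n) {p : PolarPlane} (hp : p ∈ P.perforatedSector n) :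
    P.unrollMap n p ∈ P.perforatedSurface n := by
  obtain ⟨j, hj⟩ := exists_polarDomain_of_mem hp
  have hs := (P.mem_sector_iff n).1 hp.1
  have hv := unrollMap_val hj
  refine ⟨(P.mem_rectangle_iff n).2 ?_, fun i k ↦ ?_⟩
  · rw [hv]
    exact ⟨hs.1, (unroll_mem_iff hj).2 hs.2⟩
  · rw [hv]
    exact (IsFine.unroll_notMem_hole_iff hf hj i k).2 (hp.2 i k)

variable {P n} in
theorem innerRadius_add_pos {p : P.Surface n} (hp : p ∈ P.rectangle n) :
    0 < P.innerRadius + p.1 0 := by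
  have := P.innerRadius_pos
  have := ((P.mem_rectangle_iff n).1 hp).1.1
  linarith

variable {P n} in
theorem IsFine.rollMap_mem (hf : P.IsFine n) {p : P.Surface n} (hp : p ∈ P.perforatedSurface n) :
    P.rollMap n p ∈ P.perforatedSector n := by
  obtain ⟨j, hj⟩ := exists_surfaceDomain_of_mem hp
  have hpos := innerRadius_add_pos hp.1
  have hs := (P.mem_rectangle_iff n).1 hp.1
  have hv := rollMap_val hpos
  have hd := roll_mem_polarDomain hj
  have hu := unroll_roll hj
  have h0 : (P.roll n p.1) 0 - P.innerRadius = p.1 0 := by simp [roll]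
  refine ⟨(P.mem_sector_iff n).2 ?_, fun i k ↦ ?_⟩
  · rw [hv, h0, ← unroll_mem_iff hd, hu]
    exact hs
  · rw [hv, ← IsFine.unroll_notMem_hole_iff hf hd, hu]
    exact hp.2 i k

variable {P n} in
theorem rollMap_unrollMap {p : PolarPlane} (hp : p ∈ P.perforatedSector n) :
    P.rollMap n (P.unrollMap n p) = p := by
  obtain ⟨j, hj⟩ := exists_polarDomain_of_mem hp
  apply Subtype.ext
  rw [rollMap_val, unrollMap_val hj, roll_unroll hj]
  rw [unrollMap_val hj]
  have : (P.unroll n p.1) 0 = p.1 0 - P.innerRadius := rfl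
  rw [this, add_sub_cancel]
  exact p.2

variable {P n} in
theorem unrollMap_rollMap {p : P.Surface n} (hp : p ∈ P.perforatedSurface n) :
    P.unrollMap n (P.rollMap n p) = p := by
  obtain ⟨j, hj⟩ := exists_surfaceDomain_of_mem hp
  have hv := rollMap_val (innerRadius_add_pos hp.1)
  apply Subtype.ext
  rw [unrollMap_val (j := j) (by rw [hv]; exact roll_mem_polarDomain hj), hv, unroll_roll hj]

variable {P n} in
theorem IsFine.isDiffeoOn (hf : P.IsFine n) :
    IsDiffeoOn PolarPlane.weitzenbock (P.surface n) (P.unrollMap n) (P.perforatedSector n)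
      (P.perforatedSurface n) := by
  have hinv : InvOn (P.rollMap n) (P.unrollMap n) (P.perforatedSector n) (P.perforatedSurface n) :=
    ⟨fun _ hp ↦ rollMap_unrollMap hp, fun _ hp ↦ unrollMap_rollMap hp⟩
  refine ⟨fun p hp ↦ ?_, hinv.bijOn (fun p hp ↦ IsFine.unrollMap_mem hf hp)
    fun p hp ↦ IsFine.rollMap_mem hf hp, P.rollMap n, fun p hp ↦ ?_, hinv⟩
  · obtain ⟨j, hj⟩ := exists_polarDomain_of_mem hp
    exact (contMDiffAt_unrollMap hj).contMDiffWithinAt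
  · obtain ⟨j, hj⟩ := exists_surfaceDomain_of_mem hp
    exact (contMDiffAt_rollMap hj (innerRadius_add_pos hp.1)).contMDiffWithinAt

end DislocationData

/-! ### Quadrant charts for boxes and for exteriors of ellipses -/

section Corners

variable {d : ℕ}

/-- Near `a`, the set `S` is a quadrant in suitable smooth coordinates. -/
def IsQuadrantAt (S : Set (Model d)) (a : Model d) : Prop :=
  ∃ Φ : OpenPartialHomeomorph (Model d) (Model d), ContDiffOn ℝ ∞ Φ Φ.source ∧
    ContDiffOn ℝ ∞ Φ.symm Φ.target ∧ a ∈ Φ.source ∧ ∀ y ∈ Φ.source, y ∈ S ↔ ∀ i, 0 ≤ Φ y i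

theorem IsQuadrantAt.congr {S T : Set (Model d)} {a : Model d} (h : IsQuadrantAt S a)
    (hST : ∀ᶠ y in 𝓝 a, y ∈ T ↔ y ∈ S) : IsQuadrantAt T a := by
  obtain ⟨Φ, h1, h2, ha, hS⟩ := h
  obtain ⟨U, hU, hUo, haU⟩ := eventually_nhds_iff.1 hST
  refine ⟨Φ.restrOpen U hUo, ?_, ?_, ⟨ha, haU⟩, fun y hy ↦ ?_⟩
  · exact h1.mono inter_subset_left
  · exact h2.mono fun y hy ↦ hy.1
  · exact (hU y hy.2).trans (hS y hy.1)

theorem IsQuadrantAt.preimage {S : Set (Model d)} {g : Model d ≃ₜ Model d} {a : Model d}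
    (hg : ContDiff ℝ ∞ g) (hg' : ContDiff ℝ ∞ g.symm) (h : IsQuadrantAt S (g a)) :
    IsQuadrantAt (g ⁻¹' S) a := by
  obtain ⟨Φ, h1, h2, ha, hS⟩ := h
  refine ⟨g.toOpenPartialHomeomorph.trans Φ, ?_, ?_, by simpa using ha, fun y hy ↦ ?_⟩
  · exact h1.comp hg.contDiffOn fun y hy ↦ by simpa using hy
  · exact hg'.comp_contDiffOn (h2.mono fun y hy ↦ by simpa using hy)
  · exact hS (g y) (by simpa using hy)

/-- A coordinate box. -/
def coordBox (l u : Fin d → ℝ) : Set (Model d) := {q | ∀ i, q i ∈ Icc (l i) (u i)}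

theorem isCompact_coordBox (l u : Fin d → ℝ) : IsCompact (coordBox l u) := by
  have : coordBox l u = (EuclideanSpace.equiv (Fin d) ℝ).toHomeomorph ⁻¹'
      (Set.pi univ fun i ↦ Icc (l i) (u i)) := by
    ext q; simp only [coordBox, mem_preimage, mem_univ_pi]; rfl
  rw [this, Homeomorph.isCompact_preimage]
  exact isCompact_univ_pi fun i ↦ isCompact_Icc

/-- Translation followed by reflections of some of the coordinates. -/
def signedShift (σ o : Fin d → ℝ) (hσ : ∀ i, σ i * σ i = 1) : Model d ≃ₜ Model d where
  toFun q := WithLp.toLp 2 fun i ↦ σ i * (q i - o i)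
  invFun q := WithLp.toLp 2 fun i ↦ σ i * q i + o i
  left_inv q := by ext i; simp [← mul_assoc, hσ]
  right_inv q := by ext i; simp [← mul_assoc, hσ]
  continuous_toFun := by fun_prop
  continuous_invFun := by fun_prop

/-- Since `l i < u i`, near `a` at most one of the two faces matters in each coordinate. If it is
the upper one, the coordinate is reflected. -/
theorem isQuadrantAt_coordBox {l u : Fin d → ℝ} (hlu : ∀ i, l i < u i) (a : Model d) :
    IsQuadrantAt (coordBox l u) a := by
  classical
  set σ : Fin d → ℝ := fun i ↦ if a i < u i then 1 else -1 with hσ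
  set o : Fin d → ℝ := fun i ↦ if a i < u i then l i else u i with ho
  have hσ1 : ∀ i, σ i * σ i = 1 := fun i ↦ by simp only [hσ]; split_ifs <;> norm_num
  have hU : IsOpen {q : Model d | ∀ i, if a i < u i then q i < u i else l i < q i} := by
    simp only [ofPred_forall]
    refine isOpen_iInter_of_finite fun i ↦ ?_
    have : Continuous fun q : Model d ↦ q i := by fun_prop
    split_ifs
    · exact isOpen_lt this continuous_const
    · exact isOpen_lt continuous_const this
  refine ⟨(signedShift σ o hσ1).toOpenPartialHomeomorph.restrOpen _ hU, ?_, ?_, ⟨mem_univ _, ?_⟩, ?_⟩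
  · refine ContDiff.contDiffOn (f := signedShift σ o hσ1) ?_
    rw [contDiff_euclidean]
    intro i
    change ContDiff ℝ ∞ fun q : Model d ↦ σ i * (q i - o i)
    fun_prop
  · refine ContDiff.contDiffOn (f := (signedShift σ o hσ1).symm) ?_
    rw [contDiff_euclidean]
    intro i
    change ContDiff ℝ ∞ fun q : Model d ↦ σ i * q i + o i
    fun_prop
  · intro i
    split_ifs with h
    · exact h
    · exact (hlu i).trans_le (not_lt.1 h)
  · intro y hy
    have hy2 : ∀ i, if a i < u i then y i < u i else l i < y i := hy.2
    refine forall_congr' fun i ↦ ?_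
    change y i ∈ Icc (l i) (u i) ↔ 0 ≤ σ i * (y i - o i)
    have := hy2 i
    simp only [hσ, ho]
    split_ifs with h
    · rw [if_pos h] at this
      rw [one_mul, sub_nonneg]
      exact ⟨fun h ↦ h.1, fun h ↦ ⟨h, this.le⟩⟩
    · rw [if_neg h] at this
      rw [neg_one_mul, neg_sub, sub_nonneg]
      exact ⟨fun h ↦ h.2, fun h ↦ ⟨this.le, h⟩⟩

/-- Coordinates near the right half of the unit circle in which the complement of the unit disc is the
half-plane. -/
def circleChart : OpenPartialHomeomorph (Model 2) (Model 2) where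
  -- The shift by 2 makes the second coordinate positive on the source, so that it imposes no
  -- condition and a quadrant becomes a half-plane.
  toFun q := !₂[q 0 ^ 2 + q 1 ^ 2 - 1, q 1 + 2]
  invFun q := !₂[√(q 0 + 1 - (q 1 - 2) ^ 2), q 1 - 2]
  source := {q | 0 < q 0 ∧ -2 < q 1}
  target := {q | 0 < q 0 + 1 - (q 1 - 2) ^ 2 ∧ 0 < q 1}
  map_source' q hq := by
    simp only [mem_ofPred_eq] at hq ⊢
    simp
    constructor
    · exact pow_pos hq.1 2
    · linarith [hq.2]
  map_target' q hq := by
    simp only [mem_ofPred_eq] at hq ⊢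
    simp only [Matrix.cons_val_zero, Matrix.cons_val_one]
    exact ⟨Real.sqrt_pos.2 hq.1, by linarith [hq.2]⟩
  left_inv' q hq := by
    have : √(q 0 ^ 2 + q 1 ^ 2 - 1 + 1 - (q 1 + 2 - 2) ^ 2) = q 0 := by
      rw [show q 0 ^ 2 + q 1 ^ 2 - 1 + 1 - (q 1 + 2 - 2) ^ 2 = q 0 ^ 2 by ring]
      exact Real.sqrt_sq hq.1.le
    ext i; fin_cases i
    · simpa using this
    · simp
  right_inv' q hq := by
    have := Real.sq_sqrt hq.1.le
    ext i; fin_cases i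
    · simp only [Fin.zero_eta, Matrix.cons_val_zero, Matrix.cons_val_one]
      rw [this]; ring
    · simp
  open_source := by
    have h0 : Continuous fun q : Model 2 ↦ q 0 := by fun_prop
    have h1 : Continuous fun q : Model 2 ↦ q 1 := by fun_prop
    exact (isOpen_lt continuous_const h0).inter (isOpen_lt continuous_const h1)
  open_target := by
    have h0 : Continuous fun q : Model 2 ↦ q 0 := by fun_prop
    have h1 : Continuous fun q : Model 2 ↦ q 1 := by fun_prop
    exact (isOpen_lt continuous_const ((h0.add continuous_const).sub
      ((h1.sub continuous_const).pow 2))).inter (isOpen_lt continuous_const h1)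
  continuousOn_toFun := (continuous_vec (by fun_prop) (by fun_prop)).continuousOn
  continuousOn_invFun := (continuous_vec (by fun_prop) (by fun_prop)).continuousOn

theorem isQuadrantAt_circle_right {a : Model 2} (ha : a 0 ^ 2 + a 1 ^ 2 = 1) (h0 : 0 < a 0) :
    IsQuadrantAt {q : Model 2 | 1 ≤ q 0 ^ 2 + q 1 ^ 2} a := by
  refine ⟨circleChart, ?_, ?_, ⟨h0, by nlinarith [sq_nonneg (a 0)]⟩, fun y hy ↦ ?_⟩
  · exact (DislocationData.contDiff_vec (E := Model 2) (f := fun q ↦ q 0 ^ 2 + q 1 ^ 2 - 1)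
      (g := fun q ↦ q 1 + 2) (by fun_prop) (by fun_prop)).contDiffOn
  · rw [contDiffOn_euclidean]
    intro i
    fin_cases i
    · change ContDiffOn ℝ ∞ (fun q : Model 2 ↦ √(q 0 + 1 - (q 1 - 2) ^ 2)) _
      refine ContDiffOn.sqrt (ContDiff.contDiffOn (by fun_prop)) fun q hq ↦ hq.1.ne'
    · change ContDiffOn ℝ ∞ (fun q : Model 2 ↦ q 1 - 2) _
      exact ContDiff.contDiffOn (by fun_prop)
  · have hy2 : -2 < y 1 := hy.2
    change 1 ≤ y 0 ^ 2 + y 1 ^ 2 ↔ ∀ i, 0 ≤ (!₂[y 0 ^ 2 + y 1 ^ 2 - 1, y 1 + 2] : Model 2) i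
    rw [Fin.forall_fin_two]
    simp only [Matrix.cons_val_zero, Matrix.cons_val_one]
    constructor
    · intro h; exact ⟨by linarith, by linarith⟩
    · intro h; linarith [h.1]

/-- The reflection in the second coordinate axis. -/
def flipFst : Model 2 ≃ₜ Model 2 where
  toFun q := !₂[-q 0, q 1]
  invFun q := !₂[-q 0, q 1]
  left_inv q := by ext i; fin_cases i <;> simp
  right_inv q := by ext i; fin_cases i <;> simp
  continuous_toFun := continuous_vec (by fun_prop) (by fun_prop)
  continuous_invFun := continuous_vec (by fun_prop) (by fun_prop)

/-- The exchange of the coordinates. -/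
def swapCoords : Model 2 ≃ₜ Model 2 where
  toFun q := !₂[q 1, q 0]
  invFun q := !₂[q 1, q 0]
  left_inv q := by ext i; fin_cases i <;> simp
  right_inv q := by ext i; fin_cases i <;> simp
  continuous_toFun := continuous_vec (by fun_prop) (by fun_prop)
  continuous_invFun := continuous_vec (by fun_prop) (by fun_prop)

/-- One of the coordinates is not zero; a reflection or an exchange of coordinates moves the point
to the right half of the circle. -/
theorem isQuadrantAt_circle {a : Model 2} (ha : a 0 ^ 2 + a 1 ^ 2 = 1) :
    IsQuadrantAt {q : Model 2 | 1 ≤ q 0 ^ 2 + q 1 ^ 2} a := by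
  have side : ∀ {a : Model 2}, a 0 ^ 2 + a 1 ^ 2 = 1 → a 0 ≠ 0 →
      IsQuadrantAt {q : Model 2 | 1 ≤ q 0 ^ 2 + q 1 ^ 2} a := by
    intro a ha h0
    rcases lt_or_gt_of_ne h0 with h | h
    · have hc : ContDiff ℝ ∞ flipFst := DislocationData.contDiff_vec (E := Model 2)
        (f := fun q ↦ -q 0) (g := fun q ↦ q 1) (by fun_prop) (by fun_prop)
      have := IsQuadrantAt.preimage (g := flipFst) (a := a) hc hc
        (isQuadrantAt_circle_right (a := flipFst a) (by simpa [flipFst] using ha)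
          (by simpa [flipFst] using h))
      simpa [flipFst] using this
    · exact isQuadrantAt_circle_right ha h
  by_cases h0 : a 0 = 0
  · have h1 : a 1 ≠ 0 := by
      intro h1; rw [h0, h1] at ha; norm_num at ha
    have hc : ContDiff ℝ ∞ swapCoords := DislocationData.contDiff_vec (E := Model 2)
      (f := fun q ↦ q 1) (g := fun q ↦ q 0) (by fun_prop) (by fun_prop)
    have := IsQuadrantAt.preimage (g := swapCoords) (a := a) hc hc
      (side (a := swapCoords a) (by simp [swapCoords]; linarith) (by simpa [swapCoords] using h1))
    refine this.congr (Eventually.of_forall fun y ↦ ?_)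
    simp [swapCoords, add_comm]
  · exact side ha h0

theorem exists_maximalAtlas_of_isQuadrantAt {M : Type} [TopologicalSpace M]
    [ChartedSpace (Model d) M] [IsManifold (𝓡 d) ∞ M] {K : Set M}
    {e : OpenPartialHomeomorph M (Model d)} (he : e ∈ atlas (Model d) M) {p : M} (hp : p ∈ e.source)
    {S : Set (Model d)} (hS : IsQuadrantAt S (e p)) {U : Set M} (hU : IsOpen U) (hpU : p ∈ U)
    (h : ∀ y ∈ U, y ∈ e.source → (y ∈ K ↔ e y ∈ S)) :
    ∃ Φ ∈ IsManifold.maximalAtlas (𝓡 d) ∞ M, p ∈ Φ.source ∧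
      ∀ y ∈ Φ.source, y ∈ K ↔ ∀ i, 0 ≤ Φ y i := by
  obtain ⟨Φ, h1, h2, ha, hS⟩ := hS
  have hm := IsManifold.subset_maximalAtlas (I := 𝓡 d) (n := ∞) he
  refine ⟨(e.trans Φ).restrOpen U hU, ?_, ⟨by simp [hp, ha], hpU⟩, fun y hy ↦ ?_⟩
  · apply OpenPartialHomeomorph.mem_maximalAtlas_of_contMDiffOn
    · refine ContMDiffOn.mono ?_ (inter_subset_left : _ ⊆ (e.trans Φ).source)
      exact h1.contMDiffOn.comp ((contMDiffOn_of_mem_maximalAtlas hm).mono inter_subset_left)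
        fun y hy ↦ hy.2
    · refine ContMDiffOn.mono (s := (e.trans Φ).target) ?_ fun y hy ↦ hy.1
      exact (contMDiffOn_symm_of_mem_maximalAtlas hm).comp (h2.contMDiffOn.mono inter_subset_left)
        fun y hy ↦ hy.2
  · have hy1 : y ∈ (e.trans Φ).source := hy.1
    rw [OpenPartialHomeomorph.trans_source] at hy1
    rw [h y hy.2 hy1.1, hS _ hy1.2]
    rfl

end Corners

/-- A diagonal affine map of the plane. -/
def diagAffine (α β o₀ o₁ : ℝ) (hα : α ≠ 0) (hβ : β ≠ 0) : Model 2 ≃ₜ Model 2 where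
  toFun q := !₂[α * (q 0 - o₀), β * (q 1 - o₁)]
  invFun q := !₂[q 0 / α + o₀, q 1 / β + o₁]
  left_inv q := by ext i; fin_cases i <;> simp [hα, hβ]
  right_inv q := by ext i; fin_cases i <;> simp <;> field_simp
  continuous_toFun := continuous_vec (by fun_prop) (by fun_prop)
  continuous_invFun := continuous_vec (by fun_prop) (by fun_prop)

/-! ### The perforated domains are compact domains with corners -/

namespace DislocationData

variable (P : DislocationData) (n : ℕ) [NeZero n]

/-- The perforated sector in polar coordinates. -/
def perforatedBox : Set (Model 2) :=
  {q | (q 0 - P.innerRadius ∈ Icc 0 P.b ∧ q 1 / P.angleStep n ∈ Icc 0 (2 * n : ℝ)) ∧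
    ∀ i j : Fin n, q ∈ P.outside n i j}

theorem mem_perforatedSector_iff {p : PolarPlane} :
    p ∈ P.perforatedSector n ↔ p.1 ∈ P.perforatedBox n :=
  and_congr_left' (P.mem_sector_iff n)

theorem coords_mem_iff {q : Model 2} :
    (q 0 - P.innerRadius ∈ Icc 0 P.b ∧ q 1 / P.angleStep n ∈ Icc 0 (2 * n : ℝ)) ↔
      q ∈ coordBox ![P.innerRadius, 0] ![P.innerRadius + P.b, P.angleStep n * (2 * n)] := by
  have hκ := P.angleStep_pos n
  have : q ∈ coordBox ![P.innerRadius, 0] ![P.innerRadius + P.b, P.angleStep n * (2 * n)] ↔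
      q 0 ∈ Icc P.innerRadius (P.innerRadius + P.b) ∧
      q 1 ∈ Icc 0 (P.angleStep n * (2 * n)) := by
    simp only [coordBox, mem_ofPred_eq, Fin.forall_fin_two]; rfl
  rw [this, mem_Icc, mem_Icc, mem_Icc, mem_Icc, div_le_iff₀ hκ, le_div_iff₀ hκ, zero_mul,
    sub_nonneg, sub_le_iff_le_add', mul_comm (P.angleStep n)]

theorem isQuadrantAt_coords (a : Model 2) :
    IsQuadrantAt {q | q 0 - P.innerRadius ∈ Icc 0 P.b ∧
      q 1 / P.angleStep n ∈ Icc 0 (2 * n : ℝ)} a := by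
  have hb := P.b_pos
  have hκ := P.angleStep_pos n
  have hn := cast_pos' n
  refine (isQuadrantAt_coordBox (l := ![P.innerRadius, 0])
    (u := ![P.innerRadius + P.b, P.angleStep n * (2 * n)]) ?_ a).congr
    (Eventually.of_forall fun y ↦ P.coords_mem_iff n)
  rw [Fin.forall_fin_two]
  constructor
  · change P.innerRadius < P.innerRadius + P.b
    linarith
  · change 0 < P.angleStep n * (2 * n)
    positivity

omit [NeZero n] in
theorem isOpen_outside_lt (i j : ℕ) : IsOpen {q : Model 2 | (2 * P.width n) ^ 2 <
    (q 0 - P.innerRadius - P.center n i) ^ 2 +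
    ((q 1 / P.angleStep n - (2 * j + 1)) / n) ^ 2} := by
  have h0 : Continuous fun q : Model 2 ↦ q 0 := by fun_prop
  have h1 : Continuous fun q : Model 2 ↦ q 1 := by fun_prop
  exact isOpen_lt continuous_const
    ((((h0.sub continuous_const).sub continuous_const).pow 2).add
      ((((h1.div_const _).sub continuous_const).div_const _).pow 2))

omit [NeZero n] in
theorem isClosed_outside (i j : ℕ) : IsClosed (P.outside n i j) := by
  have h0 : Continuous fun q : Model 2 ↦ q 0 := by fun_prop
  have h1 : Continuous fun q : Model 2 ↦ q 1 := by fun_prop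
  exact isClosed_le continuous_const
    ((((h0.sub continuous_const).sub continuous_const).pow 2).add
      ((((h1.div_const _).sub continuous_const).div_const _).pow 2))

/-- A diagonal affine map takes the ellipse to the unit circle. -/
theorem isQuadrantAt_outside {i j : ℕ} {a : Model 2}
    (ha : (a 0 - P.innerRadius - P.center n i) ^ 2 +
      ((a 1 / P.angleStep n - (2 * j + 1)) / n) ^ 2 = (2 * P.width n) ^ 2) :
    IsQuadrantAt (P.outside n i j) a := by
  have hw := P.width_pos n
  have hκ := P.angleStep_pos n
  have hn := cast_pos' n
  set g := diagAffine (1 / (2 * P.width n)) (1 / (P.angleStep n * n * (2 * P.width n)))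
    (P.innerRadius + P.center n i) (P.angleStep n * (2 * j + 1)) (by positivity) (by positivity)
  have key : ∀ q : Model 2, (g q) 0 ^ 2 + (g q) 1 ^ 2 =
      ((q 0 - P.innerRadius - P.center n i) ^ 2 +
      ((q 1 / P.angleStep n - (2 * j + 1)) / n) ^ 2) / (2 * P.width n) ^ 2 := by
    intro q
    change (1 / (2 * P.width n) * (q 0 - (P.innerRadius + P.center n i))) ^ 2 +
      (1 / (P.angleStep n * n * (2 * P.width n)) * (q 1 - P.angleStep n * (2 * j + 1))) ^ 2 = _
    field_simp
    ring
  have h := IsQuadrantAt.preimage (g := g) (a := a)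
    (contDiff_vec (E := Model 2)
      (f := fun q ↦ (1 / (2 * P.width n)) * (q 0 - (P.innerRadius + P.center n i)))
      (g := fun q ↦ (1 / (P.angleStep n * n * (2 * P.width n))) *
        (q 1 - P.angleStep n * (2 * j + 1))) (by fun_prop) (by fun_prop))
    (contDiff_vec (E := Model 2)
      (f := fun q ↦ q 0 / (1 / (2 * P.width n)) + (P.innerRadius + P.center n i))
      (g := fun q ↦ q 1 / (1 / (P.angleStep n * n * (2 * P.width n))) +
        P.angleStep n * (2 * j + 1)) (by fun_prop) (by fun_prop))
    (isQuadrantAt_circle (by rw [key, ha, div_self (by positivity)]))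
  refine h.congr (Eventually.of_forall fun y ↦ ?_)
  have hk := key y
  change (2 * P.width n) ^ 2 ≤ (y 0 - P.innerRadius - P.center n i) ^ 2 +
    ((y 1 / P.angleStep n - (2 * j + 1)) / n) ^ 2 ↔ 1 ≤ (g y) 0 ^ 2 + (g y) 1 ^ 2
  rw [hk, one_le_div (by positivity)]

omit [NeZero n] in
theorem center_sub (i k : ℕ) : P.center n i - P.center n k = ((i : ℝ) - k) * P.bBlock n := by
  simp only [center]; ring

theorem bBlock_le_abs_center_sub {i k : ℕ} (h : i ≠ k) :
    P.bBlock n ≤ |P.center n i - P.center n k| := by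
  have hb := P.bBlock_pos n
  rw [center_sub, abs_mul, abs_of_pos hb]
  have : (1 : ℝ) ≤ |(i : ℝ) - k| := by
    have : (1 : ℤ) ≤ |(i : ℤ) - k| := Int.one_le_abs (by omega)
    exact_mod_cast this
  nlinarith

theorem bBlock_mul : n * P.bBlock n = P.b := by
  rw [bBlock, mul_div_cancel₀ _ (cast_pos' n).ne']

variable {P n} in
theorem IsFine.center_mem (hf : P.IsFine n) {i : ℕ} (hi : i < n) :
    4 * P.width n ≤ P.center n i ∧ P.center n i + 4 * P.width n ≤ P.b := by
  have h := IsFine.slit_subset P hf i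
  have hb := P.bBlock_pos n
  have hm := P.bBlock_mul n
  have h1 : (i : ℝ) + 1 ≤ n := by exact_mod_cast hi
  have h2 : (0 : ℝ) ≤ i := by positivity
  constructor
  · nlinarith [h.1]
  · nlinarith [h.2]

variable {P n} in
-- Either `a` is strictly outside of all ellipses, and only the faces of the box matter, or it is on
-- one of them. In that case it is interior to the box and strictly outside of the other ellipses.
-- Indeed, with w the width of a dislocation line, the half-axes are 2w ≤ b_n/4 and, in half rows,
-- 2wn ≤ 1/4, while the centres have distance at least b_n horizontally or 2 vertically.
theorem IsFine.isQuadrantAt_perforatedBox (hf : P.IsFine n) {a : Model 2}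
    (ha : a ∈ P.perforatedBox n) : IsQuadrantAt (P.perforatedBox n) a := by
  have hw := P.width_pos n
  have hn := cast_pos' n
  have hκ := P.angleStep_pos n
  by_cases hs : ∀ i j : Fin n, (2 * P.width n) ^ 2 <
      (a 0 - P.innerRadius - P.center n i) ^ 2 +
      ((a 1 / P.angleStep n - (2 * (j : ℕ) + 1)) / n) ^ 2
  · refine (P.isQuadrantAt_coords n a).congr ?_
    have : ∀ᶠ q in 𝓝 a, ∀ i j : Fin n, (2 * P.width n) ^ 2 <
      (q 0 - P.innerRadius - P.center n i) ^ 2 +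
      ((q 1 / P.angleStep n - (2 * (j : ℕ) + 1)) / n) ^ 2 := by
      rw [eventually_all]; intro i
      rw [eventually_all]; intro j
      exact (P.isOpen_outside_lt n i j).mem_nhds (hs i j)
    filter_upwards [this] with q hq
    exact ⟨fun h ↦ h.1, fun h ↦ ⟨h, fun i j ↦ (hq i j).le⟩⟩
  · push Not at hs
    obtain ⟨i, j, hij⟩ := hs
    have heq := le_antisymm hij (ha.2 i j)
    have hx : |a 0 - P.innerRadius - P.center n i| ≤ 2 * P.width n := by
      refine abs_le_of_sq_le_sq ?_ (by linarith)
      nlinarith [sq_nonneg ((a 1 / P.angleStep n - (2 * (j : ℕ) + 1)) / n)]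
    have hτ : |a 1 / P.angleStep n - (2 * (j : ℕ) + 1)| ≤ 1 / 4 := by
      have h1 : |(a 1 / P.angleStep n - (2 * (j : ℕ) + 1)) / n| ≤ 2 * P.width n := by
        refine abs_le_of_sq_le_sq ?_ (by linarith)
        nlinarith [sq_nonneg (a 0 - P.innerRadius - P.center n i)]
      rw [abs_div, abs_of_pos hn, div_le_iff₀ hn] at h1
      linarith [hf.2]
    refine (P.isQuadrantAt_outside n heq).congr ?_
    -- The point stays away from the faces of the box, so that near it the box imposes no condition.
    have e0 : ∀ᶠ q : Model 2 in 𝓝 a, q 0 - P.innerRadius ∈ Ioo 0 P.b := by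
      have h0 : Continuous fun q : Model 2 ↦ q 0 - P.innerRadius := by fun_prop
      refine (isOpen_Ioo.preimage h0).mem_nhds ?_
      have := IsFine.center_mem hf i.2
      rw [abs_le] at hx
      exact ⟨by linarith, by linarith⟩
    have e1 : ∀ᶠ q : Model 2 in 𝓝 a, q 1 / P.angleStep n ∈ Ioo 0 (2 * n : ℝ) := by
      have h0 : Continuous fun q : Model 2 ↦ q 1 / P.angleStep n := by fun_prop
      refine (isOpen_Ioo.preimage h0).mem_nhds ?_
      have h1 : ((j : ℕ) : ℝ) + 1 ≤ n := by exact_mod_cast j.2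
      have h2 : (0 : ℝ) ≤ ((j : ℕ) : ℝ) := by positivity
      rw [abs_le] at hτ
      exact ⟨by linarith, by linarith⟩
    have e2 : ∀ᶠ q in 𝓝 a, ∀ k l : Fin n, ¬ (k = i ∧ l = j) → (2 * P.width n) ^ 2 <
      (q 0 - P.innerRadius - P.center n k) ^ 2 +
      ((q 1 / P.angleStep n - (2 * (l : ℕ) + 1)) / n) ^ 2 := by
      rw [eventually_all]; intro k
      rw [eventually_all]; intro l
      by_cases hkl : k = i ∧ l = j
      · exact Eventually.of_forall fun q h ↦ absurd hkl h
      refine (Eventually.mono ((P.isOpen_outside_lt n k l).mem_nhds ?_) fun q hq _ ↦ hq)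
      rw [mem_ofPred_eq]
      by_cases hk : k = i
      · have hl : (l : ℕ) ≠ j := fun h ↦ hkl ⟨hk, Fin.ext h⟩
        have h1 : (2 : ℝ) ≤ |(2 * ((j : ℕ) : ℝ) + 1) - (2 * (l : ℕ) + 1)| := by
          have h2 : (1 : ℤ) ≤ |((j : ℕ) : ℤ) - (l : ℕ)| := Int.one_le_abs (by omega)
          have h3 : (1 : ℝ) ≤ |((j : ℕ) : ℝ) - (l : ℕ)| := by exact_mod_cast h2
          rw [show (2 * ((j : ℕ) : ℝ) + 1) - (2 * (l : ℕ) + 1) = 2 * (((j : ℕ) : ℝ) - (l : ℕ)) by ring,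
            abs_mul, abs_of_pos (by norm_num : (0:ℝ) < 2)]
          linarith
        have h4 : 1 ≤ |a 1 / P.angleStep n - (2 * (l : ℕ) + 1)| := by
          have := abs_sub_abs_le_abs_sub ((2 * ((j : ℕ) : ℝ) + 1) - (2 * (l : ℕ) + 1))
            ((2 * ((j : ℕ) : ℝ) + 1) - a 1 / P.angleStep n)
          rw [abs_sub_comm (2 * ((j : ℕ) : ℝ) + 1) (a 1 / P.angleStep n)] at this
          rw [show (2 * ((j : ℕ) : ℝ) + 1) - (2 * (l : ℕ) + 1) - ((2 * ((j : ℕ) : ℝ) + 1) -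
            a 1 / P.angleStep n) = a 1 / P.angleStep n - (2 * (l : ℕ) + 1) by ring] at this
          linarith
        have h5 : 2 * P.width n < |(a 1 / P.angleStep n - (2 * (l : ℕ) + 1)) / n| := by
          rw [abs_div, abs_of_pos hn, lt_div_iff₀ hn]
          nlinarith [hf.2]
        have h6 := pow_lt_pow_left₀ h5 (by linarith) two_ne_zero
        rw [sq_abs] at h6
        nlinarith [sq_nonneg (a 0 - P.innerRadius - P.center n k)]
      · have h1 := P.bBlock_le_abs_center_sub n (i := i) (k := k) fun h ↦ hk (Fin.ext h.symm)
        have h2 : 2 * P.width n < |a 0 - P.innerRadius - P.center n k| := by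
          have := abs_sub_abs_le_abs_sub (P.center n i - P.center n k)
            (P.center n i - (a 0 - P.innerRadius))
          rw [abs_sub_comm (P.center n i) (a 0 - P.innerRadius),
            show P.center n i - P.center n k - (P.center n i - (a 0 - P.innerRadius)) =
              a 0 - P.innerRadius - P.center n k by ring] at this
          linarith [hf.1]
        have h6 := pow_lt_pow_left₀ h2 (by linarith) two_ne_zero
        rw [sq_abs] at h6
        nlinarith [sq_nonneg ((a 1 / P.angleStep n - (2 * (l : ℕ) + 1)) / n)]
    filter_upwards [e0, e1, e2] with q h0 h1 h2
    constructor
    · exact fun h ↦ h.2 i j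
    · refine fun h ↦ ⟨⟨Ioo_subset_Icc_self h0, Ioo_subset_Icc_self h1⟩, fun k l ↦ ?_⟩
      by_cases hkl : k = i ∧ l = j
      · rw [hkl.1, hkl.2]; exact h
      · exact (h2 k l hkl).le

theorem isCompact_of_val {S : Set PolarPlane} {T : Set (Model 2)} (h : ∀ p : PolarPlane, p ∈ S ↔ p.1 ∈ T)
    (hT : ∀ q ∈ T, 0 < q 0) (hc : IsCompact T) : IsCompact S := by
  rw [Topology.IsInducing.isCompact_iff (f := Subtype.val) PolarPlane.isOpenEmbedding_val.isInducing]
  convert hc using 1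
  ext q
  constructor
  · rintro ⟨p, hp, rfl⟩; exact (h p).1 hp
  · intro hq; exact ⟨⟨q, hT q hq⟩, (h _).2 hq, rfl⟩

theorem isCompact_coords : IsCompact {q : Model 2 | q 0 - P.innerRadius ∈ Icc 0 P.b ∧
    q 1 / P.angleStep n ∈ Icc 0 (2 * n : ℝ)} := by
  have := isCompact_coordBox ![P.innerRadius, 0] ![P.innerRadius + P.b, P.angleStep n * (2 * n)]
  convert this using 1
  ext q; exact P.coords_mem_iff n

omit [NeZero n] in
theorem pos_of_coords {q : Model 2} (h : q 0 - P.innerRadius ∈ Icc 0 P.b) : 0 < q 0 := by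
  have := P.innerRadius_pos
  linarith [h.1]

theorem isCompact_perforatedBox : IsCompact (P.perforatedBox n) := by
  have h : P.perforatedBox n = {q : Model 2 | q 0 - P.innerRadius ∈ Icc 0 P.b ∧
    q 1 / P.angleStep n ∈ Icc 0 (2 * n : ℝ)} ∩ ⋂ i : Fin n, ⋂ j : Fin n, P.outside n i j := by
    ext q; simp [perforatedBox]
  rw [h]
  exact (P.isCompact_coords n).inter_right
    (isClosed_iInter fun i ↦ isClosed_iInter fun j ↦ P.isClosed_outside n i j)

theorem isCompact_sector : IsCompact P.sector :=
  -- The sector does not depend on the number of half rows used to measure angles; the value 1 will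
  -- do.
  isCompact_of_val (fun _ ↦ P.mem_sector_iff 1) (fun _ hq ↦ P.pos_of_coords hq.1)
    (P.isCompact_coords 1)

theorem isCompact_perforatedSector : IsCompact (P.perforatedSector n) :=
  isCompact_of_val (fun _ ↦ P.mem_perforatedSector_iff n) (fun _ hq ↦ P.pos_of_coords hq.1.1)
    (P.isCompact_perforatedBox n)

theorem isCompactDomainWithCorners_sector :
    IsCompactDomainWithCorners (d := 2) (M := PolarPlane.weitzenbock.carrier) P.sector := by
  have := PolarPlane.isTranslationAtlas.isManifold
  refine ⟨P.isCompact_sector, fun x hx ↦ ?_⟩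
  exact exists_maximalAtlas_of_isQuadrantAt (M := PolarPlane) PolarPlane.chart_mem_atlas
    (mem_univ x) (P.isQuadrantAt_coords 1 _) isOpen_univ (mem_univ _)
    fun y _ _ ↦ P.mem_sector_iff 1

/-- `ofFlat j` as a homeomorphism. -/
def ofFlatHomeomorph (j : ℤ) : Model 2 ≃ₜ Model 2 where
  toFun := P.ofFlat n j
  invFun := P.toFlat n j
  left_inv := P.toFlat_ofFlat n j
  right_inv := P.ofFlat_toFlat n j
  continuous_toFun := (P.contDiff_ofFlat n j).continuous
  continuous_invFun := (P.contDiff_toFlat n j).continuous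

variable {P n} in
-- Compactness is carried over by `unrollMap`. Quadrant charts are carried over by `ofFlat j`, which
-- expresses polar coordinates through the flat chart around the given point.
theorem IsFine.isCompactDomainWithCorners (hf : P.IsFine n) :
    IsCompactDomainWithCorners (d := 2) (M := (P.surface n).carrier) (P.perforatedSurface n) := by
  have := (Surface.isTranslationAtlas P n).isManifold
  have hd := IsFine.isDiffeoOn hf
  constructor
  · rw [← hd.2.1.image_eq]
    exact (P.isCompact_perforatedSector n).image_of_continuousOn hd.1.continuousOn
  · intro x hx
    obtain ⟨j, hj⟩ := exists_surfaceDomain_of_mem (p := x) hx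
    have hpos := innerRadius_add_pos (p := x) hx.1
    have h0 : Continuous fun q : P.Surface n ↦ q.1 0 :=
      (PiLp.continuous_apply 2 _ 0).comp continuous_subtype_val
    have hU : IsOpen {y : P.Surface n | y.1 ∈ P.surfaceDomain n j ∧ 0 < P.innerRadius + y.1 0} :=
      ((P.isOpen_surfaceDomain n j).preimage continuous_subtype_val).inter
        (isOpen_lt continuous_const (continuous_const.add h0))
    have key : ∀ y : P.Surface n, y.1 ∈ P.surfaceDomain n j → 0 < P.innerRadius + y.1 0 →
        (y ∈ P.perforatedSurface n ↔
          Surface.flatChart P n j y ∈ P.ofFlatHomeomorph n j ⁻¹' P.perforatedBox n) := by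
      intro y hy hy'
      change _ ↔ P.ofFlat n j (Surface.flatChart P n j y) ∈ P.perforatedBox n
      rw [← rollMap_eq_ofFlat hy hy', ← mem_perforatedSector_iff]
      refine ⟨fun h ↦ IsFine.rollMap_mem hf h, fun h ↦ ?_⟩
      have h1 := IsFine.unrollMap_mem hf h
      have h2 : P.unrollMap n (P.rollMap n y) = y := by
        have hv := rollMap_val hy'
        apply Subtype.ext
        rw [unrollMap_val (j := j) (by rw [hv]; exact roll_mem_polarDomain hy), hv, unroll_roll hy]
      rwa [h2] at h1
    have hsrc : x ∈ (Surface.flatChart P n j).source := by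
      rw [Surface.flatChart_source]; exact mem_chartDomain_of_mem_surfaceDomain hj
    have hmain := exists_maximalAtlas_of_isQuadrantAt (M := P.Surface n)
      (K := P.perforatedSurface n) (mem_range_self j) hsrc
      (IsQuadrantAt.preimage (g := P.ofFlatHomeomorph n j) (P.contDiff_ofFlat n j)
        (P.contDiff_toFlat n j) (IsFine.isQuadrantAt_perforatedBox hf ((key x hj hpos).1 hx)))
      hU ⟨hj, hpos⟩ fun y hy _ ↦ key y hy.1 hy.2
    exact hmain

end DislocationData

/-! ### Metric, torsion and area of the polar plane -/

theorem WeitzenbockManifold.inner_ofFrame {d : ℕ} {M : Type} [TopologicalSpace M]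
    [ChartedSpace (Model d) M] [T2Space M] [SecondCountableTopology M]
    [MeasurableSpace M] [BorelSpace M] (h : IsTranslationAtlas d M) (e : FrameField d M)
    (x : (WeitzenbockManifold.ofFrame h e).carrier) (v w : TangentSpace (𝓡 d) x) :
    inner ℝ v w = (inner ℝ (e.inv x v : Model d) (e.inv x w) : ℝ) := rfl

namespace PolarPlane

theorem frame_inv_apply (p : PolarPlane) (v : Model 2) : frame.inv p v = !₂[v 0, p.1 0 * v 1] := by
  change (axis 0 + r p • axis 1) v = _
  ext i; fin_cases i <;> simp [axis_apply, r]

theorem frame_toFun_apply (p : PolarPlane) (v : Model 2) :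
    frame.toFun p v = !₂[v 0, (p.1 0)⁻¹ * v 1] := by
  change (axis 0 + (r p)⁻¹ • axis 1) v = _
  ext i; fin_cases i <;> simp [axis_apply, r]

theorem inner_eq (x : weitzenbock.carrier) (v w : TangentSpace (𝓡 2) x) :
    inner ℝ v w = dr x v * dr x w + radius x ^ 2 * (dphi x v * dphi x w) := by
  refine (WeitzenbockManifold.inner_ofFrame isTranslationAtlas frame x v w).trans ?_
  refine (congrArg₂ (fun a b : Model 2 ↦ (inner ℝ a b : ℝ)) (frame_inv_apply x v)
    (frame_inv_apply x w)).trans ?_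
  rw [PiLp.inner_apply, Fin.sum_univ_two]
  change dr x w * dr x v + radius x * dphi x w * (radius x * dphi x v) = _
  ring

theorem norm_eq (x : weitzenbock.carrier) (v : TangentSpace (𝓡 2) x) :
    ‖v‖ = ‖(!₂[dr x v, radius x * dphi x v] : Model 2)‖ := by
  refine (WeitzenbockManifold.norm_ofFrame isTranslationAtlas frame x v).trans ?_
  exact congrArg (fun a : Model 2 ↦ ‖a‖) (frame_inv_apply x v)

theorem conn_partialR (x : weitzenbock.carrier) : weitzenbock.conn partialR x = 0 := by
  have := isTranslationAtlas.isManifold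
  have h := (frame.isParallelFrameOn isTranslationAtlas).2.2.2 0 x (mem_univ x)
  have h2 : (frame.field 0 : VField 2 PolarPlane) = partialR := by
    funext p
    refine (frame_toFun_apply p _).trans ?_
    change _ = (EuclideanSpace.single 0 (1 : ℝ) : Model 2)
    ext i; fin_cases i <;> simp
  rw [h2] at h
  exact h

theorem conn_partialPhi (x : weitzenbock.carrier) :
    weitzenbock.conn (fun y ↦ (radius y)⁻¹ • partialPhi y) x = 0 := by
  have := isTranslationAtlas.isManifold
  have h := (frame.isParallelFrameOn isTranslationAtlas).2.2.2 1 x (mem_univ x)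
  have h2 : (frame.field 1 : VField 2 PolarPlane) = fun y ↦ (radius y)⁻¹ • partialPhi y := by
    funext p
    refine (frame_toFun_apply p _).trans ?_
    change _ = (p.1 0)⁻¹ • (EuclideanSpace.single 1 (1 : ℝ) : Model 2)
    ext i; fin_cases i <;> simp
  rw [h2] at h
  exact h

/-- Only the component `r w₁` of a constant field `w` with respect to the frame depends on the
point. Its derivative is the source of the torsion. -/
theorem mvfderiv_frame_inv (x : PolarPlane) (v w : Model 2) :
    mvfderiv (𝓡 2) (fun y : PolarPlane ↦ frame.inv y w) x v = !₂[0, v 0 * w 1] := by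
  have h1 : HasMFDerivAt (𝓡 2) (𝓡 2) PolarPlane.chart x (ContinuousLinearMap.id ℝ (Model 2)) :=
    isTranslationAtlas.hasMFDerivAt_chart chart_mem_atlas (mem_univ x)
  have h2 : HasFDerivAt (fun q : Model 2 ↦ axis 0 w + q 0 • axis 1 w)
      ((EuclideanSpace.proj 0 : Model 2 →L[ℝ] ℝ).smulRight (axis 1 w)) x.1 := by
    exact ((EuclideanSpace.proj 0 : Model 2 →L[ℝ] ℝ).hasFDerivAt.smul_const (axis 1 w)).const_add _
  have h3 : HasMFDerivAt (𝓡 2) 𝓘(ℝ, Model 2) (fun y : PolarPlane ↦ frame.inv y w) x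
      ((EuclideanSpace.proj 0 : Model 2 →L[ℝ] ℝ).smulRight (axis 1 w)) :=
    HasMFDerivAt.comp x h2.hasMFDerivAt h1
  refine (congrArg (fun A : Model 2 →L[ℝ] Model 2 ↦ A v) h3.mfderiv).trans ?_
  change v 0 • axis 1 w = _
  ext i; fin_cases i <;> simp [axis_apply]

theorem torsion_eq (x : weitzenbock.carrier) (v w : TangentSpace (𝓡 2) x) :
    weitzenbock.conn.torsion x v w = ((radius x)⁻¹ * (dr x v * dphi x w - dphi x v * dr x w)) •
      partialPhi x := by
  have := isTranslationAtlas.isManifold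
  refine (FrameField.torsion_conn isTranslationAtlas frame x v w).trans ?_
  have h := congrArg₂ (fun A B : Model 2 ↦ frame.toFun x (A - B)) (mvfderiv_frame_inv x v w)
    (mvfderiv_frame_inv x w v)
  refine h.trans ?_
  refine (frame_toFun_apply x _).trans ?_
  have gen : ∀ (ρ : ℝ) (v w : Model 2), (!₂[((!₂[0, v 0 * w 1] : Model 2) - !₂[0, w 0 * v 1]) 0,
      ρ⁻¹ * ((!₂[0, v 0 * w 1] : Model 2) - !₂[0, w 0 * v 1]) 1] : Model 2) =
      (ρ⁻¹ * (v 0 * w 1 - v 1 * w 0)) • EuclideanSpace.single 1 (1 : ℝ) := by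
    intro ρ v w
    ext i; fin_cases i
    · simp
    · simp; ring_nf; simp
  exact gen _ v w

/-- The area measure `r dr dφ`. -/
def area : Measure PolarPlane :=
  (volume.withDensity fun q : Model 2 ↦ ENNReal.ofReal (q 0)).comap Subtype.val

theorem measurableEmbedding_val : MeasurableEmbedding (Subtype.val : PolarPlane → Model 2) :=
  isOpenEmbedding_val.measurableEmbedding

theorem area_apply (s : Set PolarPlane) : area s =
    (volume.withDensity fun q : Model 2 ↦ ENNReal.ofReal (q 0)) (Subtype.val '' s) :=
  measurableEmbedding_val.comap_apply _ _

/-- In the only chart of the atlas the Gram matrix is diag(1, r²), whose determinant has the square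
root `r`. -/
theorem isRiemannianVolume_area : IsRiemannianVolume weitzenbock area := by
  intro e he s hs hsm
  have hm : MeasurableSet (Subtype.val '' s : Set (Model 2)) :=
    measurableEmbedding_val.measurableSet_image.2 hsm
  have he' : e = chart := he
  have himage : e '' s = (Subtype.val '' s : Set (Model 2)) := by rw [he']; rfl
  have hd : ∀ p : PolarPlane, (∀ v : Model 2, dr (e.symm p.1)
      (mfderiv (𝓡 2) (𝓡 2) e.symm p.1 v) = v 0) ∧
      (∀ v : Model 2, dphi (e.symm p.1) (mfderiv (𝓡 2) (𝓡 2) e.symm p.1 v) = v 1) ∧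
      radius (e.symm p.1) = p.1 0 := by
    intro p
    subst he'
    have hd : mfderiv (𝓡 2) (𝓡 2) chart.symm p.1 = ContinuousLinearMap.id ℝ (Model 2) :=
      (isTranslationAtlas.hasMFDerivAt_symm chart_mem_atlas (y := p.1)
        (chart.map_source (x := p) (mem_univ p))).mfderiv
    have hsymm : chart.symm p.1 = p := chart.left_inv (mem_univ p)
    exact ⟨fun v ↦ congrArg (fun A : Model 2 →L[ℝ] Model 2 ↦ (A v) 0) hd,
      fun v ↦ congrArg (fun A : Model 2 →L[ℝ] Model 2 ↦ (A v) 1) hd, congrArg r hsymm⟩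
  rw [himage]
  refine (area_apply s).trans ?_
  rw [withDensity_apply _ hm]
  refine setLIntegral_congr_fun hm ?_
  rintro _ ⟨p, hp, rfl⟩
  obtain ⟨h0, h1, hr⟩ := hd p
  refine congrArg ENNReal.ofReal ?_
  rw [Matrix.det_fin_two]
  simp only [Matrix.of_apply]
  rw [inner_eq, inner_eq, inner_eq, inner_eq]
  rw [h0, h0, h1, h1, hr]
  simp [Real.sqrt_sq p.2.le]

end PolarPlane

/-! ### Areas of the strips, null boundaries and the integral criterion -/

theorem volume_coordBox {d : ℕ} (l u : Fin d → ℝ) :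
    volume (coordBox l u) = ∏ i, ENNReal.ofReal (u i - l i) := by
  have h : coordBox l u = (@WithLp.ofLp 2 (Fin d → ℝ)) ⁻¹' (Set.pi univ fun i ↦ Icc (l i) (u i)) := by
    ext q; simp only [coordBox, mem_preimage, mem_univ_pi]; rfl
  rw [h, (PiLp.volume_preserving_ofLp (Fin d)).measure_preimage
    (MeasurableSet.univ_pi fun i ↦ measurableSet_Icc).nullMeasurableSet, volume_pi_pi]
  simp

theorem convex_coordBox {d : ℕ} (l u : Fin d → ℝ) : Convex ℝ (coordBox l u) := by
  intro x hx y hy a b ha hb hab i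
  have := (convex_Icc (l i) (u i)) (hx i) (hy i) ha hb hab
  simpa using this

theorem measurableSet_coordBox {d : ℕ} (l u : Fin d → ℝ) : MeasurableSet (coordBox l u) :=
  (isCompact_coordBox l u).isClosed.measurableSet

namespace PolarPlane

theorem area_preimage_eq_zero {T : Set (Model 2)} (h : volume T = 0) :
    area (Subtype.val ⁻¹' T) = 0 := by
  rw [area_apply]
  refine withDensity_absolutelyContinuous _ _ (measure_mono_null ?_ h)
  exact image_preimage_subset _ _

theorem area_preimage_le {T : Set (Model 2)} (hT : MeasurableSet T) {R : ℝ}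
    (h : ∀ q ∈ T, q 0 ≤ R) : area (Subtype.val ⁻¹' T) ≤ ENNReal.ofReal R * volume T := by
  rw [area_apply]
  refine (measure_mono (image_preimage_subset _ _)).trans ?_
  rw [withDensity_apply _ hT, ← setLIntegral_const]
  exact setLIntegral_mono' hT fun q hq ↦ ENNReal.ofReal_le_ofReal (h q hq)

end PolarPlane

namespace DislocationData

variable (P : DislocationData) (n : ℕ)

/-- The points near the abscissas of the dislocation lines. -/
def strips : Set PolarPlane :=
  {p | ∃ i < n, |p.1 0 - P.innerRadius - P.center n i| ≤ 2 * P.width n}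

/-- A bound for `n` times the area of the strips. -/
def stripArea : ℝ := (P.innerRadius + P.b) * (4 * slitWidth P.θ P.ε * (P.ε / P.b))

theorem mem_sector_def {p : PolarPlane} :
    p ∈ P.sector ↔ p.1 0 ∈ Icc P.innerRadius (P.innerRadius + P.b) ∧ p.1 1 ∈ Icc 0 (P.ε / P.b) :=
  Iff.rfl

theorem sector_eq_preimage : (P.sector : Set PolarPlane) =
    Subtype.val ⁻¹' coordBox ![P.innerRadius, 0] ![P.innerRadius + P.b, P.ε / P.b] := by
  ext p
  refine (P.mem_sector_def).trans ?_
  simp only [coordBox, Fin.forall_fin_two]; rfl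

theorem area_sector_ne_top : PolarPlane.area P.sector ≠ ⊤ := by
  rw [sector_eq_preimage]
  refine ne_top_of_le_ne_top ?_ (PolarPlane.area_preimage_le (R := P.innerRadius + P.b)
    (measurableSet_coordBox _ _) fun q hq ↦ (hq 0).2)
  exact ENNReal.mul_ne_top ENNReal.ofReal_ne_top (isCompact_coordBox _ _).measure_lt_top.ne

variable [NeZero n]

/-- There are `n` strips of width O(1/n²), all of height `ε/b`, and the density `r` is at most R₀ +
b. -/
theorem area_strips_inter_sector_le :
    PolarPlane.area (P.strips n ∩ P.sector) ≤ ENNReal.ofReal (P.stripArea / n) := by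
  have hw := P.width_pos n
  have hn := cast_pos' n
  have hb := P.b_pos
  have hε := P.ε_pos
  have hR := P.innerRadius_pos
  set B : ℕ → Set (Model 2) := fun i ↦
    coordBox ![P.innerRadius + P.center n i - 2 * P.width n, 0]
      ![P.innerRadius + P.center n i + 2 * P.width n, P.ε / P.b] ∩
      {q | q 0 ≤ P.innerRadius + P.b} with hB
  have hBm : ∀ i, MeasurableSet (B i) := fun i ↦ (measurableSet_coordBox _ _).inter
    (isClosed_le (PiLp.continuous_apply 2 _ 0) continuous_const).measurableSet
  have hsub : P.strips n ∩ P.sector ⊆ ⋃ i ∈ Finset.range n, Subtype.val ⁻¹' (B i) := by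
    rintro p ⟨⟨i, hi, hpi⟩, hp⟩
    replace hp := P.mem_sector_def.1 hp
    rw [abs_le] at hpi
    simp only [mem_iUnion, Finset.mem_range]
    refine ⟨i, hi, ?_, hp.1.2⟩
    simp only [coordBox, mem_ofPred_eq, Fin.forall_fin_two]
    refine ⟨⟨?_, ?_⟩, hp.2⟩
    · change P.innerRadius + P.center n i - 2 * P.width n ≤ p.1 0
      linarith
    · change p.1 0 ≤ P.innerRadius + P.center n i + 2 * P.width n
      linarith
  refine (measure_mono hsub).trans ((measure_biUnion_finset_le _ _).trans ?_)
  have hone : ∀ i, PolarPlane.area (Subtype.val ⁻¹' (B i)) ≤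
      ENNReal.ofReal ((P.innerRadius + P.b) * (4 * P.width n * (P.ε / P.b))) := by
    intro i
    refine (PolarPlane.area_preimage_le (hBm i) fun q hq ↦ hq.2).trans ?_
    rw [ENNReal.ofReal_mul (by positivity)]
    gcongr
    refine (measure_mono inter_subset_left).trans ?_
    rw [volume_coordBox, Fin.prod_univ_two, ← ENNReal.ofReal_mul]
    · refine le_of_eq (congrArg _ ?_)
      simp
      left; ring
    · simp; linarith
  refine (Finset.sum_le_sum fun i _ ↦ hone i).trans ?_
  rw [Finset.sum_const, Finset.card_range, nsmul_eq_mul, ← ENNReal.ofReal_natCast,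
    ← ENNReal.ofReal_mul (by positivity)]
  refine ENNReal.ofReal_le_ofReal (le_of_eq ?_)
  rw [width_eq, stripArea]
  field_simp

/-- The horizontal half-axis of an ellipse is half the width of a strip. -/
theorem sector_diff_subset : (P.sector \ P.perforatedSector n : Set PolarPlane) ⊆
    P.strips n ∩ P.sector := by
  have hw := P.width_pos n
  rintro p ⟨hp, hp'⟩
  refine ⟨?_, hp⟩
  by_contra hs
  refine hp' ⟨hp, fun i j ↦ ?_⟩
  simp only [strips, mem_ofPred_eq, not_exists, not_and, not_le] at hs
  have := pow_lt_pow_left₀ (hs i i.2) (by linarith) two_ne_zero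
  rw [sq_abs] at this
  change (2 * P.width n) ^ 2 ≤ (p.1 0 - P.innerRadius - P.center n i) ^ 2 +
    ((p.1 1 / P.angleStep n - (2 * (j : ℕ) + 1)) / n) ^ 2
  nlinarith [sq_nonneg ((p.1 1 / P.angleStep n - (2 * (j : ℕ) + 1)) / n)]

omit [NeZero n] in
-- This is an open ellipse. Convexity is wanted because it implies that the boundary is a null set.
theorem convex_compl_outside (i j : ℕ) : Convex ℝ (P.outside n i j)ᶜ := by
  intro x hx y hy a b ha hb hab
  simp only [outside, mem_compl_iff, mem_ofPred_eq, not_le] at hx hy ⊢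
  have key : ∀ X Y : ℝ, (a * X + b * Y) ^ 2 ≤ a * X ^ 2 + b * Y ^ 2 := by
    intro X Y
    have : a * X ^ 2 + b * Y ^ 2 - (a * X + b * Y) ^ 2 = a * b * (X - Y) ^ 2 := by
      rw [show b = 1 - a by linarith]; ring
    nlinarith [mul_nonneg (mul_nonneg ha hb) (sq_nonneg (X - Y))]
  have h0 : (a • x + b • y) 0 - P.innerRadius - P.center n i =
      a * (x 0 - P.innerRadius - P.center n i) + b * (y 0 - P.innerRadius - P.center n i) := by
    simp only [PiLp.add_apply, PiLp.smul_apply, smul_eq_mul]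
    rw [show b = 1 - a by linarith]; ring
  have h1 : ((a • x + b • y) 1 / P.angleStep n - (2 * j + 1)) / n =
      a * ((x 1 / P.angleStep n - (2 * j + 1)) / n) +
      b * ((y 1 / P.angleStep n - (2 * j + 1)) / n) := by
    simp only [PiLp.add_apply, PiLp.smul_apply, smul_eq_mul]
    rw [show b = 1 - a by linarith]; ring
  rw [h0, h1]
  refine (add_le_add (key _ _) (key _ _)).trans_lt ?_
  rcases ha.eq_or_lt with rfl | ha
  · rw [show b = 1 by linarith]; linarith
  · have : (2 * P.width n) ^ 2 = a * (2 * P.width n) ^ 2 + b * (2 * P.width n) ^ 2 := by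
      rw [← add_mul, hab, one_mul]
    rw [this]
    nlinarith

theorem volume_perforatedBox_diff_interior :
    volume (P.perforatedBox n \ interior (P.perforatedBox n)) = 0 := by
  set T := {q : Model 2 | q 0 - P.innerRadius ∈ Icc 0 P.b ∧
    q 1 / P.angleStep n ∈ Icc 0 (2 * n : ℝ)} with hT
  have hTc : Convex ℝ T := by
    have : T = coordBox ![P.innerRadius, 0] ![P.innerRadius + P.b, P.angleStep n * (2 * n)] := by
      ext q; exact P.coords_mem_iff n
    rw [this]; exact convex_coordBox _ _
  have h : P.perforatedBox n = T ∩ ⋂ i : Fin n, ⋂ j : Fin n, P.outside n i j := by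
    ext q; simp [perforatedBox, hT]
  have hsub : P.perforatedBox n \ interior (P.perforatedBox n) ⊆
      frontier T ∪ ⋃ i : Fin n, ⋃ j : Fin n, frontier (P.outside n i j) := by
    rintro q ⟨hq, hq'⟩
    by_contra hcon
    simp only [mem_union, mem_iUnion, not_or, not_exists] at hcon
    refine hq' ?_
    rw [h, interior_inter, interior_iInter_of_finite]
    simp_rw [interior_iInter_of_finite]
    refine ⟨?_, mem_iInter.2 fun i ↦ mem_iInter.2 fun j ↦ ?_⟩
    · by_contra h1
      exact hcon.1 ⟨subset_closure hq.1, h1⟩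
    · by_contra h1
      exact hcon.2 i j ⟨subset_closure (hq.2 i j), h1⟩
  refine measure_mono_null hsub (measure_union_null (hTc.addHaar_frontier _) ?_)
  refine measure_iUnion_null fun i ↦ measure_iUnion_null fun j ↦ ?_
  rw [← frontier_compl]
  exact (P.convex_compl_outside n i j).addHaar_frontier _

/-- `differential` is a derivative within a closed set. It is identified with the ordinary
derivative at interior points, so the boundary has to be discarded in the integrals. -/
theorem ae_mem_interior : ∀ᵐ p ∂(PolarPlane.area.restrict (P.perforatedSector n)),
    p ∈ interior (P.perforatedSector n : Set PolarPlane) := by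
  have hm : MeasurableSet (P.perforatedSector n : Set PolarPlane) :=
    (P.isCompact_perforatedSector n).isClosed.measurableSet
  refine (ae_restrict_iff' hm).2 (ae_iff.2 ?_)
  refine measure_mono_null ?_
    (PolarPlane.area_preimage_eq_zero (P.volume_perforatedBox_diff_interior n))
  intro p hp
  simp only [mem_ofPred_eq, Classical.not_imp] at hp
  refine ⟨(P.mem_perforatedSector_iff n).1 hp.1, fun hi ↦ hp.2 ?_⟩
  have : (P.perforatedSector n : Set PolarPlane) = Subtype.val ⁻¹' (P.perforatedBox n) := by
    ext p; exact P.mem_perforatedSector_iff n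
  rw [this]
  exact preimage_interior_subset_interior_preimage continuous_subtype_val hi

/-- Functions that are bounded, and small outside of the strips, have small integrals. -/
theorem tendsto_lintegral_perforatedSector {p C₁ C₂ : ℝ} (hp : 0 < p)
    (f : ℕ → PolarPlane → ℝ)
    (hf : ∀ᶠ n : ℕ in atTop, ∀ x ∈ P.perforatedSector (n + 1),
      x ∈ interior (P.perforatedSector (n + 1) : Set PolarPlane) →
      0 ≤ f n x ∧ f n x ≤ C₂ ∧ (x ∉ P.strips (n + 1) → f n x ≤ C₁ / (n + 1))) :
    Tendsto (fun n ↦ ∫⁻ x in P.perforatedSector (n + 1), ENNReal.ofReal (f n x ^ p)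
      ∂PolarPlane.area) atTop (𝓝 0) := by
  have hbound : ∀ᶠ n : ℕ in atTop, ∫⁻ x in P.perforatedSector (n + 1), ENNReal.ofReal (f n x ^ p)
      ∂PolarPlane.area ≤ ENNReal.ofReal ((C₁ / (n + 1)) ^ p) * PolarPlane.area P.sector +
        ENNReal.ofReal (C₂ ^ p) * ENNReal.ofReal (P.stripArea / ((n + 1 : ℕ) : ℝ)) := by
    filter_upwards [hf] with n hn
    set A : Set PolarPlane := P.perforatedSector (n + 1) with hA
    have hAm : MeasurableSet A := (P.isCompact_perforatedSector (n + 1)).isClosed.measurableSet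
    have hAs : A ⊆ P.sector := fun x hx ↦ hx.1
    have hae : ∀ᵐ x ∂(PolarPlane.area.restrict A), ENNReal.ofReal (f n x ^ p) ≤
        ENNReal.ofReal ((C₁ / (n + 1)) ^ p) +
          (P.strips (n + 1)).indicator (fun _ ↦ ENNReal.ofReal (C₂ ^ p)) x := by
      filter_upwards [P.ae_mem_interior (n + 1), ae_restrict_mem hAm] with x hx hxA
      obtain ⟨h0, h1, h2⟩ := hn x hxA hx
      by_cases hs : x ∈ P.strips (n + 1)
      · rw [indicator_of_mem hs]
        exact le_add_left (ENNReal.ofReal_le_ofReal (Real.rpow_le_rpow h0 h1 hp.le))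
      · exact le_add_right (ENNReal.ofReal_le_ofReal (Real.rpow_le_rpow h0 (h2 hs) hp.le))
    refine (lintegral_mono_ae hae).trans ?_
    rw [lintegral_add_left measurable_const, lintegral_const, Measure.restrict_apply_univ]
    refine add_le_add (mul_le_mul_right (measure_mono hAs) _) ?_
    refine (lintegral_indicator_const_le _ _).trans ?_
    refine mul_le_mul_right ?_ _
    rw [Measure.restrict_apply' hAm]
    exact (measure_mono (inter_subset_inter_right _ hAs)).trans
      (P.area_strips_inter_sector_le (n + 1))
  refine tendsto_of_tendsto_of_tendsto_of_le_of_le' tendsto_const_nhds ?_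
    (Eventually.of_forall fun _ ↦ zero_le) hbound
  have h1 : Tendsto (fun n : ℕ ↦ ENNReal.ofReal ((C₁ / (n + 1)) ^ p)) atTop (𝓝 0) := by
    have : Tendsto (fun n : ℕ ↦ C₁ / ((n : ℝ) + 1)) atTop (𝓝 0) := by
      have := (tendsto_one_div_add_atTop_nhds_zero_nat (𝕜 := ℝ)).const_mul C₁
      simpa [div_eq_mul_inv] using this
    have := ENNReal.tendsto_ofReal (this.rpow_const (p := p) (Or.inr hp.le))
    simpa [Real.zero_rpow hp.ne'] using this
  have h2 : Tendsto (fun n : ℕ ↦ ENNReal.ofReal (P.stripArea / ((n + 1 : ℕ) : ℝ))) atTop (𝓝 0) := by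
    have := (tendsto_one_div_add_atTop_nhds_zero_nat (𝕜 := ℝ)).const_mul P.stripArea
    simpa [div_eq_mul_inv] using ENNReal.tendsto_ofReal this
  have := (ENNReal.Tendsto.mul_const h1 (Or.inr P.area_sector_ne_top)).add
    (ENNReal.Tendsto.const_mul h2 (Or.inr (ENNReal.ofReal_ne_top (r := C₂ ^ p))))
  simpa using this

theorem tendsto_area_sector_diff : Tendsto
    (fun n ↦ PolarPlane.area (P.sector \ P.perforatedSector (n + 1))) atTop (𝓝 0) := by
  have h2 : Tendsto (fun n : ℕ ↦ ENNReal.ofReal (P.stripArea / ((n + 1 : ℕ) : ℝ))) atTop (𝓝 0) := by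
    have := (tendsto_one_div_add_atTop_nhds_zero_nat (𝕜 := ℝ)).const_mul P.stripArea
    simpa [div_eq_mul_inv] using ENNReal.tendsto_ofReal this
  exact tendsto_of_tendsto_of_tendsto_of_le_of_le tendsto_const_nhds h2 (fun _ ↦ zero_le)
    fun n ↦ (measure_mono (P.sector_diff_subset (n + 1))).trans
      (P.area_strips_inter_sector_le (n + 1))

end DislocationData

/-- The linear map `(v₀, v₁) ↦ (v₀, α v₀ + β v₁)`. -/
def slant (α β : ℝ) : Model 2 →L[ℝ] Model 2 :=
  (EuclideanSpace.proj 0 : Model 2 →L[ℝ] ℝ).smulRight !₂[1, α] +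
    (EuclideanSpace.proj 1 : Model 2 →L[ℝ] ℝ).smulRight !₂[0, β]

theorem slant_apply (α β : ℝ) (v : Model 2) : slant α β v = !₂[v 0, α * v 0 + β * v 1] := by
  ext i; fin_cases i <;> simp [slant, mul_comm]

theorem det_slant (α β : ℝ) : (slant α β).det = β := by
  change LinearMap.det (slant α β : Model 2 →ₗ[ℝ] Model 2) = β
  rw [← LinearMap.det_toMatrix (EuclideanSpace.basisFun (Fin 2) ℝ).toBasis, Matrix.det_fin_two]
  simp [LinearMap.toMatrix_apply, slant_apply]

theorem slant_inverse {α β : ℝ} (hβ : β ≠ 0) : (slant α β).inverse = slant (-α / β) β⁻¹ := by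
  refine ContinuousLinearMap.inverse_eq ?_ ?_
  · refine ContinuousLinearMap.ext fun v ↦ ?_
    simp only [ContinuousLinearMap.comp_apply, slant_apply]
    ext i; fin_cases i
    · simp
    · simp; field_simp; ring
  · refine ContinuousLinearMap.ext fun v ↦ ?_
    simp only [ContinuousLinearMap.comp_apply, slant_apply]
    ext i; fin_cases i
    · simp
    · simp; field_simp; ring

theorem norm_vec (x y : ℝ) : ‖(!₂[x, y] : Model 2)‖ = √(x ^ 2 + y ^ 2) := by
  simp [EuclideanSpace.norm_eq]

theorem abs_le_norm_vec_left (x y : ℝ) : |x| ≤ ‖(!₂[x, y] : Model 2)‖ := by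
  rw [norm_vec]; exact Real.abs_le_sqrt (by nlinarith [sq_nonneg y])

theorem abs_le_norm_vec_right (x y : ℝ) : |y| ≤ ‖(!₂[x, y] : Model 2)‖ := by
  rw [norm_vec]; exact Real.abs_le_sqrt (by nlinarith [sq_nonneg x])

theorem norm_vec_zero_left (y : ℝ) : ‖(!₂[0, y] : Model 2)‖ = |y| := by
  rw [norm_vec]; simp [Real.sqrt_sq_eq_abs]

/-- The frame field `(∂_r, r⁻¹ ∂_φ)` on the Weitzenböck manifold. -/
def PolarPlane.parallelFrame (i : Fin 2) : VField 2 PolarPlane.weitzenbock.carrier :=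
  PolarPlane.frame.field i

/-! ### The differential of the map, compared with rotations and frames -/

namespace DislocationData

variable (P : DislocationData) (n : ℕ) [NeZero n]

/-- The flat coordinate vector fields on the surface. -/
def flatFrame (i : Fin 2) : VField 2 (P.surface n).carrier :=
  (FrameField.standard 2 (P.Surface n)).field i

theorem norm_surface (x : (P.surface n).carrier) (v : TangentSpace (𝓡 2) x) :
    ‖v‖ = ‖(show Model 2 from v)‖ :=
  WeitzenbockManifold.norm_ofFrame (Surface.isTranslationAtlas P n)
    (FrameField.standard 2 (P.Surface n)) x v

omit [NeZero n] in
theorem hasFDerivAt_toFlat (j : ℤ) (q : Model 2) : HasFDerivAt (P.toFlat n j)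
    (slant ((q 1 / P.angleStep n - 2 * j) * deriv (P.smoothHeight n) (q 0 - P.innerRadius))
      (P.smoothHeight n (q 0 - P.innerRadius) / P.angleStep n)) q := by
  have h0 : HasFDerivAt (fun q : Model 2 ↦ q 0) (EuclideanSpace.proj 0 : Model 2 →L[ℝ] ℝ) q :=
    (EuclideanSpace.proj 0 : Model 2 →L[ℝ] ℝ).hasFDerivAt
  have h1 : HasFDerivAt (fun q : Model 2 ↦ q 1) (EuclideanSpace.proj 1 : Model 2 →L[ℝ] ℝ) q :=
    (EuclideanSpace.proj 1 : Model 2 →L[ℝ] ℝ).hasFDerivAt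
  have hs : HasDerivAt (P.smoothHeight n) (deriv (P.smoothHeight n) (q 0 - P.innerRadius))
      (q 0 - P.innerRadius) :=
    ((P.contDiff_smoothHeight n).differentiable (by simp)).differentiableAt.hasDerivAt
  have h2 := hs.comp_hasFDerivAt q (h0.sub_const P.innerRadius)
  have h3 := (((h1.mul_const (P.angleStep n)⁻¹).sub_const (2 * (j : ℝ))).mul h2)
  refine (hasFDerivWithinAt_univ.1 ((hasFDerivWithinAt_euclidean (𝕜 := ℝ)).2 fun i ↦
    hasFDerivWithinAt_univ.2 ?_))
  fin_cases i
  · refine (h0.sub_const P.innerRadius).congr_fderiv ?_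
    refine ContinuousLinearMap.ext fun v ↦ ?_
    simp [slant_apply]
  · refine h3.congr_fderiv ?_
    refine ContinuousLinearMap.ext fun v ↦ ?_
    simp [slant_apply]
    ring

variable {P n}

theorem le_smoothHeight_div (x : ℝ) : P.innerRadius ≤ P.smoothHeight n x / P.angleStep n := by
  have hn := cast_pos' n
  have hb := P.b_pos
  have hε := P.ε_pos
  rw [le_div_iff₀ (P.angleStep_pos n)]
  refine le_trans (le_of_eq ?_) (P.le_smoothHeight n x)
  rw [innerRadius, angleStep]; field_simp

/-- The deviation ε_n/2 of the height from the line, divided by the angle κ per half row, is b/n. -/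
theorem IsFine.abs_smoothHeight_div_sub_le (hf : P.IsFine n) {x : ℝ} (hx : x ∈ Icc 0 P.b) :
    |P.smoothHeight n x / P.angleStep n - (P.innerRadius + x)| ≤ P.b / n := by
  have hn := cast_pos' n
  have hb := P.b_pos
  have hε := P.ε_pos
  have hκ := P.angleStep_pos n
  have h := IsFine.abs_smoothHeight_sub_le P hf hx
  have h1 : P.smoothHeight n x / P.angleStep n - (P.innerRadius + x) =
      (P.smoothHeight n x - P.angleStep n * (P.innerRadius + x)) / P.angleStep n := by
    field_simp
  rw [h1, abs_div, abs_of_pos hκ, div_le_iff₀ hκ]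
  refine h.trans (le_of_eq ?_)
  rw [εBlock, angleStep]; field_simp

/-- In the coordinates, the differential of `unrollMap` is close to `diag(1, r)`. -/
theorem IsFine.exists_differential_eq (hf : P.IsFine n) {p : PolarPlane}
    (hp : p ∈ P.perforatedSector n) (hi : p ∈ interior (P.perforatedSector n : Set PolarPlane)) :
    ∃ α β : ℝ, (differential PolarPlane.weitzenbock (P.surface n) (P.unrollMap n)
        (P.perforatedSector n) p : Model 2 →L[ℝ] Model 2) = slant α β ∧ P.innerRadius ≤ β ∧
      |β - p.1 0| ≤ P.b / n ∧ |α| ≤ P.heightSlope ∧ (p ∉ P.strips n → α = 0) := by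
  obtain ⟨j, hj⟩ := exists_polarDomain_of_mem hp
  have hx := ((P.mem_sector_iff n).1 hp.1).1
  refine ⟨(p.1 1 / P.angleStep n - 2 * j) * deriv (P.smoothHeight n) (p.1 0 - P.innerRadius),
    P.smoothHeight n (p.1 0 - P.innerRadius) / P.angleStep n, ?_, le_smoothHeight_div _, ?_, ?_, ?_⟩
  · have h1 := (hasMFDerivAt_unrollMap hj).mfderiv
    replace h1 := h1.trans (P.hasFDerivAt_toFlat n j p.1).fderiv
    have h2 : mfderivWithin (𝓡 2) (𝓡 2) (P.unrollMap n) (P.perforatedSector n : Set PolarPlane) p =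
        mfderiv (𝓡 2) (𝓡 2) (P.unrollMap n) p :=
      mfderivWithin_of_mem_nhds (mem_interior_iff_mem_nhds.1 hi)
    exact h2.trans h1
  · have := hf.abs_smoothHeight_div_sub_le hx
    rwa [add_sub_cancel] at this
  · rcases hj with hj | hj
    · rw [abs_mul]
      have h := IsFine.abs_deriv_smoothHeight_le P hf (p.1 0 - P.innerRadius)
      nlinarith [abs_nonneg (p.1 1 / P.angleStep n - 2 * j),
        abs_nonneg (deriv (P.smoothHeight n) (p.1 0 - P.innerRadius))]
    -- In this part of the domain the height above the bottom side of the row may exceed one half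
    -- row, but h′ = 0.
    · have hw := P.width_pos n
      rw [P.deriv_smoothHeight_eq_zero n fun i hi h ↦ hj.2 i hi ⟨by linarith [h.1], h.2.le⟩]
      simp [P.heightSlope_nonneg]
  · intro hs
    rw [P.deriv_smoothHeight_eq_zero n, mul_zero]
    intro i hi h
    have hw := P.width_pos n
    exact hs ⟨i, hi, abs_le.2 ⟨by linarith [h.1], by linarith [h.2]⟩⟩

/-- The differential is compared with diag(1, r), which is an isometry from dr²+r²dφ² to the
Euclidean metric and has positive determinant. -/
theorem infDist_rotations_le {p : PolarPlane.weitzenbock.carrier} {y : (P.surface n).carrier} {α β : ℝ}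
    {D : TangentSpace (𝓡 2) p →L[ℝ]
      TangentSpace (𝓡 2) y}
    (hD : (D : Model 2 →L[ℝ] Model 2) = slant α β) :
    Metric.infDist D (rotations PolarPlane.weitzenbock (P.surface n) p y) ≤
      |α| + |β - PolarPlane.radius p| / PolarPlane.radius p := by
  have hr : 0 < PolarPlane.radius p := (show PolarPlane from p).2
  set R : TangentSpace (𝓡 2) p →L[ℝ]
      TangentSpace (𝓡 2) y := slant 0 (PolarPlane.radius p) with hR
  have hmem : R ∈ rotations PolarPlane.weitzenbock (P.surface n) p y := by
    refine ⟨fun v ↦ ?_, (det_slant 0 (PolarPlane.radius p)).symm ▸ hr⟩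
    rw [PolarPlane.norm_eq p v]
    refine (P.norm_surface n _ _).trans ?_
    refine (congrArg (fun a : Model 2 ↦ ‖a‖) (slant_apply 0 (PolarPlane.radius p) v)).trans ?_
    rw [zero_mul, zero_add]; rfl
  refine (Metric.infDist_le_dist_of_mem hmem).trans ?_
  refine (le_of_eq (dist_eq_norm D R)).trans ?_
  refine ContinuousLinearMap.opNorm_le_bound _ (by positivity) fun v ↦ ?_
  have h1 : (D - R) v = (show Model 2 from !₂[0, α * PolarPlane.dr p v +
      (β - PolarPlane.radius p) / PolarPlane.radius p * (PolarPlane.radius p * PolarPlane.dphi p v)]) := by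
    have : (D - R) v = (show Model 2 from (slant α β v - slant 0 (PolarPlane.radius p) v : Model 2)) :=
      congrArg (fun A : Model 2 →L[ℝ] Model 2 ↦ (A v - slant 0 (PolarPlane.radius p) v : Model 2)) hD
    refine this.trans ?_
    have gen : ∀ v : Model 2, slant α β v - slant 0 (PolarPlane.radius p) v =
        !₂[0, α * v 0 + (β - PolarPlane.radius p) / PolarPlane.radius p * (PolarPlane.radius p * v 1)] := by
      intro v
      rw [slant_apply, slant_apply]
      ext i; fin_cases i
      · simp
      · simp; field_simp; ring
    exact gen v
  rw [h1]
  refine (le_of_eq ((P.norm_surface n _ _).trans (norm_vec_zero_left _))).trans ?_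
  rw [PolarPlane.norm_eq p v]
  have h2 := abs_le_norm_vec_left (PolarPlane.dr p v) (PolarPlane.radius p * PolarPlane.dphi p v)
  have h3 := abs_le_norm_vec_right (PolarPlane.dr p v) (PolarPlane.radius p * PolarPlane.dphi p v)
  refine (abs_add_le _ _).trans ?_
  rw [abs_mul, abs_mul, abs_div, abs_of_pos hr, add_mul]
  gcongr

/-- The pull-backs of the flat frame are ∂_r − (α/β)∂_φ and β⁻¹∂_φ, and ∂_φ has length `r`. -/
theorem sum_norm_inverse_sub_le {p : PolarPlane.weitzenbock.carrier} {y : (P.surface n).carrier} {α β : ℝ} (hβ : 0 < β)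
    {D : TangentSpace (𝓡 2) p →L[ℝ]
      TangentSpace (𝓡 2) y}
    (hD : (D : Model 2 →L[ℝ] Model 2) = slant α β) :
    ∑ i, ‖(D.inverse (P.flatFrame n i y) -
      PolarPlane.parallelFrame i p : TangentSpace (𝓡 2) p)‖ ≤
      PolarPlane.radius p / β * |α| + |β - PolarPlane.radius p| / β := by
  have hr : 0 < PolarPlane.radius p := (show PolarPlane from p).2
  have hinv : (D.inverse : Model 2 →L[ℝ] Model 2) = slant (-α / β) β⁻¹ :=
    (congrArg ContinuousLinearMap.inverse hD).trans (slant_inverse hβ.ne')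
  have hcomp : ∀ i, (D.inverse (P.flatFrame n i y) -
      PolarPlane.parallelFrame i p : TangentSpace (𝓡 2) p) =
      (show Model 2 from (slant (-α / β) β⁻¹ (EuclideanSpace.single i 1) -
        !₂[(EuclideanSpace.single i (1 : ℝ) : Model 2) 0,
          (PolarPlane.radius p)⁻¹ * (EuclideanSpace.single i (1 : ℝ) : Model 2) 1] : Model 2)) := fun i ↦
    congrArg₂ (fun (A : Model 2 →L[ℝ] Model 2) (e : Model 2) ↦ A (EuclideanSpace.single i 1) - e)
      hinv (PolarPlane.frame_toFun_apply p _)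
  have h0 : (slant (-α / β) β⁻¹ (EuclideanSpace.single 0 1) -
        !₂[(EuclideanSpace.single 0 (1 : ℝ) : Model 2) 0,
          (PolarPlane.radius p)⁻¹ * (EuclideanSpace.single 0 (1 : ℝ) : Model 2) 1] : Model 2) = !₂[0, -α / β] := by
    rw [slant_apply]; ext i; fin_cases i <;> simp
  have h1 : (slant (-α / β) β⁻¹ (EuclideanSpace.single 1 1) -
        !₂[(EuclideanSpace.single 1 (1 : ℝ) : Model 2) 0,
          (PolarPlane.radius p)⁻¹ * (EuclideanSpace.single 1 (1 : ℝ) : Model 2) 1] : Model 2) =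
        !₂[0, β⁻¹ - (PolarPlane.radius p)⁻¹] := by
    rw [slant_apply]; ext i; fin_cases i <;> simp
  have hn : ∀ y : ℝ, ‖(show TangentSpace (𝓡 2) p from
      (!₂[0, y] : Model 2))‖ = PolarPlane.radius p * |y| := by
    intro y
    refine (PolarPlane.norm_eq p _).trans ?_
    refine (norm_vec_zero_left _).trans ?_
    rw [abs_mul]
    exact congrArg (· * _) (abs_of_pos hr)
  rw [Fin.sum_univ_two, hcomp, hcomp]
  refine (congrArg₂ (fun a b : Model 2 ↦
    ‖(show TangentSpace (𝓡 2) p from a)‖ +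
    ‖(show TangentSpace (𝓡 2) p from b)‖) h0 h1).trans_le ?_
  refine (congrArg₂ (· + ·) (hn (-α / β)) (hn (β⁻¹ - (PolarPlane.radius p)⁻¹))).trans_le ?_
  refine add_le_add (le_of_eq ?_) (le_of_eq ?_)
  · rw [abs_div, abs_neg, abs_of_pos hβ]; ring
  · have : β⁻¹ - (PolarPlane.radius p)⁻¹ = -(β - PolarPlane.radius p) / (β * PolarPlane.radius p) := by field_simp; ring
    rw [this, abs_div, abs_neg, abs_of_pos (mul_pos hβ hr)]; field_simp

end DislocationData

/-! ### Paths cut into pieces of equal length -/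

section IntrinsicDistance

variable {d : ℕ} {W : WeitzenbockManifold d} {K : Set W.carrier}

theorem intrinsicEDist_le_of_norm_mfderiv_path_le {γ : ℝ → W.carrier} {ℓ : ℝ}
    (hγ : ∀ s ∈ Icc (0 : ℝ) 1, ContMDiffAt 𝓘(ℝ) (𝓡 d) 1 γ s) (hK : MapsTo γ (Icc 0 1) K)
    (hb : ∀ s ∈ Icc (0 : ℝ) 1, ‖mfderiv 𝓘(ℝ) (𝓡 d) γ s (1 : ℝ)‖ ≤ ℓ) :
    intrinsicEDist W K (γ 0) (γ 1) ≤ ENNReal.ofReal ℓ := by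
  refine (intrinsicEDist_le_pathELength (fun s hs ↦ (hγ s hs).contMDiffWithinAt) hK rfl rfl).trans ?_
  rw [pathELength_eq_lintegral_mfderiv_Icc]
  refine (setLIntegral_mono' (g := fun _ ↦ ENNReal.ofReal ℓ) measurableSet_Icc fun s hs ↦ ?_).trans ?_
  · rw [← ofReal_norm]
    exact ENNReal.ofReal_le_ofReal (hb s hs)
  · simp

theorem intrinsicEDist_le_pathELength_Icc {γ : ℝ → W.carrier} {a b : ℝ} (hab : a ≤ b)
    (hγ : ContMDiffOn 𝓘(ℝ) (𝓡 d) 1 γ (Icc a b)) (hK : MapsTo γ (Icc a b) K) :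
    intrinsicEDist W K (γ a) (γ b) ≤ pathELength (𝓡 d) γ a b := by
  let η : ℝ → ℝ := fun t ↦ a + t * (b - a)
  have hm : MapsTo η (Icc 0 1) (Icc a b) := fun t ht ↦
    ⟨by simp only [η]; nlinarith [ht.1], by simp only [η]; nlinarith [ht.2]⟩
  have hη : ContMDiffOn 𝓘(ℝ) (𝓡 d) 1 (γ ∘ η) (Icc 0 1) := by
    refine hγ.comp ?_ hm
    rw [contMDiffOn_iff_contDiffOn]
    fun_prop
  have h0 : η 0 = a := by simp [η]
  have h1 : η 1 = b := by simp [η]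
  refine (intrinsicEDist_le_pathELength hη (hK.comp hm) (congrArg γ h0) (congrArg γ h1)).trans ?_
  rw [pathELength_comp_of_monotoneOn zero_le_one
    (fun s _ t _ hst ↦ by simp only [η]; nlinarith) (by fun_prop)
    (by rw [h0, h1]; exact hγ.mdifferentiableOn one_ne_zero), h0, h1]

/-- A path can be cut into pieces of equal length. -/
theorem exists_chain_of_intrinsicEDist_lt {x y : W.carrier} {r : ℝ}
    (h : intrinsicEDist W K x y < ENNReal.ofReal r) {m : ℕ} (hm : 0 < m) :
    ∃ z : ℕ → W.carrier, z 0 = x ∧ z m = y ∧ (∀ k ≤ m, z k ∈ K) ∧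
      ∀ k < m, intrinsicEDist W K (z k) (z (k + 1)) < ENNReal.ofReal (r / m) := by
  obtain ⟨γ, hγ, hK, h0, h1, hl⟩ := exists_of_intrinsicEDist_lt h
  have hr : 0 < r := by
    by_contra hr
    rw [ENNReal.ofReal_of_nonpos (not_lt.1 hr)] at hl
    exact not_lt_zero hl
  have hfin : ∀ {a b : ℝ}, 0 ≤ a → b ≤ 1 → pathELength (𝓡 d) γ a b ≠ ⊤ := fun ha hb ↦
    ((pathELength_mono ha hb).trans_lt (hl.trans ENNReal.ofReal_lt_top)).ne
  set g : ℝ → ℝ := fun t ↦ (pathELength (𝓡 d) γ 0 t).toReal with hg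
  have hadd : ∀ {s t : ℝ}, 0 ≤ s → s ≤ t → t ≤ 1 →
      g t - g s = (pathELength (𝓡 d) γ s t).toReal := by
    intro s t hs hst ht
    rw [hg]
    simp only
    rw [← pathELength_add hs hst, ENNReal.toReal_add (hfin le_rfl (hst.trans ht)) (hfin hs ht)]
    ring
  have hg0 : g 0 = 0 := by simp [hg]
  have hg1 : g 1 < r := by
    have := (ENNReal.toReal_lt_toReal (hfin le_rfl le_rfl) ENNReal.ofReal_ne_top).2 hl
    rwa [ENNReal.toReal_ofReal hr.le] at this
  -- Arc length is continuous because the integral of the speed is absolutely continuous.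
  have hcont : ContinuousOn g (Icc 0 1) := by
    rw [Metric.continuousOn_iff]
    intro t ht ε hε
    have hint := hfin (le_refl (0 : ℝ)) (le_refl (1 : ℝ))
    rw [pathELength_eq_lintegral_mfderiv_Icc] at hint
    obtain ⟨δ, hδ, hδ'⟩ := exists_pos_setLIntegral_lt_of_measure_lt hint
      (ENNReal.ofReal_pos.2 hε).ne'
    obtain ⟨δ', hδ'0, hδ'1⟩ : ∃ δ' : ℝ, 0 < δ' ∧ ENNReal.ofReal δ' < δ := by
      obtain ⟨c, hc0, hc⟩ := ENNReal.lt_iff_exists_real_btwn.1 hδ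
      exact ⟨c, ENNReal.ofReal_pos.1 hc.1, hc.2⟩
    have key : ∀ a ∈ Icc (0 : ℝ) 1, ∀ b ∈ Icc (0 : ℝ) 1, a ≤ b → b - a < δ' → g b - g a < ε := by
      intro a ha b hb hab hd
      rw [hadd ha.1 hab hb.2]
      have h2 := hδ' (Icc a b) (by
        refine lt_of_le_of_lt (Measure.restrict_apply_le _ _) ?_
        rw [Real.volume_Icc]
        exact lt_of_le_of_lt (ENNReal.ofReal_le_ofReal hd.le) hδ'1)
      rw [Measure.restrict_restrict measurableSet_Icc,
        inter_eq_left.2 (Icc_subset_Icc ha.1 hb.2), ← pathELength_eq_lintegral_mfderiv_Icc] at h2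
      exact (ENNReal.toReal_lt_of_lt_ofReal h2)
    have hmono : ∀ a ∈ Icc (0 : ℝ) 1, ∀ b ∈ Icc (0 : ℝ) 1, a ≤ b → 0 ≤ g b - g a := by
      intro a ha b hb hab
      rw [hadd ha.1 hab hb.2]; exact ENNReal.toReal_nonneg
    refine ⟨δ', hδ'0, fun s hs hst ↦ ?_⟩
    rw [Real.dist_eq, abs_lt] at hst
    rw [Real.dist_eq, abs_lt]
    rcases le_total s t with h | h
    · have := key s hs t ht h (by linarith); have := hmono s hs t ht h
      exact ⟨by linarith, by linarith⟩
    · have := key t ht s hs h (by linarith); have := hmono t ht s hs h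
      exact ⟨by linarith, by linarith⟩
  have hm0 : (0 : ℝ) < m := by exact_mod_cast hm
  have hg10 : 0 ≤ g 1 := ENNReal.toReal_nonneg
  -- The intermediate value theorem provides times at which `k` of `m` equal parts have been
  -- traversed. They are not claimed to be increasing in `k`.
  have hivt : ∀ k : ℕ, ∃ t ∈ Icc (0 : ℝ) 1, k ≤ m → g t = k * (g 1 / m) := by
    intro k
    by_cases hk : k ≤ m
    · have hk' : (k : ℝ) ≤ m := by exact_mod_cast hk
      have hmem : k * (g 1 / m) ∈ Icc (g 0) (g 1) := by
        refine ⟨by rw [hg0]; positivity, ?_⟩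
        rw [← mul_div_assoc, div_le_iff₀ hm0]
        nlinarith
      obtain ⟨t, ht, hgt⟩ := intermediate_value_Icc zero_le_one hcont hmem
      exact ⟨t, ht, fun _ ↦ hgt⟩
    · exact ⟨0, by simp, fun h ↦ absurd h hk⟩
  choose τ hτ hτg using hivt
  -- The first and the last time are replaced by 0 and 1, so that the chain ends at the prescribed
  -- points and not only at points with the right arc length.
  set σ : ℕ → ℝ := fun k ↦ if k = 0 then 0 else if k = m then 1 else τ k with hσ
  have hσm : ∀ k, σ k ∈ Icc (0 : ℝ) 1 := by
    intro k
    simp only [hσ]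
    split_ifs
    · simp
    · simp
    · exact hτ k
  have hσg : ∀ k ≤ m, g (σ k) = k * (g 1 / m) := by
    intro k hk
    simp only [hσ]
    split_ifs with h h'
    · rw [h, hg0]; simp
    · rw [h']; field_simp
    · exact hτg k hk
  have hdist : ∀ s ∈ Icc (0 : ℝ) 1, ∀ t ∈ Icc (0 : ℝ) 1, s ≤ t →
      intrinsicEDist W K (γ s) (γ t) ≤ ENNReal.ofReal (g t - g s) := by
    intro s hs t ht hst
    rw [hadd hs.1 hst ht.2, ENNReal.ofReal_toReal (hfin hs.1 ht.2)]
    exact intrinsicEDist_le_pathELength_Icc hst (hγ.mono (Icc_subset_Icc hs.1 ht.2))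
      (hK.mono_left (Icc_subset_Icc hs.1 ht.2))
  refine ⟨fun k ↦ γ (σ k), ?_, ?_, fun k _ ↦ hK (hσm k), fun k hk ↦ ?_⟩
  · simp [hσ, h0]
  · simp [hσ, hm.ne', h1]
  · have e1 := hσg k hk.le
    have e2 := hσg (k + 1) hk
    push_cast at e2
    have hlt : g 1 / m < r / m := by gcongr
    have hpos : 0 < r / m := by positivity
    rcases le_total (σ k) (σ (k + 1)) with h | h
    · refine (hdist _ (hσm k) _ (hσm (k + 1)) h).trans_lt ?_
      rw [ENNReal.ofReal_lt_ofReal_iff hpos]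
      linarith
    -- If the two times are in the wrong order, monotonicity of arc length bounds the distance by
    -- `ENNReal.ofReal` of a nonpositive number.
    · rw [intrinsicEDist_comm]
      refine (hdist _ (hσm (k + 1)) _ (hσm k) h).trans_lt ?_
      rw [ENNReal.ofReal_lt_ofReal_iff hpos]
      have : 0 ≤ g 1 / m := by positivity
      linarith

/-- A local estimate of distances gives a global one. -/
theorem intrinsicEDist_le_of_local {W' : WeitzenbockManifold d} {K' : Set W'.carrier}
    {S : W.carrier → W'.carrier} {x y : W.carrier} {r δ : ℝ} {m : ℕ} (hm : 0 < m) (hδ : 0 ≤ δ)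
    (h : intrinsicEDist W K x y < ENNReal.ofReal r)
    (hloc : ∀ z ∈ K, ∀ z' ∈ K, intrinsicEDist W K z z' < ENNReal.ofReal (r / m) →
      intrinsicEDist W' K' (S z) (S z') ≤ ENNReal.ofReal δ) :
    intrinsicEDist W' K' (S x) (S y) ≤ ENNReal.ofReal (m * δ) := by
  obtain ⟨z, rfl, rfl, hzK, hz⟩ := exists_chain_of_intrinsicEDist_lt h hm
  have : ∀ k < m, intrinsicEDist W' K' (S (z 0)) (S (z (k + 1))) ≤
      ENNReal.ofReal (((k + 1 : ℕ) : ℝ) * δ) := by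
    intro k
    induction k with
    | zero => intro hk; simpa using hloc _ (hzK _ hk.le) _ (hzK _ hk) (hz 0 hk)
    | succ k ih =>
      intro hk
      refine (intrinsicEDist_triangle _ (S (z (k + 1))) _).trans ?_
      refine (add_le_add (ih (by omega)) (hloc _ (hzK _ hk.le) _ (hzK _ hk) (hz _ hk))).trans ?_
      rw [← ENNReal.ofReal_add (by positivity) hδ]
      refine ENNReal.ofReal_le_ofReal (le_of_eq ?_)
      push_cast; ring
  obtain ⟨k, rfl⟩ : ∃ k, m = k + 1 := ⟨m - 1, by omega⟩
  exact this k (Nat.lt_succ_self k)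

end IntrinsicDistance

/-! ### Lengths of paths in the sector -/

namespace PolarPlane

/-- The pair of polar coordinates of a point of the Weitzenböck manifold. -/
def coords (x : weitzenbock.carrier) : Model 2 := (show PolarPlane from x).1

/-- Where `r ≥ m`, the metric dr²+r²dφ² dominates the flat metric dr²+m²dφ², for which straight
segments are shortest. -/
theorem norm_slant_le_pathELength {γ : ℝ → weitzenbock.carrier} {a b m : ℝ} (hab : a ≤ b)
    (hγ : ContMDiffOn 𝓘(ℝ) (𝓡 2) 1 γ (Icc a b)) (hm0 : 0 ≤ m)
    (hm : ∀ t ∈ Icc a b, m ≤ radius (γ t)) :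
    ENNReal.ofReal ‖slant 0 m (coords (γ b) - coords (γ a))‖ ≤ pathELength (𝓡 2) γ a b := by
  have := isTranslationAtlas.isManifold
  have hchart : ContMDiff (𝓡 2) (𝓡 2) 1 coords := by
    have h : ContMDiff (𝓡 2) (𝓡 2) 1 (Subtype.val : PolarPlane → Model 2) :=
      contMDiff_isOpenEmbedding isOpenEmbedding_val
    exact h
  have hc : ContDiffOn ℝ 1 (fun t ↦ coords (γ t)) (Icc a b) :=
    contMDiffOn_iff_contDiffOn.1 (hchart.comp_contMDiffOn hγ)
  have hc' : ContDiffOn ℝ 1 (fun t ↦ slant 0 m (coords (γ t))) (Icc a b) :=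
    (slant 0 m).contDiff.comp_contDiffOn hc
  have h1 := enorm_sub_le_lintegral_deriv_of_contDiffOn_Icc hc' hab
  rw [← map_sub, ← ofReal_norm] at h1
  refine h1.trans ?_
  rw [pathELength_eq_lintegral_mfderiv_Ioo, ← restrict_Ioo_eq_restrict_Icc]
  refine setLIntegral_mono' measurableSet_Ioo fun t ht ↦ ?_
  have hd : MDifferentiableAt 𝓘(ℝ) (𝓡 2) γ t :=
    ((hγ t (Ioo_subset_Icc_self ht)).contMDiffAt (Icc_mem_nhds ht.1 ht.2)).mdifferentiableAt
      one_ne_zero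
  have h2 : HasMFDerivAt (𝓡 2) (𝓡 2) coords (γ t) (ContinuousLinearMap.id ℝ (Model 2)) :=
    isTranslationAtlas.hasMFDerivAt_chart chart_mem_atlas (mem_univ _)
  have h3 : HasFDerivAt (E := ℝ) (F := Model 2) (fun t ↦ coords (γ t))
      (show ℝ →L[ℝ] Model 2 from mfderiv 𝓘(ℝ) (𝓡 2) γ t) t :=
    (h2.comp t hd.hasMFDerivAt).hasFDerivAt
  have h4 : deriv (fun t ↦ slant 0 m (coords (γ t))) t =
      slant 0 m (show Model 2 from mfderiv 𝓘(ℝ) (𝓡 2) γ t (1 : ℝ)) :=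
    ((slant 0 m).hasFDerivAt.comp_hasDerivAt t h3.hasDerivAt).deriv
  rw [h4, ← ofReal_norm, ← ofReal_norm]
  refine ENNReal.ofReal_le_ofReal ?_
  refine le_trans ?_ (norm_eq (γ t) (mfderiv 𝓘(ℝ) (𝓡 2) γ t (1 : ℝ))).ge
  have hr := hm t (Ioo_subset_Icc_self ht)
  have gen : ∀ v : Model 2, ‖slant 0 m v‖ ≤ ‖(!₂[v 0, radius (γ t) * v 1] : Model 2)‖ := by
    intro v
    rw [slant_apply, zero_mul, zero_add, norm_vec, norm_vec]
    refine Real.sqrt_le_sqrt ?_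
    rw [mul_pow, mul_pow]
    gcongr
  exact gen _

end PolarPlane

namespace DislocationData

variable {P : DislocationData}

/-- Short paths in the sector do not change the coordinates much. -/
theorem coords_sub_le_of_intrinsicEDist_lt {x y : PolarPlane.weitzenbock.carrier} {ℓ : ℝ}
    (h : intrinsicEDist PolarPlane.weitzenbock P.sector x y < ENNReal.ofReal ℓ)
    (hℓ : ℓ ≤ PolarPlane.radius x) :
    |PolarPlane.radius y - PolarPlane.radius x| ≤ ℓ ∧
      (PolarPlane.radius y - PolarPlane.radius x) ^ 2 + (PolarPlane.radius x - ℓ) ^ 2 *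
        (PolarPlane.coords y 1 - PolarPlane.coords x 1) ^ 2 ≤ ℓ ^ 2 := by
  obtain ⟨γ, hγ, hK, rfl, rfl, hl⟩ := exists_of_intrinsicEDist_lt h
  have hℓ0 : 0 < ℓ := by
    by_contra hr
    rw [ENNReal.ofReal_of_nonpos (not_lt.1 hr)] at hl
    exact not_lt_zero hl
  have hrad : ∀ t ∈ Icc (0 : ℝ) 1,
      |PolarPlane.radius (γ t) - PolarPlane.radius (γ 0)| ≤ ℓ := by
    intro t ht
    -- With `m = 0` only the radial part of the length is kept; it controls the radius along the
    -- whole path.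
    have h1 := PolarPlane.norm_slant_le_pathELength (m := 0) ht.1
      (hγ.mono (Icc_subset_Icc_right ht.2)) le_rfl fun s _ ↦ (show PolarPlane from γ s).2.le
    have h2 := (h1.trans (pathELength_mono le_rfl ht.2)).trans hl.le
    rw [ENNReal.ofReal_le_ofReal_iff hℓ0.le, slant_apply] at h2
    exact (abs_le_norm_vec_left _ _).trans h2
  refine ⟨hrad 1 (by simp), ?_⟩
  -- The radius never drops below its initial value minus `ℓ`, which is now used as the lower bound.
  have h1 := PolarPlane.norm_slant_le_pathELength (m := PolarPlane.radius (γ 0) - ℓ) zero_le_one hγ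
    (by linarith) fun t ht ↦ by linarith [(abs_le.1 (hrad t ht)).1]
  have h2 := h1.trans hl.le
  rw [ENNReal.ofReal_le_ofReal_iff hℓ0.le, slant_apply, zero_mul, zero_add, norm_vec,
    Real.sqrt_le_left hℓ0.le, mul_pow] at h2
  exact h2

theorem sector_coords_mem {x : PolarPlane.weitzenbock.carrier} (hx : x ∈ P.sector) :
    PolarPlane.radius x ∈ Icc P.innerRadius (P.innerRadius + P.b) ∧
      PolarPlane.coords x 1 ∈ Icc 0 (P.ε / P.b) := hx

/-- The segment in polar coordinates stays in the sector, which is a rectangle there, and a unit of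
angle has length at most R₀ + b. -/
theorem intrinsicEDist_sector_le {x y : PolarPlane.weitzenbock.carrier} (hx : x ∈ P.sector)
    (hy : y ∈ P.sector) : intrinsicEDist PolarPlane.weitzenbock P.sector x y ≤
      ENNReal.ofReal (|PolarPlane.radius y - PolarPlane.radius x| +
        (P.innerRadius + P.b) * |PolarPlane.coords y 1 - PolarPlane.coords x 1|) := by
  have := PolarPlane.isTranslationAtlas.isManifold
  have hR := P.innerRadius_pos
  set v : Model 2 := PolarPlane.coords y - PolarPlane.coords x with hv
  set c : ℝ → Model 2 := fun s ↦ PolarPlane.coords x + s • v with hc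
  have hc0 : c 0 = PolarPlane.coords x := by simp [hc]
  have hc1 : c 1 = PolarPlane.coords y := by simp [hc, hv]
  have hcoord : ∀ s ∈ Icc (0 : ℝ) 1, c s 0 ∈ Icc P.innerRadius (P.innerRadius + P.b) ∧
      c s 1 ∈ Icc 0 (P.ε / P.b) := by
    intro s hs
    have hx' := sector_coords_mem hx
    have hy' := sector_coords_mem hy
    have gen : ∀ i, c s i = (1 - s) * PolarPlane.coords x i + s * PolarPlane.coords y i := by
      intro i
      simp only [hc, hv, PiLp.add_apply, PiLp.smul_apply, PiLp.sub_apply, smul_eq_mul]; ring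
    have conv : ∀ i (l u : ℝ), PolarPlane.coords x i ∈ Icc l u → PolarPlane.coords y i ∈ Icc l u →
        c s i ∈ Icc l u := by
      intro i l u h1 h2
      rw [gen]
      exact ⟨by nlinarith [h1.1, h2.1, hs.1, hs.2], by nlinarith [h1.2, h2.2, hs.1, hs.2]⟩
    exact ⟨conv 0 _ _ hx'.1 hy'.1, conv 1 _ _ hx'.2 hy'.2⟩
  have hcd : ∀ s, HasDerivAt c v s := fun s ↦ by
    have := ((hasDerivAt_id s).smul_const v).const_add (PolarPlane.coords x)
    simpa [hc] using this
  have hcs : ContDiff ℝ 1 c := by fun_prop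
  set γ : ℝ → PolarPlane := fun s ↦ PolarPlane.ofCoords (c s) with hγ
  have hval : ∀ s ∈ Icc (0 : ℝ) 1, (γ s).1 = c s := fun s hs ↦
    PolarPlane.ofCoords_val (by linarith [(hcoord s hs).1.1])
  have hev : ∀ s ∈ Icc (0 : ℝ) 1, ∀ᶠ s' in 𝓝 s, γ s' ∈ PolarPlane.chart.source ∧
      PolarPlane.chart (γ s') = c s' := by
    intro s hs
    have hcont : Continuous fun s ↦ c s 0 := (PiLp.continuous_apply 2 _ 0).comp hcs.continuous
    filter_upwards [(isOpen_lt continuous_const hcont).mem_nhds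
      (show 0 < c s 0 by linarith [(hcoord s hs).1.1])] with s' hs'
    exact ⟨mem_univ _, PolarPlane.ofCoords_val hs'⟩
  have hx0 : γ 0 = x := Subtype.ext ((hval 0 (by simp)).trans hc0)
  have hy1 : γ 1 = y := Subtype.ext ((hval 1 (by simp)).trans hc1)
  have hmain := intrinsicEDist_le_of_norm_mfderiv_path_le (W := PolarPlane.weitzenbock)
    (K := P.sector) (γ := γ) (ℓ := |PolarPlane.radius y - PolarPlane.radius x| +
        (P.innerRadius + P.b) * |PolarPlane.coords y 1 - PolarPlane.coords x 1|)
    (fun s hs ↦ IsTranslationAtlas.contMDiffAt_path PolarPlane.chart_mem_atlas hcs.contDiffAt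
      (hev s hs))
    (fun s hs ↦ by
      have h1 := hcoord s hs
      rw [← hval s hs] at h1
      exact h1)
    (fun s hs ↦ by
      have h1 := PolarPlane.isTranslationAtlas.mfderiv_path PolarPlane.chart_mem_atlas (hcd s)
        (hev s hs)
      refine (PolarPlane.norm_eq (γ s) _).trans_le ?_
      have h2 : PolarPlane.radius (γ s) ≤ P.innerRadius + P.b := by
        have := (hcoord s hs).1.2
        rw [← hval s hs] at this
        exact this
      have h3 : 0 < PolarPlane.radius (γ s) := (γ s).2
      have h4 : ‖(!₂[v 0, PolarPlane.radius (γ s) * v 1] : Model 2)‖ ≤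
          |v 0| + (P.innerRadius + P.b) * |v 1| := by
        rw [norm_vec, ← sq_abs (v 0), ← sq_abs (_ * v 1), abs_mul, abs_of_pos h3]
        refine (Real.sqrt_le_left (by positivity)).2 ?_ |>.trans
          (add_le_add_right (mul_le_mul_of_nonneg_right h2 (abs_nonneg (v 1))) |v 0|)
        nlinarith [mul_nonneg (abs_nonneg (v 0)) (mul_nonneg h3.le (abs_nonneg (v 1)))]
      refine le_trans (le_of_eq ?_) h4
      exact congrArg (fun w : Model 2 ↦ ‖(!₂[w 0, PolarPlane.radius (γ s) * w 1] : Model 2)‖) h1)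
  rw [← hx0, ← hy1] at *
  exact hmain

/-- A bound for the diameter of the sector. -/
def sectorDiam (P : DislocationData) : ℝ := P.b + (P.innerRadius + P.b) * (P.ε / P.b)

theorem sectorDiam_pos : 0 < P.sectorDiam := by
  have := P.b_pos; have := P.ε_pos; have := P.innerRadius_pos
  unfold sectorDiam; positivity

theorem intrinsicEDist_sector_le_sectorDiam {x y : PolarPlane.weitzenbock.carrier}
    (hx : x ∈ P.sector) (hy : y ∈ P.sector) :
    intrinsicEDist PolarPlane.weitzenbock P.sector x y ≤ ENNReal.ofReal P.sectorDiam := by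
  have := P.b_pos; have := P.innerRadius_pos
  refine (intrinsicEDist_sector_le hx hy).trans (ENNReal.ofReal_le_ofReal ?_)
  have hx' := sector_coords_mem hx
  have hy' := sector_coords_mem hy
  refine add_le_add (abs_sub_le_iff.2 ⟨by linarith [hx'.1.1, hy'.1.2], by linarith [hx'.1.2, hy'.1.1]⟩)
    (mul_le_mul_of_nonneg_left (abs_sub_le_iff.2 ⟨by linarith [hx'.2.1, hy'.2.2],
      by linarith [hx'.2.2, hy'.2.1]⟩) (by linarith))

end DislocationData

theorem hasDerivAt_vec {f g : ℝ → ℝ} {f' g' s : ℝ} (hf : HasDerivAt f f' s)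
    (hg : HasDerivAt g g' s) : HasDerivAt (fun s ↦ (!₂[f s, g s] : Model 2)) !₂[f', g'] s := by
  rw [hasDerivAt_iff_hasFDerivAt, ← hasFDerivWithinAt_univ]
  refine hasFDerivWithinAt_euclidean.2 fun i ↦ hasFDerivWithinAt_univ.2 ?_
  fin_cases i
  · refine hf.hasFDerivAt.congr_fderiv (ContinuousLinearMap.ext fun v ↦ ?_)
    simp
  · refine hg.hasFDerivAt.congr_fderiv (ContinuousLinearMap.ext fun v ↦ ?_)
    simp

/-! ### Explicit paths on the surface -/

namespace DislocationData

variable {P : DislocationData} {n : ℕ} [NeZero n]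

omit [NeZero n] in
theorem exists_eventually_chartDomain {z : Model 2} (hz : z ∉ P.slits n) :
    ∃ j : ℤ, ∀ᶠ z' in 𝓝 z, Surface.ofCoords P n z' ∈ Surface.chartDomain P n j := by
  obtain ⟨j, hj⟩ := Surface.exists_chartDomain P n ⟨z, hz⟩
  refine ⟨j, ?_⟩
  have hopen := (Surface.isOpenEmbedding_val P n).isOpenMap _ (Surface.isOpen_chartDomain P n j)
  filter_upwards [hopen.mem_nhds ⟨⟨z, hz⟩, hj, rfl⟩] with z' hz'
  obtain ⟨p, hp, rfl⟩ := hz'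
  have : Surface.ofCoords P n p.1 = p := Subtype.ext (Surface.ofCoords_val P n p.2)
  rwa [this]

omit [NeZero n] in
theorem eventually_mem_chartDomain {z : Model 2} (hz : z ∉ P.slits n) {j : ℤ}
    (hj : Surface.ofCoords P n z ∈ Surface.chartDomain P n j) :
    ∀ᶠ z' in 𝓝 z, z' ∉ P.slits n ∧ Surface.ofCoords P n z' ∈ Surface.chartDomain P n j := by
  have hopen := (Surface.isOpenEmbedding_val P n).isOpenMap _ (Surface.isOpen_chartDomain P n j)
  filter_upwards [hopen.mem_nhds ⟨_, hj, Surface.ofCoords_val P n hz⟩] with z' hz'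
  obtain ⟨p, hp, rfl⟩ := hz'
  have : Surface.ofCoords P n p.1 = p := Subtype.ext (Surface.ofCoords_val P n p.2)
  rw [this]
  exact ⟨p.2, hp⟩

/-- The length of a path on the surface, computed in the flat charts. -/
theorem intrinsicEDist_surface_le {K : Set (P.surface n).carrier} {p q : P.Surface n}
    {z : ℝ → Model 2} {ℓ : ℝ} (hz : Continuous z) (h0 : z 0 = p.1) (h1 : z 1 = q.1)
    (hslit : ∀ s ∈ Icc (0 : ℝ) 1, z s ∉ P.slits n)
    (hK : ∀ s ∈ Icc (0 : ℝ) 1, ∀ r : P.Surface n, r.1 = z s → r ∈ K)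
    (hd : ∀ s ∈ Icc (0 : ℝ) 1, ∃ j : ℤ, Surface.ofCoords P n (z s) ∈ Surface.chartDomain P n j ∧
      ∃ (c : ℝ → Model 2) (v : Model 2), ContDiffAt ℝ 1 c s ∧ HasDerivAt c v s ∧ ‖v‖ ≤ ℓ ∧
        ∀ᶠ s' in 𝓝 s, !₂[z s' 0, (z s' 1 - 2 * j) * P.rowHeight n (z s' 0)] = c s') :
    intrinsicEDist (P.surface n) K p q ≤ ENNReal.ofReal ℓ := by
  have := (Surface.isTranslationAtlas P n).isManifold
  set γ : ℝ → P.Surface n := fun s ↦ Surface.ofCoords P n (z s) with hγ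
  have hval : ∀ s ∈ Icc (0 : ℝ) 1, (γ s).1 = z s := fun s hs ↦
    Surface.ofCoords_val P n (hslit s hs)
  have hp : γ 0 = p := Subtype.ext ((hval 0 (by simp)).trans h0)
  have hq : γ 1 = q := Subtype.ext ((hval 1 (by simp)).trans h1)
  choose! j hj c v hc hv hvℓ hcz using hd
  have hev : ∀ s ∈ Icc (0 : ℝ) 1, ∀ᶠ s' in 𝓝 s,
      γ s' ∈ (Surface.flatChart P n (j s)).source ∧ Surface.flatChart P n (j s) (γ s') = c s s' := by
    intro s hs
    filter_upwards [hz.continuousAt.eventually (eventually_mem_chartDomain (hslit s hs) (hj s hs)),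
      hcz s hs] with s' hs' hs''
    rw [Surface.flatChart_source, Surface.flatChart_apply]
    refine ⟨hs'.2, ?_⟩
    rw [← hs'']
    simp only [hγ, Surface.ofCoords_val P n hs'.1]
  have hmain := intrinsicEDist_le_of_norm_mfderiv_path_le (W := P.surface n) (K := K) (γ := γ)
    (ℓ := ℓ)
    (fun s hs ↦ IsTranslationAtlas.contMDiffAt_path (mem_range_self (j s)) (hc s hs) (hev s hs))
    (fun s hs ↦ hK s hs _ (hval s hs))
    (fun s hs ↦ by
      have h1 := (Surface.isTranslationAtlas P n).mfderiv_path (mem_range_self (j s)) (hv s hs)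
        (hev s hs)
      refine (P.norm_surface n (γ s) _).trans_le ?_
      exact (congrArg (fun w : Model 2 ↦ ‖w‖) h1).trans_le (hvℓ s hs))
  rw [hp, hq] at hmain
  exact hmain

/-- The straight path between two points, in coordinates. -/
def segmentPath (p q : Model 2) (s : ℝ) : Model 2 := p + s • (q - p)

theorem segmentPath_zero (p q : Model 2) : segmentPath p q 0 = p := by simp [segmentPath]

theorem segmentPath_one (p q : Model 2) : segmentPath p q 1 = q := by simp [segmentPath]

theorem continuous_segmentPath (p q : Model 2) : Continuous (segmentPath p q) := by
  unfold segmentPath; fun_prop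

theorem segmentPath_apply (p q : Model 2) (s : ℝ) (i : Fin 2) :
    segmentPath p q s i = p i + s * (q i - p i) := by
  simp [segmentPath]

theorem segmentPath_mem (p q : Model 2) {s : ℝ} (hs : s ∈ Icc (0 : ℝ) 1) (i : Fin 2) :
    segmentPath p q s i ∈ uIcc (p i) (q i) := by
  rw [segmentPath_apply]
  rcases le_total (p i) (q i) with h | h
  · rw [uIcc_of_le h]; exact ⟨by nlinarith [hs.1], by nlinarith [hs.2]⟩
  · rw [uIcc_of_ge h]; exact ⟨by nlinarith [hs.2], by nlinarith [hs.1]⟩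

/-- A straight path along which the height of the rows is locally constant. -/
theorem intrinsicEDist_segment_le {K : Set (P.surface n).carrier} {p q : P.Surface n} {B : ℝ}
    (hslit : ∀ s ∈ Icc (0 : ℝ) 1, segmentPath p.1 q.1 s ∉ P.slits n)
    (hconst : ∀ s ∈ Icc (0 : ℝ) 1, ∀ᶠ s' in 𝓝 s, P.rowHeight n (segmentPath p.1 q.1 s' 0) =
      P.rowHeight n (segmentPath p.1 q.1 s 0))
    (hB : ∀ s ∈ Icc (0 : ℝ) 1, P.rowHeight n (segmentPath p.1 q.1 s 0) ≤ B)
    (hK : ∀ s ∈ Icc (0 : ℝ) 1, ∀ r : P.Surface n, r.1 = segmentPath p.1 q.1 s → r ∈ K) :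
    intrinsicEDist (P.surface n) K p q ≤
      ENNReal.ofReal √((q.1 0 - p.1 0) ^ 2 + (B * (q.1 1 - p.1 1)) ^ 2) := by
  refine intrinsicEDist_surface_le (continuous_segmentPath p.1 q.1) (segmentPath_zero _ _)
    (segmentPath_one _ _) hslit hK fun s hs ↦ ?_
  obtain ⟨j, hj⟩ := exists_eventually_chartDomain (hslit s hs)
  set ρ := P.rowHeight n (segmentPath p.1 q.1 s 0) with hρ
  have hρ0 : 0 < ρ := P.rowHeight_pos n _
  refine ⟨j, hj.self_of_nhds, fun s' ↦ !₂[p.1 0 + s' * (q.1 0 - p.1 0),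
    (p.1 1 + s' * (q.1 1 - p.1 1) - 2 * j) * ρ], !₂[q.1 0 - p.1 0, (q.1 1 - p.1 1) * ρ], ?_, ?_, ?_, ?_⟩
  · exact (contDiff_vec (by fun_prop) (by fun_prop)).contDiffAt
  · refine hasDerivAt_vec ?_ ?_
    · simpa using ((hasDerivAt_id s).mul_const (q.1 0 - p.1 0)).const_add (p.1 0)
    · simpa using ((((hasDerivAt_id s).mul_const (q.1 1 - p.1 1)).const_add (p.1 1)).sub_const
        (2 * (j : ℝ))).mul_const ρ
  · rw [norm_vec]
    refine Real.sqrt_le_sqrt ?_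
    rw [mul_comm, mul_pow, mul_pow]
    have := hB s hs
    gcongr
  · filter_upwards [hconst s hs] with s' hs'
    rw [hs', segmentPath_apply, segmentPath_apply]

/-- A path on which one of the flat coordinates is constant. -/
theorem intrinsicEDist_horizontal_le {K : Set (P.surface n).carrier} {p q : P.Surface n} {j : ℤ}
    {Y : ℝ} (hp : p.1 1 = 2 * j + Y / P.rowHeight n (p.1 0))
    (hq : q.1 1 = 2 * j + Y / P.rowHeight n (q.1 0))
    (hY : ∀ x ∈ uIcc (p.1 0) (q.1 0), |Y| < P.rowHeight n x)
    (hK : ∀ r : P.Surface n, r.1 0 ∈ uIcc (p.1 0) (q.1 0) →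
      r.1 1 = 2 * j + Y / P.rowHeight n (r.1 0) → r ∈ K) :
    intrinsicEDist (P.surface n) K p q ≤ ENNReal.ofReal |q.1 0 - p.1 0| := by
  set x : ℝ → ℝ := fun s ↦ segmentPath p.1 q.1 s 0 with hx
  have hxc : Continuous x := (PiLp.continuous_apply 2 _ 0).comp (continuous_segmentPath _ _)
  set z : ℝ → Model 2 := fun s ↦ !₂[x s, 2 * j + Y / P.rowHeight n (x s)] with hz
  have hzc : Continuous z := continuous_vec hxc (continuous_const.add
    (continuous_const.div ((P.continuous_rowHeight n).comp hxc) fun s ↦ (P.rowHeight_pos n _).ne'))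
  have hlt : ∀ s ∈ Icc (0 : ℝ) 1, |z s 1 - 2 * j| < 1 := by
    intro s hs
    have hρ := P.rowHeight_pos n (x s)
    have := hY _ (segmentPath_mem p.1 q.1 hs 0)
    simp only [hz, Matrix.cons_val_one, Matrix.cons_val_fin_one]
    rw [add_sub_cancel_left, abs_div, abs_of_pos hρ, div_lt_one hρ]
    exact this
  have hslit : ∀ s ∈ Icc (0 : ℝ) 1, z s ∉ P.slits n := fun s hs ↦ P.notMem_slits_of_lt n (hlt s hs)
  refine intrinsicEDist_surface_le hzc ?_ ?_ hslit ?_ fun s hs ↦ ?_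
  · ext i; fin_cases i
    · simp [hz, hx, segmentPath_zero]
    · simp [hz, hx, segmentPath_zero, hp]
  · ext i; fin_cases i
    · simp [hz, hx, segmentPath_one]
    · simp [hz, hx, segmentPath_one, hq]
  · intro s hs r hr
    have e0 : r.1 0 = x s := by rw [hr]; simp [hz]
    refine hK r (by rw [e0]; exact segmentPath_mem _ _ hs 0) ?_
    rw [e0, hr]; simp [hz]
  · refine ⟨j, Or.inl ?_, fun s' ↦ !₂[p.1 0 + s' * (q.1 0 - p.1 0), Y], !₂[q.1 0 - p.1 0, 0],
      (contDiff_vec (by fun_prop) (by fun_prop)).contDiffAt, ?_, ?_, ?_⟩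
    · rw [Surface.ofCoords_val P n (hslit s hs)]
      have := abs_lt.1 (hlt s hs)
      exact ⟨by linarith, by linarith⟩
    · refine hasDerivAt_vec ?_ ?_
      · simpa using ((hasDerivAt_id s).mul_const (q.1 0 - p.1 0)).const_add (p.1 0)
      · simpa using hasDerivAt_const s Y
    · rw [norm_vec]; simp [Real.sqrt_sq_eq_abs]
    · refine Eventually.of_forall fun s' ↦ ?_
      have hρ := (P.rowHeight_pos n (x s')).ne'
      ext i; fin_cases i
      · simp [hz, hx, segmentPath_apply]
      · simp [hz]; field_simp

end DislocationData

/-! ### Where the holes are, and how much the heights vary -/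

namespace DislocationData

/-- `n` times a bound for the relative variation of the heights of the rows near a dislocation
line. -/
def unevenness (P : DislocationData) : ℝ := (P.ε + P.ε / (4 * P.b)) * (2 / P.a)

/-- `n` times the height, in units of half rows, of a neighbourhood of the level of the dislocation
lines that contains the holes. -/
def holeHeight (P : DislocationData) : ℝ := P.unevenness + 2 * slitWidth P.θ P.ε

theorem unevenness_pos (P : DislocationData) : 0 < P.unevenness := by
  have := P.a_pos; have := P.b_pos; have := P.ε_pos
  unfold unevenness; positivity

theorem unevenness_lt_holeHeight (P : DislocationData) : P.unevenness < P.holeHeight := by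
  have := P.slitWidth_pos P.ε_pos
  unfold holeHeight; linarith

variable {P : DislocationData} {n : ℕ} [NeZero n]

theorem unevenness_div_eq : P.unevenness / n * (P.a / (2 * n)) =
    (P.ε + P.ε / (4 * P.b)) / n ^ 2 := by
  have := P.a_pos; have := P.b_pos; have := cast_pos' n
  unfold unevenness; field_simp

/-- Both heights are within ε_n/2 of the same line, so they differ by at most ε_n, and h is at least
a/(2n). -/
theorem IsFine.rowHeight_le_smoothHeight_mul (hf : P.IsFine n) {x : ℝ} (hx : x ∈ Icc 0 P.b) :
    P.rowHeight n x ≤ P.smoothHeight n x * (1 + P.unevenness / n) := by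
  have hn := cast_pos' n
  have := P.b_pos; have := P.ε_pos
  have h1 := abs_le.1 (IsFine.abs_rowHeight_sub_le P hf hx)
  have h2 := abs_le.1 (IsFine.abs_smoothHeight_sub_le P hf hx)
  have h3 := mul_le_mul_of_nonneg_left (P.le_smoothHeight n x)
    (show 0 ≤ P.unevenness / n from div_nonneg P.unevenness_pos.le hn.le)
  rw [unevenness_div_eq] at h3
  have h4 : P.εBlock n ≤ (P.ε + P.ε / (4 * P.b)) / n ^ 2 := by
    rw [εBlock]; gcongr; have : 0 ≤ P.ε / (4 * P.b) := by positivity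
    linarith
  linarith

/-- The line itself contributes at most κ·4w ≤ κ/(2n) = ε/(4bn²), where w is the width of a
dislocation line. This explains the second term in `unevenness`. -/
theorem IsFine.rowHeight_le_mul (hf : P.IsFine n) {x y : ℝ} (hx : x ∈ Icc 0 P.b)
    (hy : y ∈ Icc 0 P.b) (hxy : |x - y| ≤ 4 * P.width n) :
    P.rowHeight n x ≤ P.rowHeight n y * (1 + P.unevenness / n) := by
  have hn := cast_pos' n
  have hb := P.b_pos; have hε := P.ε_pos
  have h1 := abs_le.1 (IsFine.abs_rowHeight_sub_le P hf hx)
  have h2 := abs_le.1 (IsFine.abs_rowHeight_sub_le P hf hy)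
  have h3 := mul_le_mul_of_nonneg_left (P.le_rowHeight n y)
    (show 0 ≤ P.unevenness / n from div_nonneg P.unevenness_pos.le hn.le)
  rw [unevenness_div_eq] at h3
  have h4 : P.angleStep n * (x - y) ≤ P.ε / (4 * P.b) / n ^ 2 := by
    have h5 : x - y ≤ 1 / (2 * n) := by
      refine ((le_abs_self _).trans hxy).trans ?_
      rw [le_div_iff₀ (by positivity)]
      linarith [hf.2]
    refine (mul_le_mul_of_nonneg_left h5 (P.angleStep_pos n).le).trans (le_of_eq ?_)
    rw [angleStep]; field_simp; norm_num
  have h6 : (P.ε + P.ε / (4 * P.b)) / n ^ 2 = P.εBlock n + P.ε / (4 * P.b) / n ^ 2 := by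
    rw [εBlock]; ring
  linarith

/-- The properties of the domains of the surface that are used to construct short paths around the
dislocation lines. -/
structure IsPassable (P : DislocationData) (n : ℕ) [NeZero n] (K : Set (P.surface n).carrier) :
    Prop where
  subset : ∀ p : P.Surface n, p ∈ K → p ∈ P.rectangle n
  clear : ∀ p : P.Surface n, p ∈ P.rectangle n →
    (∀ i < n, 2 * P.width n ≤ |p.1 0 - P.center n i|) → p ∈ K
  safe : ∀ p : P.Surface n, p ∈ P.rectangle n →
    (∃ j : ℤ, |p.1 1 - 2 * j| ≤ 1 - P.holeHeight / n) → p ∈ K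
  -- Even heights `2j` are bottom or top sides of rows. The condition allows paths to leave the
  -- vicinity of a seam vertically.
  retract : ∀ p : P.Surface n, p ∈ K → ∀ (q : P.Surface n) (j : ℤ), ∀ l ∈ Icc (0 : ℝ) 1,
    |p.1 1 - 2 * j| ≤ 1 → (2 * j : ℝ) ∈ Icc 0 (2 * n : ℝ) → q.1 0 = p.1 0 →
      q.1 1 = 2 * j + l * (p.1 1 - 2 * j) → q ∈ K

theorem mem_Icc_retract {j t l u : ℝ} (hl : l ∈ Icc (0 : ℝ) 1) (hj : j ∈ Icc 0 u)
    (ht : t ∈ Icc 0 u) : j + l * (t - j) ∈ Icc 0 u :=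
  ⟨by nlinarith [hl.1, hl.2, hj.1, ht.1], by nlinarith [hl.1, hl.2, hj.2, ht.2]⟩

variable (P n) in
theorem isPassable_rectangle : P.IsPassable n (P.rectangle n) where
  subset _ hp := hp
  clear _ hp _ := hp
  safe _ hp _ := hp
  retract p hp q j l hl _ hj h0 h1 := by
    refine (P.mem_rectangle_iff n).2 ⟨h0 ▸ ((P.mem_rectangle_iff n).1 hp).1, ?_⟩
    rw [h1]
    exact mem_Icc_retract hl hj ((P.mem_rectangle_iff n).1 hp).2

/-- `σ` is not on the same side of 0 as `m`, and an odd integer has absolute value at least 1. For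
heights relative to an even level this says that seams on the other side are far away. -/
theorem one_le_abs_sub_of_odd {σ : ℝ} {m : ℤ} (hm : Odd m) (h : σ * m ≤ 0) : 1 ≤ |σ - m| := by
  have h1 : (1 : ℝ) ≤ (m : ℝ) ^ 2 := by
    have : m ≠ 0 := by rintro rfl; simp at hm
    have : 1 ≤ m ^ 2 := by have := sq_nonneg m; have : m ^ 2 ≠ 0 := pow_ne_zero 2 ‹_›; omega
    exact_mod_cast this
  rw [← sq_le_sq₀ zero_le_one (abs_nonneg _), sq_abs]
  nlinarith [sq_nonneg σ]

omit [NeZero n] in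
theorem mem_hole_iff {q : Model 2} {i j : ℕ} : q ∈ P.hole n i j ↔
    (q 0 - P.center n i) ^ 2 + (max 0 (1 - (1 - |q 1 - (2 * j + 1)|) *
      (P.rowHeight n (q 0) / P.smoothHeight n (q 0))) / n) ^ 2 < (2 * P.width n) ^ 2 := Iff.rfl

/-- Points two widths away from a dislocation line are outside of its ellipse, and `holeHeight` is
chosen so that holes do not come closer to even levels than stated in `safe`. Shrinking towards an
even level increases the distance from the seam on the same side, while seams on the other side stay
at distance at least 1, out of reach of their holes. -/
theorem IsFine.isPassable (hf : P.IsFine n) : P.IsPassable n (P.perforatedSurface n) := by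
  have hn := cast_pos' n
  have hw := P.width_pos n
  -- The second summand of the equation of the ellipse alone reaches the square of the half-axis.
  have hhole : ∀ (q : Model 2) (i j : ℕ), 2 * P.width n * n ≤ 1 - (1 - |q 1 - (2 * j + 1)|) *
      (P.rowHeight n (q 0) / P.smoothHeight n (q 0)) → q ∉ P.hole n i j := by
    intro q i j h hq
    have h1 : 2 * P.width n ≤ max 0 (1 - (1 - |q 1 - (2 * j + 1)|) *
      (P.rowHeight n (q 0) / P.smoothHeight n (q 0))) / n := by
      rw [le_div_iff₀ hn]; exact h.trans (le_max_right _ _)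
    have h2 := pow_le_pow_left₀ (by linarith) h1 2
    have h3 := mem_hole_iff.1 hq
    nlinarith [sq_nonneg (q 0 - P.center n i)]
  have hone : 2 * P.width n * n ≤ 1 := by linarith [hf.2, mul_pos hw hn]
  refine ⟨fun p hp ↦ hp.1, fun p hp h ↦ ⟨hp, fun i j hij ↦ ?_⟩, fun p hp h ↦ ⟨hp, fun i j ↦ ?_⟩,
    fun p hp q k l hl hk hk' h0 h1 ↦ ⟨?_, fun i j hij ↦ ?_⟩⟩
  · have h1 := pow_le_pow_left₀ (by linarith) (h i i.2) 2
    rw [sq_abs] at h1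
    have h3 := mem_hole_iff.1 hij
    nlinarith [sq_nonneg (max 0 (1 - (1 - |p.1 1 - (2 * (j : ℕ) + 1)|) *
      (P.rowHeight n (p.1 0) / P.smoothHeight n (p.1 0))) / n)]
  · obtain ⟨k, hk⟩ := h
    refine hhole _ _ _ ?_
    have hs := P.smoothHeight_pos n (p.1 0)
    have hr := P.rowHeight_pos n (p.1 0)
    have hu := hf.rowHeight_le_smoothHeight_mul ((P.mem_rectangle_iff n).1 hp).1
    rw [← div_le_iff₀' hs] at hu
    set u := P.rowHeight n (p.1 0) / P.smoothHeight n (p.1 0)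
    have hu0 : 0 < u := div_pos hr hs
    have hdist : 1 - |p.1 1 - (2 * (j : ℕ) + 1)| ≤ 1 - P.holeHeight / n := by
      have h1 : (1 : ℝ) ≤ |(2 * (j : ℕ) + 1 : ℝ) - 2 * k| := by
        have : (1 : ℤ) ≤ |(2 * ((j : ℕ) : ℤ) + 1) - 2 * k| := Int.one_le_abs (by omega)
        exact_mod_cast this
      have h2 : |(2 * (j : ℕ) + 1 : ℝ) - 2 * k| ≤
          |p.1 1 - 2 * k| + |p.1 1 - (2 * (j : ℕ) + 1)| := by
        have := abs_sub_le ((2 * (j : ℕ) + 1 : ℝ)) (p.1 1) (2 * k)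
        rw [abs_sub_comm _ (p.1 1)] at this
        linarith
      linarith
    have h4 : 2 * P.width n * n = 2 * slitWidth P.θ P.ε / n := by
      rw [width_eq]; field_simp
    have hh : P.holeHeight / n = P.unevenness / n + 2 * slitWidth P.θ P.ε / n := by
      rw [holeHeight, add_div]
    have hc : 0 ≤ P.unevenness / n := div_nonneg P.unevenness_pos.le hn.le
    have hs0 : 0 ≤ 2 * slitWidth P.θ P.ε / n := by
      have := P.slitWidth_pos P.ε_pos; positivity
    have h1 := mul_le_mul_of_nonneg_right hdist hu0.le
    have hD : 0 ≤ 1 - P.holeHeight / n := (abs_nonneg _).trans hk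
    have h2 := mul_le_mul_of_nonneg_left hu hD
    rw [h4]
    nlinarith [mul_nonneg hc hc, mul_nonneg hc hs0]
  · refine (P.mem_rectangle_iff n).2 ⟨h0 ▸ ((P.mem_rectangle_iff n).1 hp.1).1, ?_⟩
    rw [h1]
    exact mem_Icc_retract hl hk' ((P.mem_rectangle_iff n).1 hp.1).2
  · set σ := p.1 1 - 2 * (k : ℝ) with hσ
    set m : ℤ := 2 * ((j : ℕ) : ℤ) + 1 - 2 * k with hm
    have hmr : (m : ℝ) = 2 * (j : ℕ) + 1 - 2 * k := by rw [hm]; push_cast; ring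
    have hodd : Odd m := ⟨(j : ℕ) - k, by rw [hm]; ring⟩
    have hs := P.smoothHeight_pos n (p.1 0)
    have hr := P.rowHeight_pos n (p.1 0)
    have hu0 : 0 < P.rowHeight n (p.1 0) / P.smoothHeight n (p.1 0) := div_pos hr hs
    have eq1 : q.1 1 - (2 * (j : ℕ) + 1) = l * σ - m := by rw [h1, hmr]; ring
    have ep1 : p.1 1 - (2 * (j : ℕ) + 1) = σ - m := by rw [hσ, hmr]; ring
    rcases le_or_gt (σ * m) 0 with h | h
    · refine hhole q.1 i j ?_ hij
      rw [eq1, h0]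
      have := one_le_abs_sub_of_odd (σ := l * σ) hodd
        (by rw [mul_assoc]; exact mul_nonpos_of_nonneg_of_nonpos hl.1 h)
      nlinarith
    · refine hp.2 i j ?_
      have hle : |σ - m| ≤ |l * σ - m| := by
        -- The height relative to the even level is at most 1, so the seam `m` on the same side is
        -- not overshot, and moving towards 0 moves away from it.
        have hm1 : |σ| ≤ |(m : ℝ)| := by
          have : (1 : ℝ) ≤ |(m : ℝ)| := by
            have := one_le_abs_sub_of_odd (σ := 0) hodd (by simp)
            simpa using this
          linarith
        have hkey : (σ - m) ^ 2 ≤ (l * σ - m) ^ 2 := by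
          have h5 : σ ^ 2 ≤ σ * m := by
            rw [← abs_of_pos h, abs_mul, ← sq_abs]
            nlinarith [abs_nonneg σ]
          have : (l * σ - m) ^ 2 - (σ - m) ^ 2 = (1 - l) * (2 * (σ * m) - (1 + l) * σ ^ 2) := by ring
          have : 0 ≤ (1 - l) * (2 * (σ * m) - (1 + l) * σ ^ 2) :=
            mul_nonneg (by linarith [hl.2]) (by nlinarith [hl.2, sq_nonneg σ])
          linarith
        exact sq_le_sq.1 hkey
      have hq := mem_hole_iff.1 hij
      rw [eq1, h0] at hq
      rw [mem_hole_iff, ep1]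
      refine lt_of_le_of_lt ?_ hq
      gcongr

end DislocationData

theorem intrinsicEDist_le_add_add {d : ℕ} {W : WeitzenbockManifold d} {K : Set W.carrier}
    {x x' y y' : W.carrier} {α β γ : ℝ} (hα : 0 ≤ α) (hβ : 0 ≤ β) (hγ : 0 ≤ γ)
    (h1 : intrinsicEDist W K x x' ≤ ENNReal.ofReal α)
    (h2 : intrinsicEDist W K x' y' ≤ ENNReal.ofReal β)
    (h3 : intrinsicEDist W K y' y ≤ ENNReal.ofReal γ) :
    intrinsicEDist W K x y ≤ ENNReal.ofReal (α + β + γ) := by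
  rw [ENNReal.ofReal_add (add_nonneg hα hβ) hγ, ENNReal.ofReal_add hα hβ]
  exact (intrinsicEDist_triangle x y' y).trans
    (add_le_add ((intrinsicEDist_triangle x x' y').trans (add_le_add h1 h2)) h3)

/-! ### Detours around a column of dislocation lines -/

namespace DislocationData

/-- `n²` times a bound for the cost of crossing a column of dislocation lines. -/
def crossCost (P : DislocationData) : ℝ :=
  (P.a + P.ε) * (P.holeHeight + 2 * P.unevenness) + 4 * slitWidth P.θ P.ε

theorem crossCost_pos (P : DislocationData) : 0 < P.crossCost := by
  have := P.a_pos; have := P.ε_pos; have := P.slitWidth_pos P.ε_pos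
  have := P.unevenness_pos
  have := P.unevenness_pos.trans P.unevenness_lt_holeHeight
  unfold crossCost; positivity

/-- The number `n` of blocks in a row is so large that there are short paths around the dislocation
lines. -/
def IsVeryFine (P : DislocationData) (n : ℕ) : Prop :=
  P.IsFine n ∧ P.holeHeight + P.unevenness ≤ n

variable {P : DislocationData} {n : ℕ} [NeZero n] {K : Set (P.surface n).carrier}

/-- Along a vertical segment ρ is constant, so the length is ρ times the change of `t`, which is at
most `1 - l`. -/
theorem IsPassable.intrinsicEDist_retract_le (hK : P.IsPassable n K) {p q : P.Surface n}
    (hp : p ∈ K) {j : ℤ} {l : ℝ} (hl : l ∈ Icc (0 : ℝ) 1) (hσ : |p.1 1 - 2 * j| ≤ 1)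
    (hj : (2 * j : ℝ) ∈ Icc 0 (2 * n : ℝ)) (h0 : q.1 0 = p.1 0)
    (h1 : q.1 1 = 2 * j + l * (p.1 1 - 2 * j)) :
    intrinsicEDist (P.surface n) K p q ≤ ENNReal.ofReal (P.rowHeight n (p.1 0) * (1 - l)) := by
  have hρ := P.rowHeight_pos n (p.1 0)
  have e0 : ∀ s, segmentPath p.1 q.1 s 0 = p.1 0 := fun s ↦ by rw [segmentPath_apply, h0]; ring
  have e1 : ∀ s, segmentPath p.1 q.1 s 1 = 2 * j + (1 - s * (1 - l)) * (p.1 1 - 2 * j) := fun s ↦ by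
    rw [segmentPath_apply, h1]; ring
  have hls : ∀ s ∈ Icc (0 : ℝ) 1, 1 - s * (1 - l) ∈ Icc (0 : ℝ) 1 := fun s hs ↦
    ⟨by nlinarith [hs.1, hs.2, hl.1, hl.2], by nlinarith [hs.1, hl.2]⟩
  refine (intrinsicEDist_segment_le (B := P.rowHeight n (p.1 0)) (fun s hs ↦ ?_) (fun s _ ↦ ?_)
    (fun s _ ↦ by rw [e0]) fun s hs r hr ↦ ?_).trans (ENNReal.ofReal_le_ofReal ?_)
  · by_cases hlt : |segmentPath p.1 q.1 s 1 - 2 * j| < 1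
    · exact P.notMem_slits_of_lt n hlt
    -- A point of the segment can lie on a seam only if it coincides with the initial point, which
    -- is not on a dislocation line.
    · have h2 := hls s hs
      rw [e1, add_sub_cancel_left, abs_mul, abs_of_nonneg h2.1, not_lt] at hlt
      have h3 : 1 - s * (1 - l) = 1 :=
        le_antisymm h2.2 (hlt.trans (mul_le_of_le_one_right h2.1 hσ))
      have : segmentPath p.1 q.1 s = p.1 := by
        ext i; fin_cases i
        · exact e0 s
        · refine (e1 s).trans ?_
          rw [h3]; simp
      rw [this]; exact p.2
  · exact Eventually.of_forall fun s' ↦ by rw [e0, e0]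
  · exact hK.retract p hp r j _ (hls s hs) hσ hj (by rw [hr, e0]) (by rw [hr, e1])
  · rw [h0, h1, sub_self, zero_pow two_ne_zero, zero_add, Real.sqrt_sq_eq_abs,
      show 2 * (j : ℝ) + l * (p.1 1 - 2 * j) - p.1 1 = -((1 - l) * (p.1 1 - 2 * j)) by ring,
      abs_mul, abs_neg, abs_mul, abs_of_pos hρ, abs_of_nonneg (show 0 ≤ 1 - l by linarith [hl.2])]
    refine mul_le_mul_of_nonneg_left ?_ hρ.le
    nlinarith [hl.2]

omit [NeZero n] in
theorem exists_int_abs_sub_le_one {t : ℝ} (ht : t ∈ Icc 0 (2 * n : ℝ)) :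
    ∃ j : ℤ, |t - 2 * j| ≤ 1 ∧ (2 * j : ℝ) ∈ Icc 0 (2 * n : ℝ) := by
  refine ⟨round (t / 2), abs_sub_round_half_le t, ?_⟩
  have h := abs_le.1 (abs_sub_round_half_le t)
  have h1 : (-1 : ℝ) < round (t / 2) := by linarith [ht.1]
  have h2 : (round (t / 2) : ℝ) < n + 1 := by linarith [ht.2]
  have h3 : (0 : ℤ) ≤ round (t / 2) := by
    have : (-1 : ℤ) < round (t / 2) := by exact_mod_cast h1
    omega
  have h4 : round (t / 2) ≤ (n : ℤ) := by
    have : round (t / 2) < (n : ℤ) + 1 := by exact_mod_cast h2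
    omega
  have h3' : (0 : ℝ) ≤ round (t / 2) := by exact_mod_cast h3
  have h4' : (round (t / 2) : ℝ) ≤ n := by exact_mod_cast h4
  exact ⟨by linarith, by linarith⟩

/-- Points of the same height on the two sides of a column of dislocation lines can be joined by a
short path. -/
theorem IsVeryFine.intrinsicEDist_cross_le (hf : P.IsVeryFine n) (hK : P.IsPassable n K)
    {p q : P.Surface n} (hp : p ∈ K) (hq : q ∈ K) {i : ℕ} (hi : i < n)
    (hpi : |p.1 0 - P.center n i| ≤ 2 * P.width n) (hqi : |q.1 0 - P.center n i| ≤ 2 * P.width n)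
    (h1 : q.1 1 = p.1 1) :
    intrinsicEDist (P.surface n) K p q ≤ ENNReal.ofReal (P.crossCost / n ^ 2) := by
  have hn := cast_pos' n
  have hw := P.width_pos n
  obtain ⟨hb0, hb1⟩ := hf.1.center_mem hi
  have hstrip : ∀ x, |x - P.center n i| ≤ 2 * P.width n → x ∈ Icc 0 P.b := fun x hx ↦ by
    rw [abs_le] at hx; exact ⟨by linarith, by linarith⟩
  have ht := ((P.mem_rectangle_iff n).1 (hK.subset p hp)).2
  obtain ⟨j, hσ, hj⟩ := exists_int_abs_sub_le_one ht
  set c := P.unevenness / n with hc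
  set h := P.holeHeight / n with hh
  have hc0 : 0 ≤ c := div_nonneg P.unevenness_pos.le hn.le
  have hh0 : 0 < h := div_pos (P.unevenness_pos.trans P.unevenness_lt_holeHeight) hn
  have hsum : h + c ≤ 1 := by
    rw [hh, hc, ← add_div, div_le_one hn]; exact hf.2
  -- `h` leaves room for the holes and `c` for the relative variation of ρ across the column.
  -- `IsVeryFine` makes `lam` nonnegative.
  set lam := 1 - h - c with hlam
  have hlam0 : 0 ≤ lam := by linarith
  set σ := p.1 1 - 2 * (j : ℝ) with hσdef
  have hρ : ∀ x, 0 < P.rowHeight n x := P.rowHeight_pos n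
  -- `Y` is the constant flat height of the horizontal part of the detour. In units of half rows it
  -- is `f x * σ`, where `f x` stays between `lam - c` and `1 - h`: low enough to miss the holes,
  -- and high enough for the two vertical parts to be short.
  set Y := lam * σ * P.rowHeight n (p.1 0) with hY
  set f : ℝ → ℝ := fun x ↦ lam * P.rowHeight n (p.1 0) / P.rowHeight n x with hf'
  have hfx : ∀ x, Y / P.rowHeight n x = f x * σ := fun x ↦ by
    simp only [hY, hf']; ring
  have hf0 : ∀ x, 0 ≤ f x := fun x ↦ div_nonneg (mul_nonneg hlam0 (hρ _).le) (hρ x).le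
  have hfle : ∀ x, |x - P.center n i| ≤ 2 * P.width n → f x ≤ 1 - h := by
    intro x hx
    have h2 := hf.1.rowHeight_le_mul (hstrip _ hpi) (hstrip x hx) (by
      refine (abs_sub_le _ (P.center n i) _).trans ?_
      rw [abs_sub_comm (P.center n i) x]; linarith)
    rw [hf', div_le_iff₀ (hρ x)]
    have h3 := mul_le_mul_of_nonneg_left h2 hlam0
    refine h3.trans ?_
    have : lam * (1 + c) ≤ 1 - h := by rw [hlam]; nlinarith
    nlinarith [hρ x]
  have hfge : ∀ x, |x - P.center n i| ≤ 2 * P.width n → 1 - f x ≤ h + 2 * c := by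
    intro x hx
    have h2 := hf.1.rowHeight_le_mul (hstrip x hx) (hstrip _ hpi) (by
      refine (abs_sub_le _ (P.center n i) _).trans ?_
      rw [abs_sub_comm (P.center n i)]; linarith)
    have h3 : lam - c ≤ f x := by
      rw [hf', le_div_iff₀ (hρ x)]
      rcases le_or_gt lam c with h4 | h4
      · exact (mul_nonpos_of_nonpos_of_nonneg (by linarith) (hρ x).le).trans
          (mul_nonneg hlam0 (hρ _).le)
      · refine (mul_le_mul_of_nonneg_left h2 (by linarith)).trans ?_
        have : (lam - c) * (1 + c) ≤ lam := by nlinarith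
        nlinarith [hρ (p.1 0)]
    linarith
  have habs : ∀ x, |x - P.center n i| ≤ 2 * P.width n → |f x * σ| ≤ 1 - h := by
    intro x hx
    rw [abs_mul, abs_of_nonneg (hf0 x)]
    nlinarith [hfle x hx, hf0 x, abs_nonneg σ]
  have hpoint : ∀ x, |x - P.center n i| ≤ 2 * P.width n →
      ∃ r : P.Surface n, r.1 0 = x ∧ r.1 1 = 2 * j + f x * σ := fun x hx ↦ by
    have hs : (!₂[x, 2 * j + f x * σ] : Model 2) ∉ P.slits n := by
      refine P.notMem_slits_of_lt n (j := j) ?_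
      simp only [Matrix.cons_val_one, Matrix.cons_val_fin_one, add_sub_cancel_left]
      linarith [habs x hx]
    exact ⟨⟨_, hs⟩, rfl, rfl⟩
  obtain ⟨p', ep0, ep1⟩ := hpoint _ hpi
  obtain ⟨q', eq0, eq1⟩ := hpoint _ hqi
  have d1 := hK.intrinsicEDist_retract_le hp (q := p') (l := f (p.1 0))
    ⟨hf0 _, by linarith [hfle _ hpi]⟩ hσ hj ep0 ep1
  have d3 := hK.intrinsicEDist_retract_le hq (q := q') (l := f (q.1 0))
    ⟨hf0 _, by linarith [hfle _ hqi]⟩ (by rw [h1]; exact hσ) hj eq0 (by rw [eq1, h1])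
  have hbetween : ∀ x ∈ uIcc (p'.1 0) (q'.1 0), |x - P.center n i| ≤ 2 * P.width n := by
    intro x hx
    have : uIcc (p'.1 0) (q'.1 0) ⊆ Icc (P.center n i - 2 * P.width n)
        (P.center n i + 2 * P.width n) := by
      rw [abs_le] at hpi hqi
      exact uIcc_subset_Icc ⟨by rw [ep0]; linarith, by rw [ep0]; linarith⟩
        ⟨by rw [eq0]; linarith, by rw [eq0]; linarith⟩
    have := this hx
    exact abs_le.2 ⟨by linarith [this.1], by linarith [this.2]⟩
  have d2 := intrinsicEDist_horizontal_le (K := K) (p := p') (q := q') (j := j) (Y := Y)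
    (by rw [ep1, hfx, ep0]) (by rw [eq1, hfx, eq0]) (fun x hx ↦ by
      have h2 := habs x (hbetween x hx)
      rw [← hfx, abs_div, abs_of_pos (hρ x), div_le_iff₀ (hρ x)] at h2
      nlinarith [hρ x]) (fun r hr hr1 ↦ by
      have h2 := habs _ (hbetween _ hr)
      rw [hfx] at hr1
      refine hK.safe r ((P.mem_rectangle_iff n).2 ⟨hstrip _ (hbetween _ hr), ?_⟩) ⟨j, ?_⟩
      · rw [hr1]
        exact mem_Icc_retract ⟨hf0 _, by linarith [hfle _ (hbetween _ hr)]⟩ hj ht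
      · rw [hr1, add_sub_cancel_left]; exact h2)
  replace d3 := (intrinsicEDist_comm (W := P.surface n) (K := K) q' q).trans_le d3
  have b1 : P.rowHeight n (p.1 0) * (1 - f (p.1 0)) ≤ (P.a + P.ε) / (2 * n) * (h + 2 * c) :=
    mul_le_mul (P.rowHeight_le n _) (hfge _ hpi) (by linarith [hfle _ hpi])
      ((hρ (p.1 0)).le.trans (P.rowHeight_le n _))
  have b3 : P.rowHeight n (q.1 0) * (1 - f (q.1 0)) ≤ (P.a + P.ε) / (2 * n) * (h + 2 * c) :=
    mul_le_mul (P.rowHeight_le n _) (hfge _ hqi) (by linarith [hfle _ hqi])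
      ((hρ (p.1 0)).le.trans (P.rowHeight_le n _))
  have b2 : |q'.1 0 - p'.1 0| ≤ 4 * P.width n := by
    rw [ep0, eq0]
    refine (abs_sub_le _ (P.center n i) _).trans ?_
    rw [abs_sub_comm (P.center n i)]; linarith
  have hcost : P.crossCost / n ^ 2 = (P.a + P.ε) / (2 * n) * (h + 2 * c) + 4 * P.width n +
      (P.a + P.ε) / (2 * n) * (h + 2 * c) := by
    rw [crossCost, hh, hc, width_eq]; field_simp; ring
  rw [hcost]
  have hnn : 0 ≤ (P.a + P.ε) / (2 * n) * (h + 2 * c) :=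
    mul_nonneg ((hρ (p.1 0)).le.trans (P.rowHeight_le n _)) (by linarith)
  exact intrinsicEDist_le_add_add (W := P.surface n) hnn (by linarith) hnn
    (d1.trans (ENNReal.ofReal_le_ofReal b1)) (d2.trans (ENNReal.ofReal_le_ofReal b2))
    (d3.trans (ENNReal.ofReal_le_ofReal b3))

end DislocationData

/-! ### Diameters of the holes and paths across many columns -/

namespace DislocationData

variable {P : DislocationData} {n : ℕ} [NeZero n] {K : Set (P.surface n).carrier}

theorem isClear_of_le {x : ℝ} (h : ∀ i < n, 2 * P.width n ≤ |x - P.center n i|) : P.IsClear n x := by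
  intro i hi hx
  have hw := P.width_pos n
  have : |x - P.center n i| ≤ P.width n := abs_le.2 ⟨by linarith [hx.1], by linarith [hx.2]⟩
  linarith [h i hi]

theorem exists_surface_point {x : ℝ} (h : ∀ i < n, 2 * P.width n ≤ |x - P.center n i|) (t : ℝ) :
    ∃ r : P.Surface n, r.1 0 = x ∧ r.1 1 = t :=
  ⟨⟨!₂[x, t], fun hs ↦ (isClear_of_le h).notMem_slitX hs.1⟩, rfl, rfl⟩

/-- Straight paths away from the dislocation lines. -/
theorem IsPassable.intrinsicEDist_straight_le (hK : P.IsPassable n K) {p q : P.Surface n} {B : ℝ}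
    (hp : p ∈ P.rectangle n) (hq : q ∈ P.rectangle n)
    (hx : ∀ x ∈ uIcc (p.1 0) (q.1 0), ∀ i < n, 2 * P.width n ≤ |x - P.center n i|)
    (hB : ∀ x ∈ uIcc (p.1 0) (q.1 0), P.rowHeight n x ≤ B) :
    intrinsicEDist (P.surface n) K p q ≤
      ENNReal.ofReal √((q.1 0 - p.1 0) ^ 2 + (B * (q.1 1 - p.1 1)) ^ 2) := by
  replace hp := (P.mem_rectangle_iff n).1 hp
  replace hq := (P.mem_rectangle_iff n).1 hq
  have hmem := fun s hs ↦ segmentPath_mem p.1 q.1 (s := s) hs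
  have hns : ∀ s ∈ Icc (0 : ℝ) 1, segmentPath p.1 q.1 s 0 ∉ P.slitX n := fun s hs ↦
    (isClear_of_le (hx _ (hmem s hs 0))).notMem_slitX
  refine intrinsicEDist_segment_le (fun s hs h ↦ hns s hs h.1) (fun s hs ↦ ?_)
    (fun s hs ↦ hB _ (hmem s hs 0)) fun s hs r hr ↦ ?_
  · have hcont : Continuous fun s ↦ segmentPath p.1 q.1 s 0 :=
      (PiLp.continuous_apply 2 _ 0).comp (continuous_segmentPath _ _)
    exact hcont.continuousAt.eventually (P.rowHeight_eventually_const n (hns s hs))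
  · refine hK.clear r ((P.mem_rectangle_iff n).2 ?_) (by rw [hr]; exact hx _ (hmem s hs 0))
    rw [hr]
    exact ⟨uIcc_subset_Icc hp.1 hq.1 (hmem s hs 0), uIcc_subset_Icc hp.2 hq.2 (hmem s hs 1)⟩

/-- `n²` times a bound for the diameters of the holes. -/
def holeDiam (P : DislocationData) : ℝ :=
  P.crossCost + (P.a + P.ε) * P.holeHeight + P.crossCost

theorem isOpen_hole (i j : ℕ) : IsOpen (P.hole n i j) := by
  have h0 : Continuous fun q : Model 2 ↦ q 0 := by fun_prop
  have h1 : Continuous fun q : Model 2 ↦ q 1 := by fun_prop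
  have hr : Continuous fun q : Model 2 ↦ P.rowHeight n (q 0) / P.smoothHeight n (q 0) :=
    ((P.continuous_rowHeight n).comp h0).div ((P.contDiff_smoothHeight n).continuous.comp h0)
      fun q ↦ (P.smoothHeight_pos n _).ne'
  exact isOpen_lt (((h0.sub continuous_const).pow 2).add (((continuous_const.max
    (continuous_const.sub ((continuous_const.sub (h1.sub continuous_const).abs).mul hr))).div_const
      _).pow 2)) continuous_const

theorem slit_subset_hole (i j : ℕ) : P.slit n i j ⊆ P.hole n i j := by
  rintro q ⟨hq0, hq1⟩
  have hw := P.width_pos n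
  rw [columnSlit_eq] at hq0
  have hs := P.smoothHeight_pos n (q 0)
  have h1 : 1 ≤ P.rowHeight n (q 0) / P.smoothHeight n (q 0) := by
    rw [one_le_div hs]; exact P.smoothHeight_le_rowHeight n _
  rw [mem_hole_iff, hq1, sub_self, abs_zero, sub_zero, one_mul, max_eq_left (by linarith), zero_div]
  have : |q 0 - P.center n i| ≤ P.width n := abs_le.2 ⟨by linarith [hq0.1], by linarith [hq0.2]⟩
  have h2 := pow_le_pow_left₀ (abs_nonneg _) this 2
  rw [sq_abs] at h2
  nlinarith

/-- Each summand in the equation is below (2w)², where w is the width of a dislocation line. With D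
the distance from the seam, u = ρ/h and c = `unevenness / n`, the second one gives 1 − (1−D)u < 2wn.
As u ≤ 1 + c, this forces D ≤ c + 2wn. -/
theorem IsFine.abs_sub_le_of_mem_hole (hf : P.IsFine n) {p : P.Surface n} (hp : p ∈ P.rectangle n)
    {i j : ℕ} (h : p.1 ∈ P.hole n i j) : |p.1 0 - P.center n i| ≤ 2 * P.width n ∧
      |p.1 1 - (2 * j + 1)| ≤ P.holeHeight / n := by
  have hn := cast_pos' n
  have hw := P.width_pos n
  have hs := P.smoothHeight_pos n (p.1 0)
  have hr := P.rowHeight_pos n (p.1 0)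
  have hu := hf.rowHeight_le_smoothHeight_mul ((P.mem_rectangle_iff n).1 hp).1
  rw [← div_le_iff₀' hs] at hu
  rw [mem_hole_iff] at h
  set u := P.rowHeight n (p.1 0) / P.smoothHeight n (p.1 0)
  have hu0 : 0 < u := div_pos hr hs
  constructor
  · rw [← sq_le_sq₀ (abs_nonneg _) (by linarith), sq_abs]
    nlinarith [sq_nonneg (max 0 (1 - (1 - |p.1 1 - (2 * j + 1)|) * u) / n)]
  · by_contra hD
    rw [not_le] at hD
    set D := |p.1 1 - (2 * (j : ℝ) + 1)|
    have hc : 0 ≤ P.unevenness / n := div_nonneg P.unevenness_pos.le hn.le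
    have hgap : (max 0 (1 - (1 - D) * u)) / n < 2 * P.width n := by
      rw [← sq_lt_sq₀ (by positivity) (by linarith)]
      nlinarith [sq_nonneg (p.1 0 - P.center n i)]
    rw [div_lt_iff₀ hn] at hgap
    have h1 : 1 - (1 - D) * u < 2 * P.width n * n := (le_max_right _ _).trans_lt hgap
    have h4 : 2 * P.width n * n = 2 * slitWidth P.θ P.ε / n := by
      rw [width_eq]; field_simp
    have hh : P.holeHeight / n = P.unevenness / n + 2 * slitWidth P.θ P.ε / n := by
      rw [holeHeight, add_div]
    have hsmall := hf.2
    have h5 : 0 < 1 - D := by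
      by_contra h5
      have : (1 - D) * u ≤ 0 := mul_nonpos_of_nonpos_of_nonneg (by linarith) hu0.le
      linarith
    have h6 := mul_le_mul_of_nonneg_left hu h5.le
    have h7 : (1 - D) * (1 + P.unevenness / n) ≤ (1 - P.holeHeight / n) * (1 + P.unevenness / n) :=
      mul_le_mul_of_nonneg_right (by linarith) (by linarith)
    have hs0 : 0 ≤ 2 * slitWidth P.θ P.ε / n := by
      have := P.slitWidth_pos P.ε_pos; positivity
    rw [hh] at h7
    rw [h4] at h1
    nlinarith [mul_nonneg hc hc, mul_nonneg hc hs0]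

/-- Two points of a hole are joined by going horizontally to the left margin of the column, along
this margin, and back at the height of the second point. The distance is the one of the whole
rectangle, so it does not matter that these paths start and end in the hole. -/
theorem IsVeryFine.isPerforated (hf : P.IsVeryFine n) :
    P.IsPerforated n (P.holeDiam / n ^ 2) (P.perforatedSurface n) := by
  have hn := cast_pos' n
  have hw := P.width_pos n
  refine ⟨fun i j ↦ P.hole n i j, fun i j ↦ ⟨isOpen_hole _ _, slit_subset_hole _ _,
    fun x y hx hy hxh hyh ↦ ?_⟩, rfl⟩
  have hK := isPassable_rectangle P n
  obtain ⟨hx0, hx1⟩ := hf.1.abs_sub_le_of_mem_hole hx hxh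
  obtain ⟨hy0, hy1⟩ := hf.1.abs_sub_le_of_mem_hole hy hyh
  have hclear : ∀ k < n, 2 * P.width n ≤ |P.center n i - 2 * P.width n - P.center n k| := by
    intro k _
    by_cases hik : (i : ℕ) = k
    · rw [hik, show P.center n k - 2 * P.width n - P.center n k = -(2 * P.width n) by ring, abs_neg]
      exact le_abs_self _
    · have h1 := P.bBlock_le_abs_center_sub n hik
      have h2 := abs_sub_abs_le_abs_sub (P.center n i - P.center n k) (2 * P.width n)
      rw [abs_of_pos (show 0 < 2 * P.width n by linarith)] at h2
      rw [show P.center n i - 2 * P.width n - P.center n k =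
        P.center n i - P.center n k - 2 * P.width n by ring]
      linarith [hf.1.1]
  obtain ⟨p, hp0, hp1⟩ := exists_surface_point hclear (x.1 1)
  obtain ⟨q, hq0, hq1⟩ := exists_surface_point hclear (y.1 1)
  obtain ⟨hb0, hb1⟩ := hf.1.center_mem i.2
  have hpK : p ∈ P.rectangle n := (P.mem_rectangle_iff n).2
    ⟨by rw [hp0]; exact ⟨by linarith, by linarith⟩, by rw [hp1]; exact ((P.mem_rectangle_iff n).1 hx).2⟩
  have hqK : q ∈ P.rectangle n := (P.mem_rectangle_iff n).2
    ⟨by rw [hq0]; exact ⟨by linarith, by linarith⟩, by rw [hq1]; exact ((P.mem_rectangle_iff n).1 hy).2⟩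
  have hside : |P.center n i - 2 * P.width n - P.center n i| ≤ 2 * P.width n := by
    rw [show P.center n i - 2 * P.width n - P.center n i = -(2 * P.width n) by ring, abs_neg,
      abs_of_pos (by linarith)]
  have d1 := hf.intrinsicEDist_cross_le hK hx hpK i.2 hx0 (by rw [hp0]; exact hside) hp1
  have d3 := hf.intrinsicEDist_cross_le hK hqK hy i.2 (by rw [hq0]; exact hside) hy0 hq1.symm
  have d2 := hK.intrinsicEDist_straight_le (B := (P.a + P.ε) / (2 * n)) hpK hqK (fun z hz ↦ by
    rw [hp0, hq0, uIcc_self] at hz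
    rw [mem_singleton_iff.1 hz]; exact hclear) fun z _ ↦ P.rowHeight_le n z
  have ha := P.a_pos; have hε := P.ε_pos
  have hh := P.unevenness_pos.trans P.unevenness_lt_holeHeight
  have d2' : √((q.1 0 - p.1 0) ^ 2 + ((P.a + P.ε) / (2 * n) * (q.1 1 - p.1 1)) ^ 2) ≤
      (P.a + P.ε) * P.holeHeight / n ^ 2 := by
    rw [hp0, hq0, sub_self, zero_pow two_ne_zero, zero_add, Real.sqrt_sq_eq_abs, abs_mul,
      abs_of_pos (by positivity), hp1, hq1]
    have : |y.1 1 - x.1 1| ≤ 2 * (P.holeHeight / n) := by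
      refine (abs_sub_le _ (2 * (j : ℕ) + 1 : ℝ) _).trans ?_
      rw [abs_sub_comm _ (x.1 1)]; linarith
    refine (mul_le_mul_of_nonneg_left this (by positivity)).trans (le_of_eq ?_)
    field_simp
  have hc := P.crossCost_pos
  have := intrinsicEDist_le_add_add (W := P.surface n) (by positivity) (by positivity) (by positivity)
    d1 (d2.trans (ENNReal.ofReal_le_ofReal d2')) d3
  rw [← add_div, ← add_div] at this
  exact this

/-- The abscissa `x` lies between the columns `g - 1` and `g` of dislocation lines. -/
def InZone (P : DislocationData) (n g : ℕ) (x : ℝ) : Prop :=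
  ∀ i < n, (i < g → P.center n i + 2 * P.width n ≤ x) ∧ (g ≤ i → x ≤ P.center n i - 2 * P.width n)

omit [NeZero n] in
theorem InZone.le_abs_sub {g : ℕ} {x : ℝ} (h : P.InZone n g x) (i : ℕ) (hi : i < n) :
    2 * P.width n ≤ |x - P.center n i| := by
  rcases lt_or_ge i g with hg | hg
  · exact (by linarith [(h i hi).1 hg] : _ ≤ x - P.center n i).trans (le_abs_self _)
  · exact (by linarith [(h i hi).2 hg] : _ ≤ -(x - P.center n i)).trans (neg_le_abs _)

omit [NeZero n] in
theorem InZone.of_mem_uIcc {g : ℕ} {x y z : ℝ} (hx : P.InZone n g x) (hy : P.InZone n g y)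
    (hz : z ∈ uIcc x y) : P.InZone n g z := by
  intro i hi
  exact ⟨fun h ↦ (le_inf ((hx i hi).1 h) ((hy i hi).1 h)).trans hz.1,
    fun h ↦ hz.2.trans (sup_le ((hx i hi).2 h) ((hy i hi).2 h))⟩

theorem center_add_bBlock_le {i k : ℕ} (h : i < k) :
    P.center n i + P.bBlock n ≤ P.center n k := by
  have hb := P.bBlock_pos n
  have h1 := P.center_sub n k i
  have h2 : (1 : ℝ) ≤ (k : ℝ) - i := by
    have : (i : ℝ) + 1 ≤ k := by exact_mod_cast h
    linarith
  nlinarith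

theorem IsFine.inZone_left (hf : P.IsFine n) {g : ℕ} :
    P.InZone n g (P.center n g - 2 * P.width n) := by
  have hw := P.width_pos n
  have hb := P.bBlock_pos n
  intro i _
  refine ⟨fun h ↦ by linarith [center_add_bBlock_le (P := P) (n := n) h, hf.1], fun h ↦ ?_⟩
  rcases h.eq_or_lt with rfl | h
  · exact le_rfl
  · linarith [center_add_bBlock_le (P := P) (n := n) h]

theorem IsFine.inZone_right (hf : P.IsFine n) {g : ℕ} :
    P.InZone n (g + 1) (P.center n g + 2 * P.width n) := by
  have hw := P.width_pos n
  have hb := P.bBlock_pos n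
  intro i _
  refine ⟨fun h ↦ ?_, fun h ↦ by linarith [center_add_bBlock_le (P := P) (n := n) h, hf.1]⟩
  rcases (Nat.lt_succ_iff.1 h).eq_or_lt with rfl | h
  · exact le_rfl
  · linarith [center_add_bBlock_le (P := P) (n := n) h]

theorem exists_inZone {x : ℝ} (h : ∀ i < n, 2 * P.width n ≤ |x - P.center n i|) :
    ∃ g ≤ n, P.InZone n g x := by
  classical
  have hw := P.width_pos n
  have hb := P.bBlock_pos n
  -- The zone is the least index from which on all columns are to the right of `x`. By minimality
  -- the preceding column is to the left, and so are all the earlier ones.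
  have hex : ∃ g, ∀ i < n, g ≤ i → x ≤ P.center n i - 2 * P.width n :=
    ⟨n, fun i hi hi' ↦ absurd hi (by omega)⟩
  refine ⟨Nat.find hex, Nat.find_min' hex fun i hi hi' ↦ absurd hi (by omega), fun i hi ↦
    ⟨fun hig ↦ ?_, fun hig ↦ Nat.find_spec hex i hi hig⟩⟩
  have hmin := Nat.find_min hex hig
  push Not at hmin
  obtain ⟨k, hk, hik, hkx⟩ := hmin
  have h1 : P.center n k + 2 * P.width n ≤ x := by
    rcases le_abs'.1 (h k hk) with h2 | h2 <;> linarith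
  rcases hik.eq_or_lt with rfl | hik
  · exact h1
  · linarith [center_add_bBlock_le (P := P) (n := n) hik]

/-- Paths that cross several columns of dislocation lines. -/
theorem IsVeryFine.intrinsicEDist_zones_le (hf : P.IsVeryFine n) (hK : P.IsPassable n K)
    {q : P.Surface n} (hq : q ∈ P.rectangle n) {B : ℝ} (k : ℕ) :
    ∀ (g : ℕ) (p : P.Surface n), p ∈ P.rectangle n → g + k ≤ n → P.InZone n g (p.1 0) →
      P.InZone n (g + k) (q.1 0) → (∀ x ∈ uIcc (p.1 0) (q.1 0), P.rowHeight n x ≤ B) →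
      intrinsicEDist (P.surface n) K p q ≤ ENNReal.ofReal
        (√((q.1 0 - p.1 0) ^ 2 + (B * (q.1 1 - p.1 1)) ^ 2) + k * (P.crossCost / n ^ 2)) := by
  have hn := cast_pos' n
  have hw := P.width_pos n
  have hc := P.crossCost_pos
  induction k with
  | zero =>
    intro g p hp _ hpg hqg hB
    refine (hK.intrinsicEDist_straight_le hp hq (fun x hx ↦ (hpg.of_mem_uIcc hqg hx).le_abs_sub)
      hB).trans (ENNReal.ofReal_le_ofReal (by simp))
  | succ k ih =>
    intro g p hp hgk hpg hqg hB
    have hgn : g < n := by omega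
    have hp0 := (hpg g hgn).2 le_rfl
    have hq0 := (hqg g hgn).1 (by omega)
    replace hp' := (P.mem_rectangle_iff n).1 hp
    replace hq' := (P.mem_rectangle_iff n).1 hq
    have hΔ : 0 < q.1 0 - p.1 0 := by linarith
    -- The segment from `p` to `q` reaches the left margin of the next column at the parameter
    -- `lam`. From there the column is crossed horizontally, and the induction hypothesis covers the
    -- rest.
    set lam := (P.center n g - 2 * P.width n - p.1 0) / (q.1 0 - p.1 0) with hlam
    have hlamΔ : lam * (q.1 0 - p.1 0) = P.center n g - 2 * P.width n - p.1 0 :=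
      div_mul_cancel₀ _ hΔ.ne'
    have hlam0 : 0 ≤ lam := div_nonneg (by linarith) hΔ.le
    have hlam1 : lam ≤ 1 := by rw [hlam, div_le_one hΔ]; linarith
    obtain ⟨u, hu0, hu1⟩ := exists_surface_point (n := n) (P := P)
      (hf.1.inZone_left (g := g)).le_abs_sub (p.1 1 + lam * (q.1 1 - p.1 1))
    obtain ⟨v, hv0, hv1⟩ := exists_surface_point (n := n) (P := P)
      (hf.1.inZone_right (g := g)).le_abs_sub (p.1 1 + lam * (q.1 1 - p.1 1))
    have ht : p.1 1 + lam * (q.1 1 - p.1 1) ∈ Icc 0 (2 * n : ℝ) :=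
      ⟨by nlinarith [hp'.2.1, hq'.2.1], by nlinarith [hp'.2.2, hq'.2.2]⟩
    have hu : u ∈ P.rectangle n := (P.mem_rectangle_iff n).2 ⟨by
      rw [hu0]; exact ⟨by linarith [hp'.1.1], by linarith [hq'.1.2]⟩, by rw [hu1]; exact ht⟩
    have hv : v ∈ P.rectangle n := (P.mem_rectangle_iff n).2 ⟨by
      rw [hv0]; exact ⟨by linarith [hp'.1.1], by linarith [hq'.1.2]⟩, by rw [hv1]; exact ht⟩
    have huz : P.InZone n g (u.1 0) := by rw [hu0]; exact hf.1.inZone_left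
    have hvz : P.InZone n (g + 1) (v.1 0) := by rw [hv0]; exact hf.1.inZone_right
    have hpq : uIcc (p.1 0) (q.1 0) = Icc (p.1 0) (q.1 0) := uIcc_of_le (by linarith)
    rw [hpq] at hB
    have d1 := hK.intrinsicEDist_straight_le (B := B) hp hu
      (fun x hx ↦ (hpg.of_mem_uIcc huz hx).le_abs_sub) (fun x hx ↦ hB x (by
        rw [hu0, uIcc_of_le hp0] at hx
        exact ⟨hx.1, by linarith [hx.2]⟩))
    have d2 := hf.intrinsicEDist_cross_le hK (hK.clear u hu huz.le_abs_sub)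
      (hK.clear v hv hvz.le_abs_sub) hgn
      (by rw [hu0, show P.center n g - 2 * P.width n - P.center n g = -(2 * P.width n) by ring,
        abs_neg, abs_of_pos (by linarith)])
      (by rw [hv0, add_sub_cancel_left, abs_of_pos (by linarith)]) (by rw [hu1, hv1])
    have d3 := ih (g + 1) v hv (by omega) hvz (by rwa [add_assoc, add_comm 1 k])
      (fun x hx ↦ hB x (by
        rw [hv0, uIcc_of_le hq0] at hx
        exact ⟨by linarith [hx.1], hx.2⟩))
    have hS0 := Real.sqrt_nonneg ((q.1 0 - p.1 0) ^ 2 + (B * (q.1 1 - p.1 1)) ^ 2)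
    have hSq := Real.sq_sqrt (show 0 ≤ (q.1 0 - p.1 0) ^ 2 + (B * (q.1 1 - p.1 1)) ^ 2 by positivity)
    set S := √((q.1 0 - p.1 0) ^ 2 + (B * (q.1 1 - p.1 1)) ^ 2) with hS
    have e1 : √((u.1 0 - p.1 0) ^ 2 + (B * (u.1 1 - p.1 1)) ^ 2) ≤ lam * S := by
      refine (Real.sqrt_le_left (mul_nonneg hlam0 hS0)).2 (le_of_eq ?_)
      rw [hu0, hu1, mul_pow lam S, hSq, ← hlamΔ]; ring
    -- The crossing has only shortened the remaining horizontal distance, so the new segment is at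
    -- most the fraction `1 - lam` of the original one.
    have e3 : √((q.1 0 - v.1 0) ^ 2 + (B * (q.1 1 - v.1 1)) ^ 2) ≤ (1 - lam) * S := by
      refine (Real.sqrt_le_left (mul_nonneg (by linarith) hS0)).2 ?_
      rw [hv0, hv1, mul_pow (1 - lam) S, hSq]
      have h1 : q.1 0 - (P.center n g + 2 * P.width n) ≤ (1 - lam) * (q.1 0 - p.1 0) := by
        rw [sub_mul, hlamΔ]; linarith
      have h2 := pow_le_pow_left₀ (by linarith) h1 2
      nlinarith
    have := intrinsicEDist_le_add_add (W := P.surface n) (mul_nonneg hlam0 hS0) (by positivity)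
      (by have := mul_nonneg (show 0 ≤ 1 - lam by linarith) hS0; positivity)
      (d1.trans (ENNReal.ofReal_le_ofReal e1)) d2
      (d3.trans (ENNReal.ofReal_le_ofReal (add_le_add_left e3 _)))
    refine this.trans (ENNReal.ofReal_le_ofReal (le_of_eq ?_))
    push_cast; ring

end DislocationData

/-! ### Shadows: short distances in the sector and on the surface -/

namespace DislocationData

variable {P : DislocationData} {n : ℕ} [NeZero n] {K : Set (P.surface n).carrier}

/-- At most `n` columns are crossed, at a cost of `crossCost / n ^ 2` each. -/
theorem IsVeryFine.intrinsicEDist_clear_le (hf : P.IsVeryFine n) (hK : P.IsPassable n K)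
    {p q : P.Surface n} (hp : p ∈ P.rectangle n) (hq : q ∈ P.rectangle n)
    (hp' : ∀ i < n, 2 * P.width n ≤ |p.1 0 - P.center n i|)
    (hq' : ∀ i < n, 2 * P.width n ≤ |q.1 0 - P.center n i|) {B : ℝ}
    (hB : ∀ x ∈ uIcc (p.1 0) (q.1 0), P.rowHeight n x ≤ B) :
    intrinsicEDist (P.surface n) K p q ≤ ENNReal.ofReal
      (√((q.1 0 - p.1 0) ^ 2 + (B * (q.1 1 - p.1 1)) ^ 2) + P.crossCost / n) := by
  have hn := cast_pos' n
  have hc := P.crossCost_pos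
  obtain ⟨g, hg, hpg⟩ := exists_inZone hp'
  obtain ⟨g', hg', hqg⟩ := exists_inZone hq'
  have hk : ∀ k ≤ n, k * (P.crossCost / n ^ 2) ≤ P.crossCost / n := by
    intro k hk
    have : (k : ℝ) ≤ n := by exact_mod_cast hk
    refine (mul_le_mul_of_nonneg_right this (by positivity)).trans (le_of_eq ?_)
    field_simp
  rcases le_total g g' with h | h
  · obtain ⟨k, rfl⟩ := Nat.exists_eq_add_of_le h
    exact (hf.intrinsicEDist_zones_le hK hq k g p hp hg' hpg hqg hB).trans
      (ENNReal.ofReal_le_ofReal (add_le_add_right (hk k (by omega)) _))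
  · obtain ⟨k, rfl⟩ := Nat.exists_eq_add_of_le h
    refine (intrinsicEDist_comm (W := P.surface n) (K := K) p q).trans_le ?_
    refine (hf.intrinsicEDist_zones_le hK hp k g' q hq hg hqg hpg (by rwa [uIcc_comm])).trans
      (ENNReal.ofReal_le_ofReal (add_le_add (le_of_eq (congrArg _ ?_)) (hk k (by omega))))
    ring

open Classical in
/-- The abscissa `x`, moved to the right if it is near a column of dislocation lines. -/
def pushOut (P : DislocationData) (n : ℕ) (x : ℝ) : ℝ :=
  if h : ∃ i < n, |x - P.center n i| < 2 * P.width n then P.center n h.choose + 2 * P.width n else x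

omit [NeZero n] in
theorem pushOut_cases (x : ℝ) :
    (∃ i < n, |x - P.center n i| < 2 * P.width n ∧
      P.pushOut n x = P.center n i + 2 * P.width n) ∨
    ((∀ i < n, 2 * P.width n ≤ |x - P.center n i|) ∧ P.pushOut n x = x) := by
  by_cases h : ∃ i < n, |x - P.center n i| < 2 * P.width n
  · exact Or.inl ⟨h.choose, h.choose_spec.1, h.choose_spec.2, dif_pos h⟩
  · refine Or.inr ⟨?_, dif_neg h⟩
    push Not at h
    exact h

theorem IsFine.pushOut_clear (hf : P.IsFine n) (x : ℝ) :
    ∀ i < n, 2 * P.width n ≤ |P.pushOut n x - P.center n i| := by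
  rcases P.pushOut_cases (n := n) x with ⟨i, _, _, h⟩ | ⟨h, h'⟩
  · rw [h]; exact hf.inZone_right.le_abs_sub
  · rwa [h']

theorem IsFine.pushOut_mem (hf : P.IsFine n) {x : ℝ} (hx : x ∈ Icc 0 P.b) :
    P.pushOut n x ∈ Icc 0 P.b := by
  have hw := P.width_pos n
  rcases P.pushOut_cases (n := n) x with ⟨i, hi, _, h⟩ | ⟨h, h'⟩
  · have := hf.center_mem hi
    rw [h]; exact ⟨by linarith, by linarith⟩
  · rwa [h']

theorem abs_pushOut_sub_le (x : ℝ) : |P.pushOut n x - x| ≤ 4 * P.width n := by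
  have hw := P.width_pos n
  rcases P.pushOut_cases (n := n) x with ⟨i, _, h1, h⟩ | ⟨_, h'⟩
  · rw [h]; rw [abs_lt] at h1
    exact abs_le.2 ⟨by linarith, by linarith⟩
  · rw [h', sub_self, abs_zero]; linarith

/-- The point of the surface with the same coordinates as a point of the sector, moved away from the
dislocation lines. -/
def shadow (P : DislocationData) (n : ℕ) (x : PolarPlane.weitzenbock.carrier) : P.Surface n :=
  Surface.ofCoords P n !₂[P.pushOut n (PolarPlane.radius x - P.innerRadius),
    PolarPlane.coords x 1 / P.angleStep n]

theorem IsFine.shadow_val (hf : P.IsFine n) (x : PolarPlane.weitzenbock.carrier) :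
    (P.shadow n x).1 = !₂[P.pushOut n (PolarPlane.radius x - P.innerRadius),
      PolarPlane.coords x 1 / P.angleStep n] :=
  Surface.ofCoords_val P n fun hs ↦ (isClear_of_le (hf.pushOut_clear _)).notMem_slitX hs.1

theorem IsFine.shadow_mem (hf : P.IsFine n) {x : PolarPlane.weitzenbock.carrier}
    (hx : x ∈ P.sector) : P.shadow n x ∈ P.rectangle n := by
  refine (P.mem_rectangle_iff n).2 ?_
  rw [hf.shadow_val]
  obtain ⟨h0, h1⟩ := (P.mem_sector_iff n).1 hx
  exact ⟨hf.pushOut_mem h0, h1⟩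

theorem four_width_le (hf : P.IsFine n) : 8 * P.width n ≤ 1 / n := by
  rw [le_div_iff₀ (cast_pos' n)]; exact hf.2

/-- Changing the first component costs `e`; enlarging the radius from `ρ` to `R` costs the factor `R
/ ρ`. -/
theorem sqrt_sq_add_sq_le {X X' Z ℓ ρ R e : ℝ} (he : 0 ≤ e) (hX : |X'| ≤ |X| + e) (hρ : 0 < ρ)
    (hR : ρ ≤ R) (hℓ : 0 ≤ ℓ) (h : X ^ 2 + ρ ^ 2 * Z ^ 2 ≤ ℓ ^ 2) :
    √(X' ^ 2 + (R * Z) ^ 2) ≤ R / ρ * ℓ + e := by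
  have hR0 : 0 < R := hρ.trans_le hR
  have hs0 := Real.sqrt_nonneg (X ^ 2 + (R * Z) ^ 2)
  have hsq := Real.sq_sqrt (show 0 ≤ X ^ 2 + (R * Z) ^ 2 by positivity)
  have hsabs : |X| ≤ √(X ^ 2 + (R * Z) ^ 2) :=
    Real.abs_le_sqrt (le_add_of_nonneg_right (sq_nonneg _))
  have s1 : √(X' ^ 2 + (R * Z) ^ 2) ≤ √(X ^ 2 + (R * Z) ^ 2) + e := by
    refine (Real.sqrt_le_left (by positivity)).2 ?_
    have h1 := pow_le_pow_left₀ (abs_nonneg _) hX 2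
    rw [sq_abs] at h1
    have h2 : |X| ^ 2 = X ^ 2 := sq_abs _
    nlinarith [mul_le_mul_of_nonneg_left hsabs he]
  have s2 : √(X ^ 2 + (R * Z) ^ 2) ≤ R / ρ * ℓ := by
    refine (Real.sqrt_le_left (by positivity)).2 ?_
    have h1 : 1 ≤ (R / ρ) ^ 2 := one_le_pow₀ ((one_le_div hρ).2 hR)
    have h2 : (R * Z) ^ 2 = (R / ρ) ^ 2 * (ρ ^ 2 * Z ^ 2) := by field_simp
    have h4 := le_mul_of_one_le_left (sq_nonneg X) h1
    have h5 := mul_le_mul_of_nonneg_left h (sq_nonneg (R / ρ))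
    rw [mul_add] at h5
    rw [h2, mul_pow]
    linarith
  linarith

/-- The error in the comparison of short distances in the sector and on the surface. -/
def localError (P : DislocationData) (n : ℕ) (ℓ : ℝ) : ℝ :=
  2 / P.innerRadius * (2 * ℓ + (1 + P.b) / n) * ℓ + (1 + P.crossCost) / n

/-- A path of length ℓ starting at radius r satisfies Δr² + (r−ℓ)²Δφ² ≤ ℓ². On the surface the
heights along the segment between the shadows are at most κR′ with R′ = r + ℓ + O(1/n), so the
length grows at most by the factor R′/(r−ℓ), apart from the moves away from the columns and the
crossings. -/
theorem IsVeryFine.intrinsicEDist_shadow_le (hf : P.IsVeryFine n) (hK : P.IsPassable n K)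
    {x y : PolarPlane.weitzenbock.carrier} (hx : x ∈ P.sector) (hy : y ∈ P.sector) {ℓ : ℝ}
    (hℓ0 : 0 ≤ ℓ) (hℓ : ℓ ≤ P.innerRadius / 2)
    (h : intrinsicEDist PolarPlane.weitzenbock P.sector x y < ENNReal.ofReal ℓ) :
    intrinsicEDist (P.surface n) K (P.shadow n x) (P.shadow n y) ≤
      ENNReal.ofReal (ℓ + P.localError n ℓ) := by
  have hn := cast_pos' n
  have hw := P.width_pos n
  have hκ := P.angleStep_pos n
  have hb := P.b_pos
  have hε := P.ε_pos
  have hR := P.innerRadius_pos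
  have hx' := sector_coords_mem hx
  have hy' := sector_coords_mem hy
  have hxs := (P.mem_sector_iff n).1 hx
  have hys := (P.mem_sector_iff n).1 hy
  obtain ⟨hr, hlen⟩ := coords_sub_le_of_intrinsicEDist_lt h (by linarith [hx'.1.1])
  have hw4 := four_width_le hf.1
  set rx := PolarPlane.radius x with hrx
  set ry := PolarPlane.radius y with hry
  set Δ := PolarPlane.coords y 1 - PolarPlane.coords x 1 with hΔ
  -- `ℓ` bounds the increase of the radius, `1/n` exceeds the displacement by `pushOut`, and `b/n`
  -- is the deviation ε_n/2 of the height of a half row divided by κ.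
  set R' := rx + ℓ + (1 + P.b) / n with hR'
  set e := (1 : ℝ) / n with he
  have he0 : 0 < e := by positivity
  have hR'e : R' = rx + ℓ + e + P.b / n := by rw [hR', he]; ring
  have hB : ∀ z ∈ uIcc ((P.shadow n x).1 0) ((P.shadow n y).1 0),
      P.rowHeight n z ≤ P.angleStep n * R' := by
    intro z hz
    rw [hf.1.shadow_val, hf.1.shadow_val] at hz
    simp only [Matrix.cons_val_zero] at hz
    have hzb : z ∈ Icc 0 P.b :=
      uIcc_subset_Icc (hf.1.pushOut_mem hxs.1) (hf.1.pushOut_mem hys.1) hz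
    have h1 := abs_le.1 (IsFine.abs_rowHeight_sub_le P hf.1 hzb)
    have h2 : z ≤ rx + ℓ - P.innerRadius + 4 * P.width n := by
      refine hz.2.trans (sup_le ?_ ?_)
      · have := (abs_le.1 (P.abs_pushOut_sub_le (n := n) (rx - P.innerRadius))).2
        linarith
      · have := (abs_le.1 (P.abs_pushOut_sub_le (n := n) (ry - P.innerRadius))).2
        have := (abs_le.1 hr).2
        linarith
    have h3 : P.εBlock n / 2 = P.angleStep n * (P.b / n) := by
      rw [εBlock, angleStep]; field_simp
    have h4 : P.angleStep n * (P.innerRadius + z) ≤ P.angleStep n * (rx + ℓ + e) :=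
      mul_le_mul_of_nonneg_left (by linarith) hκ.le
    rw [hR'e, mul_add, ← h3]
    linarith
  have hmain := hf.intrinsicEDist_clear_le hK (hf.1.shadow_mem hx) (hf.1.shadow_mem hy)
    (by rw [hf.1.shadow_val]; exact hf.1.pushOut_clear _)
    (by rw [hf.1.shadow_val]; exact hf.1.pushOut_clear _) hB
  refine hmain.trans (ENNReal.ofReal_le_ofReal ?_)
  rw [hf.1.shadow_val, hf.1.shadow_val]
  simp only [Matrix.cons_val_zero, Matrix.cons_val_one, Matrix.cons_val_fin_one]
  have e1 : P.angleStep n * R' * (PolarPlane.coords y 1 / P.angleStep n -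
      PolarPlane.coords x 1 / P.angleStep n) = R' * Δ := by
    rw [hΔ]; field_simp
  rw [e1]
  have hx1 : |P.pushOut n (ry - P.innerRadius) - P.pushOut n (rx - P.innerRadius)| ≤
      |ry - rx| + e := by
    have h1 := abs_le.1 (P.abs_pushOut_sub_le (n := n) (rx - P.innerRadius))
    have h2 := abs_le.1 (P.abs_pushOut_sub_le (n := n) (ry - P.innerRadius))
    have h3 := le_abs_self (ry - rx)
    have h4 := neg_abs_le (ry - rx)
    exact abs_le.2 ⟨by linarith, by linarith⟩
  have hR'0 : 0 < R' := by
    rw [hR'e]; have := hx'.1.1; have : 0 ≤ P.b / n := by positivity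
    linarith
  have hrm : 0 < rx - ℓ := by linarith [hx'.1.1]
  have hrm2 : P.innerRadius / 2 ≤ rx - ℓ := by linarith [hx'.1.1]
  have hRr : rx - ℓ ≤ R' := by
    rw [hR'e]; have : 0 ≤ P.b / n := by positivity
    linarith
  have s2 := sqrt_sq_add_sq_le he0.le hx1 hrm hRr hℓ0 hlen
  have s3 : R' / (rx - ℓ) ≤ 1 + 2 / P.innerRadius * (2 * ℓ + (1 + P.b) / n) := by
    have h1 : R' / (rx - ℓ) = 1 + (2 * ℓ + (1 + P.b) / n) / (rx - ℓ) := by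
      rw [hR']; field_simp; ring
    rw [h1]
    have : (2 * ℓ + (1 + P.b) / n) / (rx - ℓ) ≤ (2 * ℓ + (1 + P.b) / n) / (P.innerRadius / 2) := by
      gcongr
    refine (add_le_add_right this 1).trans (le_of_eq ?_)
    field_simp
  have s4 := mul_le_mul_of_nonneg_right s3 hℓ0
  have hee : (1 + P.crossCost) / n = e + P.crossCost / n := by rw [he]; ring
  rw [localError, hee]
  linarith

/-- Distances on the surface are not much larger than those in the sector. -/
theorem IsVeryFine.intrinsicEDist_shadow_le_of_lt (hf : P.IsVeryFine n) (hK : P.IsPassable n K)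
    {x y : PolarPlane.weitzenbock.carrier} {r : ℝ} (hr : 0 ≤ r) {m : ℕ} (hm : 0 < m)
    (hrm : r / m ≤ P.innerRadius / 2)
    (h : intrinsicEDist PolarPlane.weitzenbock P.sector x y < ENNReal.ofReal r) :
    intrinsicEDist (P.surface n) K (P.shadow n x) (P.shadow n y) ≤
      ENNReal.ofReal (r + m * P.localError n (r / m)) := by
  have hR := P.innerRadius_pos
  have hb := P.b_pos
  have hc := P.crossCost_pos
  have hm0 : (0 : ℝ) < m := by exact_mod_cast hm
  have hr0 : 0 ≤ r / m := by positivity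
  have hδ : 0 ≤ r / m + P.localError n (r / m) := by
    unfold localError; positivity
  refine (intrinsicEDist_le_of_local (W' := P.surface n) (K' := K) (S := P.shadow n) hm hδ h
    fun z hz z' hz' hzz ↦ hf.intrinsicEDist_shadow_le hK hz hz' hr0 hrm hzz).trans
    (ENNReal.ofReal_le_ofReal (le_of_eq ?_))
  field_simp

end DislocationData

/-! ### Upper bound for distances on the perforated surface -/

namespace DislocationData

variable {P : DislocationData} {n : ℕ} [NeZero n]

/-- `n²` times the distance from a point of the perforated surface to the shadow of its preimage. -/
def shadowCost (P : DislocationData) : ℝ := P.crossCost + (P.a + P.ε) * P.unevenness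

theorem shadowCost_pos (P : DislocationData) : 0 < P.shadowCost := by
  have := P.crossCost_pos; have := P.a_pos; have := P.ε_pos; have := P.unevenness_pos
  unfold shadowCost; positivity

theorem abs_stretch_sub_le {u τ c : ℝ} (hu : u ≤ 1) (hc : 1 - u ≤ c) :
    |stretch u τ - τ| ≤ c := by
  have h1 : stretch u τ - τ = -((τ - 2 * round (τ / 2)) * (1 - u)) := by rw [stretch]; ring
  have h2 : 0 ≤ 1 - u := by linarith
  rw [h1, abs_neg, abs_mul, abs_of_nonneg h2]
  exact (mul_le_of_le_one_left h2 (abs_sub_round_half_le τ)).trans hc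

/-- Within a half row the height is multiplied by h/ρ, which is at least `1 - unevenness / n`. -/
theorem IsFine.abs_unroll_sub_le (hf : P.IsFine n) {q : Model 2}
    (hq : q 0 - P.innerRadius ∈ Icc 0 P.b) :
    |P.unroll n q 1 - q 1 / P.angleStep n| ≤ P.unevenness / n := by
  have hr := P.rowHeight_pos n (q 0 - P.innerRadius)
  have hs := P.smoothHeight_pos n (q 0 - P.innerRadius)
  have h1 := P.smoothHeight_le_rowHeight n (q 0 - P.innerRadius)
  have h2 := hf.rowHeight_le_smoothHeight_mul hq
  have hu : 0 ≤ P.unevenness / n := div_nonneg P.unevenness_pos.le (cast_pos' n).le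
  refine abs_stretch_sub_le ((div_le_one hr).2 h1) ?_
  rw [sub_le_comm, le_div_iff₀ hr]
  nlinarith [mul_le_mul_of_nonneg_left h1 hu]

/-- Away from the columns the two points coincide. Otherwise the image is moved to the right margin
of its column at constant height, and then vertically by at most `unevenness / n` half rows. -/
theorem IsVeryFine.intrinsicEDist_unrollMap_shadow_le (hf : P.IsVeryFine n)
    {p : PolarPlane.weitzenbock.carrier} (hp : p ∈ P.perforatedSector n) :
    intrinsicEDist (P.surface n) (P.perforatedSurface n) (P.unrollMap n p) (P.shadow n p) ≤
      ENNReal.ofReal (P.shadowCost / n ^ 2) := by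
  have hn := cast_pos' n
  have hw := P.width_pos n
  have hK := hf.1.isPassable
  have hFK : P.unrollMap n p ∈ P.perforatedSurface n := hf.1.unrollMap_mem hp
  have hs : p ∈ P.sector := hp.1
  have hsm := (P.mem_sector_iff n).1 hs
  have hshadow := hf.1.shadow_mem hs
  have hval : (P.unrollMap n p).1 = P.unroll n p.1 := by
    obtain ⟨j, hj⟩ := exists_polarDomain_of_mem hp
    exact unrollMap_val hj
  have hsv := hf.1.shadow_val p
  have hrad : PolarPlane.radius p = p.1 0 := rfl
  have hco : PolarPlane.coords p 1 = p.1 1 := rfl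
  rw [hrad, hco] at hsv
  rcases P.pushOut_cases (n := n) (p.1 0 - P.innerRadius) with ⟨i, hi, h1, h2⟩ | ⟨h1, h2⟩
  · have hclear : ∀ k < n, 2 * P.width n ≤ |P.center n i + 2 * P.width n - P.center n k| := by
      rw [← h2]; exact hf.1.pushOut_clear _
    obtain ⟨r, hr0, hr1⟩ := exists_surface_point hclear ((P.unrollMap n p).1 1)
    have hrr : r ∈ P.rectangle n := by
      refine (P.mem_rectangle_iff n).2 ⟨?_, ?_⟩
      · rw [hr0, ← h2]; exact hf.1.pushOut_mem hsm.1
      · rw [hr1]; exact ((P.mem_rectangle_iff n).1 (hK.subset _ hFK)).2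
    have hrK : r ∈ P.perforatedSurface n := hK.clear r hrr (by rw [hr0]; exact hclear)
    have hF0 : (P.unrollMap n p).1 0 = p.1 0 - P.innerRadius := by rw [hval]; rfl
    have hs0 : (P.shadow n p).1 0 = P.center n i + 2 * P.width n := by
      rw [hsv, ← h2]; rfl
    have hs1 : (P.shadow n p).1 1 = p.1 1 / P.angleStep n := by rw [hsv]; rfl
    have d1 := hf.intrinsicEDist_cross_le hK hFK hrK hi (by rw [hF0]; exact h1.le)
      (by rw [hr0, add_sub_cancel_left, abs_of_pos (by linarith)]) hr1
    have hsingle : ∀ x ∈ uIcc (r.1 0) ((P.shadow n p).1 0), x = P.center n i + 2 * P.width n := by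
      intro x hx
      rw [hr0, hs0, uIcc_self] at hx
      exact hx
    have d2 := hK.intrinsicEDist_straight_le (B := (P.a + P.ε) / (2 * n)) hrr hshadow
      (fun x hx ↦ by rw [hsingle x hx]; exact hclear) (fun x _ ↦ P.rowHeight_le n x)
    have hcost : √(((P.shadow n p).1 0 - r.1 0) ^ 2 +
        ((P.a + P.ε) / (2 * n) * ((P.shadow n p).1 1 - r.1 1)) ^ 2) ≤
        (P.a + P.ε) * P.unevenness / n ^ 2 := by
      have := P.a_pos; have := P.ε_pos; have := P.unevenness_pos
      have h3 := hf.1.abs_unroll_sub_le hsm.1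
      rw [hs0, hr0, sub_self, hs1, hr1, hval]
      rw [zero_pow two_ne_zero, zero_add, Real.sqrt_sq_eq_abs, abs_mul, abs_sub_comm,
        abs_of_pos (by positivity)]
      refine (mul_le_mul_of_nonneg_left h3 (by positivity)).trans ?_
      rw [div_mul_div_comm, div_le_div_iff₀ (by positivity) (by positivity)]
      nlinarith [show 0 ≤ (P.a + P.ε) * P.unevenness * n ^ 2 by positivity]
    have hc := P.crossCost_pos
    have hcc : 0 ≤ (P.a + P.ε) * P.unevenness / n ^ 2 := (Real.sqrt_nonneg _).trans hcost
    refine (intrinsicEDist_triangle (W := P.surface n) (K := P.perforatedSurface n)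
      (P.unrollMap n p) r (P.shadow n p)).trans ?_
    refine (add_le_add d1 (d2.trans (ENNReal.ofReal_le_ofReal hcost))).trans (le_of_eq ?_)
    rw [← ENNReal.ofReal_add (by positivity) hcc, shadowCost, add_div]
  · have heq : P.unrollMap n p = P.shadow n p := by
      apply Subtype.ext
      rw [hval, hsv, unroll_of_isClear (isClear_of_le h1), h2]
    have := intrinsicEDist_self (W := P.surface n) (K := P.perforatedSurface n) hFK
    refine (le_of_eq ?_).trans zero_le
    rw [← heq]
    exact this

/-- Distances on the perforated surface are not much larger than those in the sector. -/
theorem eventually_intrinsicEDist_unrollMap_le (P : DislocationData) {η : ℝ} (hη : 0 < η) :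
    ∀ᶠ n : ℕ in atTop, P.IsVeryFine (n + 1) → ∀ p ∈ P.perforatedSector (n + 1),
      ∀ q ∈ P.perforatedSector (n + 1),
      intrinsicEDist (P.surface (n + 1)) (P.perforatedSurface (n + 1)) (P.unrollMap (n + 1) p)
        (P.unrollMap (n + 1) q) ≤
      intrinsicEDist PolarPlane.weitzenbock P.sector p q + ENNReal.ofReal η := by
  have hR := P.innerRadius_pos
  have hb := P.b_pos
  have hD := P.sectorDiam_pos
  have hc := P.shadowCost_pos
  have hcc := P.crossCost_pos
  set D := P.sectorDiam + η with hDdef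
  -- The number `m` of pieces is fixed before `n`. The quadratic part of the local errors adds up to
  -- 4r²/(R₀m), which is made small by `m`; the remaining errors are O(m/n) and disappear as `n`
  -- grows.
  obtain ⟨m, hm, hmR, hmη⟩ : ∃ m : ℕ, 0 < m ∧ D / m ≤ P.innerRadius / 2 ∧
      4 / P.innerRadius * D ^ 2 / m ≤ η / 4 := by
    have t1 : Tendsto (fun m : ℕ ↦ D / m) atTop (𝓝 0) :=
      tendsto_const_div_atTop_nhds_zero_nat D
    have t2 : Tendsto (fun m : ℕ ↦ 4 / P.innerRadius * D ^ 2 / m) atTop (𝓝 0) :=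
      tendsto_const_div_atTop_nhds_zero_nat _
    obtain ⟨m, h1, h2, h3⟩ := ((t1.eventually_le_const (half_pos hR)).and
      ((t2.eventually_le_const (by positivity : 0 < η / 4)).and (eventually_gt_atTop 0))).exists
    exact ⟨m, h3, h1, h2⟩
  have hm0 : (0 : ℝ) < m := by exact_mod_cast hm
  have t3 : Tendsto (fun n : ℕ ↦ (2 / P.innerRadius * (1 + P.b) * D + m * (1 + P.crossCost)
      + 2 * P.shadowCost) / ((n + 1 : ℕ) : ℝ)) atTop (𝓝 0) :=
    (tendsto_const_div_atTop_nhds_zero_nat _).comp (tendsto_add_atTop_nat 1)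
  filter_upwards [t3.eventually_le_const (by positivity : 0 < η / 4)] with n hn hf p hp q hq
  have hN : (1 : ℝ) ≤ ((n + 1 : ℕ) : ℝ) := by exact_mod_cast Nat.succ_pos n
  set N : ℝ := ((n + 1 : ℕ) : ℝ) with hNdef
  have hps : p ∈ P.sector := hp.1
  have hqs : q ∈ P.sector := hq.1
  have hdD := P.intrinsicEDist_sector_le_sectorDiam hps hqs
  set d := intrinsicEDist PolarPlane.weitzenbock P.sector p q with hd
  have hdtop : d ≠ ⊤ := ne_top_of_le_ne_top ENNReal.ofReal_ne_top hdD
  -- A length slightly larger than the distance, so that there is a path which is shorter.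
  set r := d.toReal + η / 4 with hr
  have hr0 : 0 ≤ r := by positivity
  have hrD : r ≤ D := by
    have := ENNReal.toReal_le_of_le_ofReal hD.le hdD
    rw [hr, hDdef]; linarith
  have hlt : d < ENNReal.ofReal r := by
    rw [ENNReal.lt_ofReal_iff_toReal_lt hdtop]
    rw [hr]; linarith
  have hrm : r / m ≤ P.innerRadius / 2 := (div_le_div_of_nonneg_right hrD hm0.le).trans hmR
  have hmid := hf.intrinsicEDist_shadow_le_of_lt hf.1.isPassable hr0 hm hrm hlt
  have h1 := hf.intrinsicEDist_unrollMap_shadow_le hp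
  have h2 := (intrinsicEDist_comm (W := P.surface (n + 1)) (K := P.perforatedSurface (n + 1))
    (P.shadow (n + 1) q) (P.unrollMap (n + 1) q)).trans_le
      (hf.intrinsicEDist_unrollMap_shadow_le hq)
  have hle : 0 ≤ P.localError (n + 1) (r / m) := by unfold localError; positivity
  have hfinal := intrinsicEDist_le_add_add (by positivity) (by positivity) (by positivity) h1 hmid h2
  refine hfinal.trans ?_
  rw [← ENNReal.ofReal_toReal hdtop, ← ENNReal.ofReal_add ENNReal.toReal_nonneg hη.le]
  refine ENNReal.ofReal_le_ofReal ?_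
  have e1 : P.shadowCost / N ^ 2 ≤ P.shadowCost / N :=
    div_le_div_of_nonneg_left hc.le (by positivity) (by nlinarith)
  have e2 : m * P.localError (n + 1) (r / m) =
      4 / P.innerRadius * r ^ 2 / m + (2 / P.innerRadius * (1 + P.b) * r
        + m * (1 + P.crossCost)) / N := by
    rw [localError, ← hNdef]; field_simp
    ring
  have e3 : 4 / P.innerRadius * r ^ 2 / m ≤ η / 4 := by
    refine le_trans ?_ hmη
    gcongr
  have e4 : (2 / P.innerRadius * (1 + P.b) * r + m * (1 + P.crossCost)) / N
      + 2 * (P.shadowCost / N) ≤ η / 4 := by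
    refine le_trans (le_of_eq ?_) (le_trans (b := (2 / P.innerRadius * (1 + P.b) * r +
      m * (1 + P.crossCost) + 2 * P.shadowCost) / N) le_rfl (le_trans ?_ hn))
    · ring
    · gcongr
  rw [e2]
  rw [hr] at *
  linarith

end DislocationData

/-- A `C¹` approximation of the projection of the real line onto `[-1, 1]`. -/
structure IsSoftClamp (η : ℝ) (s : ℝ → ℝ) : Prop where
  contDiff : ContDiff ℝ 1 s
  deriv_nonneg : ∀ u, 0 ≤ deriv s u
  deriv_le : ∀ u, deriv s u ≤ 1
  deriv_eq_zero : ∀ u, 1 + η ≤ |u| → deriv s u = 0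
  eq_one : ∀ u, 1 + η ≤ u → s u = 1
  eq_neg_one : ∀ u, u ≤ -(1 + η) → s u = -1
  mem_of_nonneg : ∀ u, 0 ≤ u → s u ∈ Icc 0 1
  mem_of_nonpos : ∀ u, u ≤ 0 → s u ∈ Icc (-1) 0

/-- Integrate from 0 the even trapezoidal function that is 1 on [-1, 1] and vanishes outside of
[-1-η, 1+η], and divide by its integral `c` over [0, 1+η]. As `c ≥ 1`, the slope stays at most 1. -/
theorem exists_isSoftClamp {η : ℝ} (hη : 0 < η) : ∃ s, IsSoftClamp η s := by
  set w : ℝ → ℝ := fun v ↦ max 0 (min 1 ((1 + η - |v|) / η)) with hw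
  have hwc : Continuous w := by fun_prop
  have hw0 : ∀ v, 0 ≤ w v := fun v ↦ le_max_left _ _
  have hw1 : ∀ v, w v ≤ 1 := fun v ↦ max_le zero_le_one (min_le_left _ _)
  have hwz : ∀ v, 1 + η ≤ |v| → w v = 0 := fun v hv ↦ max_eq_left ((min_le_right _ _).trans
    (div_nonpos_of_nonpos_of_nonneg (by linarith) hη.le))
  have hwone : ∀ v, |v| ≤ 1 → w v = 1 := fun v hv ↦ by
    have : 1 ≤ (1 + η - |v|) / η := by rw [one_le_div hη]; linarith
    simp only [hw]; rw [min_eq_left this, max_eq_right zero_le_one]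
  have hwneg : ∀ v, w (-v) = w v := fun v ↦ by simp only [hw, abs_neg]
  have hint : ∀ a b, IntervalIntegrable w volume a b := fun a b ↦ hwc.intervalIntegrable a b
  set g : ℝ → ℝ := fun u ↦ ∫ v in (0 : ℝ)..u, w v with hg
  have hgd : ∀ u, HasDerivAt g (w u) u := fun u ↦
    intervalIntegral.integral_hasDerivAt_right (hint 0 u)
      hwc.stronglyMeasurable.stronglyMeasurableAtFilter hwc.continuousAt
  have hgneg : ∀ u, g (-u) = -g u := fun u ↦ by
    have := intervalIntegral.integral_comp_neg (a := 0) (b := u) w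
    simp only [hwneg, neg_zero] at this
    simp only [hg]
    rw [this, intervalIntegral.integral_symm]
  have hgmono : Monotone g := by
    refine monotone_of_deriv_nonneg (fun u ↦ (hgd u).differentiableAt) fun u ↦ ?_
    rw [(hgd u).deriv]; exact hw0 u
  have hg0 : g 0 = 0 := intervalIntegral.integral_same
  set c := g (1 + η) with hc
  have hc1 : 1 ≤ c := by
    have h1 : g 1 = 1 := by
      have : g 1 = ∫ v in (0 : ℝ)..1, (1 : ℝ) := intervalIntegral.integral_congr fun v hv ↦ by
        rw [uIcc_of_le zero_le_one] at hv
        exact hwone v (abs_le.2 ⟨by linarith [hv.1], hv.2⟩)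
      rw [this]; simp
    rw [← h1]; exact hgmono (by linarith)
  have hc0 : 0 < c := by linarith
  have hgc : ∀ u, 1 + η ≤ u → g u = c := fun u hu ↦ by
    have h1 : g u = c + ∫ v in (1 + η)..u, w v :=
      (intervalIntegral.integral_add_adjacent_intervals (hint _ _) (hint _ _)).symm
    have h2 : ∫ v in (1 + η)..u, w v = ∫ v in (1 + η)..u, (0 : ℝ) :=
      intervalIntegral.integral_congr fun v hv ↦ by
        rw [uIcc_of_le hu] at hv
        exact hwz v (hv.1.trans (le_abs_self v))
    rw [h1, h2]; simp
  have hgle : ∀ u, g u ≤ c := fun u ↦ (hgmono (le_max_left u (1 + η))).trans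
    (hgc _ (le_max_right _ _)).le
  have hd : ∀ u, HasDerivAt (fun u ↦ g u / c) (w u / c) u := fun u ↦ (hgd u).div_const c
  have hderiv : deriv (fun u ↦ g u / c) = fun u ↦ w u / c := funext fun u ↦ (hd u).deriv
  have hpos : ∀ u, 0 ≤ u → 0 ≤ g u := fun u hu ↦ hg0 ▸ hgmono hu
  refine ⟨fun u ↦ g u / c, ?_, fun u ↦ ?_, fun u ↦ ?_, fun u hu ↦ ?_, fun u hu ↦ ?_, fun u hu ↦ ?_,
    fun u hu ↦ ?_, fun u hu ↦ ?_⟩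
  · rw [contDiff_one_iff_deriv, hderiv]
    exact ⟨fun u ↦ (hd u).differentiableAt, hwc.div_const c⟩
  · rw [hderiv]; exact div_nonneg (hw0 u) hc0.le
  · rw [hderiv]; exact (div_le_one hc0).2 ((hw1 u).trans hc1)
  · rw [hderiv]; simp only [hwz u hu, zero_div]
  · simp only [hgc u hu, div_self hc0.ne']
  · have := hgneg (-u)
    rw [neg_neg, hgc (-u) (by linarith)] at this
    simp only [this, neg_div, div_self hc0.ne']
  · exact ⟨div_nonneg (hpos u hu) hc0.le, (div_le_one hc0).2 (hgle u)⟩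
  · have h1 := hpos (-u) (by linarith)
    have h2 := hgle (-u)
    rw [hgneg] at h1 h2
    exact ⟨by rw [le_div_iff₀ hc0]; linarith, div_nonpos_of_nonpos_of_nonneg (by linarith) hc0.le⟩

/-! ### A nearly distance-decreasing map from the surface to the sector -/

namespace DislocationData

variable (P : DislocationData) (n : ℕ) (s : ℝ → ℝ) (Λ : ℝ)

/-- A map from the whole surface to polar coordinates, in flat coordinates around the bottom side of
row `j`: angles grow slightly faster than they should, and stop near the dislocation lines. -/
def wrapFlat (j : ℤ) (q : Model 2) : Model 2 :=
  !₂[P.innerRadius + q 0,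
    P.angleStep n * (2 * j + s (Λ * q 1 / (P.angleStep n * (P.innerRadius + q 0))))]

variable {s} in
theorem _root_.IsSoftClamp.contDiffAt_wrapFlat [NeZero n] {η : ℝ} (hs : IsSoftClamp η s) (j : ℤ)
    {q : Model 2} (hq : 0 < P.innerRadius + q 0) : ContDiffAt ℝ 1 (P.wrapFlat n s Λ j) q := by
  have h0 : ContDiffAt ℝ 1 (fun q : Model 2 ↦ P.innerRadius + q 0) q := by fun_prop
  have h1 : ContDiffAt ℝ 1 (fun q : Model 2 ↦ Λ * q 1) q := by fun_prop
  have h2 : ContDiffAt ℝ 1 (fun q : Model 2 ↦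
      Λ * q 1 / (P.angleStep n * (P.innerRadius + q 0))) q :=
    h1.div (contDiffAt_const.mul h0) (mul_pos (P.angleStep_pos n) hq).ne'
  have h3 := contDiffAt_const (c := P.angleStep n) |>.mul
    ((contDiffAt_const (c := 2 * (j : ℝ))).add (hs.contDiff.contDiffAt.comp q h2))
  rw [contDiffAt_euclidean]
  intro i; fin_cases i
  · exact h0
  · exact h3

variable {s} in
theorem _root_.IsSoftClamp.hasFDerivAt_wrapFlat [NeZero n] {η : ℝ} (hs : IsSoftClamp η s) (j : ℤ)
    {q : Model 2} (hq : 0 < P.innerRadius + q 0) {u d : ℝ}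
    (hu : u = Λ * q 1 / (P.angleStep n * (P.innerRadius + q 0))) (hd : d = deriv s u) :
    HasFDerivAt (P.wrapFlat n s Λ j)
      (slant (-(P.angleStep n * (d * u)) / (P.innerRadius + q 0)) (d * Λ / (P.innerRadius + q 0))) q := by
  have hκ := P.angleStep_pos n
  have h0 : HasFDerivAt (fun q : Model 2 ↦ q 0) (EuclideanSpace.proj 0 : Model 2 →L[ℝ] ℝ) q :=
    (EuclideanSpace.proj 0 : Model 2 →L[ℝ] ℝ).hasFDerivAt
  have h1 : HasFDerivAt (fun q : Model 2 ↦ q 1) (EuclideanSpace.proj 1 : Model 2 →L[ℝ] ℝ) q :=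
    (EuclideanSpace.proj 1 : Model 2 →L[ℝ] ℝ).hasFDerivAt
  have hr := h0.const_add P.innerRadius
  have hsd : HasDerivAt s d u := by
    rw [hd]; exact (hs.contDiff.differentiable one_ne_zero u).hasDerivAt
  have h2 := (h1.const_mul Λ).mul
    ((hasDerivAt_inv (mul_pos hκ hq).ne').comp_hasFDerivAt q (hr.const_mul (P.angleStep n)))
  have h3 := (((HasDerivAt.comp_hasFDerivAt (f := fun q : Model 2 ↦ (Λ * q 1) *
    (P.angleStep n * (P.innerRadius + q 0))⁻¹) q (by rw [← div_eq_mul_inv, ← hu]; exact hsd)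
      h2).const_add (2 * (j : ℝ))).const_mul (P.angleStep n))
  refine (hasFDerivWithinAt_univ.1 ((hasFDerivWithinAt_euclidean (𝕜 := ℝ)).2 fun i ↦
    hasFDerivWithinAt_univ.2 ?_))
  fin_cases i
  · refine hr.congr_fderiv ?_
    refine ContinuousLinearMap.ext fun v ↦ ?_
    simp [slant_apply]
  · refine h3.congr_fderiv ?_
    refine ContinuousLinearMap.ext fun v ↦ ?_
    simp [slant_apply]
    rw [hu]
    field_simp

variable [NeZero n]

/-- The angle, in units of half rows, of the image of a point with coordinates `q`. -/
def wrapAngle (q : Model 2) : ℝ :=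
  2 * round (q 1 / 2) + s (Λ * ((q 1 - 2 * round (q 1 / 2)) * P.rowHeight n (q 0)) /
    (P.angleStep n * (P.innerRadius + q 0)))

/-- The map from the whole surface to the polar plane which is given by `wrapFlat j` near row `j`. -/
def wrap (p : P.Surface n) : PolarPlane :=
  PolarPlane.ofCoords !₂[P.innerRadius + p.1 0, P.angleStep n * P.wrapAngle n s Λ p.1]

variable {P n s Λ}

omit [NeZero n] in
theorem wrap_val {p : P.Surface n} (hp : 0 < P.innerRadius + p.1 0) :
    (P.wrap n s Λ p).1 = !₂[P.innerRadius + p.1 0, P.angleStep n * P.wrapAngle n s Λ p.1] :=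
  PolarPlane.ofCoords_val hp

omit [NeZero n] in
theorem eventually_radius_pos {p : P.Surface n} (hp : 0 < P.innerRadius + p.1 0) :
    ∀ᶠ q : P.Surface n in 𝓝 p, 0 < P.innerRadius + q.1 0 := by
  refine IsOpen.mem_nhds (isOpen_lt continuous_const (continuous_const.add ?_)) hp
  exact (PiLp.continuous_apply 2 _ 0).comp continuous_subtype_val

theorem round_half_eq_or {t : ℝ} {k : ℤ} (h : |t - (2 * k + 1)| < 1) :
    round (t / 2) = k ∨ round (t / 2) = k + 1 := by
  have h1 := abs_le.1 (abs_sub_round_half_le t)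
  rw [abs_lt] at h
  have h2 : (round (t / 2) : ℝ) < k + 2 := by linarith
  have h3 : (k : ℝ) - 1 < round (t / 2) := by linarith
  have h2' : round (t / 2) < k + 2 := by exact_mod_cast h2
  have h3' : k - 1 < round (t / 2) := by exact_mod_cast h3
  omega

/-- Near the seam both half rows have used up their angle: the clamp is 1 seen from `2k` and -1 seen
from `2k+2`, which is the same angle. Hence the formula centred at `2k` is valid on both sides of
the seam. -/
theorem _root_.IsSoftClamp.wrapAngle_eq {η : ℝ} (hs : IsSoftClamp η s) {q : Model 2} {k : ℤ}
    (hr : 0 < P.innerRadius + q 0) (h : |q 1 - (2 * k + 1)| < 1)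
    (h1 : (1 + η) * (P.angleStep n * (P.innerRadius + q 0)) ≤
      Λ * ((q 1 - 2 * k) * P.rowHeight n (q 0)))
    (h2 : (1 + η) * (P.angleStep n * (P.innerRadius + q 0)) ≤
      Λ * ((2 * k + 2 - q 1) * P.rowHeight n (q 0))) :
    P.wrapAngle n s Λ q = 2 * k + s (Λ * ((q 1 - 2 * k) * P.rowHeight n (q 0)) /
      (P.angleStep n * (P.innerRadius + q 0))) := by
  have hd : 0 < P.angleStep n * (P.innerRadius + q 0) := mul_pos (P.angleStep_pos n) hr
  have e1 := hs.eq_one _ ((le_div_iff₀ hd).2 h1)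
  rcases round_half_eq_or h with hk | hk
  · rw [wrapAngle, hk]
  · rw [e1, wrapAngle, hk, hs.eq_neg_one _ (by
      rw [div_le_iff₀ hd]; push_cast; nlinarith)]
    push_cast; ring

/-- The gap hypothesis says that the clamp is saturated before the seam is reached. Rounding in
`wrapAngle` is therefore harmless, and a single smooth formula represents the map near every point.
-/
theorem _root_.IsSoftClamp.exists_eventually_wrap {η : ℝ} (hs : IsSoftClamp η s)
    {p : P.Surface n} (hr : 0 < P.innerRadius + p.1 0)
    (hgap : (1 + η) * (P.angleStep n * (P.innerRadius + p.1 0)) < Λ * P.rowHeight n (p.1 0)) :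
    ∃ j : ℤ, p ∈ (Surface.flatChart P n j).source ∧ ∀ᶠ q in 𝓝 p,
      P.wrap n s Λ q ∈ PolarPlane.chart.source ∧
      PolarPlane.chart (P.wrap n s Λ q) = P.wrapFlat n s Λ j (Surface.flatChart P n j q) := by
  have c0 : Continuous fun q : P.Surface n ↦ q.1 0 :=
    (PiLp.continuous_apply 2 _ 0).comp continuous_subtype_val
  have c1 : Continuous fun q : P.Surface n ↦ q.1 1 :=
    (PiLp.continuous_apply 2 _ 1).comp continuous_subtype_val
  have cρ : Continuous fun q : P.Surface n ↦ P.rowHeight n (q.1 0) := (P.continuous_rowHeight n).comp c0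
  have key : ∀ (j : ℤ) (q : P.Surface n), 0 < P.innerRadius + q.1 0 →
      P.wrapAngle n s Λ q.1 = 2 * j + s (Λ * ((q.1 1 - 2 * j) * P.rowHeight n (q.1 0)) /
      (P.angleStep n * (P.innerRadius + q.1 0))) → 
      P.wrap n s Λ q ∈ PolarPlane.chart.source ∧
      PolarPlane.chart (P.wrap n s Λ q) = P.wrapFlat n s Λ j (Surface.flatChart P n j q) := by
    intro j q hq hw
    refine ⟨mem_univ _, ?_⟩
    rw [PolarPlane.chart_apply, wrap_val hq, hw, Surface.flatChart_apply]
    rfl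
  have hev := eventually_radius_pos hr
  by_cases h : ∃ j : ℤ, |p.1 1 - 2 * j| < 1
  · obtain ⟨j, hj⟩ := h
    refine ⟨j, ?_, ?_⟩
    · rw [Surface.flatChart_source]
      rw [abs_lt] at hj
      exact Or.inl ⟨by linarith, by linarith⟩
    · have h1 : ∀ᶠ q : P.Surface n in 𝓝 p, |q.1 1 - 2 * j| < 1 :=
        (isOpen_lt (c1.sub continuous_const).abs continuous_const).mem_nhds hj
      filter_upwards [hev, h1] with q hq hq1
      exact key j q hq (by rw [wrapAngle, round_half_eq hq1])
  · push Not at h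
    obtain ⟨k, hk⟩ : ∃ k : ℤ, p.1 1 = 2 * k + 1 := by
      have h1 := abs_sub_round_half_le (p.1 1)
      have h2 := h (round (p.1 1 / 2))
      rcases eq_or_eq_neg_of_abs_eq (le_antisymm h1 h2) with h3 | h3
      · exact ⟨round (p.1 1 / 2), by linarith⟩
      · exact ⟨round (p.1 1 / 2) - 1, by push_cast; linarith⟩
    refine ⟨k, ?_, ?_⟩
    · rw [Surface.flatChart_source]
      exact Or.inr ⟨by linarith, by linarith, fun h' ↦ p.2 ⟨h', k, hk⟩⟩
    · have h1 : ∀ᶠ q : P.Surface n in 𝓝 p, |q.1 1 - (2 * k + 1)| < 1 :=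
        (isOpen_lt (c1.sub continuous_const).abs continuous_const).mem_nhds (by
          simp [hk])
      have cL : Continuous fun q : P.Surface n ↦
          (1 + η) * (P.angleStep n * (P.innerRadius + q.1 0)) := by fun_prop
      have h2 : ∀ᶠ q : P.Surface n in 𝓝 p,
          (1 + η) * (P.angleStep n * (P.innerRadius + q.1 0)) <
            Λ * ((q.1 1 - 2 * k) * P.rowHeight n (q.1 0)) :=
        (isOpen_lt cL (continuous_const.mul ((c1.sub continuous_const).mul cρ))).mem_nhds (by
          simpa [hk] using hgap)
      have h3 : ∀ᶠ q : P.Surface n in 𝓝 p,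
          (1 + η) * (P.angleStep n * (P.innerRadius + q.1 0)) <
            Λ * ((2 * k + 2 - q.1 1) * P.rowHeight n (q.1 0)) :=
        (isOpen_lt cL (continuous_const.mul ((continuous_const.sub c1).mul cρ))).mem_nhds (by
          have : (2 * (k : ℝ) + 2 - (2 * k + 1)) = 1 := by ring
          simpa [hk, this] using hgap)
      filter_upwards [hev, h1, h2, h3] with q hq hq1 hq2 hq3
      exact key k q hq (hs.wrapAngle_eq hq hq1 hq2.le hq3.le)

/-- The diagonal part diag(1, dΛ) has norm at most Λ, and the lower left entry contributes at most
κ(1+η). -/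
theorem norm_vec_add_le {x d u Λ κ y η : ℝ} (hΛ : 1 ≤ Λ) (hκ : 0 ≤ κ) (hη : 0 ≤ η) (hd0 : 0 ≤ d) (hd : d ≤ 1)
    (hdu : d * |u| ≤ 1 + η) :
    ‖(!₂[x, -(κ * (d * u)) * x + d * Λ * y] : Model 2)‖ ≤
      (Λ + κ * (1 + η)) * ‖(!₂[x, y] : Model 2)‖ := by
  have h1 : (!₂[x, -(κ * (d * u)) * x + d * Λ * y] : Model 2) =
      !₂[x, d * Λ * y] + !₂[0, -(κ * (d * u)) * x] := by
    ext i; fin_cases i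
    · simp
    · simp; ring
  rw [h1, add_mul]
  refine (norm_add_le _ _).trans (add_le_add ?_ ?_)
  · rw [norm_vec, norm_vec, Real.sqrt_le_left (by positivity), mul_pow Λ, Real.sq_sqrt (by positivity)]
    have hdΛ : (d * Λ) ^ 2 ≤ Λ ^ 2 :=
      pow_le_pow_left₀ (by positivity) (mul_le_of_le_one_left (by linarith) hd) 2
    have h1Λ : 1 ≤ Λ ^ 2 := one_le_pow₀ hΛ
    rw [mul_pow, mul_add]
    exact add_le_add (le_mul_of_one_le_left (sq_nonneg x) h1Λ)
      (mul_le_mul_of_nonneg_right hdΛ (sq_nonneg y))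
  · rw [norm_vec_zero_left, abs_mul, abs_neg, abs_mul, abs_mul, abs_of_nonneg hκ, abs_of_nonneg hd0]
    have := abs_le_norm_vec_left x y
    gcongr

/-- With respect to orthonormal frames the second row of the differential is (−κdu, dΛ), where u is
the argument of the clamp and d its slope there. The radius in the denominators cancels against the
length of ∂_φ. -/
theorem _root_.IsSoftClamp.norm_mfderiv_wrap_le {η : ℝ} (hs : IsSoftClamp η s) (hη : 0 ≤ η) (hΛ : 1 ≤ Λ)
    {p : (P.surface n).carrier} (hr : 0 < P.innerRadius + (show P.Surface n from p).1 0)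
    (hgap : (1 + η) * (P.angleStep n * (P.innerRadius + (show P.Surface n from p).1 0)) <
      Λ * P.rowHeight n ((show P.Surface n from p).1 0)) :
    ContMDiffAt (𝓡 2) (𝓡 2) 1 (show (P.surface n).carrier → PolarPlane.weitzenbock.carrier from
      P.wrap n s Λ) p ∧ ∀ v : TangentSpace (𝓡 2) p,
      ‖mfderiv (𝓡 2) (𝓡 2) (show (P.surface n).carrier → PolarPlane.weitzenbock.carrier from
        P.wrap n s Λ) p v‖ ≤ (Λ + P.angleStep n * (1 + η)) * ‖v‖ := by
  have := (Surface.isTranslationAtlas P n).isManifold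
  have := PolarPlane.isTranslationAtlas.isManifold
  have hκ := P.angleStep_pos n
  obtain ⟨j, hj, hev⟩ := hs.exists_eventually_wrap hr hgap
  obtain ⟨c, hc⟩ : ∃ c, c = Surface.flatChart P n j p := ⟨_, rfl⟩
  have hc0 : 0 < P.innerRadius + c 0 := by rw [hc]; exact hr
  have hD := hs.hasFDerivAt_wrapFlat P n Λ j (q := c) hc0 rfl rfl
  have hM : HasMFDerivAt (𝓡 2) (𝓡 2) (P.wrap n s Λ) p _ :=
    (Surface.isTranslationAtlas P n).hasMFDerivAt_of_charts PolarPlane.isTranslationAtlas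
    (mem_range_self j) PolarPlane.chart_mem_atlas hj (by rw [← hc]; exact hD) hev
  refine ⟨?_, fun v ↦ ?_⟩
  · exact IsTranslationAtlas.contMDiffAt_of_charts (k := 1) (mem_range_self j)
      PolarPlane.chart_mem_atlas hj (by
        rw [← hc]; exact hs.contDiffAt_wrapFlat P n Λ j hc0) hev
  · set u := Λ * c 1 / (P.angleStep n * (P.innerRadius + c 0))
    -- The argument `u` can be large, but the slope vanishes beyond `1 + η`.
    have hdu : deriv s u * |u| ≤ 1 + η := by
      rcases le_total (1 + η) |u| with h | h
      · rw [hs.deriv_eq_zero u h]; linarith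
      · exact (mul_le_of_le_one_left (abs_nonneg u) (hs.deriv_le u)).trans h
    have hv := P.norm_surface n p v
    have hb := norm_vec_add_le (x := (show Model 2 from v) 0) (y := (show Model 2 from v) 1)
      hΛ hκ.le hη (hs.deriv_nonneg u) (hs.deriv_le u) hdu
    have hvv : (!₂[(show Model 2 from v) 0, (show Model 2 from v) 1] : Model 2) = v := by
      ext i; fin_cases i <;> rfl
    have hrad : PolarPlane.radius (P.wrap n s Λ p) = P.innerRadius + c 0 := by
      have h1 : (P.wrap n s Λ p).1 0 = _ := congrArg (fun q : Model 2 ↦ q 0) (wrap_val (s := s) (Λ := Λ) hr)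
      rw [hc]
      exact h1
    have hmf := hM.mfderiv
    rw [hv]
    refine (PolarPlane.norm_eq (P.wrap n s Λ p) _).trans_le ?_
    rw [hrad]
    refine le_trans (le_of_eq ?_) (hb.trans (le_of_eq ?_))
    · have hap : mfderiv (𝓡 2) (𝓡 2) (P.wrap n s Λ) p v = slant
        (-(P.angleStep n * (deriv s u * u)) / (P.innerRadius + c 0))
        (deriv s u * Λ / (P.innerRadius + c 0)) v := by
        exact congrArg (fun A : Model 2 →L[ℝ] Model 2 ↦ A v) hmf
      have e0 : PolarPlane.dr (P.wrap n s Λ p) (mfderiv (𝓡 2) (𝓡 2) (P.wrap n s Λ) p v) =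
          (show Model 2 from v) 0 := by
        have : _ = _ := congrArg (fun w : Model 2 ↦ w 0) hap
        have h2 := congrArg (fun w : Model 2 ↦ w 0) (slant_apply
          (-(P.angleStep n * (deriv s u * u)) / (P.innerRadius + c 0))
          (deriv s u * Λ / (P.innerRadius + c 0)) (show Model 2 from v))
        exact this.trans h2
      have e1 : PolarPlane.dphi (P.wrap n s Λ p) (mfderiv (𝓡 2) (𝓡 2) (P.wrap n s Λ) p v) =
          -(P.angleStep n * (deriv s u * u)) / (P.innerRadius + c 0) * (show Model 2 from v) 0 +
            deriv s u * Λ / (P.innerRadius + c 0) * (show Model 2 from v) 1 := by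
        have : _ = _ := congrArg (fun w : Model 2 ↦ w 1) hap
        exact this.trans (congrArg (fun w : Model 2 ↦ w 1) (slant_apply _ _ (show Model 2 from v)))
      refine congrArg (fun w : Model 2 ↦ ‖w‖) (?_ : (!₂[PolarPlane.dr (P.wrap n s Λ p) (mfderiv (𝓡 2) (𝓡 2) (P.wrap n s Λ) p v), (P.innerRadius + c 0) * PolarPlane.dphi (P.wrap n s Λ p) (mfderiv (𝓡 2) (𝓡 2) (P.wrap n s Λ) p v)] : Model 2) = _)
      rw [e0, e1]
      congr 2
      field_simp
    · rw [hvv]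

end DislocationData

/-! ### Lower bound for distances on the perforated surface; the distortion -/

namespace DislocationData

variable {P : DislocationData} {n : ℕ} [NeZero n] {s : ℝ → ℝ} {η Λ : ℝ}

/-- The height is at least κ(R₀ + x − b/n). The excess of 1+2η over 1+η absorbs the error b/n once
`n` is large. -/
theorem IsFine.soft_gap (hf : P.IsFine n) (hη : 0 < η)
    (h : (1 + 2 * η) * (P.b / n) < η * P.innerRadius) {x : ℝ} (hx : x ∈ Icc 0 P.b) :
    (1 + η) * (P.angleStep n * (P.innerRadius + x)) < (1 + 2 * η) * P.rowHeight n x := by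
  have hκ := P.angleStep_pos n
  have hn := cast_pos' n
  have hb := P.b_pos
  have h1 := (abs_le.1 (IsFine.abs_rowHeight_sub_le P hf hx)).1
  have h3 : P.εBlock n / 2 = P.angleStep n * (P.b / n) := by
    rw [εBlock, angleStep]; field_simp
  rw [h3] at h1
  have h4 : (1 + 2 * η) * (P.angleStep n * (P.innerRadius + x - P.b / n)) ≤
      (1 + 2 * η) * P.rowHeight n x := mul_le_mul_of_nonneg_left (by linarith) (by linarith)
  have h5 : 0 < P.angleStep n * (η * (P.innerRadius + x) - (1 + 2 * η) * (P.b / n)) :=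
    mul_pos hκ (by nlinarith [mul_nonneg hη.le hx.1])
  linarith

omit [NeZero n] in
-- Both numbers are within 1 of the same even integer.
theorem abs_wrapAngle_sub_le (hs : IsSoftClamp η s) (q : Model 2) :
    |P.wrapAngle n s Λ q - q 1| ≤ 2 := by
  have h1 := abs_le.1 (abs_sub_round_half_le (q 1))
  rw [wrapAngle]
  generalize Λ * ((q 1 - 2 * round (q 1 / 2)) * P.rowHeight n (q 0)) /
    (P.angleStep n * (P.innerRadius + q 0)) = u
  have h2 : s u ∈ Icc (-1) 1 := by
    rcases le_total 0 u with h | h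
    · have := hs.mem_of_nonneg u h; exact ⟨by linarith [this.1], this.2⟩
    · have := hs.mem_of_nonpos u h; exact ⟨this.1, by linarith [this.2]⟩
  exact abs_le.2 ⟨by linarith [h2.1], by linarith [h2.2]⟩

/-- The clamp keeps the weak sign of its argument and has values in [-1, 1], so the angle stays in
the half row to which the height belongs. -/
theorem wrapAngle_mem (hs : IsSoftClamp η s) (hΛ : 0 < Λ) {q : Model 2}
    (hr : 0 < P.innerRadius + q 0) (hq : q 1 ∈ Icc 0 (2 * n : ℝ)) :
    P.wrapAngle n s Λ q ∈ Icc 0 (2 * n : ℝ) := by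
  have hd : 0 < P.angleStep n * (P.innerRadius + q 0) := mul_pos (P.angleStep_pos n) hr
  have hρ := P.rowHeight_pos n (q 0)
  obtain ⟨h0, h1⟩ := abs_le.1 (abs_sub_round_half_le (q 1))
  rw [wrapAngle]
  set m := round (q 1 / 2)
  have hm0 : 0 ≤ m := by
    have : (-1 : ℝ) < m := by linarith [hq.1]
    have : (-1 : ℤ) < m := by exact_mod_cast this
    omega
  have hmn : m ≤ n := by
    have : (m : ℝ) < n + 1 := by linarith [hq.2]
    have : m < n + 1 := by exact_mod_cast this
    omega
  have hm0' : (0 : ℝ) ≤ m := by exact_mod_cast hm0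
  have hmn' : (m : ℝ) ≤ n := by exact_mod_cast hmn
  have hpos : ∀ t : ℝ, 0 ≤ t → 0 ≤ Λ * (t * P.rowHeight n (q 0)) /
      (P.angleStep n * (P.innerRadius + q 0)) := fun t ht ↦ by positivity
  rcases lt_trichotomy (q 1 - 2 * m) 0 with h | h | h
  · have hm : (1 : ℝ) ≤ m := by
      have : (0 : ℝ) < m := by linarith [hq.1]
      have : (0 : ℤ) < m := by exact_mod_cast this
      exact_mod_cast this
    have h3 := hs.mem_of_nonpos (Λ * ((q 1 - 2 * m) * P.rowHeight n (q 0)) /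
      (P.angleStep n * (P.innerRadius + q 0))) (by
        have := hpos (-(q 1 - 2 * m)) (by linarith)
        rw [neg_mul, mul_neg, neg_div] at this
        linarith)
    exact ⟨by linarith [h3.1], by linarith [h3.2]⟩
  · rw [h, zero_mul, mul_zero, zero_div]
    have h3 := hs.mem_of_nonpos 0 le_rfl
    have h4 := hs.mem_of_nonneg 0 le_rfl
    exact ⟨by linarith [h4.1], by linarith [h3.2]⟩
  · have hm : (m : ℝ) + 1 ≤ n := by
      have : (m : ℝ) < n := by linarith [hq.2]
      have : m < n := by exact_mod_cast this
      exact_mod_cast (by omega : m + 1 ≤ n)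
    have h3 := hs.mem_of_nonneg _ (hpos _ h.le)
    exact ⟨by linarith [h3.1], by linarith [h3.2]⟩

theorem wrap_mem (hs : IsSoftClamp η s) (hΛ : 0 < Λ) {p : P.Surface n} (hp : p ∈ P.rectangle n) :
    P.wrap n s Λ p ∈ P.sector := by
  have hκ := (P.angleStep_pos n).ne'
  obtain ⟨h0, h1⟩ := (P.mem_rectangle_iff n).1 hp
  have hr : 0 < P.innerRadius + p.1 0 := by linarith [P.innerRadius_pos, h0.1]
  refine (P.mem_sector_iff n).2 ?_
  rw [wrap_val hr]
  simpa [hκ, mul_div_assoc] using And.intro h0 (wrapAngle_mem hs hΛ hr h1)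

theorem intrinsicEDist_wrap_le (hf : P.IsFine n) (hs : IsSoftClamp η s) (hη : 0 < η)
    (h : (1 + 2 * η) * (P.b / n) < η * P.innerRadius) (p q : P.Surface n) :
    intrinsicEDist PolarPlane.weitzenbock P.sector (P.wrap n s (1 + 2 * η) p)
      (P.wrap n s (1 + 2 * η) q) ≤ ENNReal.ofReal (1 + 2 * η + P.angleStep n * (1 + η)) *
        intrinsicEDist (P.surface n) (P.perforatedSurface n) p q := by
  have hκ := P.angleStep_pos n
  have key : ∀ x : P.Surface n, x ∈ P.perforatedSurface n → 0 < P.innerRadius + x.1 0 ∧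
      (1 + η) * (P.angleStep n * (P.innerRadius + x.1 0)) < (1 + 2 * η) * P.rowHeight n (x.1 0) := by
    intro x hx
    have h0 := ((P.mem_rectangle_iff n).1 (hf.isPassable.subset x hx)).1
    exact ⟨by linarith [P.innerRadius_pos, h0.1], hf.soft_gap hη h h0⟩
  exact intrinsicEDist_le_of_norm_mfderiv_le (W := P.surface n) (K := P.perforatedSurface n)
    (W' := PolarPlane.weitzenbock) (K' := P.sector) (G := P.wrap n s (1 + 2 * η)) (by positivity)
    (fun x hx ↦ (hs.norm_mfderiv_wrap_le hη.le (by linarith) (key x hx).1 (key x hx).2).1)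
    (fun x hx ↦ wrap_mem hs (by linarith) (hf.isPassable.subset x hx))
    (fun x hx ↦ (hs.norm_mfderiv_wrap_le hη.le (by linarith) (key x hx).1 (key x hx).2).2) p q

/-- The radius is unchanged, and the angle moves by at most `2 + unevenness` half rows, each of
angle κ = O(1/n). -/
theorem IsFine.intrinsicEDist_wrap_unrollMap_le (hf : P.IsFine n) (hs : IsSoftClamp η s)
    (hΛ : 0 < Λ) {p : PolarPlane.weitzenbock.carrier} (hp : p ∈ P.perforatedSector n) :
    intrinsicEDist PolarPlane.weitzenbock P.sector p (P.wrap n s Λ (P.unrollMap n p)) ≤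
      ENNReal.ofReal ((P.innerRadius + P.b) * (P.angleStep n * (2 + P.unevenness))) := by
  have hκ := P.angleStep_pos n
  have hn := cast_pos' n
  have hps : p ∈ P.sector := hp.1
  have hpi := (P.mem_sector_iff n).1 hps
  have hFr : P.unrollMap n p ∈ P.rectangle n := (hf.unrollMap_mem hp).1
  have hval : (P.unrollMap n p).1 = P.unroll n p.1 := by
    obtain ⟨j, hj⟩ := exists_polarDomain_of_mem hp
    exact unrollMap_val hj
  have h0 : (P.unrollMap n p).1 0 = p.1 0 - P.innerRadius := by rw [hval]; rfl
  have hr : 0 < P.innerRadius + (P.unrollMap n p).1 0 := by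
    rw [h0]; linarith [P.innerRadius_pos, hpi.1.1]
  have hw := wrap_val (s := s) (Λ := Λ) hr
  refine (intrinsicEDist_sector_le hps (wrap_mem hs hΛ hFr)).trans (ENNReal.ofReal_le_ofReal ?_)
  have e0 : PolarPlane.radius (P.wrap n s Λ (P.unrollMap n p)) = p.1 0 := by
    have : (P.wrap n s Λ (P.unrollMap n p)).1 0 = p.1 0 := by
      rw [hw]; simp [h0]
    exact this
  have e1 : PolarPlane.coords (P.wrap n s Λ (P.unrollMap n p)) 1 =
      P.angleStep n * P.wrapAngle n s Λ (P.unrollMap n p).1 := by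
    have : (P.wrap n s Λ (P.unrollMap n p)).1 1 = _ := congrArg (fun q : Model 2 ↦ q 1) hw
    exact this
  have e2 : PolarPlane.radius p = p.1 0 := rfl
  have e3 : PolarPlane.coords p 1 = P.angleStep n * (p.1 1 / P.angleStep n) := by
    have : PolarPlane.coords p 1 = p.1 1 := rfl
    rw [this]; field_simp
  rw [e0, e1, e2, e3, sub_self, abs_zero, zero_add, ← mul_sub, abs_mul, abs_of_pos hκ]
  have h1 := abs_le.1 (abs_wrapAngle_sub_le (P := P) (n := n) (Λ := Λ) hs (P.unrollMap n p).1)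
  have h2 := abs_le.1 (hf.abs_unroll_sub_le hpi.1)
  rw [← hval] at h2
  have h3 : P.unevenness / n ≤ P.unevenness :=
    div_le_self P.unevenness_pos.le (by exact_mod_cast Nat.one_le_iff_ne_zero.2 (NeZero.ne n))
  have hRb : 0 ≤ P.innerRadius + P.b := by linarith [P.innerRadius_pos, P.b_pos]
  refine mul_le_mul_of_nonneg_left (mul_le_mul_of_nonneg_left (abs_le.2 ⟨?_, ?_⟩) hκ.le) hRb
  · linarith [h1.1, h2.1]
  · linarith [h1.2, h2.2]

theorem tendsto_angleStep (P : DislocationData) :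
    Tendsto (fun n : ℕ ↦ P.angleStep (n + 1)) atTop (𝓝 0) := by
  have h : Tendsto (fun n : ℕ ↦ P.ε / (2 * P.b) / ((n + 1 : ℕ) : ℝ)) atTop (𝓝 0) :=
    (tendsto_const_div_atTop_nhds_zero_nat _).comp (tendsto_add_atTop_nat 1)
  refine h.congr fun n ↦ ?_
  have := P.b_pos
  rw [angleStep]; field_simp

/-- Distances in the sector are not much larger than those on the perforated surface. -/
theorem eventually_le_intrinsicEDist_unrollMap (P : DislocationData) {δ : ℝ} (hδ : 0 < δ) :
    ∀ᶠ n : ℕ in atTop, P.IsVeryFine (n + 1) → ∀ p ∈ P.perforatedSector (n + 1),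
      ∀ q ∈ P.perforatedSector (n + 1),
      intrinsicEDist PolarPlane.weitzenbock P.sector p q ≤
      intrinsicEDist (P.surface (n + 1)) (P.perforatedSurface (n + 1)) (P.unrollMap (n + 1) p)
        (P.unrollMap (n + 1) q) + ENNReal.ofReal δ := by
  have hR := P.innerRadius_pos
  have hb := P.b_pos
  have hD := P.sectorDiam_pos
  have hu := P.unevenness_pos
  -- By the upper bound with error 1, `D` bounds the relevant distances on the perforated surface
  -- for large `n`. This turns the factor `1 + 2η` into an additive error.
  set D := P.sectorDiam + 1 with hDdef
  have hD0 : 0 < D := by positivity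
  -- Chosen such that `2 η D = δ / 4`.
  set η := δ / (8 * D) with hη
  have hη0 : 0 < η := by positivity
  obtain ⟨s, hs⟩ := exists_isSoftClamp hη0
  have t1 : Tendsto (fun n : ℕ ↦ P.angleStep (n + 1) * ((1 + η) * D)) atTop (𝓝 0) := by
    simpa using P.tendsto_angleStep.mul_const ((1 + η) * D)
  have t2 : Tendsto (fun n : ℕ ↦ P.angleStep (n + 1) * ((2 + P.unevenness) * (P.innerRadius + P.b)))
      atTop (𝓝 0) := by
    simpa using P.tendsto_angleStep.mul_const ((2 + P.unevenness) * (P.innerRadius + P.b))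
  have t3 : Tendsto (fun n : ℕ ↦ (1 + 2 * η) * P.b / ((n + 1 : ℕ) : ℝ)) atTop (𝓝 0) :=
    (tendsto_const_div_atTop_nhds_zero_nat _).comp (tendsto_add_atTop_nat 1)
  filter_upwards [P.eventually_intrinsicEDist_unrollMap_le one_pos,
    t1.eventually_le_const (by positivity : 0 < δ / 4),
    t2.eventually_le_const (by positivity : 0 < δ / 4),
    t3.eventually_lt_const (by positivity : 0 < η * P.innerRadius)] with n h1 h2 h3 h4 hf p hp q hq
  have hκ := P.angleStep_pos (n + 1)
  set x := intrinsicEDist (P.surface (n + 1)) (P.perforatedSurface (n + 1)) (P.unrollMap (n + 1) p)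
        (P.unrollMap (n + 1) q) with hx
  have hxD : x ≤ ENNReal.ofReal D := by
    rw [hDdef, ENNReal.ofReal_add hD.le zero_le_one]
    exact (h1 hf p hp q hq).trans
      (add_le_add_left (P.intrinsicEDist_sector_le_sectorDiam hp.1 hq.1) _)
  have hxtop : x ≠ ⊤ := ne_top_of_le_ne_top ENNReal.ofReal_ne_top hxD
  have hxr : x.toReal ≤ D := ENNReal.toReal_le_of_le_ofReal hD0.le hxD
  have hx0 : 0 ≤ x.toReal := ENNReal.toReal_nonneg
  have d1 := hf.1.intrinsicEDist_wrap_unrollMap_le hs (by positivity : 0 < 1 + 2 * η) hp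
  have d2 := intrinsicEDist_wrap_le hf.1 hs hη0 (by rwa [← mul_div_assoc])
    (P.unrollMap (n + 1) p) (P.unrollMap (n + 1) q)
  have d3 := (intrinsicEDist_comm _ _).trans_le
    (hf.1.intrinsicEDist_wrap_unrollMap_le hs (by positivity : 0 < 1 + 2 * η) hq)
  rw [← hx, ← ENNReal.ofReal_toReal hxtop, ← ENNReal.ofReal_mul (by positivity)] at d2
  refine (intrinsicEDist_le_add_add (by positivity) (by positivity) (by positivity) d1 d2 d3).trans ?_
  refine le_trans (b := ENNReal.ofReal (x.toReal + δ)) (ENNReal.ofReal_le_ofReal ?_) (le_of_eq (by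
    rw [ENNReal.ofReal_add hx0 hδ.le, ENNReal.ofReal_toReal hxtop]))
  have e1 : 2 * η * x.toReal ≤ δ / 4 := by
    have : 2 * η * D = δ / 4 := by rw [hη]; field_simp; norm_num
    rw [← this]; gcongr
  have e2 : P.angleStep (n + 1) * ((1 + η) * x.toReal) ≤ δ / 4 := le_trans (by gcongr) h2
  nlinarith

/-- The maps from the sector to the perforated surfaces have small distortion. -/
theorem tendsto_distortion (P : DislocationData) (hf : ∀ᶠ n : ℕ in atTop, P.IsVeryFine (n + 1)) :
    Tendsto (fun n : ℕ ↦ distortion PolarPlane.weitzenbock (P.surface (n + 1)) P.sector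
      (P.perforatedSurface (n + 1)) (P.unrollMap (n + 1)) (P.perforatedSector (n + 1)))
      atTop (𝓝 0) := by
  rw [ENNReal.tendsto_nhds_zero]
  intro e he
  obtain ⟨δ, hδ0, hδ⟩ : ∃ δ : ℝ, 0 < δ ∧ ENNReal.ofReal δ ≤ e := by
    rcases eq_or_ne e ⊤ with rfl | h
    · exact ⟨1, one_pos, le_top⟩
    · exact ⟨e.toReal, ENNReal.toReal_pos he.ne' h, (ENNReal.ofReal_toReal h).le⟩
  filter_upwards [hf, P.eventually_intrinsicEDist_unrollMap_le hδ0,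
    P.eventually_le_intrinsicEDist_unrollMap hδ0] with n h1 h2 h3
  refine iSup₂_le fun p hp ↦ iSup₂_le fun q hq ↦ max_le ?_ ?_
  · exact tsub_le_iff_left.2 ((h3 h1 p hp q hq).trans (add_le_add_right hδ _))
  · exact tsub_le_iff_left.2 ((h2 h1 p hp q hq).trans (add_le_add_right hδ _))

end DislocationData

/-! ### The integral conditions and the convergence -/

section
variable {d : ℕ}

/-- The distance of the differential of `F` to the rotations. -/
def rotationDefect (W W' : WeitzenbockManifold d) (F : W.carrier → W'.carrier) (A : Set W.carrier)
    (x : W.carrier) : ℝ :=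
  Metric.infDist (differential W W' F A x) (rotations W W' x (F x))

theorem rotationDefect_nonneg (W W' : WeitzenbockManifold d) (F : W.carrier → W'.carrier)
    (A : Set W.carrier) (x : W.carrier) : 0 ≤ rotationDefect W W' F A x :=
  Metric.infDist_nonneg

/-- The distance of the pull-back of a frame field under `F` to another one. -/
def frameDefect (W W' : WeitzenbockManifold d) (F : W.carrier → W'.carrier) (A : Set W.carrier)
    (E : Fin d → VField d W.carrier) (E' : Fin d → VField d W'.carrier) (x : W.carrier) : ℝ :=
  ∑ i, ‖(differential W W' F A x).inverse (E' i (F x)) - E i x‖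

/-- Convergence of manifolds with global parallel frame fields. -/
theorem ConvergesTo.of_frames {p : ℝ} {W : ℕ → WeitzenbockManifold d} {K : ∀ n, Set (W n).carrier}
    {N : WeitzenbockManifold d} {L : Set N.carrier} {μ : Measure N.carrier}
    {A : ℕ → Set N.carrier} {F : ∀ n, N.carrier → (W n).carrier}
    {E : Fin d → VField d N.carrier} {E' : ∀ n, Fin d → VField d (W n).carrier}
    (hp : (d : ℝ) ≤ p) (hL : IsCompactDomainWithCorners (d := d) L)
    (hK : ∀ᶠ n in atTop, IsCompactDomainWithCorners (d := d) (K n)) (hμ : IsRiemannianVolume N μ)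
    (hF : ∀ᶠ n in atTop, A n ⊆ L ∧ IsDiffeoOn N (W n) (F n) (A n) (K n))
    (hvol : Tendsto (fun n ↦ μ (L \ A n)) atTop (𝓝 0))
    (hdis : Tendsto (fun n ↦ distortion N (W n) L (K n) (F n) (A n)) atTop (𝓝 0))
    (hrot : Tendsto (fun n ↦ ∫⁻ x in A n,
      ENNReal.ofReal (rotationDefect N (W n) (F n) (A n) x ^ p) ∂μ) atTop (𝓝 0))
    (hE : IsParallelFrameOn N.conn E univ) (hE' : ∀ n, IsParallelFrameOn (W n).conn (E' n) univ)
    (hframe : Tendsto (fun n ↦ ∫⁻ x in A n,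
      ENNReal.ofReal (frameDefect N (W n) (F n) (A n) E (E' n) x ^ p) ∂μ) atTop (𝓝 0)) :
    ConvergesTo p W K N L := by
  refine ⟨hp, hL, hK, μ, hμ, A, F, hF, hvol, hdis, hrot, fun x₀ _ ↦ ⟨univ, E, fun _ ↦ univ, E',
    mem_univ _, hE, Eventually.of_forall fun n ↦ ⟨hE' n, subset_univ _⟩, ?_⟩⟩
  simp only [univ_inter]
  exact hframe

end

namespace DislocationData

variable (P : DislocationData)

theorem eventually_isVeryFine : ∀ᶠ n : ℕ in atTop, P.IsVeryFine (n + 1) := by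
  have hb := P.b_pos
  have key : ∀ c : ℝ, ∀ᶠ n : ℕ in atTop, c ≤ ((n + 1 : ℕ) : ℝ) := fun c ↦
    (tendsto_natCast_atTop_atTop.comp (tendsto_add_atTop_nat 1)).eventually_ge_atTop c
  filter_upwards [key (8 * slitWidth P.θ P.ε / P.b), key (8 * slitWidth P.θ P.ε),
    key (P.holeHeight + P.unevenness)] with n h1 h2 h3
  have hn := cast_pos' (n + 1)
  refine ⟨⟨?_, ?_⟩, h3⟩
  · rw [width_eq, bBlock]
    rw [div_le_iff₀ hb] at h1
    rw [← mul_div_assoc, div_le_div_iff₀ (by positivity) hn]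
    nlinarith
  · rw [width_eq]
    have : 8 * (slitWidth P.θ P.ε / ((n + 1 : ℕ) : ℝ) ^ 2) * ((n + 1 : ℕ) : ℝ) =
        8 * slitWidth P.θ P.ε / ((n + 1 : ℕ) : ℝ) := by field_simp
    rw [this, div_le_one hn]
    exact h2

theorem radius_mem_of_mem_perforatedSector {n : ℕ} [NeZero n] {x : PolarPlane.weitzenbock.carrier}
    (hx : x ∈ P.perforatedSector n) :
    PolarPlane.radius x ∈ Icc P.innerRadius (P.innerRadius + P.b) :=
  (sector_coords_mem hx.1).1

/-- The differentials converge to rotations in `L^p`. -/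
theorem tendsto_lintegral_rotationDefect {p : ℝ} (hp : 0 < p) :
    Tendsto (fun n : ℕ ↦ ∫⁻ x in P.perforatedSector (n + 1),
      ENNReal.ofReal (rotationDefect PolarPlane.weitzenbock (P.surface (n + 1))
        (P.unrollMap (n + 1)) (P.perforatedSector (n + 1)) x ^ p) ∂PolarPlane.area)
        atTop (𝓝 0) := by
  have hR := P.innerRadius_pos
  have hb := P.b_pos
  -- Outside of the strips the entry α vanishes and |β − r|/r is at most b/(nR₀). Inside, α is
  -- bounded by the slope of the smooth height.
  refine P.tendsto_lintegral_perforatedSector (C₁ := P.b / P.innerRadius)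
    (C₂ := P.heightSlope + P.b / P.innerRadius) hp (fun n x ↦ rotationDefect
        PolarPlane.weitzenbock (P.surface (n + 1))
        (P.unrollMap (n + 1)) (P.perforatedSector (n + 1)) x) ?_
  filter_upwards [P.eventually_isVeryFine] with n hf x hx hi
  obtain ⟨α, β, hD, hβ, hβr, hα, hstrip⟩ := hf.1.exists_differential_eq hx hi
  have hrx := P.radius_mem_of_mem_perforatedSector hx
  have hle : rotationDefect PolarPlane.weitzenbock (P.surface (n + 1))
      (P.unrollMap (n + 1)) (P.perforatedSector (n + 1)) x ≤
      |α| + |β - PolarPlane.radius x| / PolarPlane.radius x :=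
    infDist_rotations_le (y := P.unrollMap (n + 1) x) hD
  have hN : ((n + 1 : ℕ) : ℝ) = n + 1 := by push_cast; ring
  have h1 : |β - PolarPlane.radius x| / PolarPlane.radius x ≤ P.b / P.innerRadius / (n + 1) := by
    rw [div_div, mul_comm, ← div_div, ← hN]
    exact div_le_div₀ (by positivity) hβr hR hrx.1
  have h2 : P.b / P.innerRadius / (n + 1) ≤ P.b / P.innerRadius :=
    div_le_self (by positivity) (by linarith [(Nat.cast_nonneg n : (0 : ℝ) ≤ n)])
  refine ⟨rotationDefect_nonneg _ _ _ _ _, by linarith, fun hs ↦ hle.trans ?_⟩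
  rw [hstrip hs, abs_zero, zero_add]
  exact h1

/-- The pull-backs of the parallel frames converge in `L^p`. -/
theorem tendsto_lintegral_frameDefect {p : ℝ} (hp : 0 < p) :
    Tendsto (fun n : ℕ ↦ ∫⁻ x in P.perforatedSector (n + 1),
      ENNReal.ofReal (frameDefect PolarPlane.weitzenbock (P.surface (n + 1))
        (P.unrollMap (n + 1)) (P.perforatedSector (n + 1)) PolarPlane.parallelFrame
          (P.flatFrame (n + 1)) x ^ p) ∂PolarPlane.area) atTop (𝓝 0) := by
  have hR := P.innerRadius_pos
  have hb := P.b_pos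
  have hH := P.heightSlope_nonneg
  refine P.tendsto_lintegral_perforatedSector (C₁ := P.b / P.innerRadius)
    (C₂ := (P.innerRadius + P.b) / P.innerRadius * P.heightSlope + P.b / P.innerRadius) hp
    (fun n x ↦ frameDefect PolarPlane.weitzenbock (P.surface (n + 1))
        (P.unrollMap (n + 1)) (P.perforatedSector (n + 1)) PolarPlane.parallelFrame
          (P.flatFrame (n + 1)) x) ?_
  filter_upwards [P.eventually_isVeryFine] with n hf x hx hi
  obtain ⟨α, β, hD, hβ, hβr, hα, hstrip⟩ := hf.1.exists_differential_eq hx hi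
  have hrx := P.radius_mem_of_mem_perforatedSector hx
  have hβ0 : 0 < β := hR.trans_le hβ
  have hle : frameDefect PolarPlane.weitzenbock (P.surface (n + 1))
      (P.unrollMap (n + 1)) (P.perforatedSector (n + 1)) PolarPlane.parallelFrame
        (P.flatFrame (n + 1)) x ≤
      PolarPlane.radius x / β * |α| + |β - PolarPlane.radius x| / β :=
    sum_norm_inverse_sub_le (y := P.unrollMap (n + 1) x) hβ0 hD
  have hN : ((n + 1 : ℕ) : ℝ) = n + 1 := by push_cast; ring
  have h1 : |β - PolarPlane.radius x| / β ≤ P.b / P.innerRadius / (n + 1) := by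
    rw [div_div, mul_comm, ← div_div, ← hN]
    exact div_le_div₀ (by positivity) hβr hR hβ
  have h2 : P.b / P.innerRadius / (n + 1) ≤ P.b / P.innerRadius :=
    div_le_self (by positivity) (by linarith [(Nat.cast_nonneg n : (0 : ℝ) ≤ n)])
  have h3 : PolarPlane.radius x / β * |α| ≤
      (P.innerRadius + P.b) / P.innerRadius * P.heightSlope :=
    mul_le_mul (div_le_div₀ (by positivity) hrx.2 hR hβ) hα (abs_nonneg _) (by positivity)
  refine ⟨Finset.sum_nonneg fun i _ ↦ norm_nonneg _, by linarith, fun hs ↦ hle.trans ?_⟩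
  rw [hstrip hs, abs_zero, mul_zero, zero_add]
  exact h1

theorem isParallelFrameOn_flatFrame (n : ℕ) [NeZero n] :
    IsParallelFrameOn (P.surface n).conn (P.flatFrame n) univ := by
  have := (Surface.isTranslationAtlas P n).isManifold
  exact (FrameField.standard 2 (P.Surface n)).isParallelFrameOn (Surface.isTranslationAtlas P n)

theorem isParallelFrameOn_parallelFrame :
    IsParallelFrameOn PolarPlane.weitzenbock.conn PolarPlane.parallelFrame univ := by
  have := PolarPlane.isTranslationAtlas.isManifold
  exact PolarPlane.frame.isParallelFrameOn PolarPlane.isTranslationAtlas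

theorem convergesTo {p : ℝ} (hp : 2 ≤ p) :
    ConvergesTo p (fun n ↦ P.surface (n + 1)) (fun n ↦ P.perforatedSurface (n + 1))
      PolarPlane.weitzenbock P.sector :=
  have hp0 : 0 < p := by linarith
  ConvergesTo.of_frames (W := fun n ↦ P.surface (n + 1)) (F := fun n ↦ P.unrollMap (n + 1))
    (E' := fun n ↦ P.flatFrame (n + 1))
    (by exact_mod_cast hp) P.isCompactDomainWithCorners_sector
    (P.eventually_isVeryFine.mono fun n hf ↦ hf.1.isCompactDomainWithCorners)
    PolarPlane.isRiemannianVolume_area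
    (P.eventually_isVeryFine.mono fun n hf ↦ ⟨fun x hx ↦ hx.1, hf.1.isDiffeoOn⟩)
    P.tendsto_area_sector_diff (P.tendsto_distortion P.eventually_isVeryFine)
    (P.tendsto_lintegral_rotationDefect hp0) isParallelFrameOn_parallelFrame
    (fun n ↦ P.isParallelFrameOn_flatFrame (n + 1)) (P.tendsto_lintegral_frameDefect hp0)

end DislocationData

end

/-! ### The theorem -/

theorem corollary4p1 (P : DislocationData) :
    -- the flat metric connections of the surfaces are torsion-free, that is, Levi-Civita
    (∀ n : ℕ, (P.surface (n + 1)).conn.torsion = 0) ∧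
    -- the metric of the limit is `dr² + r² dφ²`
    (∀ (x : PolarPlane.weitzenbock.carrier) (v w : TangentSpace (𝓡 2) x),
      inner ℝ v w = PolarPlane.dr x v * PolarPlane.dr x w
        + PolarPlane.radius x ^ 2 * (PolarPlane.dphi x v * PolarPlane.dphi x w)) ∧
    -- the frame `(∂_r, r⁻¹ ∂_φ)` is parallel
    (∀ x, PolarPlane.weitzenbock.conn PolarPlane.partialR x = 0) ∧
    (∀ x, PolarPlane.weitzenbock.conn
      (fun y ↦ (PolarPlane.radius y)⁻¹ • PolarPlane.partialPhi y) x = 0) ∧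
    -- the torsion of the limit is `r⁻¹ dr ∧ dφ ⊗ ∂_φ`
    (∀ (x : PolarPlane.weitzenbock.carrier) (v w : TangentSpace (𝓡 2) x),
      PolarPlane.weitzenbock.conn.torsion x v w =
        ((PolarPlane.radius x)⁻¹ * (PolarPlane.dr x v * PolarPlane.dphi x w
          - PolarPlane.dphi x v * PolarPlane.dr x w)) • PolarPlane.partialPhi x) ∧
    -- convergence, after removal of small neighbourhoods of the dislocation lines
    ∃ K : (n : ℕ) → Set (P.surface (n + 1)).carrier,
      (∃ C : ℝ, ∀ᶠ n : ℕ in atTop, P.IsPerforated (n + 1) (C / ((n : ℝ) + 1) ^ 2) (K n)) ∧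
      ∀ p : ℝ, 2 ≤ p →
        ConvergesTo p (fun n ↦ P.surface (n + 1)) K PolarPlane.weitzenbock P.sector := by
  refine ⟨fun n ↦ ?_, PolarPlane.inner_eq, PolarPlane.conn_partialR, PolarPlane.conn_partialPhi,
    PolarPlane.torsion_eq, fun n ↦ P.perforatedSurface (n + 1), ⟨P.holeDiam, ?_⟩,
    fun p hp ↦ P.convergesTo hp⟩
  · have := (DislocationData.Surface.isTranslationAtlas P (n + 1)).isManifold
    exact FrameField.standard_torsion (DislocationData.Surface.isTranslationAtlas P (n + 1))
  · filter_upwards [P.eventually_isVeryFine] with n hf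
    have := hf.isPerforated
    rwa [Nat.cast_add, Nat.cast_one] at this
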